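/- Let $\Sigma$ be a compact connected Riemann surface with canonical bundle $K$, let $a_i\in H^0(\Sigma,K^i)$ ($i=2,3,4$), and let $\pi:S\to\Sigma$ be the spectral curve $S=\{\eta^4+a_2\eta^2+a_3\eta+a_4=0\}\subset \mathrm{Tot}(K)$. Assume that $S$ is smooth (the defining section of $\pi^*K^4$ on $\mathrm{Tot}(K)$ vanishes transversally) and has only the most generic ramification: every fibre of $\pi$ consists of four points, or of three points exactly one of which is a double root. Let $(S\times_\Sigma S)_0$ be the closure in $S\times_\Sigma S\subset\mathrm{Tot}(K\oplus K)$ of the complement of the diagonal, $p_1,p_2$ its projections to $S$, $\tau(x,y)=(y,x)$, and $$\hat S_6=\mathrm{Sym}\big((S\times_\Sigma S)_0/\tau\big)\subset \mathrm{Tot}(K\oplus K^2),\qquad \mathrm{Sym}[x,y]=\big(\tfrac{x+y}{2},\,xy\big),$$ with quotient map $q:(S\times_\Sigma S)_0\to\hat S_6$. Let $\sigma$ be the involution of $\hat S_6$ with $\sigma(\mathrm{Sym}[y_1,y_2])=\mathrm{Sym}[y_3,y_4]$ whenever $y_1,\dots,y_4$ are the points of a fibre of $\pi$ counted with multiplicity.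 For a curve $Y$ let $\mathrm{Jac}(Y)$ be the group of linear equivalence classes of divisors of degree $0$, and for a covering $Y\to Z$ let $\mathrm{Prym}(Y,Z)\subset\mathrm{Jac}(Y)$ be the kernel of the norm map $[\sum n_y y]\mapsto[\sum n_y\,\phi(y)]$, where $\phi:Y\to Z$ is the covering map. Let $\Delta\subset S\times\hat S_6$ be the effective (reduced) divisor of all points $(y,\mathrm{Sym}[y,y'])$ with $(y,y')\in(S\times_\Sigma S)_0$, and let $\pi_1,\pi_2$ be the projections of $S\times\hat S_6$. Then: 1. $[D]\mapsto[\mathrm{Nm}_2(\pi_1^*(D)\cap\Delta)]$, where $\pi_1^*(D)\cap\Delta$ is taken with intersection multiplicities and $\mathrm{Nm}_2$ is the push-forward under $\pi_2$, is a well-defined homomorphism $C_\Delta:\mathrm{Jac}(S)\to\mathrm{Jac}(\hat S_6)$. 2. $C_\Delta$ maps $\mathrm{Prym}(S,\Sigma)$ into $\mathrm{Prym}(\hat S_6,\hat S_6/\sigma)$. 3. $C_\Delta$ agrees with $L\mapsto\mathcal I_3(L):=\mathcal L_-\otimes T^{-1}$, where $\mathcal L_-$ and $T$ are the subsheaves of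 $\tau$-anti-invariant sections of $q_*(p_1^*L\otimes p_2^*L)$ (for the lift of $\tau$ interchanging the factors) and of $q_*\mathcal O_{(S\times_\Sigma S)_0}$: if $L$ is a holomorphic line bundle on $S$ of degree $0$ with divisor class $c\in\mathrm{Jac}(S)$, then $\mathcal I_3(L)$ is invertible with divisor class $C_\Delta(c)$. -/

import Mathlib

open scoped Manifold ContDiff Bundle Topology TensorProduct
open TopologicalSpace Bundle

universe u v w

noncomputable section

namespace Trigonal

/-! ### Spaces with a sheaf of holomorphic functions -/

/-- A complex space given by its sheaf of holomorphic functions: for every open `U`, the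
`ℂ`-algebra `O U` of holomorphic functions on `U`, stable under restriction and local. -/
class HolSpace (Y : Type u) [TopologicalSpace Y] where
  O : (U : Opens Y) → Subalgebra ℂ (U → ℂ)
  res : ∀ {U V : Opens Y} (h : V ≤ U) {f : U → ℂ}, f ∈ O U → (fun y : V => f ⟨y, h y.2⟩) ∈ O V
  glue : ∀ {U : Opens Y} {f : U → ℂ},
    (∀ p : U, ∃ (V : Opens Y) (h : V ≤ U), p.1 ∈ V ∧ (fun y : V => f ⟨y, h y.2⟩) ∈ O V) → f ∈ O U

/-- The complex structure induced by a map `j` into a complex manifold: a function is holomorphic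
if it is locally the pullback of a holomorphic function of the manifold. For `j = id` this is the
manifold itself; for the inclusion of a complex submanifold `j` it is the submanifold. -/
@[reducible]
def HolSpace.induced {E H M : Type*} [NormedAddCommGroup E] [NormedSpace ℂ E] [TopologicalSpace H]
    (I : ModelWithCorners ℂ E H) [TopologicalSpace M] [ChartedSpace H M]
    {Y : Type u} [TopologicalSpace Y] (j : Y → M) : HolSpace Y where
  O U :=
    { carrier := {f | ∀ p : U, ∃ F : M → ℂ, ContMDiffAt I 𝓘(ℂ, ℂ) ω F (j p) ∧
        ∃ W ∈ 𝓝 p.1, ∀ y : U, y.1 ∈ W → f y = F (j y)}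
      mul_mem' := by
        intro f g hf hg p
        obtain ⟨F, hF, W, hW, h⟩ := hf p
        obtain ⟨G, hG, W', hW', h'⟩ := hg p
        refine ⟨F * G, hF.mul hG, W ∩ W', Filter.inter_mem hW hW', fun y hy => ?_⟩
        simp [h y hy.1, h' y hy.2]
      add_mem' := by
        intro f g hf hg p
        obtain ⟨F, hF, W, hW, h⟩ := hf p
        obtain ⟨G, hG, W', hW', h'⟩ := hg p
        refine ⟨F + G, hF.add hG, W ∩ W', Filter.inter_mem hW hW', fun y hy => ?_⟩
        simp [h y hy.1, h' y hy.2]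
      algebraMap_mem' := by
        intro c p
        exact ⟨fun _ => c, contMDiffAt_const, Set.univ, Filter.univ_mem, fun y _ => rfl⟩ }
  res := by
    intro U V h f hf p
    obtain ⟨F, hF, W, hW, hh⟩ := hf ⟨p, h p.2⟩
    exact ⟨F, hF, W, hW, fun y hy => hh ⟨y, h y.2⟩ hy⟩
  glue := by
    intro U f hf p
    obtain ⟨V, h, hp, hV⟩ := hf p
    obtain ⟨F, hF, W, hW, hh⟩ := hV ⟨p, hp⟩
    exact ⟨F, hF, W ∩ V, Filter.inter_mem hW (V.isOpen.mem_nhds hp),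
      fun y hy => hh ⟨y, hy.2⟩ hy.1⟩

/-- The complex structure of a quotient: a function downstairs is holomorphic if its pullback
is. -/
@[reducible]
def HolSpace.quotient {Y : Type u} {Z : Type v} [TopologicalSpace Y] [TopologicalSpace Z]
    [HolSpace Y] (r : Y → Z) (hr : Continuous r) : HolSpace Z where
  O U :=
    { carrier := {f | (fun y : (Opens.comap ⟨r, hr⟩ U : Opens Y) => f ⟨r y, y.2⟩) ∈
        HolSpace.O (Opens.comap ⟨r, hr⟩ U)}
      mul_mem' := fun hf hg => Subalgebra.mul_mem _ hf hg
      add_mem' := fun hf hg => Subalgebra.add_mem _ hf hg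
      algebraMap_mem' := fun c => Subalgebra.algebraMap_mem _ c }
  res := by
    intro U V h f hf
    exact HolSpace.res (U := Opens.comap ⟨r, hr⟩ U) (V := Opens.comap ⟨r, hr⟩ V)
      (fun y hy => h hy) hf
  glue := by
    intro U f hf
    refine HolSpace.glue fun p => ?_
    obtain ⟨V, h, hp, hV⟩ := hf ⟨r p, p.2⟩
    exact ⟨Opens.comap ⟨r, hr⟩ V, fun y hy => h hy, hp, hV⟩

/-- A holomorphic map. -/
structure HolMap (Y : Type u) (Z : Type v) [TopologicalSpace Y] [TopologicalSpace Z]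
    [HolSpace Y] [HolSpace Z] where
  toFun : Y → Z
  cont : Continuous toFun
  hol : ∀ (V : Opens Z) (f : V → ℂ), f ∈ HolSpace.O V →
    (fun y : (Opens.comap ⟨toFun, cont⟩ V : Opens Y) => f ⟨toFun y, y.2⟩) ∈
      HolSpace.O (Opens.comap ⟨toFun, cont⟩ V)

section Functions

variable {Y : Type u} [TopologicalSpace Y] [HolSpace Y]

/-- Restriction of holomorphic functions. -/
def resHom {U V : Opens Y} (h : V ≤ U) : HolSpace.O U →+* HolSpace.O V where
  toFun f := ⟨fun y => f.1 ⟨y, h y.2⟩, HolSpace.res h f.2⟩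
  map_one' := rfl
  map_mul' _ _ := rfl
  map_zero' := rfl
  map_add' _ _ := rfl

/-- Pullback of holomorphic functions. -/
def HolMap.pull {Z : Type v} [TopologicalSpace Z] [HolSpace Z] (q : HolMap Y Z) (V : Opens Z) :
    HolSpace.O V →+* HolSpace.O (Opens.comap ⟨q.toFun, q.cont⟩ V : Opens Y) where
  toFun f := ⟨fun y => f.1 ⟨q.toFun y, y.2⟩, q.hol V f.1 f.2⟩
  map_one' := rfl
  map_mul' _ _ := rfl
  map_zero' := rfl
  map_add' _ _ := rfl

/-- The function `f` on `U` is holomorphic in a neighbourhood of `p ∈ U`. -/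
def HolNear {U : Opens Y} (f : U → ℂ) (p : U) : Prop :=
  ∃ (V : Opens Y) (h : V ≤ U), p.1 ∈ V ∧ (fun y : V => f ⟨y, h y.2⟩) ∈ HolSpace.O V

/-- The function `f` is holomorphic in a neighbourhood of `p`. -/
def IsHolAt (f : Y → ℂ) (p : Y) : Prop :=
  ∃ V : Opens Y, p ∈ V ∧ (fun y : V => f y) ∈ HolSpace.O V

theorem holNear_of_mem {U : Opens Y} {f : U → ℂ} (hf : f ∈ HolSpace.O U) (p : U) : HolNear f p :=
  ⟨U, le_rfl, p.2, hf⟩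

theorem HolNear.res {U V : Opens Y} (h : V ≤ U) {f : U → ℂ} {p : V}
    (hf : HolNear f ⟨p, h p.2⟩) : HolNear (fun y : V => f ⟨y, h y.2⟩) p := by
  obtain ⟨W, hW, hp, hm⟩ := hf
  exact ⟨W ⊓ V, inf_le_right, ⟨hp, p.2⟩, HolSpace.res inf_le_left hm⟩

theorem HolNear.add {U : Opens Y} {f g : U → ℂ} {p : U} (hf : HolNear f p) (hg : HolNear g p) :
    HolNear (fun y => f y + g y) p := by
  obtain ⟨W, hW, hp, hm⟩ := hf
  obtain ⟨W', hW', hp', hm'⟩ := hg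
  exact ⟨W ⊓ W', inf_le_left.trans hW, ⟨hp, hp'⟩,
    add_mem (HolSpace.res inf_le_left hm) (HolSpace.res inf_le_right hm')⟩

theorem HolNear.mul {U : Opens Y} {f g : U → ℂ} {p : U} (hf : HolNear f p) (hg : HolNear g p) :
    HolNear (fun y => f y * g y) p := by
  obtain ⟨W, hW, hp, hm⟩ := hf
  obtain ⟨W', hW', hp', hm'⟩ := hg
  exact ⟨W ⊓ W', inf_le_left.trans hW, ⟨hp, hp'⟩,
    mul_mem (HolSpace.res inf_le_left hm) (HolSpace.res inf_le_right hm')⟩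

theorem HolNear.zero {U : Opens Y} (p : U) : HolNear (fun _ : U => (0 : ℂ)) p :=
  holNear_of_mem (zero_mem (HolSpace.O U)) p

/-! ### Divisors, class groups, Jacobians and Prym varieties -/

/-- `t` is a local coordinate at `p`: it generates the maximal ideal of the ring of germs. -/
def IsUniformizer (t : Y → ℂ) (p : Y) : Prop :=
  IsHolAt t p ∧ t p = 0 ∧ (∀ᶠ y in 𝓝[≠] p, t y ≠ 0) ∧
    ∀ g : Y → ℂ, IsHolAt g p → g p = 0 → ∃ h : Y → ℂ, IsHolAt h p ∧ ∀ᶠ y in 𝓝 p, g y = t y * h y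

/-- `f` is meromorphic at `p`, with order `n` at `p` (its value at `p` itself is irrelevant). -/
def HasOrder (f : Y → ℂ) (p : Y) (n : ℤ) : Prop :=
  ∃ t u : Y → ℂ, IsUniformizer t p ∧ IsHolAt u p ∧ u p ≠ 0 ∧ ∀ᶠ y in 𝓝[≠] p, f y = t y ^ n * u y

/-- The ramification index of `φ` at `p`: the order at `p` of the pullback of a local coordinate
at `φ p`. -/
def ramIdx {Z : Type v} [TopologicalSpace Z] [HolSpace Z] (φ : Y → Z) (p : Y) : ℕ :=
  sInf {n : ℕ | ∃ t : Z → ℂ, IsUniformizer t (φ p) ∧ HasOrder (t ∘ φ) p n}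

/-- The pullback of divisors `z ↦ ∑_{φ y = z} e_y • y` along a map with finite fibres. -/
def pullDiv {Z : Type v} [TopologicalSpace Z] [HolSpace Z] (φ : Y → Z) : (Z →₀ ℤ) →+ (Y →₀ ℤ) :=
  Finsupp.liftAddHom fun z =>
    zmultiplesHom (Y →₀ ℤ) (∑ᶠ y ∈ φ ⁻¹' {z}, Finsupp.single y (ramIdx φ y : ℤ))

/-- The norm of divisors `∑ n_y • y ↦ ∑ n_y • φ y`. -/
def normDiv {Y : Type u} {Z : Type v} (φ : Y → Z) : (Y →₀ ℤ) →+ (Z →₀ ℤ) :=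
  Finsupp.mapDomain.addMonoidHom φ

/-- The degree of a divisor. -/
def degDiv (Y : Type u) : (Y →₀ ℤ) →+ ℤ := Finsupp.liftAddHom fun _ => AddMonoidHom.id ℤ

variable (Y) in
/-- The group of principal divisors (the divisors of meromorphic functions form a group; the
closure only saves proving this here). -/
def principalDiv : AddSubgroup (Y →₀ ℤ) :=
  AddSubgroup.closure {D | ∃ f : Y → ℂ, ∀ p, HasOrder f p (D p)}

variable (Y) in
/-- The divisor class group. -/
abbrev Pic : Type u := (Y →₀ ℤ) ⧸ principalDiv Y

/-- The class of a divisor. -/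
def divClass : (Y →₀ ℤ) →+ Pic Y := QuotientAddGroup.mk' (principalDiv Y)

variable (Y) in
/-- The Jacobian: the classes of the divisors of degree zero. -/
def Jac : AddSubgroup (Pic Y) := (degDiv Y).ker.map divClass

/-- The Prym variety `Prym(Y, Z)` of `φ : Y → Z`: the kernel of the norm map on `Jac(Y)`, that is,
the classes of the divisors of degree zero whose norm is principal. -/
def Prym {Z : Type v} [TopologicalSpace Z] [HolSpace Z] (φ : Y → Z) : AddSubgroup (Pic Y) :=
  ((degDiv Y).ker ⊓ (principalDiv Z).comap (normDiv φ)).map divClass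

end Functions

/-! ### Sheaves of modules -/

section Sheaves

/-- A presheaf of modules over the sheaf of holomorphic functions. -/
structure OMod (Y : Type u) [TopologicalSpace Y] [HolSpace Y] where
  sec : Opens Y → Type v
  [grp : ∀ U, AddCommGroup (sec U)]
  [mod : ∀ U, Module (HolSpace.O U) (sec U)]
  res : ∀ {U V : Opens Y}, V ≤ U → sec U →+ sec V
  res_smul : ∀ {U V : Opens Y} (h : V ≤ U) (f : HolSpace.O U) (s : sec U),
    res h (f • s) = resHom h f • res h s
  res_res : ∀ {U V W : Opens Y} (h : V ≤ U) (h' : W ≤ V) (s : sec U),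
    res h' (res h s) = res (h'.trans h) s
  res_self : ∀ {U : Opens Y} (s : sec U), res le_rfl s = s

attribute [instance] OMod.grp OMod.mod

variable {Y : Type u} [TopologicalSpace Y] [HolSpace Y]

/-- Isomorphism of sheaves of modules. -/
def OMod.IsIso (A : OMod.{u, v} Y) (B : OMod.{u, w} Y) : Prop :=
  ∃ e : ∀ U, A.sec U ≃ₗ[HolSpace.O U] B.sec U,
    ∀ (U V : Opens Y) (h : V ≤ U) (s : A.sec U), e V (A.res h s) = B.res h (e U s)

/-- Families of linear maps over the open subsets of `U`, as a module over `O U`. -/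
def OMod.Fam (A : OMod.{u, v} Y) (B : OMod.{u, w} Y) (U : Opens Y) : Type _ :=
  ∀ W : {W : Opens Y // W ≤ U}, A.sec W.1 →ₗ[HolSpace.O W.1] B.sec W.1

instance (A : OMod.{u, v} Y) (B : OMod.{u, w} Y) (U : Opens Y) : AddCommGroup (A.Fam B U) :=
  Pi.addCommGroup

instance (A : OMod.{u, v} Y) (B : OMod.{u, w} Y) (U : Opens Y) :
    Module (HolSpace.O U) (A.Fam B U) :=
  letI (W : {W : Opens Y // W ≤ U}) :
      Module (HolSpace.O U) (A.sec W.1 →ₗ[HolSpace.O W.1] B.sec W.1) :=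
    Module.compHom _ (resHom W.2)
  Pi.module _ _ _

/-- The homomorphisms `A|_U → B|_U`. -/
def OMod.homSec (A : OMod.{u, v} Y) (B : OMod.{u, w} Y) (U : Opens Y) :
    Submodule (HolSpace.O U) (A.Fam B U) where
  carrier := {φ | ∀ (W W' : {W : Opens Y // W ≤ U}) (h : W'.1 ≤ W.1) (s : A.sec W.1),
    φ W' (A.res h s) = B.res h (φ W s)}
  zero_mem' := fun W W' h s => (map_zero (B.res h)).symm
  add_mem' := by
    intro φ ψ hφ hψ W W' h s
    change φ W' _ + ψ W' _ = B.res h (φ W s + ψ W s)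
    rw [hφ W W' h s, hψ W W' h s, map_add]
  smul_mem' := by
    intro f φ hφ W W' h s
    change resHom W'.2 f • φ W' _ = B.res h (resHom W.2 f • φ W s)
    rw [hφ W W' h s, B.res_smul]
    rfl

/-- The sheaf `Hom(A, B)`; if `A` is invertible it is `B ⊗ A⁻¹`. -/
def OMod.hom (A : OMod.{u, v} Y) (B : OMod.{u, w} Y) : OMod.{u} Y where
  sec U := A.homSec B U
  res {U V} h :=
    { toFun := fun φ => ⟨fun W => φ.1 ⟨W.1, W.2.trans h⟩,
        fun W W' h' s => φ.2 ⟨W.1, W.2.trans h⟩ ⟨W'.1, W'.2.trans h⟩ h' s⟩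
      map_zero' := rfl
      map_add' := fun _ _ => rfl }
  res_smul _ _ _ := rfl
  res_res _ _ _ := rfl
  res_self _ := rfl

/-- A sheaf of modules whose sections are functions with values in a family of complex vector
spaces. -/
structure FibSheaf (Y : Type u) [TopologicalSpace Y] [HolSpace Y] where
  fib : Y → Type v
  [grp : ∀ y, AddCommGroup (fib y)]
  [mod : ∀ y, Module ℂ (fib y)]
  sec : ∀ U : Opens Y, Submodule (HolSpace.O U) ((y : U) → fib y)
  res : ∀ {U V : Opens Y} (h : V ≤ U) {s : (y : U) → fib y}, s ∈ sec U →
    (fun y : V => s ⟨y, h y.2⟩) ∈ sec V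

attribute [instance] FibSheaf.grp FibSheaf.mod

/-- The underlying sheaf of modules. -/
def FibSheaf.toOMod (F : FibSheaf.{u, v} Y) : OMod Y where
  sec U := F.sec U
  res {U V} h :=
    { toFun := fun s => ⟨fun y : V => s.1 ⟨y, h y.2⟩, F.res h s.2⟩
      map_zero' := rfl
      map_add' := fun _ _ => rfl }
  res_smul _ _ _ := rfl
  res_res _ _ _ := rfl
  res_self _ := rfl

variable (Y) in
/-- The sheaf of holomorphic functions. -/
def structureSheaf : FibSheaf.{u, 0} Y where
  fib _ := ℂ
  sec U :=
    { carrier := {f | f ∈ HolSpace.O U}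
      zero_mem' := zero_mem (HolSpace.O U)
      add_mem' := fun hf hg => Subalgebra.add_mem _ hf hg
      smul_mem' := fun a _ hf => Subalgebra.mul_mem _ a.2 hf }
  res h _ hs := HolSpace.res h hs

/-- The sheaf `O(D)` of the meromorphic functions `f` with `div f + D ≥ 0`. A section over `U` is
recorded by its values off the support of `D` (with the value `0` on the support). -/
def sheafOfDiv (D : Y →₀ ℤ) : FibSheaf.{u, 0} Y where
  fib _ := ℂ
  sec U :=
    { carrier := {f | (∀ p : U, D p = 0 → HolNear f p) ∧
        ∀ p : U, D p ≠ 0 → f p = 0 ∧ ∀ t : Y → ℂ, IsUniformizer t p →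
          ∃ g : U → ℂ, HolNear g p ∧ ∀ᶠ y in 𝓝[≠] p, f y * t y ^ D p = g y}
      zero_mem' := by
        refine ⟨fun p _ => HolNear.zero p, fun p _ => ⟨rfl, fun t _ => ⟨_, HolNear.zero p, ?_⟩⟩⟩
        exact Filter.Eventually.of_forall fun y => zero_mul _
      add_mem' := by
        rintro f f' ⟨h1, h2⟩ ⟨h1', h2'⟩
        refine ⟨fun p hp => (h1 p hp).add (h1' p hp), fun p hp => ⟨?_, fun t ht => ?_⟩⟩
        · simp [(h2 p hp).1, (h2' p hp).1]
        · obtain ⟨g, hg, hf⟩ := (h2 p hp).2 t ht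
          obtain ⟨g', hg', hf'⟩ := (h2' p hp).2 t ht
          refine ⟨_, hg.add hg', ?_⟩
          filter_upwards [hf, hf'] with y hy hy'
          rw [← hy, ← hy', Pi.add_apply, add_mul]
      smul_mem' := by
        rintro a f ⟨h1, h2⟩
        refine ⟨fun p hp => (holNear_of_mem a.2 p).mul (h1 p hp), fun p hp => ⟨?_, fun t ht => ?_⟩⟩
        · change a.1 p * f p = 0
          rw [(h2 p hp).1, mul_zero]
        · obtain ⟨g, hg, hf⟩ := (h2 p hp).2 t ht
          refine ⟨_, (holNear_of_mem a.2 p).mul hg, ?_⟩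
          filter_upwards [hf] with y hy
          rw [← hy, ← mul_assoc]
          rfl }
  res {U V} h f hf := by
    refine ⟨fun p hp => (hf.1 ⟨p, h p.2⟩ hp).res h, fun p hp => ⟨(hf.2 ⟨p, h p.2⟩ hp).1,
      fun t ht => ?_⟩⟩
    obtain ⟨g, hg, hfg⟩ := (hf.2 ⟨p, h p.2⟩ hp).2 t ht
    refine ⟨_, hg.res h, ?_⟩
    have hc : Filter.Tendsto (fun y : V => (⟨y, h y.2⟩ : U)) (𝓝[≠] p) (𝓝[≠] ⟨p, h p.2⟩) := by
      refine tendsto_nhdsWithin_iff.2 ⟨?_, ?_⟩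
      · exact (Continuous.subtype_mk continuous_subtype_val _).continuousAt.tendsto.mono_left
          nhdsWithin_le_nhds
      · filter_upwards [self_mem_nhdsWithin] with y hy hyp
        exact hy (Subtype.ext (congrArg (fun z : U => z.1) hyp))
    exact hc.eventually hfg

/-- The sheaf `A` is invertible with divisor class `c`, i.e. it is isomorphic to `O(D)` for a
divisor `D` of class `c`. -/
def OMod.HasClass (A : OMod.{u, v} Y) (c : Pic Y) : Prop :=
  ∃ D : Y →₀ ℤ, divClass D = c ∧ A.IsIso (sheafOfDiv D).toOMod

/-- A holomorphic line bundle: a complex line bundle with holomorphic transition functions. -/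
structure LineBundle (Y : Type u) [TopologicalSpace Y] [HolSpace Y] where
  E : Y → Type v
  [grp : ∀ y, AddCommGroup (E y)]
  [mod : ∀ y, Module ℂ (E y)]
  [top : ∀ y, TopologicalSpace (E y)]
  [topTotal : TopologicalSpace (TotalSpace ℂ E)]
  [fiberBundle : FiberBundle ℂ E]
  [vectorBundle : VectorBundle ℂ ℂ E]
  hol : ∀ (e e' : Trivialization ℂ (π ℂ E)) [MemTrivializationAtlas e] [MemTrivializationAtlas e'],
    ∀ y ∈ e.baseSet ∩ e'.baseSet, IsHolAt (fun y => e.coordChangeL ℂ e' y 1) y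

attribute [instance] LineBundle.grp LineBundle.mod LineBundle.top LineBundle.topTotal
  LineBundle.fiberBundle LineBundle.vectorBundle

/-- The sheaf of holomorphic sections of a line bundle. -/
def LineBundle.sheaf (L : LineBundle.{u, v} Y) : FibSheaf.{u, v} Y where
  fib := L.E
  sec U :=
    { carrier := {s | ∀ (p : U) (e : Trivialization ℂ (π ℂ L.E)) [MemTrivializationAtlas e],
        p.1 ∈ e.baseSet → HolNear (fun y : U => e.linearMapAt ℂ y (s y)) p}
      zero_mem' := by
        intro p e _ _
        simpa using HolNear.zero p
      add_mem' := by
        intro s s' hs hs' p e _ hp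
        simpa using (hs p e hp).add (hs' p e hp)
      smul_mem' := by
        intro a s hs p e _ hp
        have := (holNear_of_mem a.2 p).mul (hs p e hp)
        convert this using 2 with y
        exact (e.linearMapAt ℂ y.1).map_smul (a.1 y) (s y) }
  res h s hs p e _ hp := (hs ⟨p, h p.2⟩ e hp).res h

/-- For maps `p₁, p₂ : Y → S`, the sheaf of holomorphic sections of `p₁^* L ⊗ p₂^* L`: the sections
that are holomorphic in the trivializations induced by those of `L`. -/
def LineBundle.box {S : Type u} [TopologicalSpace S] [HolSpace S] (L : LineBundle.{u, v} S)
    (p₁ p₂ : Y → S) : FibSheaf.{u, v} Y where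
  fib y := L.E (p₁ y) ⊗[ℂ] L.E (p₂ y)
  sec U :=
    { carrier := {s | ∀ (p : U) (e₁ e₂ : Trivialization ℂ (π ℂ L.E)) [MemTrivializationAtlas e₁]
        [MemTrivializationAtlas e₂], p₁ p ∈ e₁.baseSet → p₂ p ∈ e₂.baseSet →
        HolNear (fun y : U => LinearMap.mul' ℂ ℂ (TensorProduct.map (e₁.linearMapAt ℂ (p₁ y))
          (e₂.linearMapAt ℂ (p₂ y)) (s y))) p}
      zero_mem' := by
        intro p e₁ e₂ _ _ _ _
        simpa using HolNear.zero p
      add_mem' := by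
        intro s s' hs hs' p e₁ e₂ _ _ h₁ h₂
        simpa using (hs p e₁ e₂ h₁ h₂).add (hs' p e₁ e₂ h₁ h₂)
      smul_mem' := by
        intro a s hs p e₁ e₂ _ _ h₁ h₂
        have := (holNear_of_mem a.2 p).mul (hs p e₁ e₂ h₁ h₂)
        convert this using 2 with y
        change LinearMap.mul' ℂ ℂ (TensorProduct.map (e₁.linearMapAt ℂ (p₁ y))
          (e₂.linearMapAt ℂ (p₂ y)) (a.1 y • s y)) = _
        rw [map_smul, map_smul, smul_eq_mul] }
  res h s hs p e₁ e₂ _ _ h₁ h₂ := (hs ⟨p, h p.2⟩ e₁ e₂ h₁ h₂).res h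

/-- The sections over `V` of the direct image of `F` under a holomorphic map `q : Y → Z`. -/
def FibSheaf.pushSec {Z : Type v} [TopologicalSpace Z] [HolSpace Z] (F : FibSheaf.{u, w} Y)
    (q : HolMap Y Z) (V : Opens Z) : Type (max u w) :=
  F.sec (Opens.comap ⟨q.toFun, q.cont⟩ V)

instance {Z : Type v} [TopologicalSpace Z] [HolSpace Z] (F : FibSheaf.{u, w} Y)
    (q : HolMap Y Z) (V : Opens Z) : AddCommGroup (F.pushSec q V) :=
  inferInstanceAs (AddCommGroup (F.sec (Opens.comap ⟨q.toFun, q.cont⟩ V)))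

instance {Z : Type v} [TopologicalSpace Z] [HolSpace Z] (F : FibSheaf.{u, w} Y)
    (q : HolMap Y Z) (V : Opens Z) : Module (HolSpace.O V) (F.pushSec q V) :=
  Module.compHom (F.sec (Opens.comap ⟨q.toFun, q.cont⟩ V)) (q.pull V)

/-- For an involution `τ` of `Y` over `Z` and a lift `θ` of `τ` to the fibres of `F`: the
anti-invariant sections of the direct image of `F`. -/
def FibSheaf.antiSec {Z : Type v} [TopologicalSpace Z] [HolSpace Z] (F : FibSheaf.{u, w} Y)
    (q : HolMap Y Z) (τ : Y → Y) (hτ : ∀ y, q.toFun (τ y) = q.toFun y)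
    (θ : ∀ y, F.fib (τ y) →ₗ[ℂ] F.fib y) (V : Opens Z) :
    Submodule (HolSpace.O V) (F.pushSec q V) where
  carrier := {s | ∀ (y : Y) (hy : q.toFun y ∈ V),
    θ y (s.1 ⟨τ y, (congrArg (· ∈ V) (hτ y)).mpr hy⟩) = - s.1 ⟨y, hy⟩}
  zero_mem' := by
    intro y hy
    change θ y 0 = - 0
    rw [map_zero, neg_zero]
  add_mem' := by
    intro s s' hs hs' y hy
    exact (map_add (θ y) _ _).trans
      ((congrArg₂ (· + ·) (hs y hy) (hs' y hy)).trans (neg_add _ _).symm)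
  smul_mem' := by
    intro a s hs y hy
    change θ y (a.1 ⟨q.toFun (τ y), _⟩ • s.1 ⟨τ y, _⟩) = - (a.1 ⟨q.toFun y, hy⟩ • s.1 ⟨y, hy⟩)
    rw [map_smul, hs y hy, smul_neg]
    rw [show (⟨q.toFun (τ y), (congrArg (· ∈ V) (hτ y)).mpr hy⟩ : V) = ⟨q.toFun y, hy⟩ from
      Subtype.ext (hτ y)]

/-- The sheaf of anti-invariant sections of the direct image of `F`. -/
def FibSheaf.antiInv {Z : Type v} [TopologicalSpace Z] [HolSpace Z] (F : FibSheaf.{u, w} Y)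
    (q : HolMap Y Z) (τ : Y → Y) (hτ : ∀ y, q.toFun (τ y) = q.toFun y)
    (θ : ∀ y, F.fib (τ y) →ₗ[ℂ] F.fib y) : OMod.{v, max u w} Z where
  sec V := F.antiSec q τ hτ θ V
  res {U V} h :=
    { toFun := fun s => ⟨⟨fun y => s.1.1 ⟨y, h y.2⟩, F.res (fun y hy => h hy) s.1.2⟩,
        fun y hy => s.2 y (h hy)⟩
      map_zero' := rfl
      map_add' := fun _ _ => rfl }
  res_smul _ _ _ := rfl
  res_res _ _ _ := rfl
  res_self _ := rfl

end Sheaves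

/-! ### The canonical bundle of a Riemann surface -/

section Canonical

variable {X : Type u} [TopologicalSpace X] [ChartedSpace ℂ X]

/-- The fibre of the canonical bundle at `x`: the cotangent space. -/
abbrev K (x : X) : Type := TangentSpace 𝓘(ℂ, ℂ) x →L[ℂ] Bundle.Trivial X ℂ x

instance (x : X) : AddCommGroup (K x) := ContinuousLinearMap.addCommGroup
instance (x : X) : Module ℂ (K x) := ContinuousLinearMap.module
instance (x : X) : IsTopologicalAddGroup (K x) := ContinuousLinearMap.topologicalAddGroup
instance (x : X) : ContinuousSMul ℂ (K x) := ContinuousLinearMap.continuousSMul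
instance (x : X) : ContinuousAdd (K x) := IsTopologicalAddGroup.toContinuousAdd

/-- The fibre of the square of the canonical bundle at `x`: the bilinear forms on the
(one-dimensional) tangent space. -/
abbrev K2 (x : X) : Type := TangentSpace 𝓘(ℂ, ℂ) x →L[ℂ] K x

instance (x : X) : AddCommGroup (K2 x) := ContinuousLinearMap.addCommGroup
instance (x : X) : Module ℂ (K2 x) := ContinuousLinearMap.module

variable (X) in
/-- The total space of `K`. -/
abbrev TotK := TotalSpace (ℂ →L[ℂ] ℂ) (K : X → Type)

variable (X) in
/-- The total space of `K ⊕ K`. -/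
abbrev TotKK := TotalSpace ((ℂ →L[ℂ] ℂ) × (ℂ →L[ℂ] ℂ)) ((K : X → Type) ×ᵇ (K : X → Type))

variable (X) in
/-- The total space of `K ⊕ K²`. -/
abbrev TotKK2 :=
  TotalSpace ((ℂ →L[ℂ] ℂ) × (ℂ →L[ℂ] ℂ →L[ℂ] ℂ)) ((K : X → Type) ×ᵇ (K2 : X → Type))

variable [IsManifold 𝓘(ℂ, ℂ) ω X]

variable (X) in
/-- A holomorphic section of `K^n`: its value at `x` is an `n`-linear form on the one-dimensional
space `T_x X`, and its values on local holomorphic vector fields are holomorphic functions. -/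
structure HolDiff (n : ℕ) where
  toFun : (x : X) →
    ContinuousMultilinearMap ℂ (fun _ : Fin n => TangentSpace 𝓘(ℂ, ℂ) x) ℂ
  hol : ∀ (x : X) (v : (y : X) → TangentSpace 𝓘(ℂ, ℂ) y),
    ContMDiffAt 𝓘(ℂ, ℂ) (𝓘(ℂ, ℂ)).tangent ω
      (fun y => (⟨y, v y⟩ : TangentBundle 𝓘(ℂ, ℂ) X)) x →
    ContMDiffAt 𝓘(ℂ, ℂ) 𝓘(ℂ, ℂ) ω (fun y => toFun y (fun _ => v y)) x

variable (X) in
/-- The data `a₂, a₃, a₄` of a spectral curve `η⁴ + a₂ η² + a₃ η + a₄ = 0`: a point of the base of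
the Hitchin fibration of `SL(4, ℂ)`. -/
structure HitchinBase where
  a₂ : HolDiff X 2
  a₃ : HolDiff X 3
  a₄ : HolDiff X 4

/-- The value on `v ∈ T_x X` of `t⁴ + a₂ t² + a₃ t + a₄ ∈ K_x⁴`, for `t ∈ K_x`. -/
def HitchinBase.poly (a : HitchinBase X) (x : X) (t : K x) (v : TangentSpace 𝓘(ℂ, ℂ) x) : ℂ :=
  (t v : ℂ) ^ 4 + a.a₂.toFun x (fun _ => v) * (t v : ℂ) ^ 2
    + a.a₃.toFun x (fun _ => v) * (t v : ℂ) + a.a₄.toFun x (fun _ => v)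

/-- `t ∈ K_x` is a root of the polynomial. -/
def HitchinBase.IsRoot (a : HitchinBase X) (x : X) (t : K x) : Prop := ∀ v, a.poly x t v = 0

/-- The map `Sym : (x, y) ↦ ((x + y) / 2, x y)` from `K ⊕ K` to `K ⊕ K²`. -/
def sym (p : TotKK X) : TotKK2 X :=
  ⟨p.1, ((1 / 2 : ℂ) • (p.2.1 + p.2.2), p.2.1.smulRight p.2.2)⟩

/-- The interchange `τ` of the summands of `K ⊕ K`. -/
def swap (p : TotKK X) : TotKK X := ⟨p.1, (p.2.2, p.2.1)⟩

theorem sym_swap (p : TotKK X) : sym (swap p) = sym p := by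
  have h1 : ∀ (f : ℂ →L[ℂ] ℂ) (z : ℂ), f z = z * f 1 := by
    intro f z
    simpa using f.map_smul z 1
  have h2 : ∀ f g : ℂ →L[ℂ] ℂ, f.smulRight g = g.smulRight f := by
    intro f g
    refine ContinuousLinearMap.ext fun v => ContinuousLinearMap.ext fun w => ?_
    change f v * g w = g v * f w
    rw [h1 f v, h1 f w, h1 g v, h1 g w]
    ring
  have h3 : p.2.2.smulRight p.2.1 = p.2.1.smulRight p.2.2 := h2 p.2.2 p.2.1
  unfold sym swap
  rw [h3, add_comm p.2.2 p.2.1]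

theorem trivialization_smulRight (b0 : X) (b : X) (hb : b ∈ (trivializationAt (ℂ →L[ℂ] ℂ) (K : X → Type) b0).baseSet) (x y : K b) :
    (trivializationAt (ℂ →L[ℂ] ℂ →L[ℂ] ℂ) (K2 : X → Type) b0 ⟨b, x.smulRight y⟩).2
    = (trivializationAt (ℂ →L[ℂ] ℂ) (K : X → Type) b0 ⟨b, x⟩).2.smulRight
    (trivializationAt (ℂ →L[ℂ] ℂ) (K : X → Type) b0 ⟨b, y⟩).2 := by
  have hy : (trivializationAt (ℂ →L[ℂ] ℂ) (K : X → Type) b0 ⟨b, y⟩).2 = (trivializationAt (ℂ →L[ℂ] ℂ) (K : X → Type) b0).continuousLinearMapAt ℂ b y := by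
      rw [Trivialization.continuousLinearMapAt_apply, Trivialization.linearMapAt_def_of_mem _ hb]
      rfl
  rw [hy]
  refine ContinuousLinearMap.ext fun v => ?_
  have e1 : (trivializationAt (ℂ →L[ℂ] ℂ) (K : X → Type) b0 ⟨b, x⟩).2 v
    = x ((trivializationAt ℂ (TangentSpace 𝓘(ℂ, ℂ)) b0).symmL ℂ b v) := by
    rw [hom_trivializationAt_apply]
    simp only [ContinuousLinearMap.inCoordinates, ContinuousLinearMap.comp_apply]
    change (Bundle.Trivial.trivialization X ℂ).continuousLinearMapAt ℂ b _ = _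
    rw [Trivial.continuousLinearMapAt_trivialization]; rfl
  have e2 : (trivializationAt (ℂ →L[ℂ] ℂ →L[ℂ] ℂ) (K2 : X → Type) b0 ⟨b, x.smulRight y⟩).2 v
    = (trivializationAt (ℂ →L[ℂ] ℂ) (K : X → Type) b0).continuousLinearMapAt ℂ b 
       ((x.smulRight y) ((trivializationAt ℂ (TangentSpace 𝓘(ℂ, ℂ)) b0).symmL ℂ b v)) := by
    rw [hom_trivializationAt_apply]
    rfl
  rw [e2, ContinuousLinearMap.smulRight_apply, ContinuousLinearMap.smulRight_apply, e1]
  exact ContinuousLinearMap.map_smul _ _ _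

theorem contMDiff_sym : ContMDiff (𝓘(ℂ, ℂ).prod 𝓘(ℂ, (ℂ →L[ℂ] ℂ) × (ℂ →L[ℂ] ℂ)))
    (𝓘(ℂ, ℂ).prod 𝓘(ℂ, (ℂ →L[ℂ] ℂ) × (ℂ →L[ℂ] ℂ →L[ℂ] ℂ))) ω (sym (X := X)) := by
  intro p0
  have h0 := contMDiffAt_id (I := 𝓘(ℂ, ℂ).prod 𝓘(ℂ, (ℂ →L[ℂ] ℂ) × (ℂ →L[ℂ] ℂ)))
    (n := ω) (x := p0)
  rw [contMDiffAt_totalSpace] at h0 ⊢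
  refine ⟨h0.1, ?_⟩
  have h1 := h0.2
  simp only [id] at h1
  have hs : ContDiff ℂ ω (fun z : (ℂ →L[ℂ] ℂ) × (ℂ →L[ℂ] ℂ) =>
      ((1 / 2 : ℂ) • (z.1 + z.2), z.1.smulRight z.2)) := by
    refine ContDiff.prodMk (by fun_prop) ?_
    exact contDiff_fst.smulRight contDiff_snd
  refine ((hs.contMDiff.contMDiffAt).comp p0 h1).congr_of_eventuallyEq ?_
  have hb : ∀ᶠ p : TotKK X in 𝓝 p0,
      p.1 ∈ (trivializationAt (ℂ →L[ℂ] ℂ) (K : X → Type) p0.1).baseSet := by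
    have hc := FiberBundle.continuous_proj ((ℂ →L[ℂ] ℂ) × (ℂ →L[ℂ] ℂ))
      ((K : X → Type) ×ᵇ (K : X → Type))
    exact hc.continuousAt.eventually_mem
      ((trivializationAt (ℂ →L[ℂ] ℂ) (K : X → Type) p0.1).open_baseSet.mem_nhds
        (mem_baseSet_trivializationAt _ _ _))
  filter_upwards [hb] with p hp
  set e := trivializationAt (ℂ →L[ℂ] ℂ) (K : X → Type) p0.1 with he
  have hadd : (e ⟨p.1, (1 / 2 : ℂ) • (p.2.1 + p.2.2)⟩).2
      = (1 / 2 : ℂ) • ((e ⟨p.1, p.2.1⟩).2 + (e ⟨p.1, p.2.2⟩).2) := by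
    have hl := e.linear ℂ hp
    rw [hl.map_smul, hl.map_add]
  exact Prod.ext hadd (trivialization_smulRight p0.1 p.1 hp p.2.1 p.2.2)

theorem continuous_swap : Continuous (swap (X := X)) := by
  have h := FiberBundle.Prod.isInducing_diag (ℂ →L[ℂ] ℂ) (K : X → Type)
    (ℂ →L[ℂ] ℂ) (K : X → Type)
  rw [h.continuous_iff]
  exact (continuous_snd.prodMk continuous_fst).comp h.continuous

end Canonical

/-! ### The spectral curve and the curves built from it -/

section Curves

variable {X : Type u} [TopologicalSpace X] [ChartedSpace ℂ X] [IsManifold 𝓘(ℂ, ℂ) ω X]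

/-- `X` itself as a complex space. -/
instance : HolSpace X := HolSpace.induced 𝓘(ℂ, ℂ) (id : X → X)

namespace HitchinBase

variable (a : HitchinBase X)

/-- The spectral curve `S ⊂ Tot K`. -/
def S : Set (TotK X) := {p | a.IsRoot p.1 p.2}

/-- `S` is a smooth curve, i.e. the section `η⁴ + a₂ η² + a₃ η + a₄` of the pullback of `K⁴` to
`Tot K` vanishes transversally: in a local trivialization of `K⁴`, given by a non-vanishing
vector field `v`, its differential is non-zero along `S`. -/
def IsSmooth : Prop :=
  ∀ p ∈ a.S, ∀ v : (y : X) → TangentSpace 𝓘(ℂ, ℂ) y,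
    ContMDiffAt 𝓘(ℂ, ℂ) (𝓘(ℂ, ℂ)).tangent ω
      (fun y => (⟨y, v y⟩ : TangentBundle 𝓘(ℂ, ℂ) X)) p.1 → v p.1 ≠ 0 →
    mfderiv (𝓘(ℂ, ℂ).prod 𝓘(ℂ, ℂ →L[ℂ] ℂ)) 𝓘(ℂ, ℂ)
      (fun q : TotK X => a.poly q.1 q.2 (v q.1)) p ≠ 0

/-- `S → X` has only the most generic ramification: every fibre consists either of four points or
of three points, i.e. of one double root and two simple roots. -/
def HasGenericRamification : Prop := ∀ x : X, 3 ≤ {t : K x | a.IsRoot x t}.ncard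

/-- The fibre product `S ×_X S ⊂ Tot (K ⊕ K)`. -/
def SS : Set (TotKK X) := {p | a.IsRoot p.1 p.2.1 ∧ a.IsRoot p.1 p.2.2}

/-- The non-diagonal component `(S ×_X S)₀`: the closure in `S ×_X S` of the complement of the
diagonal. -/
def SS0 : Set (TotKK X) := {p ∈ a.SS | p ∈ closure {q ∈ a.SS | q.2.1 ≠ q.2.2}}

/-- The curve `Ŝ₆ = Sym((S ×_X S)₀ / τ) ⊂ Tot (K ⊕ K²)`. -/
def S6 : Set (TotKK2 X) := sym '' a.SS0

/-- The divisor `Δ ⊂ S × Ŝ₆` of the points `(y, Sym[y, y'])`. -/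
def Delta : Set (TotK X × TotKK2 X) :=
  (fun p : TotKK X => ((⟨p.1, p.2.1⟩ : TotK X), sym p)) '' a.SS0

instance : HolSpace a.S :=
  HolSpace.induced (𝓘(ℂ, ℂ).prod 𝓘(ℂ, ℂ →L[ℂ] ℂ)) (Subtype.val : a.S → TotK X)

instance : HolSpace a.SS0 :=
  HolSpace.induced (𝓘(ℂ, ℂ).prod 𝓘(ℂ, (ℂ →L[ℂ] ℂ) × (ℂ →L[ℂ] ℂ)))
    (Subtype.val : a.SS0 → TotKK X)

instance : HolSpace a.S6 :=
  HolSpace.induced (𝓘(ℂ, ℂ).prod 𝓘(ℂ, (ℂ →L[ℂ] ℂ) × (ℂ →L[ℂ] ℂ →L[ℂ] ℂ)))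
    (Subtype.val : a.S6 → TotKK2 X)

instance : HolSpace a.Delta :=
  HolSpace.induced ((𝓘(ℂ, ℂ).prod 𝓘(ℂ, ℂ →L[ℂ] ℂ)).prod
      (𝓘(ℂ, ℂ).prod 𝓘(ℂ, (ℂ →L[ℂ] ℂ) × (ℂ →L[ℂ] ℂ →L[ℂ] ℂ))))
    (Subtype.val : a.Delta → TotK X × TotKK2 X)

/-- The projection `π : S → X`. -/
def proj (p : a.S) : X := p.1.1

/-- The first projection `(S ×_X S)₀ → S`. -/
def p₁ (p : a.SS0) : a.S := ⟨⟨p.1.1, p.1.2.1⟩, p.2.1.1⟩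

/-- The second projection `(S ×_X S)₀ → S`. -/
def p₂ (p : a.SS0) : a.S := ⟨⟨p.1.1, p.1.2.2⟩, p.2.1.2⟩

theorem swap_mem {p : TotKK X} (hp : p ∈ a.SS0) : swap p ∈ a.SS0 := by
  refine ⟨⟨hp.1.2, hp.1.1⟩, ?_⟩
  refine map_mem_closure continuous_swap hp.2 ?_
  exact fun q hq => ⟨⟨hq.1.2, hq.1.1⟩, fun h => hq.2 h.symm⟩

/-- The involution `τ` of `(S ×_X S)₀`. -/
def τ (p : a.SS0) : a.SS0 := ⟨swap p.1, a.swap_mem p.2⟩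

/-- The quotient map `(S ×_X S)₀ → Ŝ₆`, i.e. the double cover followed by `Sym`. -/
def q : HolMap a.SS0 a.S6 where
  toFun p := ⟨sym p.1, p.1, p.2, rfl⟩
  cont := Continuous.subtype_mk (contMDiff_sym.continuous.comp continuous_subtype_val) _
  hol := by
    intro V f hf p
    obtain ⟨F, hF, W, hW, h⟩ := hf ⟨⟨sym p.1.1, p.1.1, p.1.2, rfl⟩, p.2⟩
    refine ⟨F ∘ sym, hF.comp p.1.1 contMDiff_sym.contMDiffAt,
      (fun y : a.SS0 => (⟨sym y.1, y.1, y.2, rfl⟩ : a.S6)) ⁻¹' W, ?_, fun y hy => ?_⟩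
    · exact (Continuous.subtype_mk (contMDiff_sym.continuous.comp continuous_subtype_val)
        (fun p : a.SS0 => ⟨p.1, p.2, rfl⟩)).continuousAt.preimage_mem_nhds hW
    · exact h ⟨⟨sym y.1.1, y.1.1, y.1.2, rfl⟩, y.2⟩ hy

theorem q_τ (p : a.SS0) : a.q.toFun (a.τ p) = a.q.toFun p := Subtype.ext (sym_swap p.1)

/-- The involution `σ` of `Ŝ₆`, as a relation: `Sym[y₁, y₂]` corresponds to `Sym[y₃, y₄]` when
`y₁, y₂, y₃, y₄` are the points of the fibre of `S`, counted with multiplicity. -/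
def sigmaRel (z z' : a.S6) : Prop :=
  ∃ (x : X) (t₁ t₂ t₃ t₄ : K x),
    (∀ (t : K x) (v : TangentSpace 𝓘(ℂ, ℂ) x),
      a.poly x t v = (t v - t₁ v : ℂ) * (t v - t₂ v) * (t v - t₃ v) * (t v - t₄ v)) ∧
    z.1 = sym ⟨x, (t₁, t₂)⟩ ∧ z'.1 = sym ⟨x, (t₃, t₄)⟩

/-- The quotient curve `Ŝ₆ / σ`. -/
def S6modσ : Type u := Quot a.sigmaRel

instance : TopologicalSpace a.S6modσ := inferInstanceAs (TopologicalSpace (Quot a.sigmaRel))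

/-- The quotient map `Ŝ₆ → Ŝ₆ / σ`. -/
def quotσ (z : a.S6) : a.S6modσ := Quot.mk _ z

instance : HolSpace a.S6modσ := HolSpace.quotient a.quotσ continuous_quot_mk

/-! ### The two maps -/

/-- The projection `Δ → S`. -/
def Delta₁ (d : a.Delta) : a.S := ⟨d.1.1, by
  obtain ⟨p, hp, h⟩ := d.2
  rw [← h]
  exact hp.1.1⟩

/-- The projection `Δ → Ŝ₆`. -/
def Delta₂ (d : a.Delta) : a.S6 := ⟨d.1.2, by
  obtain ⟨p, hp, h⟩ := d.2
  rw [← h]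
  exact ⟨p, hp, rfl⟩⟩

/-- The action of the correspondence on divisors, `D ↦ Nm₂(π₁^* D ∩ Δ)`: the intersection of `Δ`
with `π₁^* D` is the pullback of `D` to the curve `Δ`, and `Nm₂` is its image in `Ŝ₆`. -/
def corr : (a.S →₀ ℤ) →+ (a.S6 →₀ ℤ) := (normDiv a.Delta₂).comp (pullDiv a.Delta₁)

/-- The sheaf `L₋` of anti-invariant sections of `p₁^* L ⊗ p₂^* L`, for the lift of `τ` that
interchanges the factors. -/
def LMinus (L : LineBundle.{u, v} a.S) : OMod.{u, max u v} a.S6 :=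
  (L.box a.p₁ a.p₂).antiInv a.q a.τ a.q_τ
    (fun y => (TensorProduct.comm ℂ (L.E (a.p₂ y)) (L.E (a.p₁ y))).toLinearMap)

/-- The sheaf `T` of anti-invariant functions: `q_* O = O ⊕ T`. -/
def sheafT : OMod.{u, u} a.S6 :=
  (structureSheaf a.SS0).antiInv a.q a.τ a.q_τ (fun _ => LinearMap.id)

/-- `I₃(L) = L₋ ⊗ T⁻¹ = Hom(T, L₋)`. -/
def I3 (L : LineBundle.{u, v} a.S) : OMod.{u, max u v} a.S6 := a.sheafT.hom (a.LMinus L)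

end HitchinBase

end Curves

end Trigonal

end

/-! Everything is computed on the curve `SS0` = (S ×_X S)₀. The map (y, y') ↦ (y, Sym[y, y'])
identifies it with Δ, because y' is recovered as twice the mean minus y (`isBihol_delta`).
Intersecting π₁^*D with Δ is therefore the pullback p₁^*D, and the correspondence is `corr` = q_*
p₁^*. Since q is a double cover with involution τ, one gets q^*(corr D) = p₁^*D + p₂^*D
(`exists_hasRamification_q`); this identity drives assertions 1 and 3.

Local picture. A simple root of the quartic is an analytic branch over the base (`IsBranch`). At a
double root smoothness makes the base coordinate an analytic function ζ of the root (`IsFold`); it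
has order two, and the other merging root is `conj`, since the roots sum to zero (`fold_orders`). By
generic ramification at most two roots of a fibre coincide, so a pair of roots is of one of three
kinds: both simple, one of them half of a double root, or both equal. Each kind has explicit
parameters on S, `SS0` and Ŝ₆, and the ramification of p₁, q and Ŝ₆ → X is read off
(`hasRamification`). Where the two roots are equal, Ŝ₆ is still smooth and unramified over X,
because the complementary quadratic factor has simple roots.

1. If D = div f, the product f(y) f(y') descends along q to a function with divisor corr D
(`corr_principal`). A point lies in three pairs of its fibre, so degrees are multiplied by three.

2. The three pairs containing a given root represent the three partitions of the fibre into two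
pairs, whichever root is chosen. So the norm of corr D to Ŝ₆/σ is the pullback of the norm of D to X
(`normDiv_corr`, `baseParts_apply`), and pullback preserves principal divisors. Here σ acts without
fixed points, hence Ŝ₆ → Ŝ₆/σ is locally biholomorphic (`sigmaRel.ne`, `isParam_quotσ`).

3. An isomorphism of L with O(D) yields a meromorphic section ψ of divisor D
(`LineBundle.exists_meromorphic_section`). Then ψ ⊗ ψ is a τ-invariant section of p₁^*L ⊗ p₂^*L
whose divisor is q^*(corr D). Over a chart T is free on the difference `delta` of the two roots,
which vanishes to first order exactly at the fixed points of τ (`exists_eq_smul_generator`). Every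
homomorphism T → L₋ is consequently multiplication by r ψ ⊗ ψ with a unique meromorphic r on Ŝ₆, and
it is regular exactly when div r + corr D ≥ 0. This is the isomorphism of I₃(L) with O(corr D)
(`HasDivisor.I3_isIso`). -/

noncomputable section

namespace Trigonal

open Filter Set

set_option linter.unusedSectionVars false

/-! ### Orders of functions of one complex variable -/

/-- The function `F` is meromorphic at `s₀`, of order `n`. -/
def HasOrd (F : ℂ → ℂ) (s₀ : ℂ) (n : ℤ) : Prop :=
  ∃ g : ℂ → ℂ, AnalyticAt ℂ g s₀ ∧ g s₀ ≠ 0 ∧ ∀ᶠ s in 𝓝[≠] s₀, F s = (s - s₀) ^ n * g s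

theorem eventually_sub_ne (s₀ : ℂ) : ∀ᶠ s in 𝓝[≠] s₀, s - s₀ ≠ 0 := by
  filter_upwards [self_mem_nhdsWithin] with s hs
  exact sub_ne_zero.2 hs

theorem HasOrd.congr {F G : ℂ → ℂ} {s₀ : ℂ} {n : ℤ} (h : HasOrd F s₀ n)
    (hFG : ∀ᶠ s in 𝓝[≠] s₀, G s = F s) : HasOrd G s₀ n := by
  obtain ⟨g, h1, h2, h3⟩ := h
  refine ⟨g, h1, h2, ?_⟩
  filter_upwards [h3, hFG] with s hs hs'
  rw [hs', hs]

theorem HasOrd.mul {F G : ℂ → ℂ} {s₀ : ℂ} {m n : ℤ} (hF : HasOrd F s₀ m) (hG : HasOrd G s₀ n) :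
    HasOrd (fun s => F s * G s) s₀ (m + n) := by
  obtain ⟨f, h1, h2, h3⟩ := hF
  obtain ⟨g, h1', h2', h3'⟩ := hG
  refine ⟨fun s => f s * g s, h1.mul h1', mul_ne_zero h2 h2', ?_⟩
  filter_upwards [h3, h3', eventually_sub_ne s₀] with s hs hs' hne
  rw [hs, hs', zpow_add₀ hne]
  ring

theorem HasOrd.zpow {F : ℂ → ℂ} {s₀ : ℂ} {m : ℤ} (hF : HasOrd F s₀ m) (n : ℤ) :
    HasOrd (fun s => F s ^ n) s₀ (m * n) := by
  obtain ⟨f, h1, h2, h3⟩ := hF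
  refine ⟨fun s => f s ^ n, h1.fun_zpow h2, zpow_ne_zero _ h2, ?_⟩
  filter_upwards [h3] with s hs
  rw [hs, mul_zpow, zpow_mul]

theorem HasOrd.of_analyticAt {F : ℂ → ℂ} {s₀ : ℂ} (hF : AnalyticAt ℂ F s₀) (h : F s₀ ≠ 0) :
    HasOrd F s₀ 0 :=
  ⟨F, hF, h, Eventually.of_forall fun s => by simp⟩

theorem hasOrd_sub (s₀ : ℂ) : HasOrd (fun s => s - s₀) s₀ 1 :=
  ⟨fun _ => 1, analyticAt_const, one_ne_zero, Eventually.of_forall fun s => by simp⟩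

theorem HasOrd.eventually_ne {F : ℂ → ℂ} {s₀ : ℂ} {n : ℤ} (h : HasOrd F s₀ n) :
    ∀ᶠ s in 𝓝[≠] s₀, F s ≠ 0 := by
  obtain ⟨g, h1, h2, h3⟩ := h
  filter_upwards [h3, eventually_sub_ne s₀,
    (h1.continuousAt.eventually_ne h2).filter_mono nhdsWithin_le_nhds] with s hs hs' hg
  rw [hs]
  exact mul_ne_zero (zpow_ne_zero _ hs') hg

theorem analytic_eq_of_punctured {f g : ℂ → ℂ} {s₀ : ℂ} (hf : ContinuousAt f s₀)
    (hg : ContinuousAt g s₀) (h : ∀ᶠ s in 𝓝[≠] s₀, f s = g s) : f s₀ = g s₀ := by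
  have h1 : Tendsto f (𝓝[≠] s₀) (𝓝 (f s₀)) := hf.tendsto.mono_left nhdsWithin_le_nhds
  have h2 : Tendsto g (𝓝[≠] s₀) (𝓝 (g s₀)) := hg.tendsto.mono_left nhdsWithin_le_nhds
  exact tendsto_nhds_unique (h1.congr' h) h2

/-- If a function of non-negative order agrees with an analytic function `k` times a power, then
comparing orders at `s₀`. -/
theorem HasOrd.nonneg_of_analyticAt {F : ℂ → ℂ} {s₀ : ℂ} {n : ℤ} (h : HasOrd F s₀ n)
    (hF : ContinuousAt F s₀) : 0 ≤ n := by
  obtain ⟨g, h1, h2, h3⟩ := h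
  by_contra hn
  push Not at hn
  refine h2 ?_
  -- With `n = -(k + 1)`, clearing the pole gives `g = (s - s₀)^(k+1) F`, and continuity of `F`
  -- forces `g s₀ = 0`.
  obtain ⟨k, hk⟩ : ∃ k : ℕ, n = -((k : ℤ) + 1) := ⟨(-n - 1).toNat, by omega⟩
  have h4 : ∀ᶠ s in 𝓝[≠] s₀, g s = (s - s₀) ^ (k + 1) * F s := by
    filter_upwards [h3, eventually_sub_ne s₀] with s hs hne
    rw [hs, hk, zpow_neg, ← mul_assoc]
    have : ((s - s₀) ^ ((k : ℤ) + 1)) = (s - s₀) ^ (k + 1) := by exact_mod_cast zpow_natCast (s - s₀) (k + 1)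
    rw [this, mul_inv_cancel₀ (pow_ne_zero _ hne), one_mul]
  have := analytic_eq_of_punctured h1.continuousAt
    (((continuousAt_id.sub continuousAt_const).pow (k + 1)).mul hF) h4
  simpa using this

theorem HasOrd.unique {F : ℂ → ℂ} {s₀ : ℂ} {m n : ℤ} (h : HasOrd F s₀ m) (h' : HasOrd F s₀ n) :
    m = n := by
  have key : ∀ m n : ℤ, HasOrd F s₀ m → HasOrd F s₀ n → m ≤ n := by
    intro m n h h'
    obtain ⟨f, h1, h2, h3⟩ := h
    have h4 := (HasOrd.of_analyticAt h1 h2).zpow (-1)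
    -- The cofactor `f` equals `F (s - s₀)^(-m)` and so has order `n - m`; being continuous, it has
    -- nonnegative order.
    have h5 := (h'.mul ((hasOrd_sub s₀).zpow (-m))).congr (G := f) (by
      filter_upwards [h3, eventually_sub_ne s₀] with s hs hne
      rw [hs, zpow_neg, mul_comm, ← mul_assoc, inv_mul_cancel₀ (zpow_ne_zero _ hne), one_mul])
    have := h5.nonneg_of_analyticAt h1.continuousAt
    omega
  exact le_antisymm (key m n h h') (key n m h' h)

/-- Exponents multiply because `f ∘ h` stays a unit. The finite order of `h - t₀` also keeps `h`
away from `t₀` on a punctured neighbourhood, the only place where `F` is controlled. -/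
theorem HasOrd.comp {F h : ℂ → ℂ} {s₀ t₀ : ℂ} {n e : ℤ} (hF : HasOrd F t₀ n)
    (ha : AnalyticAt ℂ h s₀) (h0 : h s₀ = t₀) (he : HasOrd (fun s => h s - t₀) s₀ e) :
    HasOrd (fun s => F (h s)) s₀ (e * n) := by
  obtain ⟨f, h1, h2, h3⟩ := hF
  have ht : Tendsto h (𝓝[≠] s₀) (𝓝[≠] t₀) := by
    refine tendsto_nhdsWithin_iff.2 ⟨?_, ?_⟩
    · rw [← h0]
      exact ha.continuousAt.tendsto.mono_left nhdsWithin_le_nhds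
    · filter_upwards [he.eventually_ne] with s hs
      exact sub_ne_zero.1 hs
  have h4 : HasOrd (fun s => f (h s)) s₀ 0 := by
    refine HasOrd.of_analyticAt ?_ (by rwa [h0])
    exact AnalyticAt.fun_comp (by rwa [h0]) ha
  have := ((he.zpow n).mul h4).congr (G := fun s => F (h s)) (ht.eventually h3)
  simpa using this

theorem HasOrd.tendsto_punctured {h : ℂ → ℂ} {s₀ : ℂ} {e : ℤ} (ha : ContinuousAt h s₀)
    (he : HasOrd (fun s => h s - h s₀) s₀ e) : Tendsto h (𝓝[≠] s₀) (𝓝[≠] (h s₀)) := by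
  refine tendsto_nhdsWithin_iff.2 ⟨ha.tendsto.mono_left nhdsWithin_le_nhds, ?_⟩
  filter_upwards [he.eventually_ne] with s hs
  exact sub_ne_zero.1 hs

theorem analyticAt_dslope {F : ℂ → ℂ} {s₀ : ℂ} (hF : AnalyticAt ℂ F s₀) :
    AnalyticAt ℂ (dslope F s₀) s₀ := by
  obtain ⟨p, hp⟩ := hF
  exact ⟨_, hp.has_fpower_series_dslope_fslope⟩

/-- The divided difference is the required cofactor, with value `deriv F s₀` at `s₀`. -/
theorem HasOrd.of_deriv_ne_zero {F : ℂ → ℂ} {s₀ : ℂ} (hF : AnalyticAt ℂ F s₀)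
    (hd : deriv F s₀ ≠ 0) : HasOrd (fun s => F s - F s₀) s₀ 1 := by
  refine ⟨dslope F s₀, analyticAt_dslope hF, by rwa [dslope_same], ?_⟩
  refine Eventually.of_forall fun s => ?_
  have := sub_smul_dslope F s₀ s
  change F s - F s₀ = _
  rw [zpow_one, ← this, smul_eq_mul]

/-- An analytic function vanishing at `s₀` is divisible by any function of order one. -/
theorem HasOrd.exists_eq_mul {F t : ℂ → ℂ} {s₀ : ℂ} (ht : HasOrd t s₀ 1) (hF : AnalyticAt ℂ F s₀)
    (h0 : F s₀ = 0) (ht0 : t s₀ = 0) :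
    ∃ k : ℂ → ℂ, AnalyticAt ℂ k s₀ ∧ ∀ᶠ s in 𝓝 s₀, F s = t s * k s := by
  obtain ⟨g, h1, h2, h3⟩ := ht
  refine ⟨fun s => dslope F s₀ s / g s, (analyticAt_dslope hF).div h1 h2, ?_⟩
  have h4 := h1.continuousAt.eventually_ne h2
  rw [eventually_nhdsWithin_iff] at h3
  filter_upwards [h3, h4] with s hs hg
  by_cases hss : s = s₀
  · rw [hss, h0, ht0, zero_mul]
  · rw [hs hss, zpow_one]
    have := sub_smul_dslope F s₀ s
    rw [h0, sub_zero, smul_eq_mul] at this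
    rw [← this]
    field_simp

/-- A function whose composition with a non-constant analytic function is analytic is analytic. -/
theorem exists_analyticAt_of_comp {ζ G v : ℂ → ℂ} {d : ℂ} {e : ℤ} (hζ : AnalyticAt ℂ ζ d)
    (he : HasOrd (fun s => ζ s - ζ d) d e) (hv : AnalyticAt ℂ v d)
    (hG : ∀ᶠ s in 𝓝[≠] d, G (ζ s) = v s) :
    ∃ V : ℂ → ℂ, AnalyticAt ℂ V (ζ d) ∧ V (ζ d) = v d ∧ (∀ᶠ z in 𝓝[≠] (ζ d), G z = V z) ∧
      ∀ᶠ s in 𝓝 d, v s = V (ζ s) := by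
  have hne := he.eventually_ne
  have hncst : ¬ ∀ᶠ s in 𝓝 d, ζ s = ζ d := by
    intro h
    obtain ⟨s, h1, h2⟩ := (hne.and (h.filter_mono nhdsWithin_le_nhds)).exists
    exact h1 (by rw [h2, sub_self])
  -- Open mapping theorem: `ζ` covers a punctured neighbourhood of `ζ d` by points near `d`, so what
  -- holds along `ζ` near `d` holds near `ζ d`.
  have hopen : 𝓝[≠] (ζ d) ≤ map ζ (𝓝[≠] d) := by
    have h1 := hζ.eventually_constant_or_nhds_le_map_nhds.resolve_left hncst
    intro U hU
    rw [mem_map, mem_nhdsWithin_iff_eventually] at hU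
    have h2 : {z | z ≠ ζ d → z ∈ U} ∈ map ζ (𝓝 d) := by
      rw [mem_map]
      filter_upwards [hU] with s hs hz
      exact hs (fun h => hz (congrArg ζ h))
    have h3 := h1 h2
    rw [mem_nhdsWithin_iff_eventually]
    filter_upwards [h3] with z hz hz'
    exact hz hz'
  -- Zeros of `ζ'` are isolated; otherwise `ζ'` vanishes on a ball and `ζ` is constant there.
  have hder : ∀ᶠ s in 𝓝[≠] d, deriv ζ s ≠ 0 := by
    refine hζ.deriv.eventually_eq_zero_or_eventually_ne_zero.resolve_left fun h => hncst ?_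
    have h1 : ∀ᶠ s in 𝓝 d, DifferentiableAt ℂ ζ s :=
      hζ.eventually_analyticAt.mono fun s hs => hs.differentiableAt
    obtain ⟨r, hr, hb⟩ := Metric.eventually_nhds_iff_ball.1 (h.and h1)
    filter_upwards [Metric.ball_mem_nhds d hr] with s hs
    refine (convex_ball d r).is_const_of_fderivWithin_eq_zero (𝕜 := ℂ)
      (fun x hx => (hb x hx).2.differentiableWithinAt) (fun x hx => ?_) hs
      (Metric.mem_ball_self hr)
    rw [fderivWithin_of_isOpen Metric.isOpen_ball hx]
    ext
    simpa using (hb x hx).1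
  -- Off `d` and the zeros of `ζ'`, `G` agrees locally with `v` composed with a holomorphic local
  -- inverse of `ζ`.
  have hGd : ∀ᶠ s in 𝓝[≠] d, DifferentiableAt ℂ G (ζ s) := by
    have hG' : ∀ᶠ s in 𝓝[≠] d, ∀ᶠ s' in 𝓝 s, G (ζ s') = v s' := by
      have := eventually_eventually_nhdsWithin.2 hG
      filter_upwards [this, self_mem_nhdsWithin] with s hs hsd
      rwa [isOpen_compl_singleton.nhdsWithin_eq hsd] at hs
    filter_upwards [hder, hG', hζ.eventually_analyticAt.filter_mono nhdsWithin_le_nhds,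
      hv.eventually_analyticAt.filter_mono nhdsWithin_le_nhds] with s h1 h2 h3 h4
    have hs : HasStrictDerivAt ζ (deriv ζ s) s := h3.hasStrictDerivAt
    have hi := hs.to_localInverse h1
    set inv := hs.localInverse ζ (deriv ζ s) s h1 with hinv
    have hr : ∀ᶠ z in 𝓝 (ζ s), ζ (inv z) = z :=
      (hs.hasStrictFDerivAt_equiv h1).eventually_right_inverse
    have hi0 : inv (ζ s) = s :=
      (hs.hasStrictFDerivAt_equiv h1).localInverse_apply_image
    have hc : ContinuousAt inv (ζ s) := hi.hasDerivAt.continuousAt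
    have h5 : ∀ᶠ z in 𝓝 (ζ s), G z = v (inv z) := by
      have : ∀ᶠ z in 𝓝 (ζ s), G (ζ (inv z)) = v (inv z) := by
        refine hc.eventually (p := fun s' => G (ζ s') = v s') ?_
        rwa [hi0]
      filter_upwards [this, hr] with z hz hz'
      rwa [hz'] at hz
    refine DifferentiableAt.congr_of_eventuallyEq ?_ h5
    refine DifferentiableAt.comp (ζ s) ?_ hi.hasDerivAt.differentiableAt
    rw [hi0]
    exact h4.differentiableAt
  have hlim : Tendsto G (𝓝[≠] (ζ d)) (𝓝 (v d)) := by
    have h1 : Tendsto (fun s => G (ζ s)) (𝓝[≠] d) (𝓝 (v d)) :=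
      (hv.continuousAt.tendsto.mono_left nhdsWithin_le_nhds).congr' (hG.mono fun s hs => hs.symm)
    exact (tendsto_map'_iff.2 h1).mono_left hopen
  have hupd : ∀ᶠ z in 𝓝[≠] (ζ d), Function.update G (ζ d) (v d) z = G z := by
    filter_upwards [self_mem_nhdsWithin] with z hz
    exact Function.update_of_ne hz _ _
  have hcont : ContinuousAt (Function.update G (ζ d) (v d)) (ζ d) :=
    continuousAt_update_same.2 hlim
  -- Redefined at `ζ d` as its limit `v d`, `G` is continuous there and differentiable around it, so
  -- the singularity is removable.
  have hVa : AnalyticAt ℂ (Function.update G (ζ d) (v d)) (ζ d) := by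
    refine Complex.analyticAt_of_differentiable_on_punctured_nhds_of_continuousAt ?_ hcont
    have h2 : ∀ᶠ z in 𝓝[≠] (ζ d), DifferentiableAt ℂ G z := hopen hGd
    filter_upwards [h2, self_mem_nhdsWithin] with z hz hne
    refine hz.congr_of_eventuallyEq ?_
    filter_upwards [isOpen_compl_singleton.mem_nhds hne] with z' hz'
    exact Function.update_of_ne hz' _ _
  refine ⟨Function.update G (ζ d) (v d), hVa, by simp, hupd.mono fun z hz => hz.symm, ?_⟩
  rw [eventually_nhdsWithin_iff] at hG hne
  filter_upwards [hG, hne] with s hs hs'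
  by_cases hsd : s = d
  · rw [hsd, Function.update_self]
  · rw [Function.update_of_ne (sub_ne_zero.1 (hs' hsd)), hs hsd]

/-! ### Germs of holomorphic functions -/

section Germs

variable {Y : Type u} [TopologicalSpace Y] [HolSpace Y]

theorem IsHolAt.congr {f g : Y → ℂ} {p : Y} (hf : IsHolAt f p) (h : ∀ᶠ y in 𝓝 p, g y = f y) :
    IsHolAt g p := by
  obtain ⟨V, hp, hV⟩ := hf
  obtain ⟨W, hW, hWo, hpW⟩ := eventually_nhds_iff.1 h
  refine ⟨V ⊓ ⟨W, hWo⟩, ⟨hp, hpW⟩, ?_⟩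
  have := HolSpace.res (inf_le_left : V ⊓ ⟨W, hWo⟩ ≤ V) hV
  convert this using 1
  funext y
  exact hW y y.2.2

theorem IsHolAt.eventually {f : Y → ℂ} {p : Y} (hf : IsHolAt f p) : ∀ᶠ y in 𝓝 p, IsHolAt f y := by
  obtain ⟨V, hp, hV⟩ := hf
  filter_upwards [V.isOpen.mem_nhds hp] with y hy
  exact ⟨V, hy, hV⟩

theorem holNear_iff {U : Opens Y} {f : Y → ℂ} {p : U} :
    HolNear (fun y : U => f y) p ↔ IsHolAt f p := by
  constructor
  · rintro ⟨V, hV, hp, h⟩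
    exact ⟨V, hp, h⟩
  · rintro ⟨V, hp, h⟩
    exact ⟨V ⊓ U, inf_le_right, ⟨hp, p.2⟩, HolSpace.res inf_le_left h⟩

theorem isHolAt_const (c : ℂ) (p : Y) : IsHolAt (fun _ => c) p :=
  ⟨⊤, trivial, (HolSpace.O (⊤ : Opens Y)).algebraMap_mem c⟩

theorem IsHolAt.mul {f g : Y → ℂ} {p : Y} (hf : IsHolAt f p) (hg : IsHolAt g p) :
    IsHolAt (fun y => f y * g y) p := by
  obtain ⟨V, hp, hV⟩ := hf
  obtain ⟨W, hp', hW⟩ := hg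
  exact ⟨V ⊓ W, ⟨hp, hp'⟩, mul_mem (HolSpace.res inf_le_left hV) (HolSpace.res inf_le_right hW)⟩

theorem mem_O_iff {U : Opens Y} {f : U → ℂ} : f ∈ HolSpace.O U ↔ ∀ p : U, HolNear f p :=
  ⟨fun h p => holNear_of_mem h p, fun h => HolSpace.glue h⟩

theorem restrict_mem_O_iff {U : Opens Y} {f : Y → ℂ} :
    (fun y : U => f y) ∈ HolSpace.O U ↔ ∀ p ∈ U, IsHolAt f p := by
  rw [mem_O_iff]
  exact ⟨fun h p hp => holNear_iff.1 (h ⟨p, hp⟩), fun h p => holNear_iff.2 (h p p.2)⟩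

open Classical in
/-- Extension by zero of a function on an open set. -/
def extendZero {U : Opens Y} (f : U → ℂ) (y : Y) : ℂ := if h : y ∈ U then f ⟨y, h⟩ else 0

theorem extendZero_apply {U : Opens Y} (f : U → ℂ) (y : U) : extendZero f y = f y := by
  simp [extendZero]

theorem extendZero_of_mem {U : Opens Y} (f : U → ℂ) {y : Y} (hy : y ∈ U) :
    extendZero f y = f ⟨y, hy⟩ := by
  simp [extendZero, hy]

theorem holNear_iff_extendZero {U : Opens Y} {f : U → ℂ} {p : U} :
    HolNear f p ↔ IsHolAt (extendZero f) p := by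
  rw [← holNear_iff (U := U)]
  simp only [extendZero_apply]

/-! ### Local parametrizations -/

/-- `γ` is a holomorphic local parametrization of `Y` at the point `γ s₀`. -/
structure IsParam (γ : ℂ → Y) (s₀ : ℂ) : Prop where
  map_nhds : map γ (𝓝 s₀) = 𝓝 (γ s₀)
  leftInv : ∃ r : Y → ℂ, ∀ᶠ s in 𝓝 s₀, r (γ s) = s
  hol : ∀ f : Y → ℂ, IsHolAt f (γ s₀) ↔ AnalyticAt ℂ (fun s => f (γ s)) s₀

variable (Y) in
/-- Every point of `Y` has a local parametrization. -/
def IsCurve : Prop := ∀ p : Y, ∃ (γ : ℂ → Y) (s₀ : ℂ), γ s₀ = p ∧ IsParam γ s₀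

namespace IsParam

variable {γ : ℂ → Y} {s₀ : ℂ}

theorem eventually_iff (h : IsParam γ s₀) {P : Y → Prop} :
    (∀ᶠ y in 𝓝 (γ s₀), P y) ↔ ∀ᶠ s in 𝓝 s₀, P (γ s) := by
  rw [← h.map_nhds, eventually_map]

theorem continuousAt (h : IsParam γ s₀) : ContinuousAt γ s₀ := h.map_nhds.le

theorem eventually_ne (h : IsParam γ s₀) : ∀ᶠ s in 𝓝 s₀, γ s = γ s₀ → s = s₀ := by
  obtain ⟨r, hr⟩ := h.leftInv
  filter_upwards [hr] with s hs hss
  rw [← hs, hss, hr.self_of_nhds]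

/-- Beyond `map_nhds` this needs that near `s₀` the value `γ s₀` is taken only at `s₀`, which the
left inverse supplies. -/
theorem eventually_punctured_iff (h : IsParam γ s₀) {P : Y → Prop} :
    (∀ᶠ y in 𝓝[≠] (γ s₀), P y) ↔ ∀ᶠ s in 𝓝[≠] s₀, P (γ s) := by
  rw [eventually_nhdsWithin_iff, eventually_nhdsWithin_iff, h.eventually_iff]
  constructor
  · intro hP
    filter_upwards [hP, h.eventually_ne] with s hs hs' hne
    exact hs fun h => hne (hs' h)
  · intro hP
    filter_upwards [hP] with s hs hne
    exact hs fun h => hne (by rw [mem_singleton_iff] at h ⊢; rw [h])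

theorem map_punctured (h : IsParam γ s₀) : map γ (𝓝[≠] s₀) = 𝓝[≠] (γ s₀) :=
  Filter.ext fun _ => h.eventually_punctured_iff.symm

theorem neBot (h : IsParam γ s₀) : (𝓝[≠] (γ s₀)).NeBot := by
  rw [← h.map_punctured]
  infer_instance

theorem continuousAt_iff (h : IsParam γ s₀) {Z : Type*} [TopologicalSpace Z] {f : Y → Z} :
    ContinuousAt f (γ s₀) ↔ ContinuousAt (fun s => f (γ s)) s₀ := by
  unfold ContinuousAt
  rw [← h.map_nhds, tendsto_map'_iff]
  rfl

theorem continuousAt_of_isHolAt (h : IsParam γ s₀) {f : Y → ℂ} (hf : IsHolAt f (γ s₀)) :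
    ContinuousAt f (γ s₀) :=
  h.continuousAt_iff.2 ((h.hol f).1 hf).continuousAt

/-- Every analytic function of the parameter is a holomorphic function on the curve. -/
theorem exists_isHolAt (h : IsParam γ s₀) {F : ℂ → ℂ} (hF : AnalyticAt ℂ F s₀) :
    ∃ f : Y → ℂ, IsHolAt f (γ s₀) ∧ ∀ᶠ s in 𝓝 s₀, f (γ s) = F s := by
  obtain ⟨r, hr⟩ := h.leftInv
  have h1 : ∀ᶠ s in 𝓝 s₀, F (r (γ s)) = F s := by
    filter_upwards [hr] with s hs
    rw [hs]
  exact ⟨fun y => F (r y), (h.hol _).2 (hF.congr (h1.mono fun s hs => hs.symm)), h1⟩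

/-- The germ of `s - s₀` is a function on the curve, so a uniformizer divides it; conversely `s -
s₀` divides the uniformizer. The two quotients are inverse to each other, hence units, which is
order one. In the other direction a function of order one divides every germ vanishing at the point.
-/
theorem isUniformizer_iff (h : IsParam γ s₀) {t : Y → ℂ} :
    IsUniformizer t (γ s₀) ↔ AnalyticAt ℂ (fun s => t (γ s)) s₀ ∧ t (γ s₀) = 0 ∧
      HasOrd (fun s => t (γ s)) s₀ 1 := by
  constructor
  · rintro ⟨h1, h2, h3, h4⟩
    have ha := (h.hol t).1 h1
    refine ⟨ha, h2, ?_⟩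
    obtain ⟨r, hr, hrs⟩ := h.exists_isHolAt (F := fun s => s - s₀) (by fun_prop)
    obtain ⟨k, hk, hrk⟩ := h4 r hr (by simpa using hrs.self_of_nhds)
    obtain ⟨l, hl, htl⟩ := (hasOrd_sub s₀).exists_eq_mul ha h2 (sub_self s₀)
    have hka := (h.hol k).1 hk
    rw [h.eventually_iff] at hrk
    have h5 : ∀ᶠ s in 𝓝[≠] s₀, l s * k (γ s) = 1 := by
      filter_upwards [eventually_sub_ne s₀, hrs.filter_mono nhdsWithin_le_nhds,
        hrk.filter_mono nhdsWithin_le_nhds, htl.filter_mono nhdsWithin_le_nhds] with s hs h1 h2 h3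
      rw [h1, h3] at h2
      have : (s - s₀) * (l s * k (γ s)) = (s - s₀) * 1 := by rw [mul_one, ← mul_assoc, ← h2]
      exact mul_left_cancel₀ hs this
    have h6 := analytic_eq_of_punctured (hl.continuousAt.mul hka.continuousAt)
      (continuousAt_const (y := (1 : ℂ))) h5
    refine ⟨l, hl, fun h0 => by simp [h0] at h6, ?_⟩
    filter_upwards [htl.filter_mono nhdsWithin_le_nhds] with s hs
    rw [hs, zpow_one]
  · rintro ⟨h1, h2, h3⟩
    refine ⟨(h.hol t).2 h1, h2, h.eventually_punctured_iff.2 h3.eventually_ne, ?_⟩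
    intro g hg hg0
    obtain ⟨k, hk, hgk⟩ := h3.exists_eq_mul ((h.hol g).1 hg) hg0 h2
    obtain ⟨f, hf, hfk⟩ := h.exists_isHolAt hk
    refine ⟨f, hf, h.eventually_iff.2 ?_⟩
    filter_upwards [hgk, hfk] with s hs hs'
    rw [hs, hs']

theorem exists_isUniformizer (h : IsParam γ s₀) : ∃ t : Y → ℂ, IsUniformizer t (γ s₀) ∧
    ∀ᶠ s in 𝓝 s₀, t (γ s) = s - s₀ := by
  obtain ⟨r, hr, hrs⟩ := h.exists_isHolAt (F := fun s => s - s₀) (by fun_prop)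
  refine ⟨r, h.isUniformizer_iff.2 ⟨(h.hol r).1 hr, by simpa using hrs.self_of_nhds, ?_⟩, hrs⟩
  exact (hasOrd_sub s₀).congr (hrs.filter_mono nhdsWithin_le_nhds)

/-- This reduces the calculus of orders on a curve to one complex variable; it is how all the rules
below are obtained. -/
theorem hasOrder_iff (h : IsParam γ s₀) {f : Y → ℂ} {n : ℤ} :
    HasOrder f (γ s₀) n ↔ HasOrd (fun s => f (γ s)) s₀ n := by
  constructor
  · rintro ⟨t, k, ht, hk, hk0, hf⟩
    have h1 := (h.isUniformizer_iff.1 ht).2.2.zpow n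
    have h2 := HasOrd.of_analyticAt ((h.hol k).1 hk) hk0
    have := (h1.mul h2).congr (h.eventually_punctured_iff.1 hf)
    simpa using this
  · rintro ⟨g, h1, h2, h3⟩
    obtain ⟨t, ht, hts⟩ := h.exists_isUniformizer
    obtain ⟨k, hk, hks⟩ := h.exists_isHolAt h1
    refine ⟨t, k, ht, hk, by rwa [hks.self_of_nhds], h.eventually_punctured_iff.2 ?_⟩
    filter_upwards [h3, hts.filter_mono nhdsWithin_le_nhds,
      hks.filter_mono nhdsWithin_le_nhds] with s hs hs' hs''
    rw [hs, hs', hs'']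

/-- Transport of a parametrization along an isomorphism of germs. -/
theorem transport {Z : Type v} [TopologicalSpace Z] [HolSpace Z] (h : IsParam γ s₀) (Φ : Y → Z)
    (Ψ : Z → Y) (hmap : map Φ (𝓝 (γ s₀)) = 𝓝 (Φ (γ s₀))) (hΨ : ∀ᶠ y in 𝓝 (γ s₀), Ψ (Φ y) = y)
    (hhol : ∀ f : Z → ℂ, IsHolAt f (Φ (γ s₀)) ↔ IsHolAt (fun y => f (Φ y)) (γ s₀)) :
    IsParam (fun s => Φ (γ s)) s₀ where
  map_nhds := by
    rw [← hmap, ← h.map_nhds, map_map]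
    rfl
  leftInv := by
    obtain ⟨r, hr⟩ := h.leftInv
    refine ⟨fun z => r (Ψ z), ?_⟩
    filter_upwards [hr, h.eventually_iff.1 hΨ] with s hs hs'
    rw [hs', hs]
  hol f := by rw [hhol, h.hol]

end IsParam

theorem IsHolAt.continuousAt (hY : IsCurve Y) {f : Y → ℂ} {p : Y} (hf : IsHolAt f p) :
    ContinuousAt f p := by
  obtain ⟨γ, s₀, rfl, h⟩ := hY p
  exact h.continuousAt_of_isHolAt hf

theorem IsCurve.neBot (hY : IsCurve Y) (p : Y) : (𝓝[≠] p).NeBot := by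
  obtain ⟨γ, s₀, rfl, h⟩ := hY p
  exact h.neBot

theorem IsCurve.exists_isUniformizer (hY : IsCurve Y) (p : Y) : ∃ t : Y → ℂ, IsUniformizer t p := by
  obtain ⟨γ, s₀, rfl, h⟩ := hY p
  exact ⟨_, h.exists_isUniformizer.choose_spec.1⟩

theorem IsHolAt.inv (hY : IsCurve Y) {f : Y → ℂ} {p : Y} (hf : IsHolAt f p) (h0 : f p ≠ 0) :
    IsHolAt (fun y => (f y)⁻¹) p := by
  obtain ⟨γ, s₀, rfl, h⟩ := hY p
  exact (h.hol _).2 (((h.hol _).1 hf).inv h0)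

theorem IsHolAt.zpow (hY : IsCurve Y) {f : Y → ℂ} {p : Y} (hf : IsHolAt f p) (h0 : f p ≠ 0)
    (n : ℤ) : IsHolAt (fun y => f y ^ n) p := by
  obtain ⟨γ, s₀, rfl, h⟩ := hY p
  exact (h.hol _).2 (((h.hol _).1 hf).fun_zpow h0)

theorem eq_of_punctured (hY : IsCurve Y) {f g : Y → ℂ} {p : Y} (hf : ContinuousAt f p)
    (hg : ContinuousAt g p) (h : ∀ᶠ y in 𝓝[≠] p, f y = g y) : f p = g p := by
  have := hY.neBot p
  have h1 : Tendsto f (𝓝[≠] p) (𝓝 (f p)) := hf.tendsto.mono_left nhdsWithin_le_nhds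
  have h2 : Tendsto g (𝓝[≠] p) (𝓝 (g p)) := hg.tendsto.mono_left nhdsWithin_le_nhds
  exact tendsto_nhds_unique (h1.congr' h) h2

theorem HasOrder.congr {f g : Y → ℂ} {p : Y} {n : ℤ} (hf : HasOrder f p n)
    (h : ∀ᶠ y in 𝓝[≠] p, g y = f y) : HasOrder g p n := by
  obtain ⟨t, k, ht, hk, hk0, hfk⟩ := hf
  refine ⟨t, k, ht, hk, hk0, ?_⟩
  filter_upwards [h, hfk] with y hy hy'
  rw [hy, hy']

theorem HasOrder.mul (hY : IsCurve Y) {f g : Y → ℂ} {p : Y} {m n : ℤ} (hf : HasOrder f p m)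
    (hg : HasOrder g p n) : HasOrder (fun y => f y * g y) p (m + n) := by
  obtain ⟨γ, s₀, rfl, h⟩ := hY p
  rw [h.hasOrder_iff] at *
  exact hf.mul hg

theorem HasOrder.zpow (hY : IsCurve Y) {f : Y → ℂ} {p : Y} {m : ℤ} (hf : HasOrder f p m)
    (n : ℤ) : HasOrder (fun y => f y ^ n) p (m * n) := by
  obtain ⟨γ, s₀, rfl, h⟩ := hY p
  rw [h.hasOrder_iff] at *
  exact hf.zpow n

theorem HasOrder.unique (hY : IsCurve Y) {f : Y → ℂ} {p : Y} {m n : ℤ} (hf : HasOrder f p m)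
    (hf' : HasOrder f p n) : m = n := by
  obtain ⟨γ, s₀, rfl, h⟩ := hY p
  rw [h.hasOrder_iff] at *
  exact hf.unique hf'

theorem HasOrder.eventually_ne (hY : IsCurve Y) {f : Y → ℂ} {p : Y} {n : ℤ} (hf : HasOrder f p n) :
    ∀ᶠ y in 𝓝[≠] p, f y ≠ 0 := by
  obtain ⟨γ, s₀, rfl, h⟩ := hY p
  exact h.eventually_punctured_iff.2 (h.hasOrder_iff.1 hf).eventually_ne

theorem HasOrder.of_isHolAt (hY : IsCurve Y) {f : Y → ℂ} {p : Y} (hf : IsHolAt f p)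
    (h0 : f p ≠ 0) : HasOrder f p 0 := by
  obtain ⟨γ, s₀, rfl, h⟩ := hY p
  exact h.hasOrder_iff.2 (HasOrd.of_analyticAt ((h.hol f).1 hf) h0)

theorem IsUniformizer.hasOrder (hY : IsCurve Y) {t : Y → ℂ} {p : Y} (ht : IsUniformizer t p) :
    HasOrder t p 1 := by
  obtain ⟨γ, s₀, rfl, h⟩ := hY p
  exact h.hasOrder_iff.2 (h.isUniformizer_iff.1 ht).2.2

/-- `f` has at most a pole of order `n` at `p`. -/
def HasPoleLE (f : Y → ℂ) (p : Y) (n : ℤ) : Prop :=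
  ∃ k g : Y → ℂ, HasOrder k p n ∧ IsHolAt g p ∧ ∀ᶠ y in 𝓝[≠] p, f y * k y = g y

/-- Two functions of the same order differ by a unit, so the auxiliary function in `HasPoleLE` may
be replaced by any other of that order. -/
theorem HasPoleLE.exists_of_hasOrder (hY : IsCurve Y) {f k : Y → ℂ} {p : Y} {n : ℤ}
    (hf : HasPoleLE f p n) (hk : HasOrder k p n) :
    ∃ g : Y → ℂ, IsHolAt g p ∧ ∀ᶠ y in 𝓝[≠] p, f y * k y = g y := by
  obtain ⟨l, g, hl, hg, hfg⟩ := hf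
  obtain ⟨γ, s₀, rfl, h⟩ := hY p
  rw [h.hasOrder_iff] at hl hk
  obtain ⟨a, ha, ha0, hla⟩ := hl
  obtain ⟨b, hb, hb0, hkb⟩ := hk
  have hga := (h.hol g).1 hg
  obtain ⟨G, hG, hGs⟩ := h.exists_isHolAt ((hga.mul hb).div ha ha0)
  refine ⟨G, hG, h.eventually_punctured_iff.2 ?_⟩
  filter_upwards [hla, hkb, hGs.filter_mono nhdsWithin_le_nhds, h.eventually_punctured_iff.1 hfg,
    (ha.continuousAt.eventually_ne ha0).filter_mono nhdsWithin_le_nhds] with s h1 h2 h3 h4 h5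
  rw [h3, h2]
  simp only [Pi.div_apply, Pi.mul_apply]
  rw [← h4, h1]
  field_simp

theorem eventually_eventually_punctured [T1Space Y] {p : Y} {P : Y → Prop}
    (h : ∀ᶠ y in 𝓝[≠] p, P y) : ∀ᶠ y in 𝓝[≠] p, ∀ᶠ y' in 𝓝 y, P y' := by
  have h3 := eventually_eventually_nhdsWithin.2 h
  filter_upwards [h3, self_mem_nhdsWithin] with s hs hsd
  rwa [isOpen_compl_singleton.nhdsWithin_eq hsd] at hs

/-- Near `p` the function is `g / (t ^ n k)`, whose denominator is holomorphic and nonzero off `p`;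
poles are isolated. -/
theorem HasPoleLE.eventually_isHolAt [T1Space Y] (hY : IsCurve Y) {f : Y → ℂ} {p : Y} {n : ℤ}
    (hf : HasPoleLE f p n) : ∀ᶠ y in 𝓝[≠] p, IsHolAt f y := by
  obtain ⟨l, g, hl, hg, hfg⟩ := hf
  have hl0 := hl.eventually_ne hY
  obtain ⟨t, k, ht, hk, hk0, hlk⟩ := hl
  have key : ∀ᶠ y in 𝓝[≠] p, f y = g y * (t y ^ n * k y)⁻¹ ∧ l y = t y ^ n * k y := by
    filter_upwards [hfg, hlk, hl0] with s h1 h2 h3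
    refine ⟨?_, h2⟩
    rw [← h2, ← h1, mul_assoc, mul_inv_cancel₀ h3, mul_one]
  filter_upwards [eventually_eventually_punctured key,
    hg.eventually.filter_mono nhdsWithin_le_nhds, hk.eventually.filter_mono nhdsWithin_le_nhds,
    ht.1.eventually.filter_mono nhdsWithin_le_nhds, ht.2.2.1, hl0] with y h1 h2 h3 h4 h5 h6
  refine (h2.mul (IsHolAt.inv hY ((h4.zpow hY h5 n).mul h3) ?_)).congr (h1.mono fun y hy => hy.1)
  rwa [← h1.self_of_nhds.2]

theorem HasPoleLE.congr {f g : Y → ℂ} {p : Y} {n : ℤ} (hf : HasPoleLE f p n)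
    (h : ∀ᶠ y in 𝓝[≠] p, g y = f y) : HasPoleLE g p n := by
  obtain ⟨k, G, hk, hG, hfG⟩ := hf
  refine ⟨k, G, hk, hG, ?_⟩
  filter_upwards [hfG, h] with y hy hy'
  rw [← hy, hy']

theorem hasPoleLE_zero_iff (hY : IsCurve Y) {f : Y → ℂ} {p : Y} :
    HasPoleLE f p 0 ↔ ∃ g : Y → ℂ, IsHolAt g p ∧ ∀ᶠ y in 𝓝[≠] p, f y = g y := by
  constructor
  · intro h
    obtain ⟨g, hg, hfg⟩ := h.exists_of_hasOrder hY
      (HasOrder.of_isHolAt hY (isHolAt_const 1 p) one_ne_zero)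
    exact ⟨g, hg, by simpa using hfg⟩
  · rintro ⟨g, hg, hfg⟩
    exact ⟨_, g, HasOrder.of_isHolAt hY (isHolAt_const 1 p) one_ne_zero, hg, by simpa using hfg⟩

/-! ### Sections of `O(D)` -/

theorem eventually_apply_eq_zero [T1Space Y] (D : Y →₀ ℤ) (p : Y) : ∀ᶠ y in 𝓝[≠] p, D y = 0 := by
  have h : IsClosed ((D.support : Set Y) \ {p}) := (D.support.finite_toSet.subset sdiff_subset).isClosed
  have h1 : ∀ᶠ y in 𝓝 p, y ∉ (D.support : Set Y) \ {p} := h.isOpen_compl.mem_nhds (by simp)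
  filter_upwards [h1.filter_mono nhdsWithin_le_nhds, self_mem_nhdsWithin] with y hy hyp
  by_contra h0
  exact hy ⟨by simpa using h0, hyp⟩

theorem hasPoleLE_of_mem_sheafOfDiv (hY : IsCurve Y) {D : Y →₀ ℤ} {U : Opens Y} {f : U → ℂ}
    (hf : f ∈ (sheafOfDiv D).sec U) {p : Y} (hp : p ∈ U) : HasPoleLE (extendZero f) p (D p) := by
  by_cases hD : D p = 0
  · rw [hD, hasPoleLE_zero_iff hY]
    exact ⟨extendZero f, holNear_iff_extendZero.1 (hf.1 ⟨p, hp⟩ hD), Eventually.of_forall fun _ => rfl⟩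
  · obtain ⟨t, ht⟩ := hY.exists_isUniformizer p
    obtain ⟨g, hg, hfg⟩ := (hf.2 ⟨p, hp⟩ hD).2 t ht
    refine ⟨fun y => t y ^ D p, extendZero g, ?_, holNear_iff_extendZero.1 hg, ?_⟩
    · simpa using (ht.hasOrder hY).zpow hY (D p)
    · rw [eventually_nhdsWithin_iff] at hfg ⊢
      rw [show 𝓝 p = map ((↑) : U → Y) (𝓝 ⟨p, hp⟩) from
        (U.isOpen.isOpenEmbedding_subtypeVal.map_nhds_eq ⟨p, hp⟩).symm, eventually_map]
      filter_upwards [hfg] with y hy hne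
      rw [extendZero_apply, extendZero_apply]
      exact hy (fun h => hne (by rw [mem_singleton_iff] at h ⊢; rw [h]))

theorem tendsto_coe_punctured {U : Opens Y} {p : U} :
    Tendsto ((↑) : U → Y) (𝓝[≠] p) (𝓝[≠] p.1) := by
  refine tendsto_nhdsWithin_iff.2
    ⟨continuous_subtype_val.continuousAt.tendsto.mono_left nhdsWithin_le_nhds, ?_⟩
  filter_upwards [self_mem_nhdsWithin] with y hy hyp
  exact hy (Subtype.ext hyp)

/-- A meromorphic function with poles bounded by `D`, normalized as a section of `O(D)`. -/
def normalize (D : Y →₀ ℤ) (f : Y → ℂ) (p : Y) : ℂ :=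
  if D p = 0 then limUnder (𝓝[≠] p) f else 0

/-- Off isolated points `f` is holomorphic, hence continuous, and its punctured limit is its value.
-/
theorem normalize_eventually_eq [T1Space Y] (hY : IsCurve Y) {D : Y →₀ ℤ} {f : Y → ℂ} {p : Y} {n : ℤ}
    (hf : HasPoleLE f p n) : ∀ᶠ y in 𝓝[≠] p, normalize D f y = f y := by
  filter_upwards [hf.eventually_isHolAt hY, eventually_apply_eq_zero D p] with y hy hD
  have := hY.neBot y
  rw [normalize, if_pos hD]
  exact ((hy.continuousAt hY).tendsto.mono_left nhdsWithin_le_nhds).limUnder_eq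

/-- Meromorphic functions are only handled up to their values at isolated points, while a section of
`O(D)` has prescribed values everywhere; taking punctured limits off the support of `D` passes from
the former to the latter. -/
theorem normalize_mem [T1Space Y] (hY : IsCurve Y) {D : Y →₀ ℤ} {U : Opens Y} {f : Y → ℂ}
    (hf : ∀ p ∈ U, HasPoleLE f p (D p)) :
    (fun y : U => normalize D f y) ∈ (sheafOfDiv D).sec U := by
  refine ⟨fun p hp => holNear_iff.2 ?_, fun p hp => ⟨if_neg hp, fun t ht => ?_⟩⟩
  · have h1 := hf p p.2
    have h2 := normalize_eventually_eq hY (D := D) h1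
    rw [hp, hasPoleLE_zero_iff hY] at h1
    obtain ⟨g, hg, hfg⟩ := h1
    have := hY.neBot p.1
    refine hg.congr ?_
    have h3 : normalize D f p = g p := by
      rw [normalize, if_pos hp]
      refine Tendsto.limUnder_eq ?_
      refine Tendsto.congr' (hfg.mono fun y hy => hy.symm) ?_
      exact (hg.continuousAt hY).tendsto.mono_left nhdsWithin_le_nhds
    rw [eventually_nhdsWithin_iff] at h2 hfg
    filter_upwards [h2, hfg] with y hy hy'
    by_cases hyp : y = p
    · rw [hyp, h3]
    · rw [hy hyp, hy' hyp]
  · have h1 : HasOrder (fun y => t y ^ D p) p.1 (D p) := by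
      simpa using (ht.hasOrder hY).zpow hY (D p)
    obtain ⟨g, hg, hfg⟩ := (hf p p.2).exists_of_hasOrder hY h1
    refine ⟨fun y => g y, holNear_iff.2 hg, ?_⟩
    have h2 := normalize_eventually_eq hY (D := D) (hf p p.2)
    have h3 : ∀ᶠ y in 𝓝[≠] p.1, normalize D f y * t y ^ D p = g y := by
      filter_upwards [hfg, h2] with y hy hy'
      rw [hy', hy]
    exact tendsto_coe_punctured.eventually h3

/-- Sections of `O(D)` are determined by their germs away from isolated points. -/
theorem sheafOfDiv_ext (hY : IsCurve Y) {D : Y →₀ ℤ} {U : Opens Y} {f g : U → ℂ}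
    (hf : f ∈ (sheafOfDiv D).sec U) (hg : g ∈ (sheafOfDiv D).sec U)
    (h : ∀ p ∈ U, ∀ᶠ y in 𝓝[≠] p, extendZero f y = extendZero g y) : f = g := by
  funext p
  by_cases hp : D p = 0
  · have h1 := (holNear_iff_extendZero.1 (hf.1 p hp)).continuousAt hY
    have h2 := (holNear_iff_extendZero.1 (hg.1 p hp)).continuousAt hY
    have := eq_of_punctured hY h1 h2 (h p p.2)
    rwa [extendZero_apply, extendZero_apply] at this
  · rw [(hf.2 p hp).1, (hg.2 p hp).1]

end Germs

/-! ### Local forms of holomorphic maps -/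

section LocalForm

variable {Y : Type u} [TopologicalSpace Y] [HolSpace Y] {Z : Type v} [TopologicalSpace Z]
  [HolSpace Z]

/-- The map `φ` is given near `p` by an analytic function of order `e` between local parameters. -/
def HasRamification (φ : Y → Z) (p : Y) (e : ℕ) : Prop :=
  ∃ (γ : ℂ → Y) (γ' : ℂ → Z) (h : ℂ → ℂ) (s₀ : ℂ), γ s₀ = p ∧ IsParam γ s₀ ∧ IsParam γ' (h s₀) ∧
    (∀ᶠ s in 𝓝 s₀, φ (γ s) = γ' (h s)) ∧ AnalyticAt ℂ h s₀ ∧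
      HasOrd (fun s => h s - h s₀) s₀ e

namespace HasRamification

variable {φ : Y → Z} {p : Y} {e : ℕ}

theorem continuousAt (hφ : HasRamification φ p e) : ContinuousAt φ p := by
  obtain ⟨γ, γ', h, s₀, rfl, hγ, hγ', hh, ha, he⟩ := hφ
  rw [hγ.continuousAt_iff]
  exact (hγ'.continuousAt.comp ha.continuousAt).congr (hh.mono fun s hs => hs.symm)

theorem tendsto_punctured (hφ : HasRamification φ p e) : Tendsto φ (𝓝[≠] p) (𝓝[≠] (φ p)) := by
  obtain ⟨γ, γ', h, s₀, rfl, hγ, hγ', hh, ha, he⟩ := hφ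
  rw [hh.self_of_nhds, ← hγ.map_punctured, ← hγ'.map_punctured, tendsto_map'_iff]
  refine Tendsto.congr' ?_ (tendsto_map.comp (he.tendsto_punctured ha.continuousAt))
  filter_upwards [hh.filter_mono nhdsWithin_le_nhds] with s hs
  exact hs.symm

theorem isHolAt_comp (hφ : HasRamification φ p e) {f : Z → ℂ} (hf : IsHolAt f (φ p)) :
    IsHolAt (fun y => f (φ y)) p := by
  obtain ⟨γ, γ', h, s₀, rfl, hγ, hγ', hh, ha, he⟩ := hφ
  rw [hh.self_of_nhds, hγ'.hol] at hf
  rw [hγ.hol]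
  refine (hf.fun_comp ha).congr ?_
  filter_upwards [hh] with s hs
  rw [hs]

theorem hasOrder_comp (hφ : HasRamification φ p e) {f : Z → ℂ} {n : ℤ} (hf : HasOrder f (φ p) n) :
    HasOrder (fun y => f (φ y)) p (e * n) := by
  obtain ⟨γ, γ', h, s₀, rfl, hγ, hγ', hh, ha, he⟩ := hφ
  rw [hh.self_of_nhds, hγ'.hasOrder_iff] at hf
  rw [hγ.hasOrder_iff]
  refine (hf.comp ha rfl he).congr ?_
  filter_upwards [hh.filter_mono nhdsWithin_le_nhds] with s hs
  rw [hs]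

/-- Functions on the source that factor through `φ` descend holomorphically. -/
theorem exists_descend (hφ : HasRamification φ p e) {G : Z → ℂ} {v : Y → ℂ} (hv : IsHolAt v p)
    (hG : ∀ᶠ y in 𝓝[≠] p, G (φ y) = v y) :
    ∃ V : Z → ℂ, IsHolAt V (φ p) ∧ V (φ p) = v p ∧ (∀ᶠ z in 𝓝[≠] (φ p), G z = V z) ∧
      ∀ᶠ y in 𝓝 p, v y = V (φ y) := by
  obtain ⟨γ, γ', h, s₀, rfl, hγ, hγ', hh, ha, he⟩ := hφ
  rw [hγ.eventually_punctured_iff] at hG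
  obtain ⟨V, hV, hV0, hGV, hvV⟩ := exists_analyticAt_of_comp (G := fun z => G (γ' z)) ha he
    ((hγ.hol v).1 hv) (by
      filter_upwards [hG, hh.filter_mono nhdsWithin_le_nhds] with s hs hs'
      rw [← hs', hs])
  obtain ⟨W, hW, hWV⟩ := hγ'.exists_isHolAt hV
  rw [hh.self_of_nhds]
  refine ⟨W, hW, by rw [hWV.self_of_nhds, hV0], hγ'.eventually_punctured_iff.2 ?_,
    hγ.eventually_iff.2 ?_⟩
  · filter_upwards [hGV, hWV.filter_mono nhdsWithin_le_nhds] with z hz hz'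
    rw [hz', hz]
  · filter_upwards [hvV, hh, ha.continuousAt.eventually hWV] with s h1 h2 h3
    rw [h2, h3, h1]

/-- Multiplying by `t ^ (-n)` for a uniformizer `t` at `φ p` reduces to order zero upstairs; there
the function extends to a unit, and units descend to units. -/
theorem hasOrder_of_comp (hφ : HasRamification φ p e) (hY : IsCurve Y) (hZ : IsCurve Z) {f : Z → ℂ}
    {n : ℤ} (hf : HasOrder (fun y => f (φ y)) p (e * n)) : HasOrder f (φ p) n := by
  obtain ⟨t, ht⟩ := hZ.exists_isUniformizer (φ p)
  have ho := ht.hasOrder hZ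
  have h1 := hf.mul hY ((hφ.hasOrder_comp ho).zpow hY (-n))
  obtain ⟨_, k, -, hk, hk0, hfk⟩ := h1
  rw [show (e * n + e * 1 * -n : ℤ) = 0 by ring] at hfk
  obtain ⟨V, hV, hV0, hGV, -⟩ := hφ.exists_descend (G := fun z => f z * t z ^ (-n)) hk
    (by simpa using hfk)
  have h2 := (HasOrder.of_isHolAt hZ hV (by rwa [hV0])).mul hZ (ho.zpow hZ n)
  rw [zero_add, one_mul] at h2
  refine h2.congr ?_
  filter_upwards [hGV, ho.eventually_ne hZ] with z hz hz'
  rw [← hz, zpow_neg, mul_assoc, inv_mul_cancel₀ (zpow_ne_zero _ hz'), mul_one]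

/-- The order of `t ∘ φ` is `e` for every uniformizer `t`, so the infimum in `ramIdx` is taken over
the single number `e`. -/
theorem ramIdx_eq (hφ : HasRamification φ p e) (hY : IsCurve Y) (hZ : IsCurve Z) :
    ramIdx φ p = e := by
  have key : {n : ℕ | ∃ t : Z → ℂ, IsUniformizer t (φ p) ∧ HasOrder (t ∘ φ) p n} = {e} := by
    ext n
    rw [mem_singleton_iff]
    constructor
    · rintro ⟨t, ht, hn⟩
      have := hn.unique hY (hφ.hasOrder_comp (ht.hasOrder hZ))
      omega
    · rintro rfl
      obtain ⟨t, ht⟩ := hZ.exists_isUniformizer (φ p)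
      have := hφ.hasOrder_comp (ht.hasOrder hZ)
      rw [mul_one] at this
      exact ⟨t, ht, this⟩
  rw [ramIdx, key, csInf_singleton]

end HasRamification

/-- Finiteness of the fibres makes the `finsum` in `pullDiv` an honest finite sum. -/
theorem pullDiv_apply (φ : Y → Z) (hfin : ∀ z, (φ ⁻¹' {z}).Finite) (D : Z →₀ ℤ) (y : Y) :
    pullDiv φ D y = ramIdx φ y * D (φ y) := by
  classical
  induction D using Finsupp.induction_linear with
  | zero => simp
  | add f g hf hg => rw [map_add, Finsupp.add_apply, hf, hg, Finsupp.add_apply, mul_add]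
  | single z n =>
    rw [pullDiv, Finsupp.liftAddHom_apply_single, zmultiplesHom_apply,
      finsum_mem_eq_finite_toFinset_sum _ (hfin z), Finsupp.smul_apply, Finsupp.finsetSum_apply]
    simp only [Finsupp.single_apply, Finset.sum_ite_eq', Finite.mem_toFinset, mem_preimage,
      mem_singleton_iff, smul_eq_mul]
    by_cases h : φ y = z
    · rw [if_pos h, if_pos h.symm, mul_comm]
    · rw [if_neg h, if_neg (Ne.symm h), mul_zero, mul_zero]

end LocalForm

theorem normDiv_apply {Y : Type u} {Z : Type v} (φ : Y → Z) (z : Z) (F : Finset Y)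
    (hF : ∀ y, φ y = z ↔ y ∈ F) (D : Y →₀ ℤ) : normDiv φ D z = ∑ y ∈ F, D y := by
  classical
  induction D using Finsupp.induction_linear with
  | zero => simp
  | add f g hf hg => simp only [map_add, Finsupp.add_apply, hf, hg, Finset.sum_add_distrib]
  | single y n =>
    change Finsupp.mapDomain φ (Finsupp.single y n) z = _
    rw [Finsupp.mapDomain_single, Finsupp.single_apply]
    simp only [Finsupp.single_apply, Finset.sum_ite_eq, hF]

/-! ### Coordinates on K, K² and the total spaces induced by a chart of the base. -/

section Coordinates

variable {X : Type u} [TopologicalSpace X] [ChartedSpace ℂ X] [IsManifold 𝓘(ℂ, ℂ) ω X]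

/-- The coordinate vector field of the chart at `x₀`. -/
def vf (x₀ x : X) : TangentSpace 𝓘(ℂ, ℂ) x :=
  (trivializationAt ℂ (TangentSpace 𝓘(ℂ, ℂ) : X → Type) x₀).symmL ℂ x 1

/-- The differential of the coordinate of the chart at `x₀`. -/
def dz (x₀ x : X) : K x :=
  (trivializationAt ℂ (TangentSpace 𝓘(ℂ, ℂ) : X → Type) x₀).continuousLinearMapAt ℂ x

theorem dz_vf {x₀ x : X} (hx : x ∈ (chartAt ℂ x₀).source) : dz x₀ x (vf x₀ x) = (1 : ℂ) :=
  (trivializationAt ℂ (TangentSpace 𝓘(ℂ, ℂ) : X → Type) x₀).continuousLinearMapAt_symmL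
    (R := ℂ) (by simpa using hx) 1

theorem dz_smul_vf {x₀ x : X} (hx : x ∈ (chartAt ℂ x₀).source) (v : TangentSpace 𝓘(ℂ, ℂ) x) :
    (dz x₀ x v : ℂ) • vf x₀ x = v := by
  have := (trivializationAt ℂ (TangentSpace 𝓘(ℂ, ℂ) : X → Type) x₀).symmL_continuousLinearMapAt
    (R := ℂ) (b := x) (by simpa using hx) v
  rw [vf, ← map_smul, smul_eq_mul, mul_one]
  exact this

theorem K_apply {x₀ x : X} (hx : x ∈ (chartAt ℂ x₀).source) (t : K x)
    (v : TangentSpace 𝓘(ℂ, ℂ) x) : (t v : ℂ) = (dz x₀ x v : ℂ) * (t (vf x₀ x) : ℂ) := by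
  conv_lhs => rw [← dz_smul_vf hx v, map_smul]
  rfl

theorem K_ext {x₀ x : X} (hx : x ∈ (chartAt ℂ x₀).source) {t t' : K x}
    (h : (t (vf x₀ x) : ℂ) = t' (vf x₀ x)) : t = t' := by
  refine ContinuousLinearMap.ext fun v => ?_
  refine (K_apply hx t v).trans (Eq.trans ?_ (K_apply hx t' v).symm)
  rw [h]

theorem K2_ext {x₀ x : X} (hx : x ∈ (chartAt ℂ x₀).source) {t t' : K2 x}
    (h : (t (vf x₀ x) (vf x₀ x) : ℂ) = t' (vf x₀ x) (vf x₀ x)) : t = t' := by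
  refine ContinuousLinearMap.ext fun v => K_ext hx ?_
  rw [← dz_smul_vf hx v, map_smul, map_smul]
  change _ * (t _ _ : ℂ) = _ * (t' _ _ : ℂ)
  rw [h]

/-- The coordinate of a covector. -/
def Kcoord (x₀ : X) {x : X} (t : K x) : ℂ := t (vf x₀ x)

/-- The covector with given coordinate. -/
def Kmk (x₀ x : X) (c : ℂ) : K x := c • dz x₀ x

theorem Kcoord_Kmk {x₀ x : X} (hx : x ∈ (chartAt ℂ x₀).source) (c : ℂ) :
    Kcoord x₀ (Kmk x₀ x c) = c := by
  change c * (dz x₀ x (vf x₀ x) : ℂ) = c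
  rw [dz_vf hx, mul_one]

theorem Kmk_Kcoord {x₀ x : X} (hx : x ∈ (chartAt ℂ x₀).source) (t : K x) :
    Kmk x₀ x (Kcoord x₀ t) = t :=
  K_ext hx (Kcoord_Kmk hx (Kcoord x₀ t))

/-- The coordinate of a quadratic covector. -/
def K2coord (x₀ : X) {x : X} (t : K2 x) : ℂ := t (vf x₀ x) (vf x₀ x)

/-- The quadratic covector with given coordinate. -/
def K2mk (x₀ x : X) (c : ℂ) : K2 x := (Kmk x₀ x c).smulRight (dz x₀ x)

theorem K2coord_K2mk {x₀ x : X} (hx : x ∈ (chartAt ℂ x₀).source) (c : ℂ) :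
    K2coord x₀ (K2mk x₀ x c) = c := by
  change Kcoord x₀ (Kmk x₀ x c) * (dz x₀ x (vf x₀ x) : ℂ) = c
  rw [dz_vf hx, mul_one, Kcoord_Kmk hx]

theorem K2mk_K2coord {x₀ x : X} (hx : x ∈ (chartAt ℂ x₀).source) (t : K2 x) :
    K2mk x₀ x (K2coord x₀ t) = t :=
  K2_ext hx (K2coord_K2mk hx (K2coord x₀ t))

/-- No condition on `x` is needed: both sides are built from the same `symmL`, which is linear also
off the base set. -/
theorem K_trivialization (x₀ : X) {x : X} (t : K x) :
    (trivializationAt (ℂ →L[ℂ] ℂ) (K : X → Type) x₀ ⟨x, t⟩).2 =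
      Kcoord x₀ t • ContinuousLinearMap.id ℂ ℂ := by
  refine ContinuousLinearMap.ext fun v => ?_
  rw [hom_trivializationAt_apply]
  simp only [ContinuousLinearMap.inCoordinates, ContinuousLinearMap.comp_apply]
  change (Bundle.Trivial.trivialization X ℂ).continuousLinearMapAt ℂ x _ = _
  rw [Trivial.continuousLinearMapAt_trivialization]
  change (t ((trivializationAt ℂ (TangentSpace 𝓘(ℂ, ℂ)) x₀).symmL ℂ x v) : ℂ) = Kcoord x₀ t * v
  have hv : v = v • (1 : ℂ) := by simp
  conv_lhs => rw [hv, map_smul, map_smul]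
  exact mul_comm _ _

theorem mem_baseSet_K {x₀ x : X} (hx : x ∈ (chartAt ℂ x₀).source) :
    x ∈ (trivializationAt (ℂ →L[ℂ] ℂ) (K : X → Type) x₀).baseSet := by
  rw [hom_trivializationAt_baseSet]
  exact ⟨by simpa using hx, by simp⟩

/-- On a line every bilinear form is a multiple of `dz ⊗ dz`, so the statement reduces to the one
for `K` through `trivialization_smulRight`. -/
theorem K2_trivialization (x₀ : X) {x : X} (hx : x ∈ (chartAt ℂ x₀).source) (t : K2 x) :
    (trivializationAt (ℂ →L[ℂ] ℂ →L[ℂ] ℂ) (K2 : X → Type) x₀ ⟨x, t⟩).2 =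
      (K2coord x₀ t • ContinuousLinearMap.id ℂ ℂ).smulRight (ContinuousLinearMap.id ℂ ℂ) := by
  have ht : t = (Kmk x₀ x (K2coord x₀ t)).smulRight (dz x₀ x) := (K2mk_K2coord hx t).symm
  conv_lhs => rw [ht]
  rw [trivialization_smulRight x₀ x (mem_baseSet_K hx), K_trivialization x₀,
    K_trivialization x₀, Kcoord_Kmk hx, show Kcoord x₀ (dz x₀ x) = 1 from dz_vf hx]
  ext
  simp

theorem mem_baseSet_K2 {x₀ x : X} (hx : x ∈ (chartAt ℂ x₀).source) :
    x ∈ (trivializationAt (ℂ →L[ℂ] ℂ →L[ℂ] ℂ) (K2 : X → Type) x₀).baseSet := by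
  rw [hom_trivializationAt_baseSet]
  exact ⟨by simpa using hx, mem_baseSet_K hx⟩

/-! #### Coordinates on the total spaces -/

/-- The coordinate of the chart at `x₀`. -/
def zc (x₀ x : X) : ℂ := chartAt ℂ x₀ x

/-- The inverse of the chart at `x₀`. -/
def zinv (x₀ : X) (z : ℂ) : X := (chartAt ℂ x₀).symm z

theorem contMDiffAt_zc {x₀ x : X} (hx : x ∈ (chartAt ℂ x₀).source) :
    ContMDiffAt 𝓘(ℂ, ℂ) 𝓘(ℂ, ℂ) ω (zc x₀) x :=
  contMDiffAt_of_mem_maximalAtlas (IsManifold.chart_mem_maximalAtlas x₀) hx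

theorem contMDiffAt_zinv {x₀ : X} {z : ℂ} (hz : z ∈ (chartAt ℂ x₀).target) :
    ContMDiffAt 𝓘(ℂ, ℂ) 𝓘(ℂ, ℂ) ω (zinv x₀) z :=
  contMDiffAt_symm_of_mem_maximalAtlas (IsManifold.chart_mem_maximalAtlas x₀) hz

theorem zinv_mem {x₀ : X} {z : ℂ} (hz : z ∈ (chartAt ℂ x₀).target) :
    zinv x₀ z ∈ (chartAt ℂ x₀).source := (chartAt ℂ x₀).map_target hz

theorem zc_mem {x₀ x : X} (hx : x ∈ (chartAt ℂ x₀).source) :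
    zc x₀ x ∈ (chartAt ℂ x₀).target := (chartAt ℂ x₀).map_source hx

theorem zc_zinv {x₀ : X} {z : ℂ} (hz : z ∈ (chartAt ℂ x₀).target) : zc x₀ (zinv x₀ z) = z :=
  (chartAt ℂ x₀).right_inv hz

theorem zinv_zc {x₀ x : X} (hx : x ∈ (chartAt ℂ x₀).source) : zinv x₀ (zc x₀ x) = x :=
  (chartAt ℂ x₀).left_inv hx

/-- Local coordinates on `Tot K`. -/
def coordK (x₀ : X) (p : TotK X) : ℂ × ℂ := (zc x₀ p.1, Kcoord x₀ p.2)

/-- The inverse of the local coordinates on `Tot K`. -/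
def embK (x₀ : X) (a : ℂ × ℂ) : TotK X := ⟨zinv x₀ a.1, Kmk x₀ _ a.2⟩

/-- Local coordinates on `Tot (K ⊕ K)`. -/
def coordKK (x₀ : X) (p : TotKK X) : ℂ × ℂ × ℂ := (zc x₀ p.1, Kcoord x₀ p.2.1, Kcoord x₀ p.2.2)

/-- The inverse of the local coordinates on `Tot (K ⊕ K)`. -/
def embKK (x₀ : X) (a : ℂ × ℂ × ℂ) : TotKK X := ⟨zinv x₀ a.1, (Kmk x₀ _ a.2.1, Kmk x₀ _ a.2.2)⟩

/-- Local coordinates on `Tot (K ⊕ K²)`. -/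
def coordKK2 (x₀ : X) (p : TotKK2 X) : ℂ × ℂ × ℂ :=
  (zc x₀ p.1, Kcoord x₀ p.2.1, K2coord x₀ p.2.2)

/-- The inverse of the local coordinates on `Tot (K ⊕ K²)`. -/
def embKK2 (x₀ : X) (a : ℂ × ℂ × ℂ) : TotKK2 X :=
  ⟨zinv x₀ a.1, (Kmk x₀ _ a.2.1, K2mk x₀ _ a.2.2)⟩

theorem coordK_embK {x₀ : X} {a : ℂ × ℂ} (ha : a.1 ∈ (chartAt ℂ x₀).target) :
    coordK x₀ (embK x₀ a) = a :=
  Prod.ext (zc_zinv ha) (Kcoord_Kmk (zinv_mem ha) _)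

theorem coordKK_embKK {x₀ : X} {a : ℂ × ℂ × ℂ} (ha : a.1 ∈ (chartAt ℂ x₀).target) :
    coordKK x₀ (embKK x₀ a) = a :=
  Prod.ext (zc_zinv ha) (Prod.ext (Kcoord_Kmk (zinv_mem ha) _) (Kcoord_Kmk (zinv_mem ha) _))

theorem coordKK2_embKK2 {x₀ : X} {a : ℂ × ℂ × ℂ} (ha : a.1 ∈ (chartAt ℂ x₀).target) :
    coordKK2 x₀ (embKK2 x₀ a) = a :=
  Prod.ext (zc_zinv ha) (Prod.ext (Kcoord_Kmk (zinv_mem ha) _) (K2coord_K2mk (zinv_mem ha) _))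

theorem embK_coordK {x₀ : X} {p : TotK X} (hp : p.1 ∈ (chartAt ℂ x₀).source) :
    embK x₀ (coordK x₀ p) = p := by
  obtain ⟨x, t⟩ := p
  change (⟨zinv x₀ (zc x₀ x), Kmk x₀ _ (Kcoord x₀ t)⟩ : TotK X) = ⟨x, t⟩
  rw [zinv_zc hp, Kmk_Kcoord hp]

theorem embKK_coordKK {x₀ : X} {p : TotKK X} (hp : p.1 ∈ (chartAt ℂ x₀).source) :
    embKK x₀ (coordKK x₀ p) = p := by
  obtain ⟨x, t, t'⟩ := p
  change (⟨zinv x₀ (zc x₀ x), (Kmk x₀ _ (Kcoord x₀ t), Kmk x₀ _ (Kcoord x₀ t'))⟩ : TotKK X) =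
    ⟨x, (t, t')⟩
  rw [zinv_zc hp, Kmk_Kcoord hp, Kmk_Kcoord hp]

theorem embKK2_coordKK2 {x₀ : X} {p : TotKK2 X} (hp : p.1 ∈ (chartAt ℂ x₀).source) :
    embKK2 x₀ (coordKK2 x₀ p) = p := by
  obtain ⟨x, t, t'⟩ := p
  change (⟨zinv x₀ (zc x₀ x), (Kmk x₀ _ (Kcoord x₀ t), K2mk x₀ _ (K2coord x₀ t'))⟩ : TotKK2 X) =
    ⟨x, (t, t')⟩
  rw [zinv_zc hp, Kmk_Kcoord hp, K2mk_K2coord hp]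

theorem coordKK2_sym (x₀ : X) (p : TotKK X) : coordKK2 x₀ (sym p) =
    ((coordKK x₀ p).1, ((coordKK x₀ p).2.1 + (coordKK x₀ p).2.2) / 2,
      (coordKK x₀ p).2.1 * (coordKK x₀ p).2.2) := by
  refine Prod.ext rfl (Prod.ext ?_ rfl)
  change (1 / 2 : ℂ) * (Kcoord x₀ p.2.1 + Kcoord x₀ p.2.2) = (Kcoord x₀ p.2.1 + Kcoord x₀ p.2.2) / 2
  ring

abbrev IK := (𝓘(ℂ, ℂ)).prod 𝓘(ℂ, ℂ →L[ℂ] ℂ)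
abbrev IKK := (𝓘(ℂ, ℂ)).prod 𝓘(ℂ, (ℂ →L[ℂ] ℂ) × (ℂ →L[ℂ] ℂ))
abbrev IKK2 := (𝓘(ℂ, ℂ)).prod 𝓘(ℂ, (ℂ →L[ℂ] ℂ) × (ℂ →L[ℂ] ℂ →L[ℂ] ℂ))

theorem contMDiffAt_embK {x₀ : X} {a : ℂ × ℂ} (ha : a.1 ∈ (chartAt ℂ x₀).target) :
    ContMDiffAt 𝓘(ℂ, ℂ × ℂ) IK ω (embK x₀) a := by
  have hz : ContMDiffAt 𝓘(ℂ, ℂ × ℂ) 𝓘(ℂ, ℂ) ω (fun a : ℂ × ℂ => zinv x₀ a.1) a :=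
    (contMDiffAt_zinv ha).comp a contDiff_fst.contMDiff.contMDiffAt
  rw [Trivialization.contMDiffAt_iff (e := trivializationAt (ℂ →L[ℂ] ℂ) (K : X → Type) x₀)
    ((Trivialization.mem_source _).2 (mem_baseSet_K (zinv_mem ha)))]
  refine ⟨hz, ?_⟩
  have h1 : ContDiff ℂ ω (fun a : ℂ × ℂ => a.2 • ContinuousLinearMap.id ℂ ℂ) := by fun_prop
  refine h1.contMDiff.contMDiffAt.congr_of_eventuallyEq ?_
  filter_upwards [((chartAt ℂ x₀).open_target.preimage continuous_fst).mem_nhds ha] with b hb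
  rw [embK, K_trivialization x₀, Kcoord_Kmk (zinv_mem hb)]

theorem contMDiffAt_embKK {x₀ : X} {a : ℂ × ℂ × ℂ} (ha : a.1 ∈ (chartAt ℂ x₀).target) :
    ContMDiffAt 𝓘(ℂ, ℂ × ℂ × ℂ) IKK ω (embKK x₀) a := by
  have hz : ContMDiffAt 𝓘(ℂ, ℂ × ℂ × ℂ) 𝓘(ℂ, ℂ) ω (fun a : ℂ × ℂ × ℂ => zinv x₀ a.1) a :=
    (contMDiffAt_zinv ha).comp a contDiff_fst.contMDiff.contMDiffAt
  rw [Trivialization.contMDiffAt_iff (e := trivializationAt ((ℂ →L[ℂ] ℂ) × (ℂ →L[ℂ] ℂ))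
    ((K : X → Type) ×ᵇ (K : X → Type)) x₀)
    ((Trivialization.mem_source _).2 ⟨mem_baseSet_K (zinv_mem ha), mem_baseSet_K (zinv_mem ha)⟩)]
  refine ⟨hz, ?_⟩
  have h1 : ContDiff ℂ ω (fun a : ℂ × ℂ × ℂ => (a.2.1 • ContinuousLinearMap.id ℂ ℂ,
    a.2.2 • ContinuousLinearMap.id ℂ ℂ)) := by fun_prop
  refine h1.contMDiff.contMDiffAt.congr_of_eventuallyEq ?_
  filter_upwards [((chartAt ℂ x₀).open_target.preimage continuous_fst).mem_nhds ha] with b hb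
  refine Prod.ext ?_ ?_
  · refine (K_trivialization x₀ _).trans ?_
    simp only [embKK, Kcoord_Kmk (zinv_mem hb)]
  · refine (K_trivialization x₀ _).trans ?_
    simp only [embKK, Kcoord_Kmk (zinv_mem hb)]

set_option synthInstance.maxHeartbeats 400000 in
set_option maxHeartbeats 1000000 in
theorem contMDiffAt_totKK2_iff {E H M : Type*} [NormedAddCommGroup E] [NormedSpace ℂ E]
    [TopologicalSpace H] {I : ModelWithCorners ℂ E H} [TopologicalSpace M] [ChartedSpace H M]
    {x₀ : X} {f : M → TotKK2 X} {m : M} (hm : (f m).1 ∈ (chartAt ℂ x₀).source) :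
    ContMDiffAt I IKK2 ω f m ↔ ContMDiffAt I 𝓘(ℂ, ℂ) ω (fun a => (f a).1) m ∧
      ContMDiffAt I 𝓘(ℂ, (ℂ →L[ℂ] ℂ) × (ℂ →L[ℂ] ℂ →L[ℂ] ℂ)) ω
        (fun a => (trivializationAt ((ℂ →L[ℂ] ℂ) × (ℂ →L[ℂ] ℂ →L[ℂ] ℂ))
          ((K : X → Type) ×ᵇ (K2 : X → Type)) x₀ (f a)).2) m :=
  Trivialization.contMDiffAt_iff (IB := 𝓘(ℂ, ℂ)) (n := ω)
    (F := (ℂ →L[ℂ] ℂ) × (ℂ →L[ℂ] ℂ →L[ℂ] ℂ)) (E := (K : X → Type) ×ᵇ (K2 : X → Type))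
    ((Trivialization.mem_source _).2 ⟨mem_baseSet_K hm, mem_baseSet_K2 hm⟩)

set_option synthInstance.maxHeartbeats 200000 in
theorem contMDiffAt_embKK2 {x₀ : X} {a : ℂ × ℂ × ℂ} (ha : a.1 ∈ (chartAt ℂ x₀).target) :
    ContMDiffAt 𝓘(ℂ, ℂ × ℂ × ℂ) IKK2 ω (embKK2 x₀) a := by
  have hz : ContMDiffAt 𝓘(ℂ, ℂ × ℂ × ℂ) 𝓘(ℂ, ℂ) ω (fun a : ℂ × ℂ × ℂ => zinv x₀ a.1) a :=
    (contMDiffAt_zinv ha).comp a contDiff_fst.contMDiff.contMDiffAt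
  refine (contMDiffAt_totKK2_iff (x₀ := x₀) (zinv_mem ha)).2 ⟨hz, ?_⟩
  have h1 : ContDiff ℂ ω (fun a : ℂ × ℂ × ℂ => (a.2.1 • ContinuousLinearMap.id ℂ ℂ,
    (a.2.2 • ContinuousLinearMap.id ℂ ℂ).smulRight (ContinuousLinearMap.id ℂ ℂ))) := by
    have h2 : ContDiff ℂ ω (fun a : ℂ × ℂ × ℂ => a.2.2 • ContinuousLinearMap.id ℂ ℂ) := by fun_prop
    have h3 : ContDiff ℂ ω (fun _ : ℂ × ℂ × ℂ => ContinuousLinearMap.id ℂ ℂ) := contDiff_const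
    refine ContDiff.prodMk (by fun_prop) (h2.smulRight h3)
  refine h1.contMDiff.contMDiffAt.congr_of_eventuallyEq ?_
  filter_upwards [((chartAt ℂ x₀).open_target.preimage continuous_fst).mem_nhds ha] with b hb
  refine Prod.ext ?_ ?_
  · refine (K_trivialization x₀ _).trans ?_
    simp only [embKK2, Kcoord_Kmk (zinv_mem hb)]
  · refine (K2_trivialization x₀ (zinv_mem hb) _).trans ?_
    simp only [embKK2, K2coord_K2mk (zinv_mem hb)]

theorem eventually_mem_source {F : Type*} [NormedAddCommGroup F] [NormedSpace ℂ F] {E : X → Type*}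
    [TopologicalSpace (TotalSpace F E)] [∀ x, TopologicalSpace (E x)] [FiberBundle F E] {x₀ : X}
    {p : TotalSpace F E} (hp : p.1 ∈ (chartAt ℂ x₀).source) :
    ∀ᶠ q : TotalSpace F E in 𝓝 p, q.1 ∈ (chartAt ℂ x₀).source :=
  (FiberBundle.continuous_proj F E).continuousAt.eventually_mem
    ((chartAt ℂ x₀).open_source.mem_nhds hp)

theorem contMDiffAt_coordK {x₀ : X} {p : TotK X} (hp : p.1 ∈ (chartAt ℂ x₀).source) :
    ContMDiffAt IK 𝓘(ℂ, ℂ × ℂ) ω (coordK x₀) p := by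
  have h := contMDiffAt_id (I := IK) (n := ω) (x := p)
  rw [Trivialization.contMDiffAt_iff (e := trivializationAt (ℂ →L[ℂ] ℂ) (K : X → Type) x₀)
    ((Trivialization.mem_source _).2 (mem_baseSet_K hp))] at h
  refine ContMDiffAt.prodMk_space ((contMDiffAt_zc hp).comp p h.1) ?_
  have h1 : ContDiff ℂ ω (fun f : ℂ →L[ℂ] ℂ => f 1) := by fun_prop
  refine (h1.contMDiff.contMDiffAt.comp p h.2).congr_of_eventuallyEq ?_
  filter_upwards [eventually_mem_source hp] with q hq
  simp only [Function.comp_apply, id]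
  rw [K_trivialization x₀ q.2]
  simp

theorem contMDiffAt_coordKK {x₀ : X} {p : TotKK X} (hp : p.1 ∈ (chartAt ℂ x₀).source) :
    ContMDiffAt IKK 𝓘(ℂ, ℂ × ℂ × ℂ) ω (coordKK x₀) p := by
  have h := contMDiffAt_id (I := IKK) (n := ω) (x := p)
  rw [Trivialization.contMDiffAt_iff (e := trivializationAt ((ℂ →L[ℂ] ℂ) × (ℂ →L[ℂ] ℂ))
    ((K : X → Type) ×ᵇ (K : X → Type)) x₀)
    ((Trivialization.mem_source _).2 ⟨mem_baseSet_K hp, mem_baseSet_K hp⟩)] at h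
  refine ContMDiffAt.prodMk_space ((contMDiffAt_zc hp).comp p h.1) ?_
  have h1 : ContDiff ℂ ω (fun f : (ℂ →L[ℂ] ℂ) × (ℂ →L[ℂ] ℂ) => (f.1 1, f.2 1)) := by fun_prop
  refine (h1.contMDiff.contMDiffAt.comp p h.2).congr_of_eventuallyEq ?_
  filter_upwards [eventually_mem_source hp] with q hq
  refine Prod.ext ?_ ?_
  · have : Kcoord x₀ q.2.1 =
        (trivializationAt (ℂ →L[ℂ] ℂ) (K : X → Type) x₀ ⟨q.1, q.2.1⟩).2 1 := by
      rw [K_trivialization]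
      simp
    exact this
  · have : Kcoord x₀ q.2.2 =
        (trivializationAt (ℂ →L[ℂ] ℂ) (K : X → Type) x₀ ⟨q.1, q.2.2⟩).2 1 := by
      rw [K_trivialization]
      simp
    exact this

set_option synthInstance.maxHeartbeats 200000 in
theorem contMDiffAt_coordKK2 {x₀ : X} {p : TotKK2 X} (hp : p.1 ∈ (chartAt ℂ x₀).source) :
    ContMDiffAt IKK2 𝓘(ℂ, ℂ × ℂ × ℂ) ω (coordKK2 x₀) p := by
  have h := contMDiffAt_id (I := IKK2) (n := ω) (x := p)
  rw [contMDiffAt_totKK2_iff (x₀ := x₀) hp] at h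
  refine ContMDiffAt.prodMk_space ((contMDiffAt_zc hp).comp p h.1) ?_
  have h1 : ContDiff ℂ ω (fun f : (ℂ →L[ℂ] ℂ) × (ℂ →L[ℂ] ℂ →L[ℂ] ℂ) => (f.1 1, f.2 1 1)) := by
    fun_prop
  refine (h1.contMDiff.contMDiffAt.comp p h.2).congr_of_eventuallyEq ?_
  filter_upwards [eventually_mem_source hp] with q hq
  refine Prod.ext ?_ ?_
  · have : Kcoord x₀ q.2.1 =
        (trivializationAt (ℂ →L[ℂ] ℂ) (K : X → Type) x₀ ⟨q.1, q.2.1⟩).2 1 := by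
      rw [K_trivialization]
      simp
    exact this
  · have : K2coord x₀ q.2.2 =
        (trivializationAt (ℂ →L[ℂ] ℂ →L[ℂ] ℂ) (K2 : X → Type) x₀ ⟨q.1, q.2.2⟩).2 1 1 := by
      rw [K2_trivialization x₀ hq]
      simp
    exact this

/-- In the trivialization of the chart the field is the constant 1. Both `HolDiff.hol` and
`IsSmooth` are tested on vector fields, and this is the field used for them. -/
theorem contMDiffAt_vf {x₀ x : X} (hx : x ∈ (chartAt ℂ x₀).source) :
    ContMDiffAt 𝓘(ℂ, ℂ) (𝓘(ℂ, ℂ)).tangent ω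
      (fun y => (⟨y, vf x₀ y⟩ : TangentBundle 𝓘(ℂ, ℂ) X)) x := by
  have hm : ∀ y ∈ (chartAt ℂ x₀).source,
      y ∈ (trivializationAt ℂ (TangentSpace 𝓘(ℂ, ℂ) : X → Type) x₀).baseSet := by
    intro y hy
    simpa using hy
  rw [Trivialization.contMDiffAt_iff
    (e := trivializationAt ℂ (TangentSpace 𝓘(ℂ, ℂ) : X → Type) x₀)
    ((Trivialization.mem_source _).2 (hm x hx))]
  refine ⟨contMDiffAt_id, ?_⟩
  refine (contMDiffAt_const (c := (1 : ℂ))).congr_of_eventuallyEq ?_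
  filter_upwards [(chartAt ℂ x₀).open_source.mem_nhds hx] with y hy
  have h1 := (trivializationAt ℂ (TangentSpace 𝓘(ℂ, ℂ) : X → Type) x₀).apply_mk_symm (hm y hy) 1
  have h2 : vf x₀ y = (trivializationAt ℂ (TangentSpace 𝓘(ℂ, ℂ) : X → Type) x₀).symm y 1 :=
    Trivialization.symmL_apply _ (hm y hy) 1
  rw [h2]
  exact congrArg Prod.snd h1

theorem vf_ne_zero {x₀ x : X} (hx : x ∈ (chartAt ℂ x₀).source) : vf x₀ x ≠ 0 := by
  intro h
  have := dz_vf hx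
  rw [h, map_zero] at this
  exact zero_ne_one (α := ℂ) this

end Coordinates

/-! ### Germs on subsets of manifolds -/

section Induced

variable {E H M : Type*} [NormedAddCommGroup E] [NormedSpace ℂ E] [TopologicalSpace H]
  {I : ModelWithCorners ℂ E H} [TopologicalSpace M] [ChartedSpace H M]
  {Y : Type u} [TopologicalSpace Y] {j : Y → M}

theorem isHolAt_induced_iff [IsManifold I ω M] (hj : Continuous j) {f : Y → ℂ} {p : Y} :
    @IsHolAt Y _ (HolSpace.induced I j) f p ↔
      ∃ F : M → ℂ, ContMDiffAt I 𝓘(ℂ, ℂ) ω F (j p) ∧ ∀ᶠ y in 𝓝 p, f y = F (j y) := by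
  constructor
  · rintro ⟨V, hp, hV⟩
    obtain ⟨F, hF, W, hW, h⟩ := hV ⟨p, hp⟩
    refine ⟨F, hF, ?_⟩
    filter_upwards [hW, V.isOpen.mem_nhds hp] with y hy hy'
    exact h ⟨y, hy'⟩ hy
  · rintro ⟨F, hF, h⟩
    have h1 := hj.continuousAt.eventually ((contMDiffAt_iff_contMDiffAt_nhds (by simp)).1 hF)
    obtain ⟨V, hV, hVo, hp⟩ := eventually_nhds_iff.1 (h.and h1)
    refine ⟨⟨V, hVo⟩, hp, fun q => ⟨F, (hV q q.2).2, V, hVo.mem_nhds q.2, fun y hy => (hV y y.2).1⟩⟩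

/-- The ambient function `R` restricts to the inverse of `γ`. Hence a function `f` with `f ∘ γ`
analytic has the ambient holomorphic extension `(f ∘ γ) ∘ R`. -/
theorem isParam_induced [IsManifold I ω M] (hj : Continuous j) {γ : ℂ → Y} {s₀ : ℂ}
    {R : M → ℂ} (h1 : ContMDiffAt 𝓘(ℂ, ℂ) I ω (fun s => j (γ s)) s₀) (hγ : ContinuousAt γ s₀)
    (h2 : ContMDiffAt I 𝓘(ℂ, ℂ) ω R (j (γ s₀))) (h3 : ∀ᶠ s in 𝓝 s₀, R (j (γ s)) = s)
    (h4 : ∀ᶠ y in 𝓝 (γ s₀), γ (R (j y)) = y) :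
    @IsParam Y _ (HolSpace.induced I j) γ s₀ := by
  let _ := HolSpace.induced I j
  have hR : Tendsto (fun y => R (j y)) (𝓝 (γ s₀)) (𝓝 s₀) := by
    have : ContinuousAt (fun y => R (j y)) (γ s₀) := h2.continuousAt.comp hj.continuousAt
    have h5 := this.tendsto
    rwa [h3.self_of_nhds] at h5
  refine ⟨le_antisymm hγ ?_, ⟨fun y => R (j y), h3⟩, fun f => ?_⟩
  · intro U hU
    filter_upwards [hR hU, h4] with y hy hy'
    rw [← hy']
    exact hy
  · rw [isHolAt_induced_iff hj]
    constructor
    · rintro ⟨F, hF, h⟩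
      have h5 : ContMDiffAt 𝓘(ℂ, ℂ) 𝓘(ℂ, ℂ) ω (fun s => F (j (γ s))) s₀ := hF.comp s₀ h1
      refine (contMDiffAt_iff_contDiffAt.1 h5).analyticAt.congr ?_
      filter_upwards [hγ.eventually h] with s hs
      exact hs.symm
    · intro hf
      have h5 : ContMDiffAt 𝓘(ℂ, ℂ) 𝓘(ℂ, ℂ) ω (fun s => f (γ s)) s₀ :=
        contMDiffAt_iff_contDiffAt.2 hf.contDiffAt
      refine ⟨fun m => f (γ (R m)), ?_, ?_⟩
      · refine ContMDiffAt.comp (j (γ s₀)) (g := fun s => f (γ s)) ?_ h2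
        rwa [h3.self_of_nhds]
      · filter_upwards [h4] with y hy
        rw [hy]

end Induced

/-! ### Families of quartics -/

/-- The quartic polynomial `c⁴ + α₁ c² + α₂ c + α₃`. -/
def quartic (α : ℂ × ℂ × ℂ) (c : ℂ) : ℂ := c ^ 4 + α.1 * c ^ 2 + α.2.1 * c + α.2.2

/-- `c₁, …, c₄` are the roots of the quartic. -/
structure IsFib (α : ℂ × ℂ × ℂ) (c₁ c₂ c₃ c₄ : ℂ) : Prop where
  s₁ : c₁ + c₂ + c₃ + c₄ = 0
  s₂ : α.1 = c₁ * c₂ + c₁ * c₃ + c₁ * c₄ + c₂ * c₃ + c₂ * c₄ + c₃ * c₄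
  s₃ : α.2.1 = -(c₁ * c₂ * c₃ + c₁ * c₂ * c₄ + c₁ * c₃ * c₄ + c₂ * c₃ * c₄)
  s₄ : α.2.2 = c₁ * c₂ * c₃ * c₄

namespace IsFib

variable {α : ℂ × ℂ × ℂ} {c₁ c₂ c₃ c₄ : ℂ}

theorem eval (h : IsFib α c₁ c₂ c₃ c₄) (c : ℂ) :
    quartic α c = (c - c₁) * (c - c₂) * (c - c₃) * (c - c₄) := by
  rw [quartic, h.s₂, h.s₃, h.s₄]
  linear_combination c ^ 3 * h.s₁

theorem eval_eq_zero (h : IsFib α c₁ c₂ c₃ c₄) (c : ℂ) :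
    quartic α c = 0 ↔ c = c₁ ∨ c = c₂ ∨ c = c₃ ∨ c = c₄ := by
  rw [h.eval]
  simp only [mul_eq_zero, sub_eq_zero, or_assoc]

/-- The coefficients are read off by interpolation at `0, ±1, ±2`. -/
theorem of_eval (h : ∀ c, quartic α c = (c - c₁) * (c - c₂) * (c - c₃) * (c - c₄)) :
    IsFib α c₁ c₂ c₃ c₄ := by
  have h0 := h 0
  have h1 := h 1
  have h2 := h (-1)
  have h3 := h 2
  have h4 := h (-2)
  simp only [quartic] at h0 h1 h2 h3 h4
  refine ⟨?_, ?_, ?_, ?_⟩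
  · linear_combination (1 / 12) * h3 - (1 / 12) * h4 - (1 / 6) * h1 + (1 / 6) * h2
  · linear_combination (1 / 2) * h1 + (1 / 2) * h2 - h0
  · linear_combination (2 / 3) * h1 - (2 / 3) * h2 - (1 / 12) * h3 + (1 / 12) * h4
  · linear_combination h0

theorem swap₁₂ (h : IsFib α c₁ c₂ c₃ c₄) : IsFib α c₂ c₁ c₃ c₄ :=
  of_eval fun c => by rw [h.eval]; ring

theorem swap₂₃ (h : IsFib α c₁ c₂ c₃ c₄) : IsFib α c₁ c₃ c₂ c₄ :=
  of_eval fun c => by rw [h.eval]; ring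

theorem swap₃₄ (h : IsFib α c₁ c₂ c₃ c₄) : IsFib α c₁ c₂ c₄ c₃ :=
  of_eval fun c => by rw [h.eval]; ring

theorem swapPairs (h : IsFib α c₁ c₂ c₃ c₄) : IsFib α c₃ c₄ c₁ c₂ :=
  of_eval fun c => by rw [h.eval]; ring

end IsFib

theorem exists_quadratic_roots (b c : ℂ) : ∃ u v : ℂ, u + v = -b ∧ u * v = c := by
  obtain ⟨s, hs⟩ := IsAlgClosed.exists_eq_mul_self (b ^ 2 - 4 * c)
  exact ⟨(-b + s) / 2, (-b - s) / 2, by ring, by linear_combination (1 / 4) * hs⟩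

theorem exists_isFib_of_ne {α : ℂ × ℂ × ℂ} {c₁ c₂ : ℂ} (h₁ : quartic α c₁ = 0)
    (h₂ : quartic α c₂ = 0) (hne : c₁ ≠ c₂) : ∃ c₃ c₄, IsFib α c₁ c₂ c₃ c₄ := by
  -- The remaining roots are those of the quotient by `(c - c₁)(c - c₂)`; its two lower coefficients
  -- are dictated by the missing cubic term and by `α.1`.
  obtain ⟨u, v, hu, hv⟩ := exists_quadratic_roots (c₁ + c₂) (α.1 + (c₁ + c₂) ^ 2 - c₁ * c₂)
  have hn : c₁ - c₂ ≠ 0 := sub_ne_zero.2 hne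
  unfold quartic at h₁ h₂
  -- Subtracting the two root equations leaves a multiple of `c₁ - c₂`; cancelling it yields the
  -- linear coefficient.
  have e3 : α.2.1 = -(c₁ * c₂ * (u + v) + (c₁ + c₂) * (u * v)) := by
    apply mul_left_cancel₀ hn
    rw [hu, hv]
    linear_combination h₁ - h₂
  refine ⟨u, v, by rw [add_assoc, hu]; ring, ?_, ?_, ?_⟩
  · linear_combination -hv - (c₁ + c₂) * hu
  · linear_combination e3
  · rw [e3, hu, hv] at h₁
    linear_combination h₁ - c₁ * c₂ * hv

theorem exists_isFib_of_root {α : ℂ × ℂ × ℂ} {c₁ : ℂ} (h₁ : quartic α c₁ = 0) :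
    ∃ c₂ c₃ c₄, IsFib α c₁ c₂ c₃ c₄ := by
  -- This cubic is the quotient of the quartic by `c - c₁`.
  obtain ⟨c₂, h₂⟩ : ∃ c₂ : ℂ, c₂ ^ 3 + c₁ * c₂ ^ 2 + (α.1 + c₁ ^ 2) * c₂ +
      (α.2.1 + α.1 * c₁ + c₁ ^ 3) = 0 := by
    obtain ⟨x, hx⟩ := IsAlgClosed.exists_root (Polynomial.X ^ 3 + Polynomial.C c₁ * Polynomial.X ^ 2
      + Polynomial.C (α.1 + c₁ ^ 2) * Polynomial.X + Polynomial.C (α.2.1 + α.1 * c₁ + c₁ ^ 3))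
      (by
        have : (Polynomial.X ^ 3 + Polynomial.C c₁ * Polynomial.X ^ 2
          + Polynomial.C (α.1 + c₁ ^ 2) * Polynomial.X
          + Polynomial.C (α.2.1 + α.1 * c₁ + c₁ ^ 3)).degree = 3 := by compute_degree!
        rw [this]
        decide)
    exact ⟨x, by simpa [Polynomial.IsRoot] using hx⟩
  obtain ⟨u, v, hu, hv⟩ := exists_quadratic_roots (c₁ + c₂) (α.1 + (c₁ + c₂) ^ 2 - c₁ * c₂)
  unfold quartic at h₁
  refine ⟨c₂, u, v, by linear_combination hu, ?_, ?_, ?_⟩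
  · linear_combination -hv - (c₁ + c₂) * hu
  · linear_combination h₂ + (c₁ + c₂) * hv + c₁ * c₂ * hu
  · linear_combination h₁ - c₁ * h₂ - c₁ * c₂ * hv

/-- At most two of the four numbers coincide. -/
def Generic (c₁ c₂ c₃ c₄ : ℂ) : Prop := 3 ≤ ({c₁, c₂, c₃, c₄} : Set ℂ).ncard

/-- Any further coincidence would leave at most two distinct numbers. -/
theorem Generic.of_eq {c₁ c₂ c₃ c₄ : ℂ} (h : Generic c₁ c₂ c₃ c₄) (h₁₂ : c₁ = c₂) :
    c₁ ≠ c₃ ∧ c₁ ≠ c₄ ∧ c₃ ≠ c₄ := by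
  have key : ∀ a b : ℂ, ({a, b} : Set ℂ).ncard ≤ 2 := fun a b =>
    (Set.ncard_insert_le a {b}).trans (by simp)
  unfold Generic at h
  refine ⟨?_, ?_, ?_⟩ <;>
  · intro h'
    have h2 : ({c₁, c₂, c₃, c₄} : Set ℂ) = {c₁, c₄} ∨ ({c₁, c₂, c₃, c₄} : Set ℂ) = {c₁, c₃} := by
      subst h₁₂
      subst h'
      simp [Set.pair_comm]
    rcases h2 with h2 | h2 <;> rw [h2] at h
    · exact absurd (h.trans (key _ _)) (by norm_num)
    · exact absurd (h.trans (key _ _)) (by norm_num)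

theorem isInvertible_of_ne_zero (f : ℂ →L[ℂ] ℂ) (h : f 1 ≠ 0) : f.IsInvertible := by
  refine ⟨ContinuousLinearEquiv.smulLeft (Units.mk0 (f 1) h), ?_⟩
  ext
  simp [Units.smul_def]

/-- The implicit function theorem for one analytic equation. -/
theorem exists_implicit {F : ℂ × ℂ → ℂ} {a b : ℂ} (hF : AnalyticAt ℂ F (a, b)) (h0 : F (a, b) = 0)
    (hd : deriv (fun y => F (a, y)) b ≠ 0) :
    ∃ g : ℂ → ℂ, AnalyticAt ℂ g a ∧ g a = b ∧ ∀ᶠ p in 𝓝 (a, b), F p = 0 ↔ p.2 = g p.1 := by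
  have hc : ContDiffAt ℂ ω F (a, b) := hF.contDiffAt
  have hi : (fderiv ℂ F (a, b) ∘L .inr ℂ ℂ ℂ).IsInvertible := by
    refine isInvertible_of_ne_zero _ ?_
    have h1 : HasDerivAt (fun y : ℂ => ((a, y) : ℂ × ℂ)) (0, 1) b :=
      (hasDerivAt_const b a).prodMk (hasDerivAt_id b)
    have h2 := hF.differentiableAt.hasFDerivAt.comp_hasDerivAt b h1
    change deriv (F ∘ Prod.mk a) b ≠ 0 at hd
    rw [h2.deriv] at hd
    simpa using hd
  refine ⟨hc.implicitFunction (by simp) hi, (hc.contDiffAt_implicitFunction _ hi).analyticAt,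
    hc.implicitFunction_apply_self _ hi, ?_⟩
  filter_upwards [hc.eventually_apply_eq_iff_implicitFunction (by simp) hi] with p hp
  rw [h0] at hp
  rw [hp, eq_comm]

section Families

variable {A : ℂ → ℂ × ℂ × ℂ} {z₀ c₁ c₂ c₃ c₄ : ℂ}

theorem analyticAt_quartic (hA : AnalyticAt ℂ A z₀) (c : ℂ) :
    AnalyticAt ℂ (fun p : ℂ × ℂ => quartic (A p.1) p.2) (z₀, c) := by
  have h1 : AnalyticAt ℂ (fun p : ℂ × ℂ => A p.1) (z₀, c) := AnalyticAt.fun_comp hA analyticAt_fst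
  have h2 : AnalyticAt ℂ (fun p : ℂ × ℂ => p.2) (z₀, c) := analyticAt_snd
  have e1 : AnalyticAt ℂ (fun p : ℂ × ℂ => (A p.1).1) (z₀, c) := analyticAt_fst.fun_comp h1
  have e2 : AnalyticAt ℂ (fun p : ℂ × ℂ => (A p.1).2) (z₀, c) := analyticAt_snd.fun_comp h1
  have e3 : AnalyticAt ℂ (fun p : ℂ × ℂ => (A p.1).2.1) (z₀, c) := analyticAt_fst.fun_comp e2
  have e4 : AnalyticAt ℂ (fun p : ℂ × ℂ => (A p.1).2.2) (z₀, c) := analyticAt_snd.fun_comp e2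
  unfold quartic
  exact (((h2.pow 4).add (e1.mul (h2.pow 2))).add (e3.mul h2)).add e4

/-- A simple root varies analytically. -/
theorem exists_simple_root (hA : AnalyticAt ℂ A z₀) (h : IsFib (A z₀) c₁ c₂ c₃ c₄)
    (h₂ : c₁ ≠ c₂) (h₃ : c₁ ≠ c₃) (h₄ : c₁ ≠ c₄) :
    ∃ β : ℂ → ℂ, AnalyticAt ℂ β z₀ ∧ β z₀ = c₁ ∧
      ∀ᶠ p in 𝓝 (z₀, c₁), quartic (A p.1) p.2 = 0 ↔ p.2 = β p.1 := by
  refine exists_implicit (analyticAt_quartic hA c₁) ((h.eval_eq_zero c₁).2 (Or.inl rfl)) ?_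
  have h1 : (fun c => quartic (A z₀) c) =
      fun c => (c - c₁) * ((c - c₂) * (c - c₃) * (c - c₄)) := by
    funext c
    rw [h.eval]
    ring
  have h2 : HasDerivAt (fun c => (c - c₁) * ((c - c₂) * (c - c₃) * (c - c₄)))
      ((c₁ - c₂) * (c₁ - c₃) * (c₁ - c₄)) c₁ := by
    have e1 : HasDerivAt (fun c => c - c₁) 1 c₁ := (hasDerivAt_id c₁).sub_const c₁
    have e2 : DifferentiableAt ℂ (fun c => (c - c₂) * (c - c₃) * (c - c₄)) c₁ := by fun_prop
    have := e1.fun_mul e2.hasDerivAt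
    simpa using this
  change deriv (fun c => quartic (A z₀) c) c₁ ≠ 0
  rw [h1, h2.deriv]
  exact mul_ne_zero (mul_ne_zero (sub_ne_zero.2 h₂) (sub_ne_zero.2 h₃)) (sub_ne_zero.2 h₄)

theorem tendsto_prodMk_nhds {f : ℂ → ℂ} {g : ℂ → ℂ} {s₀ : ℂ} (hf : ContinuousAt f s₀)
    (hg : ContinuousAt g s₀) : Tendsto (fun s => (f s, g s)) (𝓝 s₀) (𝓝 (f s₀, g s₀)) :=
  (hf.prodMk hg).tendsto

theorem eventually_root {β : ℂ → ℂ} (hβ : AnalyticAt ℂ β z₀) (hβ0 : β z₀ = c₁)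
    (h : ∀ᶠ p in 𝓝 (z₀, c₁), quartic (A p.1) p.2 = 0 ↔ p.2 = β p.1) :
    ∀ᶠ z in 𝓝 z₀, quartic (A z) (β z) = 0 := by
  have h1 := tendsto_prodMk_nhds (f := fun z => z) continuousAt_id hβ.continuousAt
  rw [hβ0] at h1
  filter_upwards [h1.eventually h] with z hz
  exact hz.2 rfl

end Families

/-- `x, y` are two of the four roots of the quartic, counted with multiplicity. -/
def IsPair (α : ℂ × ℂ × ℂ) (x y : ℂ) : Prop := ∃ c₃ c₄, IsFib α x y c₃ c₄

/-- `c² - 2 m c + w` divides the quartic. -/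
def IsQuad (α : ℂ × ℂ × ℂ) (m w : ℂ) : Prop :=
  ∀ c, quartic α c = (c ^ 2 - 2 * m * c + w) * (c ^ 2 + 2 * m * c + (α.1 - w + 4 * m ^ 2))

theorem IsPair.isQuad {α : ℂ × ℂ × ℂ} {x y : ℂ} (h : IsPair α x y) :
    IsQuad α ((x + y) / 2) (x * y) := by
  obtain ⟨c₃, c₄, h⟩ := h
  intro c
  have h4 : c₄ = -(x + y + c₃) := by linear_combination h.s₁
  rw [h.eval, h.s₂, h4]
  ring

theorem IsPair.swap {α : ℂ × ℂ × ℂ} {x y : ℂ} (h : IsPair α x y) : IsPair α y x := by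
  obtain ⟨c₃, c₄, h⟩ := h
  exact ⟨c₃, c₄, h.swap₁₂⟩

theorem IsPair.left_root {α : ℂ × ℂ × ℂ} {x y : ℂ} (h : IsPair α x y) : quartic α x = 0 := by
  obtain ⟨c₃, c₄, h⟩ := h
  exact (h.eval_eq_zero x).2 (Or.inl rfl)

theorem isPair_of_ne {α : ℂ × ℂ × ℂ} {x y : ℂ} (hx : quartic α x = 0) (hy : quartic α y = 0)
    (hne : x ≠ y) : IsPair α x y :=
  exists_isFib_of_ne hx hy hne

section Families

variable {A : ℂ → ℂ × ℂ × ℂ} {z₀ c₁ c₂ c₃ c₄ d : ℂ}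

/-- `β` is the branch of the roots of the family `A` near `(z₀, c₁)`. -/
structure IsBranch (A : ℂ → ℂ × ℂ × ℂ) (z₀ c₁ : ℂ) (β : ℂ → ℂ) : Prop where
  an : AnalyticAt ℂ β z₀
  val : β z₀ = c₁
  root_iff : ∀ᶠ p in 𝓝 (z₀, c₁), quartic (A p.1) p.2 = 0 ↔ p.2 = β p.1

theorem IsBranch.root {β : ℂ → ℂ} (h : IsBranch A z₀ c₁ β) :
    ∀ᶠ z in 𝓝 z₀, quartic (A z) (β z) = 0 :=
  eventually_root h.an h.val h.root_iff

theorem exists_isBranch (hA : AnalyticAt ℂ A z₀) (h : IsFib (A z₀) c₁ c₂ c₃ c₄)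
    (h₂ : c₁ ≠ c₂) (h₃ : c₁ ≠ c₃) (h₄ : c₁ ≠ c₄) : ∃ β, IsBranch A z₀ c₁ β := by
  obtain ⟨β, h1, h2, h3⟩ := exists_simple_root hA h h₂ h₃ h₄
  exact ⟨β, h1, h2, h3⟩

/-- Near a double root, the curve is the graph of `ζ` over the root. -/
structure IsFold (A : ℂ → ℂ × ℂ × ℂ) (z₀ d : ℂ) (ζ : ℂ → ℂ) : Prop where
  an : AnalyticAt ℂ ζ d
  val : ζ d = z₀
  root_iff : ∀ᶠ p in 𝓝 (z₀, d), quartic (A p.1) p.2 = 0 ↔ p.1 = ζ p.2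

/-- The implicit function theorem with the variables exchanged: at a double root the derivative in
the root vanishes, but the one in the base coordinate does not. -/
theorem exists_isFold (hA : AnalyticAt ℂ A z₀) (hd : quartic (A z₀) d = 0)
    (hs : deriv (fun z => quartic (A z) d) z₀ ≠ 0) : ∃ ζ, IsFold A z₀ d ζ := by
  have h1 : AnalyticAt ℂ (fun p : ℂ × ℂ => quartic (A p.2) p.1) (d, z₀) :=
    AnalyticAt.fun_comp (g := fun p : ℂ × ℂ => quartic (A p.1) p.2) (f := fun p : ℂ × ℂ => (p.2, p.1))
      (analyticAt_quartic hA d) (analyticAt_snd.prod analyticAt_fst)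
  obtain ⟨ζ, h2, h3, h4⟩ := exists_implicit h1 hd hs
  refine ⟨ζ, h2, h3, ?_⟩
  have : Tendsto (fun p : ℂ × ℂ => (p.2, p.1)) (𝓝 (z₀, d)) (𝓝 (d, z₀)) :=
    (continuous_snd.prodMk continuous_fst).tendsto _
  exact this.eventually h4

theorem IsFold.root {ζ : ℂ → ℂ} (h : IsFold A z₀ d ζ) :
    ∀ᶠ s in 𝓝 d, quartic (A (ζ s)) s = 0 := by
  have h1 := tendsto_prodMk_nhds (g := fun z => z) h.an.continuousAt continuousAt_id
  rw [h.val] at h1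
  filter_upwards [h1.eventually h.root_iff] with z hz
  exact hz.2 rfl

theorem eventually_ne_of_continuousAt {T : Type*} [TopologicalSpace T] {f g : T → ℂ} {t : T}
    (hf : ContinuousAt f t) (hg : ContinuousAt g t) (h : f t ≠ g t) : ∀ᶠ s in 𝓝 t, f s ≠ g s := by
  have := (hf.sub hg).eventually_ne (y := 0) (sub_ne_zero.2 h)
  filter_upwards [this] with s hs
  exact sub_ne_zero.1 hs

/-! #### Pairs of roots -/

theorem eventually_isPair_branches {β₁ β₂ : ℂ → ℂ} (h₁ : IsBranch A z₀ c₁ β₁)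
    (h₂ : IsBranch A z₀ c₂ β₂) (hne : c₁ ≠ c₂) : ∀ᶠ z in 𝓝 z₀, IsPair (A z) (β₁ z) (β₂ z) := by
  have h3 := eventually_ne_of_continuousAt h₁.an.continuousAt h₂.an.continuousAt
    (by rwa [h₁.val, h₂.val])
  filter_upwards [h₁.root, h₂.root, h3] with z hz hz' hz''
  exact isPair_of_ne hz hz' hz''

theorem eventually_eq_branches {β₁ β₂ : ℂ → ℂ} (h₁ : IsBranch A z₀ c₁ β₁)
    (h₂ : IsBranch A z₀ c₂ β₂) : ∀ᶠ p : ℂ × ℂ × ℂ in 𝓝 (z₀, c₁, c₂),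
      IsPair (A p.1) p.2.1 p.2.2 → p.2.1 = β₁ p.1 ∧ p.2.2 = β₂ p.1 := by
  have t1 : Tendsto (fun p : ℂ × ℂ × ℂ => (p.1, p.2.1)) (𝓝 (z₀, c₁, c₂)) (𝓝 (z₀, c₁)) :=
    (continuous_fst.prodMk (continuous_fst.comp continuous_snd)).tendsto _
  have t2 : Tendsto (fun p : ℂ × ℂ × ℂ => (p.1, p.2.2)) (𝓝 (z₀, c₁, c₂)) (𝓝 (z₀, c₂)) :=
    (continuous_fst.prodMk (continuous_snd.comp continuous_snd)).tendsto _
  filter_upwards [t1.eventually h₁.root_iff, t2.eventually h₂.root_iff] with p hp hp' hpair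
  exact ⟨hp.1 hpair.left_root, hp'.1 hpair.swap.left_root⟩

theorem eventually_isPair_fold {ζ β₂ : ℂ → ℂ} (h₁ : IsFold A z₀ d ζ)
    (h₂ : IsBranch A z₀ c₂ β₂) (hne : d ≠ c₂) :
    ∀ᶠ s in 𝓝 d, IsPair (A (ζ s)) s (β₂ (ζ s)) := by
  have hζ : Tendsto ζ (𝓝 d) (𝓝 z₀) := by
    have := h₁.an.continuousAt.tendsto
    rwa [h₁.val] at this
  have hβ : ContinuousAt (fun s => β₂ (ζ s)) d :=
    ContinuousAt.comp (by rw [h₁.val]; exact h₂.an.continuousAt) h₁.an.continuousAt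
  have h3 := eventually_ne_of_continuousAt (f := fun s => s) continuousAt_id hβ
    (by rwa [h₁.val, h₂.val])
  filter_upwards [h₁.root, hζ.eventually h₂.root, h3] with z hz hz' hz''
  exact isPair_of_ne hz hz' hz''

theorem eventually_eq_fold {ζ β₂ : ℂ → ℂ} (h₁ : IsFold A z₀ d ζ)
    (h₂ : IsBranch A z₀ c₂ β₂) : ∀ᶠ p : ℂ × ℂ × ℂ in 𝓝 (z₀, d, c₂),
      IsPair (A p.1) p.2.1 p.2.2 → p.1 = ζ p.2.1 ∧ p.2.2 = β₂ p.1 := by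
  have t1 : Tendsto (fun p : ℂ × ℂ × ℂ => (p.1, p.2.1)) (𝓝 (z₀, d, c₂)) (𝓝 (z₀, d)) :=
    (continuous_fst.prodMk (continuous_fst.comp continuous_snd)).tendsto _
  have t2 : Tendsto (fun p : ℂ × ℂ × ℂ => (p.1, p.2.2)) (𝓝 (z₀, d, c₂)) (𝓝 (z₀, c₂)) :=
    (continuous_fst.prodMk (continuous_snd.comp continuous_snd)).tendsto _
  filter_upwards [t1.eventually h₁.root_iff, t2.eventually h₂.root_iff] with p hp hp' hpair
  exact ⟨hp.1 hpair.left_root, hp'.1 hpair.swap.left_root⟩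

/-- The other root near a double root. -/
def conj (ζ β₃ β₄ : ℂ → ℂ) (s : ℂ) : ℂ := -s - β₃ (ζ s) - β₄ (ζ s)

theorem eq_or_eq_of_two_roots {α : ℂ × ℂ × ℂ} {x y c c' b b' : ℂ} (h : IsFib α x y c c')
    (hb : quartic α b = 0) (hb' : quartic α b' = 0) (hne : b ≠ b') (h1 : b ≠ x) (h2 : b ≠ y)
    (h3 : b' ≠ x) (h4 : b' ≠ y) : (c = b ∧ c' = b') ∨ (c = b' ∧ c' = b) := by
  rw [h.eval_eq_zero] at hb hb'
  rcases hb with rfl | rfl | rfl | rfl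
  · exact absurd rfl h1
  · exact absurd rfl h2
  · rcases hb' with rfl | rfl | rfl | rfl
    · exact absurd rfl h3
    · exact absurd rfl h4
    · exact absurd rfl hne
    · exact Or.inl ⟨rfl, rfl⟩
  · rcases hb' with rfl | rfl | rfl | rfl
    · exact absurd rfl h3
    · exact absurd rfl h4
    · exact Or.inr ⟨rfl, rfl⟩
    · exact absurd rfl hne

variable {ζ β₃ β₄ : ℂ → ℂ}

theorem IsFold.tendsto (h₁ : IsFold A z₀ d ζ) : Tendsto ζ (𝓝 d) (𝓝 z₀) := by
  have := h₁.an.continuousAt.tendsto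
  rwa [h₁.val] at this

theorem IsFold.comp_branch (h₁ : IsFold A z₀ d ζ) (h₃ : IsBranch A z₀ c₃ β₃) :
    AnalyticAt ℂ (fun s => β₃ (ζ s)) d :=
  AnalyticAt.fun_comp (by rw [h₁.val]; exact h₃.an) h₁.an

theorem analyticAt_conj (h₁ : IsFold A z₀ d ζ) (h₃ : IsBranch A z₀ c₃ β₃)
    (h₄ : IsBranch A z₀ c₄ β₄) : AnalyticAt ℂ (conj ζ β₃ β₄) d :=
  (analyticAt_id.neg.sub (h₁.comp_branch h₃)).sub (h₁.comp_branch h₄)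

theorem conj_apply (h : IsFib (A z₀) d d c₃ c₄) (h₁ : IsFold A z₀ d ζ) (h₃ : IsBranch A z₀ c₃ β₃)
    (h₄ : IsBranch A z₀ c₄ β₄) : conj ζ β₃ β₄ d = d := by
  rw [conj, h₁.val, h₃.val, h₄.val]
  linear_combination -h.s₁

/-- The branches `β₃`, `β₄` give two distinct roots over `ζ s`, so `s`, which differs from both, is
one of the other two. The vanishing sum of the roots identifies the last one as `conj s`. -/
theorem eventually_isFib_conj (h₁ : IsFold A z₀ d ζ) (h₃ : IsBranch A z₀ c₃ β₃)
    (h₄ : IsBranch A z₀ c₄ β₄) (hd₃ : d ≠ c₃) (hd₄ : d ≠ c₄) (h₃₄ : c₃ ≠ c₄) :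
    ∀ᶠ s in 𝓝 d, IsFib (A (ζ s)) s (conj ζ β₃ β₄ s) (β₃ (ζ s)) (β₄ (ζ s)) := by
  have e1 := eventually_ne_of_continuousAt (f := fun s => s) continuousAt_id
    (h₁.comp_branch h₃).continuousAt (by rwa [h₁.val, h₃.val])
  have e2 := eventually_ne_of_continuousAt (f := fun s => s) continuousAt_id
    (h₁.comp_branch h₄).continuousAt (by rwa [h₁.val, h₄.val])
  have e3 := eventually_ne_of_continuousAt (h₁.comp_branch h₃).continuousAt
    (h₁.comp_branch h₄).continuousAt (by rwa [h₁.val, h₃.val, h₄.val])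
  filter_upwards [h₁.root, h₁.tendsto.eventually h₃.root, h₁.tendsto.eventually h₄.root, e1, e2, e3]
    with s r1 r3 r4 n1 n2 n3
  obtain ⟨u, v, hf⟩ := exists_isFib_of_ne r3 r4 n3
  have hs := hf.s₁
  rcases (hf.eval_eq_zero s).1 r1 with h | h | rfl | rfl
  · exact absurd h n1
  · exact absurd h n2
  · have : conj ζ β₃ β₄ s = v := by
      rw [conj]
      linear_combination -hs
    rw [this]
    exact hf.swapPairs
  · have : conj ζ β₃ β₄ s = u := by
      rw [conj]
      linear_combination -hs
    rw [this]
    exact hf.swapPairs.swap₁₂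

/-- Near `(z₀, d, d)` neither entry of the pair can be on the branches `β₃` or `β₄`, so these are
the complementary roots and the vanishing sum gives the second entry. -/
theorem eventually_eq_conj (h₁ : IsFold A z₀ d ζ) (h₃ : IsBranch A z₀ c₃ β₃)
    (h₄ : IsBranch A z₀ c₄ β₄) (hd₃ : d ≠ c₃) (hd₄ : d ≠ c₄) (h₃₄ : c₃ ≠ c₄) :
    ∀ᶠ p : ℂ × ℂ × ℂ in 𝓝 (z₀, d, d),
      IsPair (A p.1) p.2.1 p.2.2 → p.1 = ζ p.2.1 ∧ p.2.2 = conj ζ β₃ β₄ p.2.1 := by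
  have t0 : Tendsto (fun p : ℂ × ℂ × ℂ => p.1) (𝓝 (z₀, d, d)) (𝓝 z₀) := continuous_fst.tendsto _
  have t1 : Tendsto (fun p : ℂ × ℂ × ℂ => (p.1, p.2.1)) (𝓝 (z₀, d, d)) (𝓝 (z₀, d)) :=
    (continuous_fst.prodMk (continuous_fst.comp continuous_snd)).tendsto _
  have cx : ContinuousAt (fun p : ℂ × ℂ × ℂ => p.2.1) (z₀, d, d) := by fun_prop
  have cy : ContinuousAt (fun p : ℂ × ℂ × ℂ => p.2.2) (z₀, d, d) := by fun_prop
  have c3 : ContinuousAt (fun p : ℂ × ℂ × ℂ => β₃ p.1) (z₀, d, d) :=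
    ContinuousAt.comp (f := fun p : ℂ × ℂ × ℂ => p.1) h₃.an.continuousAt continuousAt_fst
  have c4 : ContinuousAt (fun p : ℂ × ℂ × ℂ => β₄ p.1) (z₀, d, d) :=
    ContinuousAt.comp (f := fun p : ℂ × ℂ × ℂ => p.1) h₄.an.continuousAt continuousAt_fst
  filter_upwards [t1.eventually h₁.root_iff, t0.eventually h₃.root, t0.eventually h₄.root,
    eventually_ne_of_continuousAt c3 c4 (by rwa [h₃.val, h₄.val]),
    eventually_ne_of_continuousAt c3 cx (by rw [h₃.val]; exact hd₃.symm),
    eventually_ne_of_continuousAt c3 cy (by rw [h₃.val]; exact hd₃.symm),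
    eventually_ne_of_continuousAt c4 cx (by rw [h₄.val]; exact hd₄.symm),
    eventually_ne_of_continuousAt c4 cy (by rw [h₄.val]; exact hd₄.symm)]
    with p hp r3 r4 n n1 n2 n3 n4 hpair
  have hz := hp.1 hpair.left_root
  refine ⟨hz, ?_⟩
  obtain ⟨c, c', hf⟩ := hpair
  have hs := hf.s₁
  rw [conj, ← hz]
  rcases eq_or_eq_of_two_roots hf r3 r4 n n1 n2 n3 n4 with ⟨e, e'⟩ | ⟨e, e'⟩
  · rw [e, e'] at hs
    linear_combination hs
  · rw [e, e'] at hs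
    linear_combination hs

theorem deriv_of_hasOrd_mul {F w : ℂ → ℂ} {s₀ : ℂ} (hw : AnalyticAt ℂ w s₀) (hw0 : w s₀ = 0)
    (hF : ∀ᶠ s in 𝓝 s₀, F s = (s - s₀) * w s) : HasDerivAt F 0 s₀ := by
  have h1 : HasDerivAt (fun s => (s - s₀) * w s) (1 * w s₀ + (s₀ - s₀) * deriv w s₀) s₀ :=
    ((hasDerivAt_id s₀).sub_const s₀).fun_mul hw.differentiableAt.hasDerivAt
  rw [hw0, sub_self, mul_zero, zero_mul, add_zero] at h1
  exact h1.congr_of_eventuallyEq hF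

/-- The fold has order two, and the difference of the two roots has order one. -/
theorem fold_orders (hA : AnalyticAt ℂ A z₀) (h : IsFib (A z₀) d d c₃ c₄)
    (hsm : deriv (fun z => quartic (A z) d) z₀ ≠ 0) (h₁ : IsFold A z₀ d ζ)
    (h₃ : IsBranch A z₀ c₃ β₃) (h₄ : IsBranch A z₀ c₄ β₄) (hd₃ : d ≠ c₃) (hd₄ : d ≠ c₄)
    (h₃₄ : c₃ ≠ c₄) : HasOrd (fun s => ζ s - ζ d) d 2 ∧
      HasOrd (fun s => s - conj ζ β₃ β₄ s) d 1 ∧ HasOrd (fun s => conj ζ β₃ β₄ s - d) d 1 := by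
  have hq : AnalyticAt ℂ (fun z => quartic (A z) d) z₀ :=
    AnalyticAt.fun_comp (g := fun p : ℂ × ℂ => quartic (A p.1) p.2) (f := fun z => (z, d))
      (analyticAt_quartic hA d) (analyticAt_id.prod analyticAt_const)
  have hq0 : quartic (A z₀) d = 0 := (h.eval_eq_zero d).2 (Or.inl rfl)
  have ho := HasOrd.of_deriv_ne_zero hq hsm
  obtain ⟨u, hu, hu0, hqu⟩ := ho
  have hqu' : ∀ᶠ z in 𝓝 z₀, quartic (A z) d = (z - z₀) * u z := by
    rw [eventually_nhdsWithin_iff] at hqu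
    filter_upwards [hqu] with z hz
    by_cases hzz : z = z₀
    · rw [hzz, hq0, sub_self, zero_mul]
    · have := hz hzz
      rwa [hq0, sub_zero, zpow_one] at this
  have hι := analyticAt_conj h₁ h₃ h₄
  have hιd := conj_apply h h₁ h₃ h₄
  have huζ : AnalyticAt ℂ (fun s => u (ζ s)) d := AnalyticAt.fun_comp (by rwa [h₁.val]) h₁.an
  have huζ0 : u (ζ d) ≠ 0 := by rwa [h₁.val]
  have h3ζ := h₁.comp_branch h₃
  have h4ζ := h₁.comp_branch h₄
  have hfib := eventually_isFib_conj h₁ h₃ h₄ hd₃ hd₄ h₃₄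
  set v : ℂ → ℂ := fun s => (d - β₃ (ζ s)) * (d - β₄ (ζ s)) / u (ζ s) with hv
  have hva : AnalyticAt ℂ v d :=
    ((analyticAt_const.sub h3ζ).mul (analyticAt_const.sub h4ζ)).div huζ huζ0
  have hv0 : v d ≠ 0 := by
    rw [hv]
    simp only [h₁.val, h₃.val, h₄.val]
    exact div_ne_zero (mul_ne_zero (sub_ne_zero.2 hd₃) (sub_ne_zero.2 hd₄)) hu0
  -- The quartic over `ζ s` is evaluated at `d` in two ways: as `(ζ s - z₀) u(ζ s)`, by
  -- transversality, and as the product over its roots `s`, `conj s`, `β₃`, `β₄`.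
  have hmain : ∀ᶠ s in 𝓝 d, ζ s - z₀ = (s - d) * ((conj ζ β₃ β₄ s - d) * v s) := by
    filter_upwards [h₁.tendsto.eventually hqu', hfib, huζ.continuousAt.eventually_ne huζ0]
      with s e1 e2 e3
    rw [e2.eval] at e1
    rw [hv]
    field_simp
    linear_combination -e1
  -- Since `conj` fixes `d`, both factors on the right of `hmain` vanish at `d`.
  have hζ' : HasDerivAt ζ 0 d := by
    have := deriv_of_hasOrd_mul (F := fun s => ζ s - z₀) ((hι.sub analyticAt_const).mul hva)
      (by simp [hιd]) hmain
    simpa using this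
  -- As `ζ' d = 0`, the branches over `ζ s` are stationary at `d`, and only the term `-s` of `conj`
  -- contributes.
  have hι' : HasDerivAt (conj ζ β₃ β₄) (-1) d := by
    have e3 : HasDerivAt (fun s => β₃ (ζ s)) 0 d := by
      have h5 : HasDerivAt β₃ (deriv β₃ z₀) (ζ d) := by
        rw [h₁.val]
        exact h₃.an.differentiableAt.hasDerivAt
      have := h5.comp d hζ'
      rwa [mul_zero] at this
    have e4 : HasDerivAt (fun s => β₄ (ζ s)) 0 d := by
      have h5 : HasDerivAt β₄ (deriv β₄ z₀) (ζ d) := by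
        rw [h₁.val]
        exact h₄.an.differentiableAt.hasDerivAt
      have := h5.comp d hζ'
      rwa [mul_zero] at this
    have := ((hasDerivAt_id d).neg.sub e3).sub e4
    rw [sub_zero, sub_zero] at this
    exact this
  have o1 : HasOrd (fun s => conj ζ β₃ β₄ s - d) d 1 := by
    have := HasOrd.of_deriv_ne_zero hι (by rw [hι'.deriv]; norm_num)
    rwa [hιd] at this
  refine ⟨?_, ?_, o1⟩
  · have := ((hasOrd_sub d).mul (o1.mul (HasOrd.of_analyticAt hva hv0))).congr
      (G := fun s => ζ s - ζ d) (by
        filter_upwards [hmain.filter_mono nhdsWithin_le_nhds] with s hs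
        rw [h₁.val, hs])
    exact this
  · have h5 : HasDerivAt (fun s => s - conj ζ β₃ β₄ s) (1 - (-1)) d := (hasDerivAt_id d).sub hι'
    have := HasOrd.of_deriv_ne_zero (F := fun s => s - conj ζ β₃ β₄ s) (analyticAt_id.sub hι)
      (by rw [h5.deriv]; norm_num)
    simpa [hιd] using this

/-! #### Quadratic factors -/

theorem continuousAt_A (hA : AnalyticAt ℂ A z₀) {T : Type*} [TopologicalSpace T] {f : T → ℂ} {t : T}
    (hf : ContinuousAt f t) (hft : f t = z₀) : ContinuousAt (fun s => A (f s)) t :=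
  ContinuousAt.comp (by rw [hft]; exact hA.continuousAt) hf

/-- Near a factor `(c - c₁)(c - c₂)`, a simple root `c₁` of the quartic is a root of the factor. -/
theorem eventually_quad_root {β₁ : ℂ → ℂ} (hA : AnalyticAt ℂ A z₀) (h : IsFib (A z₀) c₁ c₂ c₃ c₄)
    (h₁ : IsBranch A z₀ c₁ β₁) (h₁₃ : c₁ ≠ c₃) (h₁₄ : c₁ ≠ c₄) :
    ∀ᶠ p : ℂ × ℂ × ℂ in 𝓝 (z₀, (c₁ + c₂) / 2, c₁ * c₂), IsQuad (A p.1) p.2.1 p.2.2 →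
      β₁ p.1 ^ 2 - 2 * p.2.1 * β₁ p.1 + p.2.2 = 0 := by
  set P : ℂ × ℂ × ℂ := (z₀, (c₁ + c₂) / 2, c₁ * c₂) with hP
  have t0 : Tendsto (fun p : ℂ × ℂ × ℂ => p.1) (𝓝 P) (𝓝 z₀) := continuous_fst.tendsto _
  have c1 : ContinuousAt (fun p : ℂ × ℂ × ℂ => β₁ p.1) P :=
    ContinuousAt.comp (f := fun p : ℂ × ℂ × ℂ => p.1) h₁.an.continuousAt continuousAt_fst
  have cA : ContinuousAt (fun p : ℂ × ℂ × ℂ => (A p.1).1) P :=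
    (continuousAt_A hA (f := fun p : ℂ × ℂ × ℂ => p.1) continuousAt_fst rfl).fst
  have cm : ContinuousAt (fun p : ℂ × ℂ × ℂ => p.2.1) P := by fun_prop
  have cw : ContinuousAt (fun p : ℂ × ℂ × ℂ => p.2.2) P := by fun_prop
  have cc : ContinuousAt (fun p : ℂ × ℂ × ℂ => β₁ p.1 ^ 2 + 2 * p.2.1 * β₁ p.1 +
      ((A p.1).1 - p.2.2 + 4 * p.2.1 ^ 2)) P :=
    ((c1.pow 2).add ((continuousAt_const.mul cm).mul c1)).add
      ((cA.sub cw).add (continuousAt_const.mul (cm.pow 2)))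
  have hne : β₁ P.1 ^ 2 + 2 * P.2.1 * β₁ P.1 + ((A P.1).1 - P.2.2 + 4 * P.2.1 ^ 2) ≠ 0 := by
    rw [hP]
    simp only [h₁.val, h.s₂]
    have e4 : c₄ = -(c₁ + c₂ + c₃) := by linear_combination h.s₁
    have : c₁ ^ 2 + 2 * ((c₁ + c₂) / 2) * c₁ + (c₁ * c₂ + c₁ * c₃ + c₁ * c₄ + c₂ * c₃ + c₂ * c₄ +
        c₃ * c₄ - c₁ * c₂ + 4 * ((c₁ + c₂) / 2) ^ 2) = (c₁ - c₃) * (c₁ - c₄) := by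
      rw [e4]
      ring
    rw [this]
    exact mul_ne_zero (sub_ne_zero.2 h₁₃) (sub_ne_zero.2 h₁₄)
  filter_upwards [cc.eventually_ne hne, t0.eventually h₁.root] with p hp hr hquad
  have := hquad (β₁ p.1)
  rw [hr] at this
  exact (mul_eq_zero.1 this.symm).resolve_right hp

/-- A monic quadratic is determined by two distinct roots, and both branches are roots of the
factor. -/
theorem eventually_quad_eq_branches {β₁ β₂ : ℂ → ℂ} (hA : AnalyticAt ℂ A z₀)
    (h : IsFib (A z₀) c₁ c₂ c₃ c₄) (h₁ : IsBranch A z₀ c₁ β₁) (h₂ : IsBranch A z₀ c₂ β₂)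
    (h₁₂ : c₁ ≠ c₂) (h₁₃ : c₁ ≠ c₃) (h₁₄ : c₁ ≠ c₄) (h₂₃ : c₂ ≠ c₃) (h₂₄ : c₂ ≠ c₄) :
    ∀ᶠ p : ℂ × ℂ × ℂ in 𝓝 (z₀, (c₁ + c₂) / 2, c₁ * c₂), IsQuad (A p.1) p.2.1 p.2.2 →
      p.2.1 = (β₁ p.1 + β₂ p.1) / 2 ∧ p.2.2 = β₁ p.1 * β₂ p.1 := by
  have e1 := eventually_quad_root hA h h₁ h₁₃ h₁₄
  have e2 := eventually_quad_root hA h.swap₁₂ h₂ h₂₃ h₂₄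
  rw [add_comm c₂ c₁, mul_comm c₂ c₁] at e2
  have t0 : Tendsto (fun p : ℂ × ℂ × ℂ => p.1) (𝓝 (z₀, (c₁ + c₂) / 2, c₁ * c₂)) (𝓝 z₀) :=
    continuous_fst.tendsto _
  have h3 := eventually_ne_of_continuousAt h₁.an.continuousAt h₂.an.continuousAt
    (by rwa [h₁.val, h₂.val])
  filter_upwards [e1, e2, t0.eventually h3] with p hp hp' hne hquad
  have r1 := hp hquad
  have r2 := hp' hquad
  have hn := sub_ne_zero.2 hne
  have hm : p.2.1 = (β₁ p.1 + β₂ p.1) / 2 := by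
    apply mul_left_cancel₀ hn
    linear_combination -(1 / 2) * r1 + (1 / 2) * r2
  refine ⟨hm, ?_⟩
  rw [hm] at r1
  linear_combination r1

/-- The simple branch `β₂` is a root of the factor, so the other root is twice the mean minus `β₂`.
It is a root of the quartic close to `d`, hence lies on the fold. -/
theorem eventually_quad_eq_fold {ζ β₂ : ℂ → ℂ} (hA : AnalyticAt ℂ A z₀)
    (h : IsFib (A z₀) d c₂ c₃ c₄) (h₁ : IsFold A z₀ d ζ) (h₂ : IsBranch A z₀ c₂ β₂)
    (h₂₃ : c₂ ≠ c₃) (h₂₄ : c₂ ≠ c₄) :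
    ∀ᶠ p : ℂ × ℂ × ℂ in 𝓝 (z₀, (d + c₂) / 2, d * c₂), IsQuad (A p.1) p.2.1 p.2.2 →
      p.1 = ζ (2 * p.2.1 - β₂ p.1) ∧ p.2.2 = (2 * p.2.1 - β₂ p.1) * β₂ p.1 := by
  have e2 := eventually_quad_root hA h.swap₁₂ h₂ h₂₃ h₂₄
  rw [add_comm c₂ d, mul_comm c₂ d] at e2
  set P : ℂ × ℂ × ℂ := (z₀, (d + c₂) / 2, d * c₂) with hP
  have c2 : ContinuousAt (fun p : ℂ × ℂ × ℂ => β₂ p.1) P :=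
    ContinuousAt.comp (f := fun p : ℂ × ℂ × ℂ => p.1) h₂.an.continuousAt continuousAt_fst
  have ct : ContinuousAt (fun p : ℂ × ℂ × ℂ => (p.1, 2 * p.2.1 - β₂ p.1)) P := by
    refine continuousAt_fst.prodMk (ContinuousAt.sub ?_ c2)
    fun_prop
  have ht : Tendsto (fun p : ℂ × ℂ × ℂ => (p.1, 2 * p.2.1 - β₂ p.1)) (𝓝 P) (𝓝 (z₀, d)) := by
    have := ct.tendsto
    have e : (P.1, 2 * P.2.1 - β₂ P.1) = (z₀, d) := by
      rw [hP]
      simp only [h₂.val]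
      exact Prod.ext rfl (by ring)
    rwa [e] at this
  filter_upwards [e2, ht.eventually h₁.root_iff] with p hp hr hquad
  have r2 := hp hquad
  refine ⟨hr.1 ?_, by linear_combination r2⟩
  rw [hquad]
  refine mul_eq_zero_of_left ?_ _
  linear_combination r2

/-- Neither root of this factor is analytic in the base coordinate, but the complementary factor has
the simple roots `c₃`, `c₄`. The case of two branches applies to it, and its coefficients determine
those of the given factor. -/
theorem eventually_quad_eq_conj (hA : AnalyticAt ℂ A z₀) (h : IsFib (A z₀) d d c₃ c₄)
    (h₃ : IsBranch A z₀ c₃ β₃) (h₄ : IsBranch A z₀ c₄ β₄) (hd₃ : d ≠ c₃) (hd₄ : d ≠ c₄)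
    (h₃₄ : c₃ ≠ c₄) :
    ∀ᶠ p : ℂ × ℂ × ℂ in 𝓝 (z₀, (d + d) / 2, d * d), IsQuad (A p.1) p.2.1 p.2.2 →
      p.2.1 = -(β₃ p.1 + β₄ p.1) / 2 ∧
        p.2.2 = (A p.1).1 - β₃ p.1 * β₄ p.1 + (β₃ p.1 + β₄ p.1) ^ 2 := by
  have ht : Tendsto (fun p : ℂ × ℂ × ℂ => (p.1, -p.2.1, (A p.1).1 - p.2.2 + 4 * p.2.1 ^ 2))
      (𝓝 (z₀, (d + d) / 2, d * d)) (𝓝 (z₀, (c₃ + c₄) / 2, c₃ * c₄)) := by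
    have cA : ContinuousAt (fun p : ℂ × ℂ × ℂ => (A p.1).1) (z₀, (d + d) / 2, d * d) :=
      (continuousAt_A hA (f := fun p : ℂ × ℂ × ℂ => p.1) continuousAt_fst rfl).fst
    have ct : ContinuousAt (fun p : ℂ × ℂ × ℂ => (p.1, -p.2.1, (A p.1).1 - p.2.2 + 4 * p.2.1 ^ 2))
        (z₀, (d + d) / 2, d * d) :=
      continuousAt_fst.prodMk (ContinuousAt.prodMk (by fun_prop)
        ((cA.sub (by fun_prop)).add (by fun_prop)))
    have e : (z₀, -((d + d) / 2), (A z₀).1 - d * d + 4 * ((d + d) / 2) ^ 2) =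
        (z₀, (c₃ + c₄) / 2, c₃ * c₄) := by
      refine Prod.ext rfl (Prod.ext ?_ ?_)
      · change -((d + d) / 2) = (c₃ + c₄) / 2
        linear_combination -(1 / 2) * h.s₁
      · change (A z₀).1 - d * d + 4 * ((d + d) / 2) ^ 2 = c₃ * c₄
        rw [h.s₂]
        linear_combination 2 * d * h.s₁
    have := ct.tendsto
    rwa [e] at this
  have key := ht.eventually (eventually_quad_eq_branches hA h.swapPairs h₃ h₄ h₃₄ hd₃.symm hd₃.symm
    hd₄.symm hd₄.symm)
  filter_upwards [key] with p hp hquad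
  obtain ⟨e1, e2⟩ := hp (by
    intro c
    rw [hquad c]
    ring)
  have em : p.2.1 = -(β₃ p.1 + β₄ p.1) / 2 := by linear_combination -e1
  refine ⟨em, ?_⟩
  have e3 : p.2.2 = (A p.1).1 - β₃ p.1 * β₄ p.1 + 4 * p.2.1 ^ 2 := by linear_combination -e2
  rw [e3, em]
  ring

end Families

section Abstract

variable {E H M : Type*} [NormedAddCommGroup E] [NormedSpace ℂ E] [TopologicalSpace H]
  {I : ModelWithCorners ℂ E H} [TopologicalSpace M] [ChartedSpace H M] [IsManifold I ω M]
  {F : Type*} [NormedAddCommGroup F] [NormedSpace ℂ F] [CompleteSpace F]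

/-- Construction of parametrizations of a subset of a manifold in coordinates. -/
theorem exists_isParam_subset {Y : Set M} (y : Y) {emb : F → M} {coord : M → F} {f : ℂ → F}
    {r : F → ℂ} {s₀ : ℂ} (hemb : ContMDiffAt 𝓘(ℂ, F) I ω emb (coord y))
    (hcoord : ContMDiffAt I 𝓘(ℂ, F) ω coord y) (hinv : ∀ᶠ m in 𝓝 y.1, emb (coord m) = m)
    (hinv' : ∀ᶠ e in 𝓝 (coord y), coord (emb e) = e) (hf : AnalyticAt ℂ f s₀)
    (hf0 : f s₀ = coord y) (hr : AnalyticAt ℂ r (coord y)) (hrf : ∀ᶠ s in 𝓝 s₀, r (f s) = s)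
    (hmem : ∀ᶠ s in 𝓝 s₀, emb (f s) ∈ Y)
    (huniq : ∀ᶠ e in 𝓝 (coord y), emb e ∈ Y → f (r e) = e) :
    ∃ γ : ℂ → Y, γ s₀ = y ∧ (∀ᶠ s in 𝓝 s₀, (γ s).1 = emb (f s)) ∧
      @IsParam Y _ (HolSpace.induced I (Subtype.val : Y → M)) γ s₀ := by
  classical
  set γ : ℂ → Y := fun s => if h : emb (f s) ∈ Y then ⟨emb (f s), h⟩ else y with hγ
  have hγs : ∀ᶠ s in 𝓝 s₀, (γ s).1 = emb (f s) := by
    filter_upwards [hmem] with s hs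
    simp only [hγ, dif_pos hs]
  have hγ0 : γ s₀ = y := by
    apply Subtype.ext
    rw [hγs.self_of_nhds, hf0, hinv.self_of_nhds]
  have hfm : ContMDiffAt 𝓘(ℂ, ℂ) 𝓘(ℂ, F) ω f s₀ := contMDiffAt_iff_contDiffAt.2 hf.contDiffAt
  have hsm : ContMDiffAt 𝓘(ℂ, ℂ) I ω (fun s => (γ s).1) s₀ := by
    refine ContMDiffAt.congr_of_eventuallyEq ?_ hγs
    exact ContMDiffAt.comp s₀ (g := emb) (by rwa [hf0]) hfm
  have hc : ContinuousAt γ s₀ := by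
    rw [Topology.IsInducing.subtypeVal.continuousAt_iff]
    exact hsm.continuousAt
  refine ⟨γ, hγ0, hγs, ?_⟩
  refine isParam_induced continuous_subtype_val (R := fun m => r (coord m)) hsm hc ?_ ?_ ?_
  · rw [hγ0]
    exact ContMDiffAt.comp (y : M) (contMDiffAt_iff_contDiffAt.2 hr.contDiffAt) hcoord
  · have h1 : ∀ᶠ s in 𝓝 s₀, coord (emb (f s)) = f s := by
      refine hf.continuousAt.eventually (p := fun e => coord (emb e) = e) ?_
      rwa [hf0]
    filter_upwards [hγs, h1, hrf] with s e1 e2 e3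
    rw [e1, e2, e3]
  · rw [hγ0]
    have h1 : Tendsto (fun m : Y => coord m) (𝓝 y) (𝓝 (coord y)) :=
      hcoord.continuousAt.comp continuous_subtype_val.continuousAt
    filter_upwards [h1.eventually huniq, continuous_subtype_val.continuousAt.eventually hinv]
      with m e1 e2
    rw [e2] at e1
    have e3 : emb (f (r (coord m))) = m := by rw [e1 m.2, e2]
    apply Subtype.ext
    simp only [hγ, e3, dif_pos m.2]

end Abstract

/-! ### The spectral curve and its fibre product in coordinates. -/

section Curves

variable {X : Type u} [TopologicalSpace X] [ChartedSpace ℂ X] [IsManifold 𝓘(ℂ, ℂ) ω X]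

namespace HitchinBase

variable (a : HitchinBase X)

/-- The coefficients of the spectral polynomial in the coordinate of the chart at `x₀`. -/
def coef (x₀ : X) (z : ℂ) : ℂ × ℂ × ℂ :=
  (a.a₂.toFun (zinv x₀ z) (fun _ => vf x₀ _), a.a₃.toFun (zinv x₀ z) (fun _ => vf x₀ _),
    a.a₄.toFun (zinv x₀ z) (fun _ => vf x₀ _))

theorem analyticAt_coef {x₀ : X} {z : ℂ} (hz : z ∈ (chartAt ℂ x₀).target) :
    AnalyticAt ℂ (a.coef x₀) z := by
  have key : ∀ n (b : HolDiff X n),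
      AnalyticAt ℂ (fun z => b.toFun (zinv x₀ z) (fun _ => vf x₀ _)) z := by
    intro n b
    have h1 := b.hol (zinv x₀ z) (vf x₀) (contMDiffAt_vf (zinv_mem hz))
    have h2 := ContMDiffAt.comp z h1 (contMDiffAt_zinv hz)
    exact (contMDiffAt_iff_contDiffAt.1 h2).analyticAt
  exact (key 2 a.a₂).prod ((key 3 a.a₃).prod (key 4 a.a₄))

variable {a}

theorem poly_vf {x₀ x : X} (hx : x ∈ (chartAt ℂ x₀).source) (t : K x) :
    a.poly x t (vf x₀ x) = quartic (a.coef x₀ (zc x₀ x)) (Kcoord x₀ t) := by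
  rw [coef, zinv_zc hx]
  rfl

/-- Homogeneity of degree four lets a root be tested on a single nonzero tangent vector. -/
theorem poly_smul (x : X) (t : K x) (c : ℂ) (v : TangentSpace 𝓘(ℂ, ℂ) x) :
    a.poly x t (c • v) = c ^ 4 * a.poly x t v := by
  have h2 := a.a₂.toFun x |>.map_smul_univ (fun _ => c) (fun _ => v)
  have h3 := a.a₃.toFun x |>.map_smul_univ (fun _ => c) (fun _ => v)
  have h4 := a.a₄.toFun x |>.map_smul_univ (fun _ => c) (fun _ => v)
  simp only [Finset.prod_const, Finset.card_univ, Fintype.card_fin, smul_eq_mul] at h2 h3 h4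
  have h1 : (t (c • v) : ℂ) = c * t v := by
    rw [map_smul]
    rfl
  unfold poly
  rw [h1, h2, h3, h4]
  ring

theorem isRoot_iff {x₀ x : X} (hx : x ∈ (chartAt ℂ x₀).source) (t : K x) :
    a.IsRoot x t ↔ quartic (a.coef x₀ (zc x₀ x)) (Kcoord x₀ t) = 0 := by
  rw [← poly_vf hx]
  constructor
  · intro h
    exact h _
  · intro h v
    rw [← dz_smul_vf hx v, poly_smul, h, mul_zero]

theorem generic_of_isFib (hR : a.HasGenericRamification) {x₀ x : X}
    (hx : x ∈ (chartAt ℂ x₀).source) {c₁ c₂ c₃ c₄ : ℂ}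
    (h : IsFib (a.coef x₀ (zc x₀ x)) c₁ c₂ c₃ c₄) : Generic c₁ c₂ c₃ c₄ := by
  have h1 : ({c₁, c₂, c₃, c₄} : Set ℂ) = Kcoord x₀ '' {t : K x | a.IsRoot x t} := by
    ext c
    have e : c ∈ ({c₁, c₂, c₃, c₄} : Set ℂ) ↔ quartic (a.coef x₀ (zc x₀ x)) c = 0 := by
      rw [h.eval_eq_zero]
      simp
    rw [e]
    constructor
    · intro hc
      refine ⟨Kmk x₀ x c, ?_, Kcoord_Kmk hx c⟩
      change a.IsRoot x _
      rwa [isRoot_iff hx, Kcoord_Kmk hx]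
    · rintro ⟨t, ht, rfl⟩
      exact (isRoot_iff hx t).1 ht
  unfold Generic
  have hinj : Function.Injective (fun t : K x => Kcoord x₀ t) := fun t t' h => K_ext hx h
  rw [h1, Set.ncard_image_of_injective _ hinj]
  exact hR x

/-- At a double root the derivative along the fibre vanishes, so if the derivative along the base
vanished too the whole differential would be zero, against transversality. -/
theorem deriv_ne_zero_of_isSmooth (hS : a.IsSmooth) {x₀ : X} {z₀ d c₃ c₄ : ℂ}
    (hz : z₀ ∈ (chartAt ℂ x₀).target) (h : IsFib (a.coef x₀ z₀) d d c₃ c₄) :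
    deriv (fun z => quartic (a.coef x₀ z) d) z₀ ≠ 0 := by
  intro h0
  set p := embK x₀ (z₀, d) with hp
  have hps : p.1 ∈ (chartAt ℂ x₀).source := zinv_mem hz
  have hcp : coordK x₀ p = (z₀, d) := coordK_embK hz
  have hpS : p ∈ a.S := by
    change a.IsRoot p.1 p.2
    rw [isRoot_iff hps]
    have e1 : zc x₀ p.1 = z₀ := congrArg Prod.fst hcp
    have e2 : Kcoord x₀ p.2 = d := congrArg Prod.snd hcp
    rw [e1, e2, h.eval]
    ring
  refine hS p hpS (vf x₀) (contMDiffAt_vf hps) (vf_ne_zero hps) ?_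
  set G : ℂ × ℂ → ℂ := fun w => quartic (a.coef x₀ w.1) w.2 with hG
  have hGa : AnalyticAt ℂ G (z₀, d) := analyticAt_quartic (a.analyticAt_coef hz) d
  have hG0 : HasFDerivAt G (0 : ℂ × ℂ →L[ℂ] ℂ) (z₀, d) := by
    have h1 := hGa.differentiableAt.hasFDerivAt
    have e1 : HasDerivAt (fun z : ℂ => ((z, d) : ℂ × ℂ)) (1, 0) z₀ :=
      (hasDerivAt_id z₀).prodMk (hasDerivAt_const z₀ d)
    have e2 : HasDerivAt (fun c : ℂ => ((z₀, c) : ℂ × ℂ)) (0, 1) d :=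
      (hasDerivAt_const d z₀).prodMk (hasDerivAt_id d)
    have f1 := h1.comp_hasDerivAt z₀ e1
    have f2 := h1.comp_hasDerivAt d e2
    have g1 : fderiv ℂ G (z₀, d) (1, 0) = 0 := f1.deriv.symm.trans h0
    have g2 : fderiv ℂ G (z₀, d) (0, 1) = 0 := by
      refine f2.unique ?_
      have h3 : ∀ᶠ c in 𝓝 d, (G ∘ fun c : ℂ => ((z₀, c) : ℂ × ℂ)) c =
          (c - d) * ((c - d) * (c - c₃) * (c - c₄)) := by
        refine Eventually.of_forall fun c => ?_
        change quartic (a.coef x₀ z₀) c = _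
        rw [h.eval]
        ring
      refine deriv_of_hasOrd_mul ?_ (by simp) h3
      fun_prop
    have : fderiv ℂ G (z₀, d) = 0 := by
      ext
      · simpa using g1
      · simpa using g2
    rwa [this] at h1
  have hmd : MDifferentiableAt IK 𝓘(ℂ, ℂ × ℂ) (coordK x₀) p :=
    (contMDiffAt_coordK hps).mdifferentiableAt (by simp)
  have hm1 : HasMFDerivAt 𝓘(ℂ, ℂ × ℂ) 𝓘(ℂ, ℂ) G (coordK x₀ p) (0 : ℂ × ℂ →L[ℂ] ℂ) := by
    rw [hcp]
    exact hG0.hasMFDerivAt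
  have hm2 := hm1.comp p hmd.hasMFDerivAt
  have hev : (fun q : TotK X => a.poly q.1 q.2 (vf x₀ q.1)) =ᶠ[𝓝 p] G ∘ coordK x₀ := by
    filter_upwards [eventually_mem_source hps] with q hq
    rw [poly_vf hq]
    rfl
  have hm3 := hm2.congr_of_eventuallyEq hev
  rw [hm3.mfderiv]
  exact ContinuousLinearMap.zero_comp _

/-! #### Points of the curves in coordinates -/

theorem mem_S_iff {x₀ : X} {p : TotK X} (hp : p.1 ∈ (chartAt ℂ x₀).source) :
    p ∈ a.S ↔ quartic (a.coef x₀ (zc x₀ p.1)) (Kcoord x₀ p.2) = 0 :=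
  isRoot_iff hp p.2

theorem mem_SS_iff {x₀ : X} {p : TotKK X} (hp : p.1 ∈ (chartAt ℂ x₀).source) :
    p ∈ a.SS ↔ quartic (a.coef x₀ (zc x₀ p.1)) (Kcoord x₀ p.2.1) = 0 ∧
      quartic (a.coef x₀ (zc x₀ p.1)) (Kcoord x₀ p.2.2) = 0 :=
  and_congr (isRoot_iff hp p.2.1) (isRoot_iff hp p.2.2)

/-- Only diagonal points need an argument. Near a simple root all roots lie on one branch, so two
distinct roots over the same base point cannot both be close to it; a diagonal limit of off-diagonal
pairs is therefore a multiple root. -/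
theorem isPair_of_mem_SS0 {x₀ : X} {p : TotKK X} (hp : p.1 ∈ (chartAt ℂ x₀).source)
    (h : p ∈ a.SS0) :
    IsPair (a.coef x₀ (zc x₀ p.1)) (Kcoord x₀ p.2.1) (Kcoord x₀ p.2.2) := by
  obtain ⟨h1, h2⟩ := (mem_SS_iff hp).1 h.1
  by_cases hne : Kcoord x₀ p.2.1 = Kcoord x₀ p.2.2
  · rw [← hne]
    obtain ⟨c₂, c₃, c₄, hf⟩ := exists_isFib_of_root h1
    by_cases e2 : Kcoord x₀ p.2.1 = c₂
    · rw [← e2] at hf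
      exact ⟨_, _, hf⟩
    by_cases e3 : Kcoord x₀ p.2.1 = c₃
    · rw [← e3] at hf
      exact ⟨_, _, hf.swap₂₃⟩
    by_cases e4 : Kcoord x₀ p.2.1 = c₄
    · rw [← e4] at hf
      exact ⟨_, _, hf.swap₃₄.swap₂₃⟩
    exfalso
    obtain ⟨β, hβ⟩ := exists_isBranch (a.analyticAt_coef (zc_mem hp)) hf e2 e3 e4
    have hc := (contMDiffAt_coordKK hp).continuousAt
    have t1 : Tendsto (fun q : TotKK X => (zc x₀ q.1, Kcoord x₀ q.2.1)) (𝓝 p)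
        (𝓝 (zc x₀ p.1, Kcoord x₀ p.2.1)) :=
      ((continuous_fst.prodMk (continuous_fst.comp continuous_snd)).tendsto _).comp hc.tendsto
    have t2 : Tendsto (fun q : TotKK X => (zc x₀ q.1, Kcoord x₀ q.2.2)) (𝓝 p)
        (𝓝 (zc x₀ p.1, Kcoord x₀ p.2.1)) := by
      rw [hne]
      exact ((continuous_fst.prodMk (continuous_snd.comp continuous_snd)).tendsto _).comp hc.tendsto
    have hfr := mem_closure_iff_frequently.1 h.2
    obtain ⟨q, ⟨hq, hqne⟩, r1, r2, hqs⟩ := (hfr.and_eventually ((t1.eventually hβ.root_iff).and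
      ((t2.eventually hβ.root_iff).and (eventually_mem_source hp)))).exists
    obtain ⟨q1, q2⟩ := (mem_SS_iff hqs).1 hq
    exact hqne (K_ext hqs ((r1.1 q1).trans (r2.1 q2).symm))
  · exact isPair_of_ne h1 h2 hne

/-- A repeated root `d` is a fold, and the points `(s, conj s)` tend to it. They are off the
diagonal for `s ≠ d` because `s - conj s` has order one. -/
theorem mem_SS0_of_isPair (hS : a.IsSmooth) (hR : a.HasGenericRamification) {x₀ : X} {p : TotKK X}
    (hp : p.1 ∈ (chartAt ℂ x₀).source)
    (h : IsPair (a.coef x₀ (zc x₀ p.1)) (Kcoord x₀ p.2.1) (Kcoord x₀ p.2.2)) : p ∈ a.SS0 := by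
  have hSS : p ∈ a.SS := (mem_SS_iff hp).2 ⟨h.left_root, h.swap.left_root⟩
  refine ⟨hSS, ?_⟩
  by_cases hne : Kcoord x₀ p.2.1 = Kcoord x₀ p.2.2
  · rw [← hne] at h
    obtain ⟨c₃, c₄, hf⟩ := h
    obtain ⟨n3, n4, n34⟩ := (generic_of_isFib hR hp hf).of_eq rfl
    have hz := zc_mem hp
    have hA := a.analyticAt_coef hz
    have hd := deriv_ne_zero_of_isSmooth hS hz hf
    obtain ⟨ζ, hζ⟩ := exists_isFold hA ((hf.eval_eq_zero _).2 (Or.inl rfl)) hd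
    obtain ⟨β₃, h3⟩ := exists_isBranch hA hf.swapPairs n34 n3.symm n3.symm
    obtain ⟨β₄, h4⟩ := exists_isBranch hA hf.swapPairs.swap₁₂ n34.symm n4.symm n4.symm
    obtain ⟨-, o1, -⟩ := fold_orders hA hf hd hζ h3 h4 n3 n4 n34
    have hfib := eventually_isFib_conj hζ h3 h4 n3 n4 n34
    set d := Kcoord x₀ p.2.1 with hdd
    have hcont : ContinuousAt (fun s => embKK x₀ (ζ s, s, conj ζ β₃ β₄ s)) d := by
      have e : ContinuousAt (embKK x₀) (ζ d, d, conj ζ β₃ β₄ d) :=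
        (contMDiffAt_embKK (by rwa [hζ.val])).continuousAt
      exact ContinuousAt.comp (f := fun s => (ζ s, s, conj ζ β₃ β₄ s)) e
        (hζ.an.continuousAt.prodMk (continuousAt_id.prodMk (analyticAt_conj hζ h3 h4).continuousAt))
    have hval : embKK x₀ (ζ d, d, conj ζ β₃ β₄ d) = p := by
      rw [hζ.val, conj_apply hf hζ h3 h4]
      have := embKK_coordKK hp
      rw [coordKK, ← hne] at this
      exact this
    have ht : Tendsto (fun s => embKK x₀ (ζ s, s, conj ζ β₃ β₄ s)) (𝓝[≠] d) (𝓝 p) := by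
      have := hcont.tendsto.mono_left (nhdsWithin_le_nhds (s := {d}ᶜ))
      rwa [hval] at this
    refine mem_closure_of_tendsto ht ?_
    have hzt : ∀ᶠ s in 𝓝 d, ζ s ∈ (chartAt ℂ x₀).target :=
      hζ.tendsto.eventually ((chartAt ℂ x₀).open_target.mem_nhds hz)
    filter_upwards [o1.eventually_ne, hfib.filter_mono nhdsWithin_le_nhds,
      hzt.filter_mono nhdsWithin_le_nhds] with s hs hsf hst
    have hcoord := coordKK_embKK (a := (ζ s, s, conj ζ β₃ β₄ s)) hst
    have e0 : zc x₀ (embKK x₀ (ζ s, s, conj ζ β₃ β₄ s)).1 = ζ s := congrArg Prod.fst hcoord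
    have e1 : Kcoord x₀ (embKK x₀ (ζ s, s, conj ζ β₃ β₄ s)).2.1 = s :=
      congrArg (fun w => w.2.1) hcoord
    have e2 : Kcoord x₀ (embKK x₀ (ζ s, s, conj ζ β₃ β₄ s)).2.2 = conj ζ β₃ β₄ s :=
      congrArg (fun w => w.2.2) hcoord
    refine ⟨(mem_SS_iff (zinv_mem hst)).2 ?_, fun heq => ?_⟩
    · rw [e0, e1, e2]
      exact ⟨(hsf.eval_eq_zero _).2 (Or.inl rfl), (hsf.eval_eq_zero _).2 (Or.inr (Or.inl rfl))⟩
    · rw [← e2, ← heq, e1, sub_self] at hs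
      exact hs rfl
  · exact subset_closure ⟨hSS, fun h => hne (by rw [h])⟩

theorem mem_SS0_iff (hS : a.IsSmooth) (hR : a.HasGenericRamification) {x₀ : X} {p : TotKK X}
    (hp : p.1 ∈ (chartAt ℂ x₀).source) : p ∈ a.SS0 ↔
      IsPair (a.coef x₀ (zc x₀ p.1)) (Kcoord x₀ p.2.1) (Kcoord x₀ p.2.2) :=
  ⟨isPair_of_mem_SS0 hp, mem_SS0_of_isPair hS hR hp⟩

theorem embKK_mem_SS0_iff (hS : a.IsSmooth) (hR : a.HasGenericRamification) {x₀ : X}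
    {w : ℂ × ℂ × ℂ} (hw : w.1 ∈ (chartAt ℂ x₀).target) :
    embKK x₀ w ∈ a.SS0 ↔ IsPair (a.coef x₀ w.1) w.2.1 w.2.2 := by
  have h := coordKK_embKK hw
  rw [mem_SS0_iff hS hR (zinv_mem hw)]
  have e0 : zc x₀ (embKK x₀ w).1 = w.1 := congrArg Prod.fst h
  have e1 : Kcoord x₀ (embKK x₀ w).2.1 = w.2.1 := congrArg (fun w => w.2.1) h
  have e2 : Kcoord x₀ (embKK x₀ w).2.2 = w.2.2 := congrArg (fun w => w.2.2) h
  rw [e0, e1, e2]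

theorem embK_mem_S_iff {x₀ : X} {w : ℂ × ℂ} (hw : w.1 ∈ (chartAt ℂ x₀).target) :
    embK x₀ w ∈ a.S ↔ quartic (a.coef x₀ w.1) w.2 = 0 := by
  have h := coordK_embK hw
  rw [mem_S_iff (zinv_mem hw)]
  have e0 : zc x₀ (embK x₀ w).1 = w.1 := congrArg Prod.fst h
  have e1 : Kcoord x₀ (embK x₀ w).2 = w.2 := congrArg Prod.snd h
  rw [e0, e1]

theorem sym_embKK {x₀ : X} {w : ℂ × ℂ × ℂ} (hw : w.1 ∈ (chartAt ℂ x₀).target) :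
    sym (embKK x₀ w) = embKK2 x₀ (w.1, (w.2.1 + w.2.2) / 2, w.2.1 * w.2.2) := by
  have h1 : (sym (embKK x₀ w)).1 ∈ (chartAt ℂ x₀).source := zinv_mem hw
  rw [← embKK2_coordKK2 h1, coordKK2_sym, coordKK_embKK hw]

theorem isQuad_of_mem_S6 {x₀ : X} {p : TotKK2 X} (hp : p.1 ∈ (chartAt ℂ x₀).source)
    (h : p ∈ a.S6) : IsQuad (a.coef x₀ (zc x₀ p.1)) (Kcoord x₀ p.2.1) (K2coord x₀ p.2.2) := by
  obtain ⟨q, hq, rfl⟩ := h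
  have h1 := (isPair_of_mem_SS0 (x₀ := x₀) (p := q) hp hq).isQuad
  have h2 := coordKK2_sym x₀ q
  have e1 : Kcoord x₀ (sym q).2.1 = (Kcoord x₀ q.2.1 + Kcoord x₀ q.2.2) / 2 :=
    congrArg (fun w => w.2.1) h2
  have e2 : K2coord x₀ (sym q).2.2 = Kcoord x₀ q.2.1 * Kcoord x₀ q.2.2 :=
    congrArg (fun w => w.2.2) h2
  rw [e1, e2]
  exact h1

theorem isQuad_of_embKK2_mem {x₀ : X} {w : ℂ × ℂ × ℂ} (hw : w.1 ∈ (chartAt ℂ x₀).target)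
    (h : embKK2 x₀ w ∈ a.S6) : IsQuad (a.coef x₀ w.1) w.2.1 w.2.2 := by
  have h1 := isQuad_of_mem_S6 (zinv_mem hw) h
  have h2 := coordKK2_embKK2 hw
  have e0 : zc x₀ (embKK2 x₀ w).1 = w.1 := congrArg Prod.fst h2
  have e1 : Kcoord x₀ (embKK2 x₀ w).2.1 = w.2.1 := congrArg (fun w => w.2.1) h2
  have e2 : K2coord x₀ (embKK2 x₀ w).2.2 = w.2.2 := congrArg (fun w => w.2.2) h2
  rwa [e0, e1, e2] at h1

end HitchinBase

end Curves

theorem analyticAt_snd_fst (w : ℂ × ℂ × ℂ) : AnalyticAt ℂ (fun e : ℂ × ℂ × ℂ => e.2.1) w :=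
  AnalyticAt.fun_comp (g := Prod.fst) (f := Prod.snd) analyticAt_fst analyticAt_snd

theorem analyticAt_snd_snd (w : ℂ × ℂ × ℂ) : AnalyticAt ℂ (fun e : ℂ × ℂ × ℂ => e.2.2) w :=
  AnalyticAt.fun_comp (g := Prod.snd) (f := Prod.snd) analyticAt_snd analyticAt_snd

/-! ### Parameters on the three curves, and the ramification of the projections at the three kinds
of pairs. -/

section Curves

variable {X : Type u} [TopologicalSpace X] [ChartedSpace ℂ X] [IsManifold 𝓘(ℂ, ℂ) ω X]

theorem isParam_zinv {x₀ : X} {z : ℂ} (hz : z ∈ (chartAt ℂ x₀).target) :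
    IsParam (zinv x₀) z := by
  have h0 := zinv_mem hz
  refine isParam_induced (I := 𝓘(ℂ, ℂ)) (j := (id : X → X)) continuous_id (R := zc x₀)
    (contMDiffAt_zinv hz) (contMDiffAt_zinv hz).continuousAt (contMDiffAt_zc h0) ?_ ?_
  · filter_upwards [(chartAt ℂ x₀).open_target.mem_nhds hz] with s hs
    exact zc_zinv hs
  · filter_upwards [(chartAt ℂ x₀).open_source.mem_nhds h0] with s hs
    exact zinv_zc hs

namespace HitchinBase

variable {a : HitchinBase X} {x₀ : X}

theorem eventually_mem_target {F : Type*} [TopologicalSpace F] {e : ℂ × F}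
    (he : e.1 ∈ (chartAt ℂ x₀).target) : ∀ᶠ w : ℂ × F in 𝓝 e, w.1 ∈ (chartAt ℂ x₀).target :=
  continuous_fst.continuousAt.eventually_mem ((chartAt ℂ x₀).open_target.mem_nhds he)

/-- Here `f` is the candidate parametrization in coordinates and `r` an ambient inverse. The
hypothesis `huniq` says that the equation of the curve has no other solutions nearby. -/
theorem exists_param_S (y : a.S) (hy : y.1.1 ∈ (chartAt ℂ x₀).source) {f : ℂ → ℂ × ℂ}
    {r : ℂ × ℂ → ℂ} {s₀ : ℂ} (hf : AnalyticAt ℂ f s₀) (hf0 : f s₀ = coordK x₀ y)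
    (hr : AnalyticAt ℂ r (coordK x₀ y)) (hrf : ∀ᶠ s in 𝓝 s₀, r (f s) = s)
    (hmem : ∀ᶠ s in 𝓝 s₀, quartic (a.coef x₀ (f s).1) (f s).2 = 0)
    (huniq : ∀ᶠ e in 𝓝 (coordK x₀ y), quartic (a.coef x₀ e.1) e.2 = 0 → f (r e) = e) :
    ∃ γ : ℂ → a.S, γ s₀ = y ∧ (∀ᶠ s in 𝓝 s₀, (γ s).1 = embK x₀ (f s)) ∧ IsParam γ s₀ := by
  have ht : (coordK x₀ y.1).1 ∈ (chartAt ℂ x₀).target := zc_mem hy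
  refine exists_isParam_subset (I := IK) (Y := a.S) y (contMDiffAt_embK ht)
    (contMDiffAt_coordK hy) ?_ ?_ hf hf0 hr hrf ?_ ?_
  · filter_upwards [eventually_mem_source hy] with m hm
    exact embK_coordK hm
  · filter_upwards [eventually_mem_target ht] with e he
    exact coordK_embK he
  · have h1 := hf.continuousAt.tendsto
    rw [hf0] at h1
    filter_upwards [hmem, h1.eventually (eventually_mem_target ht)] with s hs hs'
    exact (embK_mem_S_iff hs').2 hs
  · filter_upwards [huniq, eventually_mem_target ht] with e he he' hm
    exact he ((embK_mem_S_iff he').1 hm)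

theorem exists_param_SS0 (hS : a.IsSmooth) (hR : a.HasGenericRamification) (y : a.SS0)
    (hy : y.1.1 ∈ (chartAt ℂ x₀).source) {f : ℂ → ℂ × ℂ × ℂ}
    {r : ℂ × ℂ × ℂ → ℂ} {s₀ : ℂ} (hf : AnalyticAt ℂ f s₀) (hf0 : f s₀ = coordKK x₀ y)
    (hr : AnalyticAt ℂ r (coordKK x₀ y)) (hrf : ∀ᶠ s in 𝓝 s₀, r (f s) = s)
    (hmem : ∀ᶠ s in 𝓝 s₀, IsPair (a.coef x₀ (f s).1) (f s).2.1 (f s).2.2)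
    (huniq : ∀ᶠ e in 𝓝 (coordKK x₀ y), IsPair (a.coef x₀ e.1) e.2.1 e.2.2 → f (r e) = e) :
    ∃ γ : ℂ → a.SS0, γ s₀ = y ∧ (∀ᶠ s in 𝓝 s₀, (γ s).1 = embKK x₀ (f s)) ∧ IsParam γ s₀ := by
  have ht : (coordKK x₀ y.1).1 ∈ (chartAt ℂ x₀).target := zc_mem hy
  refine exists_isParam_subset (I := IKK) (Y := a.SS0) y (contMDiffAt_embKK ht)
    (contMDiffAt_coordKK hy) ?_ ?_ hf hf0 hr hrf ?_ ?_
  · filter_upwards [eventually_mem_source hy] with m hm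
    exact embKK_coordKK hm
  · filter_upwards [eventually_mem_target ht] with e he
    exact coordKK_embKK he
  · have h1 := hf.continuousAt.tendsto
    rw [hf0] at h1
    filter_upwards [hmem, h1.eventually (eventually_mem_target ht)] with s hs hs'
    exact (embKK_mem_SS0_iff hS hR hs').2 hs
  · filter_upwards [huniq, eventually_mem_target ht] with e he he' hm
    exact he ((embKK_mem_SS0_iff hS hR he').1 hm)

/-- Membership is certified by an actual pair of roots, whereas local uniqueness only uses that
points of `Ŝ₆` give quadratic factors; so no converse to `isQuad_of_embKK2_mem` is required. -/
theorem exists_param_S6 (hS : a.IsSmooth) (hR : a.HasGenericRamification) (y : a.S6)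
    (hy : y.1.1 ∈ (chartAt ℂ x₀).source) {f : ℂ → ℂ × ℂ × ℂ}
    {r : ℂ × ℂ × ℂ → ℂ} {s₀ : ℂ} (hf : AnalyticAt ℂ f s₀) (hf0 : f s₀ = coordKK2 x₀ y)
    (hr : AnalyticAt ℂ r (coordKK2 x₀ y)) (hrf : ∀ᶠ s in 𝓝 s₀, r (f s) = s)
    (hmem : ∀ᶠ s in 𝓝 s₀, ∃ c₁ c₂, IsPair (a.coef x₀ (f s).1) c₁ c₂ ∧
      f s = ((f s).1, (c₁ + c₂) / 2, c₁ * c₂))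
    (huniq : ∀ᶠ e in 𝓝 (coordKK2 x₀ y), IsQuad (a.coef x₀ e.1) e.2.1 e.2.2 → f (r e) = e) :
    ∃ γ : ℂ → a.S6, γ s₀ = y ∧ (∀ᶠ s in 𝓝 s₀, (γ s).1 = embKK2 x₀ (f s)) ∧ IsParam γ s₀ := by
  have ht : (coordKK2 x₀ y.1).1 ∈ (chartAt ℂ x₀).target := zc_mem hy
  refine exists_isParam_subset (I := IKK2) (Y := a.S6) y (contMDiffAt_embKK2 ht)
    (contMDiffAt_coordKK2 hy) ?_ ?_ hf hf0 hr hrf ?_ ?_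
  · filter_upwards [eventually_mem_source hy] with m hm
    exact embKK2_coordKK2 hm
  · filter_upwards [eventually_mem_target ht] with e he
    exact coordKK2_embKK2 he
  · have h1 := hf.continuousAt.tendsto
    rw [hf0] at h1
    filter_upwards [hmem, h1.eventually (eventually_mem_target ht)] with s hs hs'
    obtain ⟨c₁, c₂, hc, hfs⟩ := hs
    have hw : ((f s).1, c₁, c₂).1 ∈ (chartAt ℂ x₀).target := hs'
    have := sym_embKK (x₀ := x₀) hw
    rw [hfs, ← this]
    exact ⟨_, (embKK_mem_SS0_iff hS hR hw).2 hc, rfl⟩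
  · filter_upwards [huniq, eventually_mem_target ht] with e he he' hm
    exact he (isQuad_of_embKK2_mem he' hm)

theorem p₁_eq {y : a.SS0} {w : ℂ × ℂ × ℂ} {p : a.S} (hy : y.1 = embKK x₀ w)
    (hp : p.1 = embK x₀ (w.1, w.2.1)) : a.p₁ y = p := by
  apply Subtype.ext
  rw [hp]
  change (⟨y.1.1, y.1.2.1⟩ : TotK X) = _
  rw [hy]
  rfl

theorem q_eq {y : a.SS0} {w : ℂ × ℂ × ℂ} {p : a.S6} (hw : w.1 ∈ (chartAt ℂ x₀).target)
    (hy : y.1 = embKK x₀ w) (hp : p.1 = embKK2 x₀ (w.1, (w.2.1 + w.2.2) / 2, w.2.1 * w.2.2)) :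
    a.q.toFun y = p := by
  apply Subtype.ext
  rw [hp]
  change sym y.1 = _
  rw [hy, sym_embKK hw]

/-- The projection of `Ŝ₆` to the base curve. -/
def base₆ (z : a.S6) : X := z.1.1

/-- The coordinate difference `c₁ - c₂` on `(S ×_X S)₀`. -/
def delta (x₀ : X) (y : a.SS0) : ℂ := Kcoord x₀ y.1.2.1 - Kcoord x₀ y.1.2.2

theorem coordKK2_q (y : a.SS0) : coordKK2 x₀ (a.q.toFun y).1 = (zc x₀ y.1.1,
    (Kcoord x₀ y.1.2.1 + Kcoord x₀ y.1.2.2) / 2, Kcoord x₀ y.1.2.1 * Kcoord x₀ y.1.2.2) :=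
  coordKK2_sym x₀ y.1

theorem exists_param_S_branch {y : a.S} (hy : y.1.1 ∈ (chartAt ℂ x₀).source) {β : ℂ → ℂ}
    (hβ : IsBranch (a.coef x₀) (zc x₀ y.1.1) (Kcoord x₀ y.1.2) β) :
    ∃ γ : ℂ → a.S, γ (zc x₀ y.1.1) = y ∧
      (∀ᶠ z in 𝓝 (zc x₀ y.1.1), (γ z).1 = embK x₀ (z, β z)) ∧ IsParam γ (zc x₀ y.1.1) := by
  refine exists_param_S (r := Prod.fst) y hy (analyticAt_id.prod hβ.an) (Prod.ext rfl hβ.val)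
    analyticAt_fst (Eventually.of_forall fun _ => rfl) hβ.root ?_
  filter_upwards [hβ.root_iff] with e he h
  exact Prod.ext rfl (he.1 h).symm

theorem exists_param_S_fold {y : a.S} (hy : y.1.1 ∈ (chartAt ℂ x₀).source) {ζ : ℂ → ℂ}
    (hζ : IsFold (a.coef x₀) (zc x₀ y.1.1) (Kcoord x₀ y.1.2) ζ) :
    ∃ γ : ℂ → a.S, γ (Kcoord x₀ y.1.2) = y ∧
      (∀ᶠ s in 𝓝 (Kcoord x₀ y.1.2), (γ s).1 = embK x₀ (ζ s, s)) ∧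
      IsParam γ (Kcoord x₀ y.1.2) := by
  refine exists_param_S (r := Prod.snd) y hy (hζ.an.prod analyticAt_id) (Prod.ext hζ.val rfl)
    analyticAt_snd (Eventually.of_forall fun _ => rfl) hζ.root ?_
  filter_upwards [hζ.root_iff] with e he h
  exact Prod.ext (he.1 h).symm rfl

theorem target_of_tendsto {y : X} (hy : y ∈ (chartAt ℂ x₀).source) {h : ℂ → ℂ} {s₀ : ℂ}
    (hc : ContinuousAt h s₀) (h0 : h s₀ = zc x₀ y) :
    ∀ᶠ s in 𝓝 s₀, h s ∈ (chartAt ℂ x₀).target :=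
  hc.eventually_mem ((chartAt ℂ x₀).open_target.mem_nhds (by rw [h0]; exact zc_mem hy))

/-- Both roots simple. -/
theorem ramification_simple (hS : a.IsSmooth) (hR : a.HasGenericRamification) (y : a.SS0)
    (hy : y.1.1 ∈ (chartAt ℂ x₀).source) {c₃ c₄ : ℂ}
    (h : IsFib (a.coef x₀ (zc x₀ y.1.1)) (Kcoord x₀ y.1.2.1) (Kcoord x₀ y.1.2.2) c₃ c₄)
    (h₁₂ : Kcoord x₀ y.1.2.1 ≠ Kcoord x₀ y.1.2.2) (h₁₃ : Kcoord x₀ y.1.2.1 ≠ c₃)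
    (h₁₄ : Kcoord x₀ y.1.2.1 ≠ c₄) (h₂₃ : Kcoord x₀ y.1.2.2 ≠ c₃) (h₂₄ : Kcoord x₀ y.1.2.2 ≠ c₄) :
    HasRamification a.p₁ y 1 ∧ HasRamification a.q.toFun y 1 ∧
      HasRamification base₆ (a.q.toFun y) 1 := by
  have hA := a.analyticAt_coef (zc_mem hy)
  obtain ⟨β₁, hβ₁⟩ := exists_isBranch hA h h₁₂ h₁₃ h₁₄
  obtain ⟨β₂, hβ₂⟩ := exists_isBranch hA h.swap₁₂ h₁₂.symm h₂₃ h₂₄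
  obtain ⟨γ, hγ0, hγ, hγp⟩ := exists_param_SS0 (x₀ := x₀) (s₀ := zc x₀ y.1.1) (r := Prod.fst)
    (f := fun z => (z, β₁ z, β₂ z)) hS hR y hy
    (analyticAt_id.prod (hβ₁.an.prod hβ₂.an)) (Prod.ext rfl (Prod.ext hβ₁.val hβ₂.val))
    analyticAt_fst (Eventually.of_forall fun _ => rfl) (eventually_isPair_branches hβ₁ hβ₂ h₁₂)
    (by
      filter_upwards [eventually_eq_branches hβ₁ hβ₂] with e he hp
      exact Prod.ext rfl (Prod.ext (he hp).1.symm (he hp).2.symm))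
  obtain ⟨γS, hγS0, hγS, hγSp⟩ := exists_param_S_branch (y := a.p₁ y) hy hβ₁
  have hb := eventually_isPair_branches hβ₁ hβ₂ h₁₂
  obtain ⟨γ6, hγ60, hγ6, hγ6p⟩ := exists_param_S6 (x₀ := x₀) (s₀ := zc x₀ y.1.1) (r := Prod.fst)
    (f := fun z => (z, (β₁ z + β₂ z) / 2, β₁ z * β₂ z)) hS hR (a.q.toFun y) hy
    (analyticAt_id.prod (((hβ₁.an.add hβ₂.an).div_const).prod (hβ₁.an.mul hβ₂.an)))
    (by rw [coordKK2_q, hβ₁.val, hβ₂.val])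
    analyticAt_fst (Eventually.of_forall fun _ => rfl)
    (by
      filter_upwards [hb] with z hz
      exact ⟨_, _, hz, rfl⟩)
    (by
      rw [coordKK2_q]
      filter_upwards [eventually_quad_eq_branches hA h hβ₁ hβ₂ h₁₂ h₁₃ h₁₄ h₂₃ h₂₄] with e he hp
      exact Prod.ext rfl (Prod.ext (he hp).1.symm (he hp).2.symm))
  have htt := target_of_tendsto hy (h := fun z => z) continuousAt_id rfl
  refine ⟨⟨γ, γS, id, _, hγ0, hγp, hγSp, ?_, analyticAt_id, by simpa using hasOrd_sub _⟩,
    ⟨γ, γ6, id, _, hγ0, hγp, hγ6p, ?_, analyticAt_id, by simpa using hasOrd_sub _⟩,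
    ⟨γ6, zinv x₀, id, _, hγ60, hγ6p, isParam_zinv (zc_mem hy), ?_, analyticAt_id,
      by simpa using hasOrd_sub _⟩⟩
  · filter_upwards [hγ, hγS] with z e1 e2
    exact p₁_eq e1 e2
  · filter_upwards [hγ, hγ6, htt] with z e1 e2 e3
    exact q_eq e3 e1 e2
  · filter_upwards [hγ6] with z e1
    change (γ6 z).1.1 = _
    rw [e1]
    rfl

/-- The first root is double, the second one is simple. -/
theorem ramification_fold (hS : a.IsSmooth) (hR : a.HasGenericRamification) (y : a.SS0)
    (hy : y.1.1 ∈ (chartAt ℂ x₀).source) {c₄ : ℂ}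
    (h : IsFib (a.coef x₀ (zc x₀ y.1.1)) (Kcoord x₀ y.1.2.1) (Kcoord x₀ y.1.2.2)
      (Kcoord x₀ y.1.2.1) c₄)
    (h₁₂ : Kcoord x₀ y.1.2.1 ≠ Kcoord x₀ y.1.2.2)
    (h₁₄ : Kcoord x₀ y.1.2.1 ≠ c₄) (h₂₄ : Kcoord x₀ y.1.2.2 ≠ c₄) :
    HasRamification a.p₁ y 1 ∧ HasRamification a.p₁ (a.τ y) 2 ∧ HasRamification a.q.toFun y 1 ∧
      HasRamification a.q.toFun (a.τ y) 1 ∧ HasRamification base₆ (a.q.toFun y) 2 := by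
  have hz := zc_mem hy
  have hA := a.analyticAt_coef hz
  have hd := deriv_ne_zero_of_isSmooth hS hz h.swap₂₃
  obtain ⟨ζ, hζ⟩ := exists_isFold hA ((h.eval_eq_zero _).2 (Or.inl rfl)) hd
  obtain ⟨β₂, hβ₂⟩ := exists_isBranch hA h.swap₁₂ h₁₂.symm h₁₂.symm h₂₄
  obtain ⟨β₄, hβ₄⟩ := exists_isBranch hA h.swapPairs.swap₁₂ h₁₄.symm h₁₄.symm h₂₄.symm
  obtain ⟨o2, -, -⟩ := fold_orders hA h.swap₂₃ hd hζ hβ₂ hβ₄ h₁₂ h₁₄ h₂₄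
  have hb := eventually_isPair_fold hζ hβ₂ h₁₂
  -- The double root `s` is the parameter, and the simple root follows it through `ζ s`.
  obtain ⟨γ, hγ0, hγ, hγp⟩ := exists_param_SS0 (x₀ := x₀) (s₀ := Kcoord x₀ y.1.2.1)
    (r := fun e => e.2.1) (f := fun s => (ζ s, s, β₂ (ζ s))) hS hR y hy
    (hζ.an.prod (analyticAt_id.prod (hζ.comp_branch hβ₂)))
    (by rw [hζ.val, hβ₂.val]; rfl)
    (analyticAt_snd_fst _) (Eventually.of_forall fun _ => rfl) hb
    (by
      filter_upwards [eventually_eq_fold hζ hβ₂] with e he hp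
      obtain ⟨h1, h2⟩ := he hp
      refine Prod.ext h1.symm (Prod.ext rfl ?_)
      change β₂ (ζ e.2.1) = e.2.2
      rw [← h1, h2])
  -- At the swapped point `p₁` selects the simple root, where the base coordinate is a parameter of
  -- `S`; the projection is then `s ↦ ζ s`, of order two.
  obtain ⟨γ', hγ'0, hγ', hγ'p⟩ := exists_param_SS0 (x₀ := x₀) (s₀ := Kcoord x₀ y.1.2.1)
    (r := fun e => e.2.2) (f := fun s => (ζ s, β₂ (ζ s), s)) hS hR (a.τ y) hy
    (hζ.an.prod ((hζ.comp_branch hβ₂).prod analyticAt_id))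
    (by rw [hζ.val, hβ₂.val]; rfl)
    (analyticAt_snd_snd _) (Eventually.of_forall fun _ => rfl)
    (by
      filter_upwards [hb] with s hs
      exact hs.swap)
    (by
      have ht : Tendsto (fun e : ℂ × ℂ × ℂ => (e.1, e.2.2, e.2.1)) (𝓝 (coordKK x₀ (a.τ y).1))
          (𝓝 (coordKK x₀ y.1)) :=
        (continuous_fst.prodMk ((continuous_snd.comp continuous_snd).prodMk
          (continuous_fst.comp continuous_snd))).tendsto _
      filter_upwards [ht.eventually (eventually_eq_fold hζ hβ₂)] with e he hp
      obtain ⟨h1, h2⟩ := he hp.swap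
      change e.1 = ζ e.2.2 at h1
      change e.2.1 = β₂ e.1 at h2
      refine Prod.ext h1.symm (Prod.ext ?_ rfl)
      change β₂ (ζ e.2.2) = e.2.1
      rw [← h1, h2])
  obtain ⟨γS, hγS0, hγS, hγSp⟩ := exists_param_S_fold (y := a.p₁ y) hy hζ
  obtain ⟨γT, hγT0, hγT, hγTp⟩ := exists_param_S_branch (y := a.p₁ (a.τ y)) hy hβ₂
  -- The double root is recovered as twice the mean minus `β₂`, so `s` is a parameter of `Ŝ₆` as
  -- well.
  obtain ⟨γ6, hγ60, hγ6, hγ6p⟩ := exists_param_S6 (x₀ := x₀) (s₀ := Kcoord x₀ y.1.2.1)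
    (r := fun e => 2 * e.2.1 - β₂ e.1)
    (f := fun s => (ζ s, (s + β₂ (ζ s)) / 2, s * β₂ (ζ s))) hS hR (a.q.toFun y) hy
    (hζ.an.prod (((analyticAt_id.add (hζ.comp_branch hβ₂)).div_const).prod
      (analyticAt_id.mul (hζ.comp_branch hβ₂))))
    (by
      rw [coordKK2_q, hζ.val, hβ₂.val])
    (by
      rw [coordKK2_q]
      refine AnalyticAt.sub (analyticAt_const.mul (analyticAt_snd_fst _)) ?_
      exact AnalyticAt.fun_comp (f := fun e : ℂ × ℂ × ℂ => e.1) hβ₂.an analyticAt_fst)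
    (Eventually.of_forall fun s => by ring)
    (by
      filter_upwards [hb] with z hz
      exact ⟨_, _, hz, rfl⟩)
    (by
      rw [coordKK2_q]
      filter_upwards [eventually_quad_eq_fold hA h hζ hβ₂ h₁₂.symm h₂₄] with e he hp
      obtain ⟨h1, h2⟩ := he hp
      refine Prod.ext h1.symm (Prod.ext ?_ ?_)
      · change (2 * e.2.1 - β₂ e.1 + β₂ (ζ (2 * e.2.1 - β₂ e.1))) / 2 = e.2.1
        rw [← h1]
        ring
      · change (2 * e.2.1 - β₂ e.1) * β₂ (ζ (2 * e.2.1 - β₂ e.1)) = e.2.2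
        rw [← h1, h2])
  have htt := target_of_tendsto hy hζ.an.continuousAt hζ.val
  refine ⟨⟨γ, γS, id, _, hγ0, hγp, hγSp, ?_, analyticAt_id, by simpa using hasOrd_sub _⟩,
    ⟨γ', γT, ζ, _, hγ'0, hγ'p, ?_, ?_, hζ.an, o2⟩,
    ⟨γ, γ6, id, _, hγ0, hγp, hγ6p, ?_, analyticAt_id, by simpa using hasOrd_sub _⟩,
    ⟨γ', γ6, id, _, hγ'0, hγ'p, hγ6p, ?_, analyticAt_id, by simpa using hasOrd_sub _⟩,
    ⟨γ6, zinv x₀, ζ, _, hγ60, hγ6p, ?_, ?_, hζ.an, o2⟩⟩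
  · filter_upwards [hγ, hγS] with z e1 e2
    exact p₁_eq e1 e2
  · rw [hζ.val]
    exact hγTp
  · filter_upwards [hγ', hζ.tendsto.eventually hγT] with z e1 e2
    exact p₁_eq e1 e2
  · filter_upwards [hγ, hγ6, htt] with z e1 e2 e3
    exact q_eq e3 e1 e2
  · filter_upwards [hγ', hγ6, htt] with z e1 e2 e3
    refine q_eq e3 e1 ?_
    rw [id, e2, add_comm, mul_comm]
  · rw [hζ.val]
    exact isParam_zinv hz
  · filter_upwards [hγ6] with z e1
    change (γ6 z).1.1 = _
    rw [e1]
    rfl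

/-- Both roots coincide. -/
theorem ramification_double (hS : a.IsSmooth) (hR : a.HasGenericRamification) (y : a.SS0)
    (hy : y.1.1 ∈ (chartAt ℂ x₀).source) {c₃ c₄ : ℂ}
    (h : IsFib (a.coef x₀ (zc x₀ y.1.1)) (Kcoord x₀ y.1.2.1) (Kcoord x₀ y.1.2.2) c₃ c₄)
    (h₁₂ : Kcoord x₀ y.1.2.1 = Kcoord x₀ y.1.2.2) :
    HasRamification a.p₁ y 1 ∧ HasRamification a.q.toFun y 2 ∧
      HasRamification base₆ (a.q.toFun y) 1 ∧ HasOrder (a.delta x₀) y 1 := by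
  have hz := zc_mem hy
  have hA := a.analyticAt_coef hz
  obtain ⟨n3, n4, n34⟩ := (generic_of_isFib hR hy h).of_eq h₁₂
  have hyd : coordKK x₀ y.1 = (zc x₀ y.1.1, Kcoord x₀ y.1.2.1, Kcoord x₀ y.1.2.1) :=
    Prod.ext rfl (Prod.ext rfl h₁₂.symm)
  have hcq := coordKK2_q (x₀ := x₀) y
  rw [← h₁₂] at h hcq
  have hd := deriv_ne_zero_of_isSmooth hS hz h
  obtain ⟨ζ, hζ⟩ := exists_isFold hA ((h.eval_eq_zero _).2 (Or.inl rfl)) hd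
  obtain ⟨β₃, h3⟩ := exists_isBranch hA h.swapPairs n34 n3.symm n3.symm
  obtain ⟨β₄, h4⟩ := exists_isBranch hA h.swapPairs.swap₁₂ n34.symm n4.symm n4.symm
  obtain ⟨o2, o1, -⟩ := fold_orders hA h hd hζ h3 h4 n3 n4 n34
  have hfib := eventually_isFib_conj hζ h3 h4 n3 n4 n34
  have hb34 := eventually_isPair_branches h3 h4 n34
  have hconj := conj_apply h hζ h3 h4
  -- The merging roots are `s` and `conj s`, and either one determines the point; `s` serves as the
  -- parameter.
  obtain ⟨γ, hγ0, hγ, hγp⟩ := exists_param_SS0 (x₀ := x₀) (s₀ := Kcoord x₀ y.1.2.1)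
    (r := fun e => e.2.1) (f := fun s => (ζ s, s, conj ζ β₃ β₄ s)) hS hR y hy
    (hζ.an.prod (analyticAt_id.prod (analyticAt_conj hζ h3 h4)))
    (by rw [hyd, hζ.val, hconj])
    (analyticAt_snd_fst _) (Eventually.of_forall fun _ => rfl)
    (by
      filter_upwards [hfib] with s hs
      exact ⟨_, _, hs⟩)
    (by
      rw [hyd]
      filter_upwards [eventually_eq_conj hζ h3 h4 n3 n4 n34] with e he hp
      obtain ⟨h1, h2⟩ := he hp
      exact Prod.ext h1.symm (Prod.ext rfl h2.symm))
  obtain ⟨γS, hγS0, hγS, hγSp⟩ := exists_param_S_fold (y := a.p₁ y) hy hζ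
  have hA1 : AnalyticAt ℂ (fun z => (a.coef x₀ z).1) (zc x₀ y.1.1) :=
    AnalyticAt.fun_comp (g := Prod.fst) analyticAt_fst hA
  -- The factor `(c - s)(c - conj s)` is the cofactor of two simple branches, so its coefficients
  -- are analytic in the base coordinate. That coordinate is thus a parameter of `Ŝ₆`, and `q`
  -- becomes `s ↦ ζ s`.
  obtain ⟨γ6, hγ60, hγ6, hγ6p⟩ := exists_param_S6 (x₀ := x₀) (s₀ := zc x₀ y.1.1)
    (r := Prod.fst)
    (f := fun z => (z, -(β₃ z + β₄ z) / 2, (a.coef x₀ z).1 - β₃ z * β₄ z + (β₃ z + β₄ z) ^ 2))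
    hS hR (a.q.toFun y) hy
    (analyticAt_id.prod (((h3.an.add h4.an).neg.div_const).prod
      ((hA1.sub (h3.an.mul h4.an)).add ((h3.an.add h4.an).pow 2))))
    (by
      rw [hcq, h3.val, h4.val, h.s₂]
      refine Prod.ext rfl (Prod.ext ?_ ?_)
      · change -(c₃ + c₄) / 2 = _
        linear_combination -(1 / 2) * h.s₁
      · simp only
        linear_combination (c₃ + c₄) * h.s₁)
    analyticAt_fst (Eventually.of_forall fun _ => rfl)
    (by
      filter_upwards [hb34] with z hz
      obtain ⟨u, v, hf⟩ := hz
      refine ⟨u, v, ⟨_, _, hf.swapPairs⟩, Prod.ext rfl (Prod.ext ?_ ?_)⟩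
      · change -(β₃ z + β₄ z) / 2 = (u + v) / 2
        linear_combination -(1 / 2) * hf.s₁
      · change (a.coef x₀ z).1 - β₃ z * β₄ z + (β₃ z + β₄ z) ^ 2 = u * v
        rw [hf.s₂]
        linear_combination (β₃ z + β₄ z) * hf.s₁)
    (by
      rw [hcq]
      filter_upwards [eventually_quad_eq_conj hA h h3 h4 n3 n4 n34] with e he hp
      exact Prod.ext rfl (Prod.ext (he hp).1.symm (he hp).2.symm))
  have htt := target_of_tendsto hy hζ.an.continuousAt hζ.val
  refine ⟨⟨γ, γS, id, _, hγ0, hγp, hγSp, ?_, analyticAt_id, by simpa using hasOrd_sub _⟩,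
    ⟨γ, γ6, ζ, _, hγ0, hγp, ?_, ?_, hζ.an, o2⟩,
    ⟨γ6, zinv x₀, id, _, hγ60, hγ6p, isParam_zinv hz, ?_, analyticAt_id,
      by simpa using hasOrd_sub _⟩, ?_⟩
  · filter_upwards [hγ, hγS] with z e1 e2
    exact p₁_eq e1 e2
  · rw [hζ.val]
    exact hγ6p
  · filter_upwards [hγ, hζ.tendsto.eventually hγ6, htt, hfib] with s e1 e2 e3 hf
    refine q_eq e3 e1 (e2.trans ?_)
    congr 1
    refine Prod.ext rfl (Prod.ext ?_ ?_)
    · change -(β₃ (ζ s) + β₄ (ζ s)) / 2 = (s + conj ζ β₃ β₄ s) / 2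
      linear_combination -(1 / 2) * hf.s₁
    · change (a.coef x₀ (ζ s)).1 - β₃ (ζ s) * β₄ (ζ s) + (β₃ (ζ s) + β₄ (ζ s)) ^ 2 =
        s * conj ζ β₃ β₄ s
      rw [hf.s₂]
      linear_combination (β₃ (ζ s) + β₄ (ζ s)) * hf.s₁
  · filter_upwards [hγ6] with z e1
    change (γ6 z).1.1 = _
    rw [e1]
    rfl
  · rw [← hγ0, hγp.hasOrder_iff]
    refine o1.congr ?_
    filter_upwards [hγ.filter_mono nhdsWithin_le_nhds, htt.filter_mono nhdsWithin_le_nhds]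
      with s e1 e2
    have hc := coordKK_embKK (a := (ζ s, s, conj ζ β₃ β₄ s)) e2
    have k1 : Kcoord x₀ (embKK x₀ (ζ s, s, conj ζ β₃ β₄ s)).2.1 = s :=
      congrArg (fun w => w.2.1) hc
    have k2 : Kcoord x₀ (embKK x₀ (ζ s, s, conj ζ β₃ β₄ s)).2.2 = conj ζ β₃ β₄ s :=
      congrArg (fun w => w.2.2) hc
    rw [delta, e1, k1, k2]

end HitchinBase

end Curves

/-! ### Biholomorphic maps and maps induced by ambient holomorphic maps. -/

section Bihol

variable {Y : Type u} [TopologicalSpace Y] [HolSpace Y] {Z : Type v} [TopologicalSpace Z]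
  [HolSpace Z]

/-- A biholomorphic map. -/
structure IsBihol (Φ : Y ≃ Z) : Prop where
  cont : Continuous Φ
  cont_symm : Continuous Φ.symm
  hol : ∀ (y : Y) (f : Z → ℂ), IsHolAt f (Φ y) → IsHolAt (fun y => f (Φ y)) y
  hol_symm : ∀ (z : Z) (f : Y → ℂ), IsHolAt f (Φ.symm z) → IsHolAt (fun z => f (Φ.symm z)) z

theorem IsBihol.isParam {Φ : Y ≃ Z} (hΦ : IsBihol Φ) {γ : ℂ → Y} {s₀ : ℂ} (h : IsParam γ s₀) :
    IsParam (fun s => Φ (γ s)) s₀ := by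
  refine h.transport Φ Φ.symm ((Homeomorph.mk Φ hΦ.cont hΦ.cont_symm).map_nhds_eq (γ s₀))
    (Eventually.of_forall fun y => Φ.symm_apply_apply y) fun f => ⟨hΦ.hol _ f, fun hf => ?_⟩
  have := hΦ.hol_symm (Φ (γ s₀)) (fun y => f (Φ y)) (by rwa [Φ.symm_apply_apply])
  simpa using this

/-- Ramification is unchanged by biholomorphic maps. -/
theorem HasRamification.comp_bihol {W : Type w} [TopologicalSpace W] [HolSpace W] {Φ : Y ≃ Z}
    (hΦ : IsBihol Φ) {φ : Y → W} {ψ : Z → W} {y : Y} {e : ℕ} (h : HasRamification φ y e)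
    (hψ : ∀ y, ψ (Φ y) = φ y) : HasRamification ψ (Φ y) e := by
  obtain ⟨γ, γ', k, s₀, rfl, hγ, hγ', hk, ha, he⟩ := h
  exact ⟨_, γ', k, s₀, rfl, hΦ.isParam hγ, hγ', hk.mono fun s hs => (hψ _).trans hs, ha, he⟩

end Bihol

section Induced

variable {E₁ H₁ M₁ E₂ H₂ M₂ : Type*} [NormedAddCommGroup E₁] [NormedSpace ℂ E₁]
  [TopologicalSpace H₁] {I₁ : ModelWithCorners ℂ E₁ H₁} [TopologicalSpace M₁] [ChartedSpace H₁ M₁]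
  [IsManifold I₁ ω M₁] [NormedAddCommGroup E₂] [NormedSpace ℂ E₂]
  [TopologicalSpace H₂] {I₂ : ModelWithCorners ℂ E₂ H₂} [TopologicalSpace M₂] [ChartedSpace H₂ M₂]
  [IsManifold I₂ ω M₂] {Y₁ : Type u} {Y₂ : Type v} [TopologicalSpace Y₁] [TopologicalSpace Y₂]
  {j₁ : Y₁ → M₁} {j₂ : Y₂ → M₂}

/-- In this lemma and the next the map is matched with an ambient one only near `y`, so a formula
valid in one chart is enough. They are applied to τ, to σ and to the identification with Δ. -/
theorem continuousAt_induced (hj₁ : Continuous j₁) (hj₂ : Topology.IsInducing j₂) {Φ : Y₁ → Y₂} {y : Y₁}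
    {A : M₁ → M₂} (hA : ContMDiffAt I₁ I₂ ω A (j₁ y)) (h : ∀ᶠ y' in 𝓝 y, j₂ (Φ y') = A (j₁ y')) :
    ContinuousAt Φ y := by
  rw [hj₂.continuousAt_iff]
  exact (hA.continuousAt.comp hj₁.continuousAt).congr (h.mono fun _ h => h.symm)

theorem isHolAt_comp_induced (hj₁ : Continuous j₁) (hj₂ : Topology.IsInducing j₂) {Φ : Y₁ → Y₂} {y : Y₁}
    {A : M₁ → M₂} (hA : ContMDiffAt I₁ I₂ ω A (j₁ y)) (h : ∀ᶠ y' in 𝓝 y, j₂ (Φ y') = A (j₁ y'))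
    {f : Y₂ → ℂ} (hf : @IsHolAt Y₂ _ (HolSpace.induced I₂ j₂) f (Φ y)) :
    @IsHolAt Y₁ _ (HolSpace.induced I₁ j₁) (fun y => f (Φ y)) y := by
  have hc := continuousAt_induced hj₁ hj₂ hA h
  rw [isHolAt_induced_iff hj₂.continuous] at hf
  rw [isHolAt_induced_iff hj₁]
  obtain ⟨F, hF, hfF⟩ := hf
  rw [h.self_of_nhds] at hF
  refine ⟨F ∘ A, hF.comp _ hA, ?_⟩
  filter_upwards [h, hc.eventually hfF] with y' h1 h2
  rw [h2, h1]
  rfl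

end Induced

/-! ### Fibres of the spectral curve, and the curves as Riemann surfaces. -/

section Curves

variable {X : Type u} [TopologicalSpace X] [ChartedSpace ℂ X] [IsManifold 𝓘(ℂ, ℂ) ω X]

/-- The property T1 passes from the model space to anything covered by charts. -/
theorem t1Space_totalSpace {F : Type*} [NormedAddCommGroup F] [NormedSpace ℂ F] {E : X → Type*}
    [TopologicalSpace (TotalSpace F E)] [∀ x, TopologicalSpace (E x)] [FiberBundle F E] :
    T1Space (TotalSpace F E) := by
  have : T1Space (ModelProd ℂ F) := inferInstanceAs (T1Space (ℂ × F))
  exact ChartedSpace.t1Space (ModelProd ℂ F) _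

namespace HitchinBase

variable (a : HitchinBase X)

instance : T1Space a.S :=
  have : T1Space (TotK X) := t1Space_totalSpace
  inferInstance

instance : T1Space a.SS0 :=
  have : T1Space (TotKK X) := t1Space_totalSpace
  inferInstance

instance : T1Space a.S6 :=
  have : T1Space (TotKK2 X) := t1Space_totalSpace (E := (K : X → Type) ×ᵇ (K2 : X → Type))
  inferInstance

/-- `t₁, …, t₄` are the points of the fibre of the spectral curve over `x`, with multiplicity. -/
def Fib (x : X) (t₁ t₂ t₃ t₄ : K x) : Prop :=
  ∀ x₀ : X, x ∈ (chartAt ℂ x₀).source → IsFib (a.coef x₀ (zc x₀ x)) (Kcoord x₀ t₁) (Kcoord x₀ t₂)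
    (Kcoord x₀ t₃) (Kcoord x₀ t₄)

variable {a} {x : X} {t₁ t₂ t₃ t₄ t₃' t₄' : K x}

/-- Both sides scale with the fourth power of the coordinate of `v`, so the coordinate field of a
chart suffices. The right side is the chart-free form that appears in `sigmaRel`. -/
theorem fib_iff_poly : a.Fib x t₁ t₂ t₃ t₄ ↔ ∀ (t : K x) (v : TangentSpace 𝓘(ℂ, ℂ) x),
    a.poly x t v = (t v - t₁ v : ℂ) * (t v - t₂ v) * (t v - t₃ v) * (t v - t₄ v) := by
  constructor
  · intro h t v
    have hx := mem_chart_source ℂ x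
    have h1 : ∀ t : K x, (t v : ℂ) = (dz x x v : ℂ) * Kcoord x t := fun t => K_apply hx t v
    have h2 : a.poly x t v = (dz x x v : ℂ) ^ 4 * a.poly x t (vf x x) := by
      conv_lhs => rw [← dz_smul_vf hx v]
      exact poly_smul x t _ _
    rw [h2, poly_vf hx, (h x hx).eval, h1 t, h1 t₁, h1 t₂, h1 t₃, h1 t₄]
    ring
  · intro h x₀ hx
    refine IsFib.of_eval fun c => ?_
    have := h (Kmk x₀ x c) (vf x₀ x)
    rw [poly_vf hx, Kcoord_Kmk hx] at this
    rw [this]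
    have e : (Kmk x₀ x c (vf x₀ x) : ℂ) = c := Kcoord_Kmk hx c
    rw [e]
    rfl

/-- One chart is enough because the factorization of `poly` does not refer to charts. -/
theorem fib_of_isFib {x₀ : X} (hx : x ∈ (chartAt ℂ x₀).source)
    (h : IsFib (a.coef x₀ (zc x₀ x)) (Kcoord x₀ t₁) (Kcoord x₀ t₂)
      (Kcoord x₀ t₃) (Kcoord x₀ t₄)) : a.Fib x t₁ t₂ t₃ t₄ := by
  rw [fib_iff_poly]
  intro t v
  have h1 : ∀ t : K x, (t v : ℂ) = (dz x₀ x v : ℂ) * Kcoord x₀ t := fun t => K_apply hx t v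
  have h2 : a.poly x t v = (dz x₀ x v : ℂ) ^ 4 * a.poly x t (vf x₀ x) := by
    conv_lhs => rw [← dz_smul_vf hx v]
    exact poly_smul x t _ _
  rw [h2, poly_vf hx, h.eval, h1 t, h1 t₁, h1 t₂, h1 t₃, h1 t₄]
  ring

namespace Fib

theorem isFib (h : a.Fib x t₁ t₂ t₃ t₄) : IsFib (a.coef x (zc x x)) (Kcoord x t₁) (Kcoord x t₂)
    (Kcoord x t₃) (Kcoord x t₄) := h x (mem_chart_source ℂ x)

theorem swap₁₂ (h : a.Fib x t₁ t₂ t₃ t₄) : a.Fib x t₂ t₁ t₃ t₄ := fun x₀ hx => (h x₀ hx).swap₁₂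

theorem swap₂₃ (h : a.Fib x t₁ t₂ t₃ t₄) : a.Fib x t₁ t₃ t₂ t₄ := fun x₀ hx => (h x₀ hx).swap₂₃

theorem swap₃₄ (h : a.Fib x t₁ t₂ t₃ t₄) : a.Fib x t₁ t₂ t₄ t₃ := fun x₀ hx => (h x₀ hx).swap₃₄

theorem swapPairs (h : a.Fib x t₁ t₂ t₃ t₄) : a.Fib x t₃ t₄ t₁ t₂ :=
  fun x₀ hx => (h x₀ hx).swapPairs

theorem isRoot_iff (h : a.Fib x t₁ t₂ t₃ t₄) (t : K x) :
    a.IsRoot x t ↔ t = t₁ ∨ t = t₂ ∨ t = t₃ ∨ t = t₄ := by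
  have hx := mem_chart_source ℂ x
  have e : ∀ s : K x, Kcoord x t = Kcoord x s ↔ t = s := fun s =>
    ⟨fun h => K_ext hx h, fun h => by rw [h]⟩
  rw [HitchinBase.isRoot_iff hx, h.isFib.eval_eq_zero, e, e, e, e]

theorem of_eq (hR : a.HasGenericRamification) (h : a.Fib x t₁ t₂ t₃ t₄) (h₁₂ : t₁ = t₂) :
    t₁ ≠ t₃ ∧ t₁ ≠ t₄ ∧ t₃ ≠ t₄ := by
  obtain ⟨h1, h2, h3⟩ := (generic_of_isFib hR (mem_chart_source ℂ x) h.isFib).of_eq (by rw [h₁₂])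
  exact ⟨fun h => h1 (by rw [h]), fun h => h2 (by rw [h]), fun h => h3 (by rw [h])⟩

/-- The last two points of a fibre are determined by the first two. -/
theorem det (h : a.Fib x t₁ t₂ t₃ t₄) (h' : a.Fib x t₁ t₂ t₃' t₄') :
    t₃ = t₃' ∧ t₄ = t₄' ∨ t₃ = t₄' ∧ t₄ = t₃' := by
  have hx := mem_chart_source ℂ x
  have e : ∀ t s : K x, Kcoord x t = Kcoord x s ↔ t = s := fun t s =>
    ⟨fun h => K_ext hx h, fun h => by rw [h]⟩
  have f := h.isFib
  have f' := h'.isFib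
  have hs : Kcoord x t₃ + Kcoord x t₄ = Kcoord x t₃' + Kcoord x t₄' := by
    linear_combination f.s₁ - f'.s₁
  have hp : Kcoord x t₃ * Kcoord x t₄ = Kcoord x t₃' * Kcoord x t₄' := by
    linear_combination f'.s₂ - f.s₂ - (Kcoord x t₁ + Kcoord x t₂) * hs
  have h0 : (Kcoord x t₃ - Kcoord x t₃') * (Kcoord x t₃ - Kcoord x t₄') = 0 := by
    linear_combination Kcoord x t₃ * hs - hp
  rw [← e, ← e, ← e, ← e]
  rcases mul_eq_zero.1 h0 with h0 | h0
  · refine Or.inl ⟨sub_eq_zero.1 h0, ?_⟩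
    linear_combination hs - h0
  · refine Or.inr ⟨sub_eq_zero.1 h0, ?_⟩
    linear_combination hs - h0

/-- The remaining points of a fibre are determined by the first one. -/
theorem mem_of_fib {s u v : K x} (h : a.Fib x t₁ t₂ t₃ t₄) (h' : a.Fib x t₁ s u v) :
    s = t₂ ∨ s = t₃ ∨ s = t₄ := by
  have hx := mem_chart_source ℂ x
  have e : ∀ t s : K x, t = s ↔ Kcoord x t - Kcoord x s = 0 := fun t s =>
    ⟨fun h => by rw [h, sub_self], fun h => K_ext hx (sub_eq_zero.1 h)⟩
  -- The root `t₁` and the coefficients determine the cubic cofactor, so `s` is a zero of the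
  -- product over `t₂, t₃, t₄`.
  rw [e, e, e, ← mul_eq_zero, ← mul_eq_zero]
  set c := Kcoord x s
  set c₁ := Kcoord x t₁
  linear_combination (-c ^ 2 - c * c₁ - c₁ ^ 2) * (h.isFib.s₁ - h'.isFib.s₁) -
    (c + c₁) * (h.isFib.s₂ - h'.isFib.s₂) - (h.isFib.s₃ - h'.isFib.s₃)

/-- The point `(t₁, t₂)` of `(S ×_X S)₀`. -/
def pt (hS : a.IsSmooth) (hR : a.HasGenericRamification) (h : a.Fib x t₁ t₂ t₃ t₄) : a.SS0 :=
  ⟨⟨x, (t₁, t₂)⟩, mem_SS0_of_isPair (x₀ := x) hS hR (mem_chart_source ℂ x) ⟨_, _, h.isFib⟩⟩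

end Fib

theorem exists_fib_of_pair {x : X} {t₁ t₂ : K x}
    (h : IsPair (a.coef x (zc x x)) (Kcoord x t₁) (Kcoord x t₂)) :
    ∃ t₃ t₄, a.Fib x t₁ t₂ t₃ t₄ := by
  have hx := mem_chart_source ℂ x
  obtain ⟨c₃, c₄, h⟩ := h
  exact ⟨Kmk x x c₃, Kmk x x c₄, fib_of_isFib hx (by rwa [Kcoord_Kmk hx, Kcoord_Kmk hx])⟩

theorem exists_fib (y : a.SS0) : ∃ t₃ t₄, a.Fib y.1.1 y.1.2.1 y.1.2.2 t₃ t₄ :=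
  exists_fib_of_pair (isPair_of_mem_SS0 (mem_chart_source ℂ y.1.1) y.2)

theorem exists_fib_of_isRoot {t : K x} (h : a.IsRoot x t) : ∃ t₂ t₃ t₄, a.Fib x t t₂ t₃ t₄ := by
  have hx := mem_chart_source ℂ x
  obtain ⟨c₂, c₃, c₄, h⟩ := exists_isFib_of_root ((isRoot_iff hx t).1 h)
  refine ⟨Kmk x x c₂, Kmk x x c₃, Kmk x x c₄, fib_of_isFib hx ?_⟩
  rwa [Kcoord_Kmk hx, Kcoord_Kmk hx, Kcoord_Kmk hx]

variable (a) in
theorem exists_fib_of_base (x : X) : ∃ t₁ t₂ t₃ t₄, a.Fib x t₁ t₂ t₃ t₄ := by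
  have hx := mem_chart_source ℂ x
  obtain ⟨c, hc⟩ : ∃ c, quartic (a.coef x (zc x x)) c = 0 := by
    set α := a.coef x (zc x x)
    obtain ⟨c, hc⟩ := IsAlgClosed.exists_root (Polynomial.X ^ 4 + Polynomial.C α.1 *
      Polynomial.X ^ 2 + Polynomial.C α.2.1 * Polynomial.X + Polynomial.C α.2.2)
      (by
        have : (Polynomial.X ^ 4 + Polynomial.C α.1 * Polynomial.X ^ 2 +
          Polynomial.C α.2.1 * Polynomial.X + Polynomial.C α.2.2).degree = 4 := by compute_degree!
        rw [this]
        decide)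
    refine ⟨c, ?_⟩
    simpa [Polynomial.IsRoot, quartic] using hc
  exact ⟨_, exists_fib_of_isRoot (t := Kmk x x c) ((isRoot_iff hx _).2 (by rwa [Kcoord_Kmk hx]))⟩

open Classical in
/-- The ramification of the projections at the point `(t₁, t₂)` of `(S ×_X S)₀`. -/
theorem hasRamification (hS : a.IsSmooth) (hR : a.HasGenericRamification) (y : a.SS0)
    {t₃ t₄ : K y.1.1} (h : a.Fib y.1.1 y.1.2.1 y.1.2.2 t₃ t₄) :
    HasRamification a.p₁ y (if y.1.2.2 = t₃ ∨ y.1.2.2 = t₄ then 2 else 1) ∧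
      HasRamification a.q.toFun y (if y.1.2.1 = y.1.2.2 then 2 else 1) ∧
      HasRamification base₆ (a.q.toFun y) (if y.1.2.1 = t₃ ∨ y.1.2.1 = t₄ ∨
        y.1.2.2 = t₃ ∨ y.1.2.2 = t₄ then 2 else 1) := by
  have hx := mem_chart_source ℂ y.1.1
  have e : ∀ {t s : K y.1.1}, t ≠ s → Kcoord y.1.1 t ≠ Kcoord y.1.1 s := fun h h' => h (K_ext hx h')
  -- At most one pair among the four roots coincides, so each case below excludes all the others.
  by_cases h₁₂ : y.1.2.1 = y.1.2.2
  · obtain ⟨n3, n4, n34⟩ := h.of_eq hR h₁₂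
    obtain ⟨r1, r2, r3, -⟩ := ramification_double hS hR y hx h.isFib (by rw [h₁₂])
    have m3 := n3
    have m4 := n4
    rw [h₁₂] at m3 m4
    rw [if_neg (by tauto), if_pos h₁₂, if_neg (by tauto)]
    exact ⟨r1, r2, r3⟩
  rw [if_neg h₁₂]
  by_cases h₁₃ : y.1.2.1 = t₃
  · subst h₁₃
    obtain ⟨-, n4, n24⟩ := h.swap₂₃.of_eq hR rfl
    obtain ⟨r1, -, r3, -, r5⟩ := ramification_fold hS hR y hx h.isFib (e h₁₂) (e n4) (e n24)
    rw [if_neg (by tauto), if_pos (by tauto)]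
    exact ⟨r1, r3, r5⟩
  by_cases h₁₄ : y.1.2.1 = t₄
  · subst h₁₄
    obtain ⟨-, n4, n24⟩ := h.swap₃₄.swap₂₃.of_eq hR rfl
    obtain ⟨r1, -, r3, -, r5⟩ := ramification_fold hS hR y hx h.swap₃₄.isFib (e h₁₂) (e n4) (e n24)
    rw [if_neg (by tauto), if_pos (by tauto)]
    exact ⟨r1, r3, r5⟩
  -- A repeated second entry is the fold case for `τ y`, whose first entry is the double root.
  by_cases h₂₃ : y.1.2.2 = t₃
  · subst h₂₃
    obtain ⟨-, n4, n24⟩ := h.swap₁₂.swap₂₃.of_eq hR rfl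
    obtain ⟨-, r2, -, r4, r5⟩ := ramification_fold (y := a.τ y) hS hR hx h.swap₁₂.isFib
      (e (Ne.symm h₁₂)) (e n4) (e n24)
    rw [if_pos (by tauto), if_pos (by tauto)]
    rw [a.q_τ] at r5
    exact ⟨r2, r4, r5⟩
  by_cases h₂₄ : y.1.2.2 = t₄
  · subst h₂₄
    obtain ⟨-, n4, n24⟩ := h.swap₁₂.swap₃₄.swap₂₃.of_eq hR rfl
    obtain ⟨-, r2, -, r4, r5⟩ := ramification_fold (y := a.τ y) hS hR hx h.swap₁₂.swap₃₄.isFib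
      (e (Ne.symm h₁₂)) (e n4) (e n24)
    rw [if_pos (by tauto), if_pos (by tauto)]
    rw [a.q_τ] at r5
    exact ⟨r2, r4, r5⟩
  · rw [if_neg (by tauto), if_neg (by tauto)]
    exact ramification_simple hS hR y hx h.isFib (e h₁₂) (e h₁₃) (e h₁₄) (e h₂₃) (e h₂₄)

theorem HasRamification.source {Y : Type u} [TopologicalSpace Y] [HolSpace Y] {Z : Type v}
    [TopologicalSpace Z] [HolSpace Z] {φ : Y → Z} {p : Y} {e : ℕ} (h : HasRamification φ p e) :
    ∃ (γ : ℂ → Y) (s₀ : ℂ), γ s₀ = p ∧ IsParam γ s₀ := by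
  obtain ⟨γ, _, _, s₀, h0, hγ, -⟩ := h
  exact ⟨γ, s₀, h0, hγ⟩

theorem HasRamification.target {Y : Type u} [TopologicalSpace Y] [HolSpace Y] {Z : Type v}
    [TopologicalSpace Z] [HolSpace Z] {φ : Y → Z} {p : Y} {e : ℕ} (h : HasRamification φ p e) :
    ∃ (γ : ℂ → Z) (s₀ : ℂ), γ s₀ = φ p ∧ IsParam γ s₀ := by
  obtain ⟨_, γ', k, s₀, rfl, -, hγ', hk, -⟩ := h
  exact ⟨γ', k s₀, hk.self_of_nhds.symm, hγ'⟩

theorem isCurve_SS0 (hS : a.IsSmooth) (hR : a.HasGenericRamification) : IsCurve a.SS0 := fun y => by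
  obtain ⟨t₃, t₄, h⟩ := exists_fib y
  exact HasRamification.source (hasRamification hS hR y h).1

theorem isCurve_S (hS : a.IsSmooth) (hR : a.HasGenericRamification) : IsCurve a.S := fun p => by
  obtain ⟨t₂, t₃, t₄, h⟩ := exists_fib_of_isRoot p.2
  exact HasRamification.target (hasRamification hS hR (h.pt hS hR) h).1

theorem q_surjective (z : a.S6) : ∃ y, a.q.toFun y = z := by
  obtain ⟨_, p, hp, rfl⟩ := z
  exact ⟨⟨p, hp⟩, rfl⟩

theorem isCurve_S6 (hS : a.IsSmooth) (hR : a.HasGenericRamification) : IsCurve a.S6 := fun z => by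
  obtain ⟨y, rfl⟩ := q_surjective z
  obtain ⟨t₃, t₄, h⟩ := exists_fib y
  exact HasRamification.target (hasRamification hS hR y h).2.1

/-- Half the sum and the product determine an unordered pair. -/
theorem q_eq_iff {y y' : a.SS0} : a.q.toFun y = a.q.toFun y' ↔ y = y' ∨ y = a.τ y' := by
  constructor
  · intro h
    have h0 : sym y.1 = sym y'.1 := congrArg Subtype.val h
    obtain ⟨⟨x, t₁, t₂⟩, hy⟩ := y
    obtain ⟨⟨x', t₁', t₂'⟩, hy'⟩ := y'
    have hxx : x = x' := congrArg (fun p => p.1) h0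
    subst hxx
    have hx := mem_chart_source ℂ x
    have e : ∀ t s : K x, Kcoord x t = Kcoord x s → t = s := fun t s h => K_ext hx h
    have hc := congrArg (coordKK2 x) h0
    rw [coordKK2_sym, coordKK2_sym] at hc
    have hs : (Kcoord x t₁ + Kcoord x t₂) / 2 = (Kcoord x t₁' + Kcoord x t₂') / 2 :=
      congrArg (fun w => w.2.1) hc
    have hp : Kcoord x t₁ * Kcoord x t₂ = Kcoord x t₁' * Kcoord x t₂' :=
      congrArg (fun w => w.2.2) hc
    have h1 : (Kcoord x t₁ - Kcoord x t₁') * (Kcoord x t₁ - Kcoord x t₂') = 0 := by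
      linear_combination 2 * Kcoord x t₁ * hs - hp
    rcases mul_eq_zero.1 h1 with h1 | h1
    · left
      have e1 := e _ _ (sub_eq_zero.1 h1)
      have e2 : t₂ = t₂' := e _ _ (by linear_combination 2 * hs - h1)
      subst e1 e2
      rfl
    · right
      have e1 := e _ _ (sub_eq_zero.1 h1)
      have e2 : t₂ = t₁' := e _ _ (by linear_combination 2 * hs - h1)
      subst e1 e2
      rfl
  · rintro (rfl | rfl)
    · rfl
    · exact a.q_τ y'

/-- The involution `τ` as a permutation. -/
def τEquiv (a : HitchinBase X) : a.SS0 ≃ a.SS0 := ⟨a.τ, a.τ, fun _ => rfl, fun _ => rfl⟩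

theorem isBihol_τ : IsBihol a.τEquiv := by
  have hA : ∀ p : TotKK X, ContMDiffAt IKK IKK ω
      (fun m => embKK p.1 ((coordKK p.1 m).1, (coordKK p.1 m).2.2, (coordKK p.1 m).2.1)) p := by
    intro p
    have hp := mem_chart_source ℂ p.1
    have h1 : ContDiff ℂ ω (fun w : ℂ × ℂ × ℂ => (w.1, w.2.2, w.2.1)) := by fun_prop
    exact ContMDiffAt.comp (g := embKK p.1) p (contMDiffAt_embKK (zc_mem hp))
      (h1.contMDiff.contMDiffAt.comp p (contMDiffAt_coordKK hp))
  have hE : ∀ y : a.SS0, ∀ᶠ y' : a.SS0 in 𝓝 y, (a.τ y').1 = embKK y.1.1 ((coordKK y.1.1 y'.1).1,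
      (coordKK y.1.1 y'.1).2.2, (coordKK y.1.1 y'.1).2.1) := by
    intro y
    filter_upwards [continuous_subtype_val.continuousAt.eventually
      (eventually_mem_source (mem_chart_source ℂ y.1.1))] with y' hy'
    exact (embKK_coordKK (p := (a.τ y').1) hy').symm
  have hc : Continuous a.τ := continuous_iff_continuousAt.2 fun y =>
    continuousAt_induced (I₁ := IKK) (I₂ := IKK) (j₁ := Subtype.val) (j₂ := Subtype.val)
      continuous_subtype_val .subtypeVal (hA y.1) (hE y)
  have hh : ∀ (y : a.SS0) (f : a.SS0 → ℂ), IsHolAt f (a.τ y) → IsHolAt (fun y => f (a.τ y)) y :=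
    fun y f hf => isHolAt_comp_induced (I₁ := IKK) (I₂ := IKK) (j₁ := Subtype.val)
      (j₂ := Subtype.val) continuous_subtype_val .subtypeVal (hA y.1) (hE y) hf
  exact ⟨hc, hc, hh, hh⟩

end HitchinBase

end Curves

section Curves

variable {X : Type u} [TopologicalSpace X] [ChartedSpace ℂ X] [IsManifold 𝓘(ℂ, ℂ) ω X]

namespace HitchinBase

variable {a : HitchinBase X}

/-! #### The incidence divisor -/

/-- The parametrization of the incidence divisor by `(S ×_X S)₀`. -/
def toDelta (y : a.SS0) : a.Delta := ⟨(⟨y.1.1, y.1.2.1⟩, sym y.1), y.1, y.2, rfl⟩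

/-- The point `Sym[y, y']` determines the pair up to order, and the component `y` fixes the order.
-/
theorem toDelta_bijective : Function.Bijective (toDelta (a := a)) := by
  constructor
  · intro y y' h
    have h1 : (⟨y.1.1, y.1.2.1⟩ : TotK X) = ⟨y'.1.1, y'.1.2.1⟩ :=
      congrArg (fun d : a.Delta => d.1.1) h
    have h2 : a.q.toFun y = a.q.toFun y' := Subtype.ext (congrArg (fun d : a.Delta => d.1.2) h)
    rcases q_eq_iff.1 h2 with h3 | h3
    · exact h3
    · subst h3
      obtain ⟨⟨x, t₁, t₂⟩, hy⟩ := y'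
      have h4 : t₂ = t₁ := eq_of_heq (TotalSpace.mk.inj h1).2
      subst h4
      rfl
  · rintro ⟨_, p, hp, rfl⟩
    exact ⟨⟨p, hp⟩, rfl⟩

/-- The parametrization of the incidence divisor by `(S ×_X S)₀`. -/
def deltaEquiv (a : HitchinBase X) : a.SS0 ≃ a.Delta := Equiv.ofBijective _ toDelta_bijective

theorem deltaEquiv_coe (y : a.SS0) : (a.deltaEquiv y).1 = (⟨y.1.1, y.1.2.1⟩, sym y.1) := rfl

/-- The inverse is holomorphic since the second root is twice the mean minus the first.
Multiplicities of intersection with Δ thus become ramification indices of `p₁`. -/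
theorem isBihol_delta : IsBihol a.deltaEquiv := by
  have h1 : ∀ p : TotKK X, ContMDiffAt IKK (IK.prod IKK2) ω
      (fun m => (embK p.1 ((coordKK p.1 m).1, (coordKK p.1 m).2.1), sym m)) p := by
    intro p
    have hp := mem_chart_source ℂ p.1
    have h1 : ContDiff ℂ ω (fun w : ℂ × ℂ × ℂ => (w.1, w.2.1)) := by fun_prop
    exact ContMDiffAt.prodMk (ContMDiffAt.comp (g := embK p.1) p (contMDiffAt_embK (zc_mem hp))
      (h1.contMDiff.contMDiffAt.comp p (contMDiffAt_coordKK hp))) contMDiff_sym.contMDiffAt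
  have e1 : ∀ y : a.SS0, ∀ᶠ y' : a.SS0 in 𝓝 y, (a.deltaEquiv y').1 =
      (embK y.1.1 ((coordKK y.1.1 y'.1).1, (coordKK y.1.1 y'.1).2.1), sym y'.1) := by
    intro y
    filter_upwards [continuous_subtype_val.continuousAt.eventually
      (eventually_mem_source (mem_chart_source ℂ y.1.1))] with y' hy'
    exact Prod.ext (embK_coordK (p := ⟨y'.1.1, y'.1.2.1⟩) hy').symm rfl
  have h2 : ∀ (x : X) (p : TotK X × TotKK2 X), p.1.1 = x → p.2.1 = x →
      ContMDiffAt (IK.prod IKK2) IKK ω (fun m => embKK x ((coordK x m.1).1, (coordK x m.1).2,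
        2 * (coordKK2 x m.2).2.1 - (coordK x m.1).2)) p := by
    rintro x p rfl h
    have hp := mem_chart_source ℂ p.1.1
    have h1 : ContDiff ℂ ω (fun w : (ℂ × ℂ) × ℂ × ℂ × ℂ => (w.1.1, w.1.2, 2 * w.2.2.1 - w.1.2)) := by
      fun_prop
    refine ContMDiffAt.comp (g := embKK p.1.1) p (contMDiffAt_embKK (zc_mem hp)) ?_
    refine ContMDiffAt.comp (g := fun w : (ℂ × ℂ) × ℂ × ℂ × ℂ => (w.1.1, w.1.2, 2 * w.2.2.1 - w.1.2))
      (f := fun m : TotK X × TotKK2 X => (coordK p.1.1 m.1, coordKK2 p.1.1 m.2)) p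
      h1.contMDiff.contMDiffAt ?_
    exact ContMDiffAt.prodMk_space ((contMDiffAt_coordK hp).comp p contMDiffAt_fst)
      (ContMDiffAt.comp (g := coordKK2 p.1.1) p (contMDiffAt_coordKK2 (by rw [h]; exact hp))
        contMDiffAt_snd)
  have e2 : ∀ y : a.SS0, ∀ᶠ d : a.Delta in 𝓝 (a.deltaEquiv y), (a.deltaEquiv.symm d).1 =
      embKK y.1.1 ((coordK y.1.1 d.1.1).1, (coordK y.1.1 d.1.1).2,
        2 * (coordKK2 y.1.1 d.1.2).2.1 - (coordK y.1.1 d.1.1).2) := by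
    intro y
    have hc : Tendsto (fun d : a.Delta => d.1.1) (𝓝 (a.deltaEquiv y)) (𝓝 ⟨y.1.1, y.1.2.1⟩) :=
      (continuous_fst.comp continuous_subtype_val).tendsto (a.deltaEquiv y)
    filter_upwards [hc.eventually (eventually_mem_source (mem_chart_source ℂ y.1.1))] with d hd
    obtain ⟨y', rfl⟩ := a.deltaEquiv.surjective d
    rw [Equiv.symm_apply_apply, deltaEquiv_coe, coordKK2_sym]
    have := embKK_coordKK (x₀ := y.1.1) (p := y'.1) hd
    conv_lhs => rw [← this]
    congr 1
    refine Prod.ext rfl (Prod.ext rfl ?_)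
    change Kcoord y.1.1 y'.1.2.2 = 2 * ((Kcoord y.1.1 y'.1.2.1 + Kcoord y.1.1 y'.1.2.2) / 2) -
      Kcoord y.1.1 y'.1.2.1
    ring
  refine ⟨continuous_iff_continuousAt.2 fun y => ?_, continuous_iff_continuousAt.2 fun d => ?_,
    fun y f hf => ?_, fun d f hf => ?_⟩
  · exact continuousAt_induced (I₁ := IKK) (I₂ := IK.prod IKK2) (j₁ := Subtype.val)
      (j₂ := Subtype.val) continuous_subtype_val .subtypeVal (h1 y.1) (e1 y)
  · obtain ⟨y, rfl⟩ := a.deltaEquiv.surjective d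
    exact continuousAt_induced (I₂ := IKK) (I₁ := IK.prod IKK2) (j₁ := Subtype.val)
      (j₂ := Subtype.val) continuous_subtype_val .subtypeVal (h2 y.1.1 _ rfl rfl) (e2 y)
  · exact isHolAt_comp_induced (I₁ := IKK) (I₂ := IK.prod IKK2) (j₁ := Subtype.val)
      (j₂ := Subtype.val) continuous_subtype_val .subtypeVal (h1 y.1) (e1 y) hf
  · obtain ⟨y, rfl⟩ := a.deltaEquiv.surjective d
    exact isHolAt_comp_induced (I₂ := IKK) (I₁ := IK.prod IKK2) (j₁ := Subtype.val)
      (j₂ := Subtype.val) continuous_subtype_val .subtypeVal (h2 y.1.1 _ rfl rfl) (e2 y) hf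

theorem Delta₁_deltaEquiv (y : a.SS0) : a.Delta₁ (a.deltaEquiv y) = a.p₁ y := rfl

theorem Delta₂_deltaEquiv (y : a.SS0) : a.Delta₂ (a.deltaEquiv y) = a.q.toFun y := rfl

theorem isCurve_Delta (hS : a.IsSmooth) (hR : a.HasGenericRamification) : IsCurve a.Delta := by
  intro d
  obtain ⟨y, rfl⟩ := a.deltaEquiv.surjective d
  obtain ⟨γ, s₀, rfl, h⟩ := isCurve_SS0 hS hR y
  exact ⟨_, s₀, rfl, isBihol_delta.isParam h⟩

theorem ramIdx_Delta₁ (hS : a.IsSmooth) (hR : a.HasGenericRamification) (y : a.SS0) :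
    ramIdx a.Delta₁ (a.deltaEquiv y) = ramIdx a.p₁ y := by
  obtain ⟨t₃, t₄, h⟩ := exists_fib y
  have h1 := (hasRamification hS hR y h).1
  rw [h1.ramIdx_eq (isCurve_SS0 hS hR) (isCurve_S hS hR)]
  exact (h1.comp_bihol (ψ := a.Delta₁) isBihol_delta fun _ => rfl).ramIdx_eq
    (isCurve_Delta hS hR) (isCurve_S hS hR)

theorem hasRamification_p₁ (hS : a.IsSmooth) (hR : a.HasGenericRamification) (y : a.SS0) :
    HasRamification a.p₁ y (ramIdx a.p₁ y) := by
  obtain ⟨t₃, t₄, h⟩ := exists_fib y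
  have h1 := (hasRamification hS hR y h).1
  rwa [h1.ramIdx_eq (isCurve_SS0 hS hR) (isCurve_S hS hR)]

theorem hasRamification_p₂ (hS : a.IsSmooth) (hR : a.HasGenericRamification) (y : a.SS0) :
    HasRamification a.p₂ y (ramIdx a.p₁ (a.τ y)) :=
  (hasRamification_p₁ hS hR (a.τ y)).comp_bihol (ψ := a.p₂) (isBihol_τ (a := a)) fun _ => rfl

theorem finite_fibre_p₁ (p : a.S) : (a.p₁ ⁻¹' {p}).Finite := by
  obtain ⟨⟨x, t₁⟩, hp⟩ := p
  obtain ⟨t₂, t₃, t₄, h⟩ := exists_fib_of_isRoot hp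
  have hf : ({t₁, t₂, t₃, t₄} : Set (K x)).Finite := by simp
  refine Set.Finite.of_injOn (f := fun y : a.SS0 => y.1)
    (t := (fun t => (⟨x, (t₁, t)⟩ : TotKK X)) '' {t₁, t₂, t₃, t₄}) ?_
    Subtype.val_injective.injOn (hf.image _)
  rintro ⟨⟨x', s₁, s₂⟩, hy⟩ h'
  have h0 : (⟨x', s₁⟩ : TotK X) = ⟨x, t₁⟩ := congrArg Subtype.val h'
  obtain ⟨rfl, h1⟩ := TotalSpace.mk.inj h0
  obtain rfl := eq_of_heq h1
  exact ⟨s₂, (h.isRoot_iff s₂).1 hy.1.2, rfl⟩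

theorem finite_fibre_Delta₁ (p : a.S) : (a.Delta₁ ⁻¹' {p}).Finite := by
  refine ((finite_fibre_p₁ p).image a.deltaEquiv).subset ?_
  intro d hd
  obtain ⟨y, rfl⟩ := a.deltaEquiv.surjective d
  exact ⟨y, hd, rfl⟩

-- The fibre of `q` through `y` is the set `{y, τ y}`; at a fixed point of τ it has one element and
-- contributes a single term.
open Classical in
theorem corr_apply (hS : a.IsSmooth) (hR : a.HasGenericRamification) (D : a.S →₀ ℤ) (y : a.SS0) :
    a.corr D (a.q.toFun y) = ∑ y' ∈ {y, a.τ y}, (ramIdx a.p₁ y' : ℤ) * D (a.p₁ y') := by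
  change normDiv a.Delta₂ (pullDiv a.Delta₁ D) _ = _
  rw [normDiv_apply a.Delta₂ _ (Finset.map a.deltaEquiv.toEmbedding {y, a.τ y})]
  · rw [Finset.sum_map]
    refine Finset.sum_congr rfl fun y' _ => ?_
    rw [pullDiv_apply _ finite_fibre_Delta₁]
    change (ramIdx a.Delta₁ (a.deltaEquiv y') : ℤ) * _ = _
    rw [ramIdx_Delta₁ hS hR]
    rfl
  · intro d
    obtain ⟨y', rfl⟩ := a.deltaEquiv.surjective d
    rw [Delta₂_deltaEquiv, q_eq_iff, Finset.mem_map_equiv, Equiv.symm_apply_apply]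
    simp

theorem corr_apply_of_ne (hS : a.IsSmooth) (hR : a.HasGenericRamification) (D : a.S →₀ ℤ)
    {y : a.SS0} (hy : y ≠ a.τ y) : a.corr D (a.q.toFun y) =
      ramIdx a.p₁ y * D (a.p₁ y) + ramIdx a.p₁ (a.τ y) * D (a.p₂ y) := by
  classical
  rw [corr_apply hS hR, Finset.sum_pair hy]
  rfl

theorem eq_τ_iff {y : a.SS0} : y = a.τ y ↔ y.1.2.1 = y.1.2.2 := by
  constructor
  · intro h
    have h1 : y.1.2 = (y.1.2.2, y.1.2.1) :=
      eq_of_heq (TotalSpace.mk.inj (congrArg Subtype.val h)).2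
    exact congrArg Prod.fst h1
  · intro h
    apply Subtype.ext
    obtain ⟨⟨x, t₁, t₂⟩, hy⟩ := y
    obtain rfl : t₁ = t₂ := h
    rfl

theorem ramIdx_p₁ (hS : a.IsSmooth) (hR : a.HasGenericRamification) (y : a.SS0) {t₃ t₄ : K y.1.1}
    [Decidable (y.1.2.2 = t₃ ∨ y.1.2.2 = t₄)]
    (h : a.Fib y.1.1 y.1.2.1 y.1.2.2 t₃ t₄) :
    ramIdx a.p₁ y = if y.1.2.2 = t₃ ∨ y.1.2.2 = t₄ then 2 else 1 := by
  rw [(hasRamification hS hR y h).1.ramIdx_eq (isCurve_SS0 hS hR) (isCurve_S hS hR)]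
  congr

theorem ramIdx_p₁_of_eq (hS : a.IsSmooth) (hR : a.HasGenericRamification) {y : a.SS0}
    (hy : y = a.τ y) : ramIdx a.p₁ y = 1 := by
  classical
  rw [eq_τ_iff] at hy
  obtain ⟨t₃, t₄, h⟩ := exists_fib y
  obtain ⟨h1, h2, -⟩ := h.of_eq hR hy
  rw [hy] at h1 h2
  rw [ramIdx_p₁ hS hR y h, if_neg (by tauto)]

theorem corr_apply_of_eq (hS : a.IsSmooth) (hR : a.HasGenericRamification) (D : a.S →₀ ℤ)
    {y : a.SS0} (hy : y = a.τ y) : a.corr D (a.q.toFun y) = D (a.p₁ y) := by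
  classical
  rw [corr_apply hS hR, ← hy]
  simp [ramIdx_p₁_of_eq hS hR hy]

open Classical in
theorem hasRamification_q (hS : a.IsSmooth) (hR : a.HasGenericRamification) (y : a.SS0) :
    HasRamification a.q.toFun y (if y = a.τ y then 2 else 1) := by
  obtain ⟨t₃, t₄, h⟩ := exists_fib y
  have := (hasRamification hS hR y h).2.1
  simp only [eq_τ_iff]
  exact this

/-- The pullback of `corr D` to `(S ×_X S)₀` is `p₁^* D + p₂^* D`. -/
theorem exists_hasRamification_q (hS : a.IsSmooth) (hR : a.HasGenericRamification) (D : a.S →₀ ℤ)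
    (y : a.SS0) : ∃ e : ℕ, HasRamification a.q.toFun y e ∧ e * a.corr D (a.q.toFun y) =
      ramIdx a.p₁ y * D (a.p₁ y) + ramIdx a.p₁ (a.τ y) * D (a.p₂ y) := by
  classical
  refine ⟨_, hasRamification_q hS hR y, ?_⟩
  -- At a fixed point of τ the map `q` has index two, while `p₁` and `p₂` agree and are unramified;
  -- both sides are twice `D (p₁ y)`.
  by_cases hy : y = a.τ y
  · rw [if_pos hy, corr_apply_of_eq hS hR D hy]
    have e : a.p₂ y = a.p₁ y := congrArg a.p₁ hy.symm
    rw [← hy, ramIdx_p₁_of_eq hS hR hy, e]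
    push_cast
    ring
  · rw [if_neg hy, corr_apply_of_ne hS hR D hy]
    push_cast
    ring

/-- The norm of a function along the correspondence. -/
def corrFun (f : a.S → ℂ) (z : a.S6) : ℂ :=
  f (a.p₁ (Function.surjInv q_surjective z)) * f (a.p₂ (Function.surjInv q_surjective z))

theorem corrFun_q (f : a.S → ℂ) (y : a.SS0) :
    corrFun f (a.q.toFun y) = f (a.p₁ y) * f (a.p₂ y) := by
  have h := Function.surjInv_eq (q_surjective (a := a)) (a.q.toFun y)
  unfold corrFun
  rcases q_eq_iff.1 h with h | h
  · rw [h]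
  · rw [h, mul_comm]
    rfl

/-- The function `corrFun f` pulls back under `q` to the product of the two pullbacks of `f`, whose
order is that of `q^*(corr D)`; orders descend along `q`. -/
theorem corr_principal (hS : a.IsSmooth) (hR : a.HasGenericRamification) {D : a.S →₀ ℤ}
    (hD : D ∈ principalDiv a.S) : a.corr D ∈ principalDiv a.S6 := by
  have : principalDiv a.S ≤ (principalDiv a.S6).comap a.corr := by
    refine (AddSubgroup.closure_le _).2 ?_
    rintro D ⟨f, hf⟩
    refine AddSubgroup.subset_closure ⟨corrFun f, fun z => ?_⟩
    obtain ⟨y, rfl⟩ := q_surjective z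
    obtain ⟨e, he, hD⟩ := exists_hasRamification_q hS hR D y
    refine he.hasOrder_of_comp (isCurve_SS0 hS hR) (isCurve_S6 hS hR) ?_
    rw [hD]
    simp only [corrFun_q]
    exact ((hasRamification_p₁ hS hR y).hasOrder_comp (hf _)).mul (isCurve_SS0 hS hR)
      ((hasRamification_p₂ hS hR y).hasOrder_comp (hf _))
  exact this hD

/-- A root has three partners. When two partners coincide, the single point they give is counted
twice, which is its ramification index for `p₁`. -/
theorem corr_single (hS : a.IsSmooth) (hR : a.HasGenericRamification) {x : X} {t₁ t₂ t₃ t₄ : K x}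
    (h : a.Fib x t₁ t₂ t₃ t₄) (hp : (⟨x, t₁⟩ : TotK X) ∈ a.S) :
    a.corr (Finsupp.single ⟨_, hp⟩ 1) = Finsupp.single (a.q.toFun (h.pt hS hR)) 1 +
      Finsupp.single (a.q.toFun (h.swap₂₃.pt hS hR)) 1 +
      Finsupp.single (a.q.toFun (h.swap₃₄.swap₂₃.pt hS hR)) 1 := by
  classical
  have hpull : pullDiv a.Delta₁ (Finsupp.single (⟨⟨x, t₁⟩, hp⟩ : a.S) 1) =
      Finsupp.single (a.deltaEquiv (h.pt hS hR)) 1 +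
      Finsupp.single (a.deltaEquiv (h.swap₂₃.pt hS hR)) 1 +
      Finsupp.single (a.deltaEquiv (h.swap₃₄.swap₂₃.pt hS hR)) 1 := by
    ext d
    obtain ⟨y, rfl⟩ := a.deltaEquiv.surjective d
    rw [pullDiv_apply _ finite_fibre_Delta₁, ramIdx_Delta₁ hS hR, Delta₁_deltaEquiv]
    simp only [Finsupp.add_apply, Finsupp.single_apply, EmbeddingLike.apply_eq_iff_eq]
    by_cases hy : (⟨⟨x, t₁⟩, hp⟩ : a.S) = a.p₁ y
    · obtain ⟨⟨x', s₁, s₂⟩, hy'⟩ := y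
      have h0 : (⟨x, t₁⟩ : TotK X) = ⟨x', s₁⟩ := congrArg Subtype.val hy
      obtain ⟨rfl, h1⟩ := TotalSpace.mk.inj h0
      obtain rfl := eq_of_heq h1
      have e : ∀ {s s' s'' : K x} (h' : a.Fib x t₁ s s' s''),
          (h'.pt hS hR = (⟨⟨x, (t₁, s₂)⟩, hy'⟩ : a.SS0)) ↔ s = s₂ := by
        intro s s' s'' h'
        constructor
        · intro h
          exact congrArg Prod.snd (eq_of_heq (TotalSpace.mk.inj (congrArg Subtype.val h)).2)
        · rintro rfl
          rfl
      simp only [e]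
      -- With `s₂` the partner `u`, the index is one plus the number of further partners equal to
      -- it; two further ones are impossible by generic ramification.
      have key : ∀ {u v w : K x} (h' : a.Fib x t₁ u v w), s₂ = u →
          (((ramIdx a.p₁ (⟨⟨x, (t₁, s₂)⟩, hy'⟩ : a.SS0) : ℕ) : ℤ) = 1 + (if v = s₂ then 1 else 0) +
            (if w = s₂ then 1 else 0)) := by
        rintro u v w h' rfl
        rw [ramIdx_p₁ hS hR ⟨⟨x, (t₁, s₂)⟩, hy'⟩ h']
        by_cases hv : s₂ = v
        · have := (h'.swap₁₂.swap₂₃.of_eq hR hv).2.1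
          rw [if_pos (Or.inl hv), if_pos hv.symm, if_neg (Ne.symm this)]
          norm_num
        · rw [if_neg (Ne.symm hv)]
          by_cases hw : s₂ = w
          · rw [if_pos (Or.inr hw), if_pos hw.symm]
            norm_num
          · rw [if_neg (by tauto), if_neg (Ne.symm hw)]
            norm_num
      rw [if_pos hy, mul_one]
      obtain ⟨u, v, hf⟩ := exists_fib ⟨⟨x, (t₁, s₂)⟩, hy'⟩
      rcases h.mem_of_fib hf with rfl | rfl | rfl
      · rw [key h rfl, if_pos rfl]
      · rw [key h.swap₂₃ rfl, if_pos rfl]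
        ring
      · rw [key h.swap₃₄.swap₂₃ rfl, if_pos rfl]
        ring
    · rw [if_neg hy, mul_zero]
      have e : ∀ {s s' s'' : K x} (h' : a.Fib x t₁ s s' s''), h'.pt hS hR ≠ y := by
        rintro s s' s'' h' rfl
        exact hy rfl
      rw [if_neg (e _), if_neg (e _), if_neg (e _)]
      rfl
  change normDiv a.Delta₂ (pullDiv a.Delta₁ _) = _
  rw [hpull, map_add, map_add]
  simp only [normDiv, Finsupp.mapDomain.addMonoidHom_apply, Finsupp.mapDomain_single]
  rfl

/-- It suffices to check one point, which goes to a sum of three. -/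
theorem degDiv_corr (hS : a.IsSmooth) (hR : a.HasGenericRamification) (D : a.S →₀ ℤ) :
    degDiv a.S6 (a.corr D) = 3 * degDiv a.S D := by
  have : (degDiv a.S6).comp a.corr = (3 : ℤ) • degDiv a.S := by
    refine Finsupp.addHom_ext' fun p => AddMonoidHom.ext_int ?_
    obtain ⟨⟨x, t₁⟩, hp⟩ := p
    obtain ⟨t₂, t₃, t₄, h⟩ := exists_fib_of_isRoot hp
    change degDiv a.S6 (a.corr (Finsupp.single _ 1)) = (3 : ℤ) • degDiv a.S (Finsupp.single _ 1)
    rw [corr_single hS hR h hp, map_add, map_add]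
    simp [degDiv]
  exact DFunLike.congr_fun this D

/-- The action of the correspondence on divisor classes. -/
def corrClass (hS : a.IsSmooth) (hR : a.HasGenericRamification) : Pic a.S →+ Pic a.S6 :=
  QuotientAddGroup.map _ _ a.corr fun _ hD => corr_principal hS hR hD

theorem corrClass_divClass (hS : a.IsSmooth) (hR : a.HasGenericRamification) (D : a.S →₀ ℤ) :
    corrClass hS hR (divClass D) = divClass (a.corr D) := rfl

theorem corrClass_mem_Jac (hS : a.IsSmooth) (hR : a.HasGenericRamification) {c : Pic a.S}
    (hc : c ∈ Jac a.S) : corrClass hS hR c ∈ Jac a.S6 := by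
  obtain ⟨D, hD, rfl⟩ := hc
  refine ⟨a.corr D, ?_, rfl⟩
  have hD' : degDiv a.S D = 0 := hD
  change degDiv a.S6 _ = 0
  rw [degDiv_corr hS hR, hD', mul_zero]

/-- The homomorphism of Jacobians induced by the correspondence. -/
def corrJac (hS : a.IsSmooth) (hR : a.HasGenericRamification) : Jac a.S →+ Jac a.S6 :=
  ((corrClass hS hR).comp (Jac a.S).subtype).codRestrict _ fun c => corrClass_mem_Jac hS hR c.2

end HitchinBase

end Curves

section Curves

variable {X : Type u} [TopologicalSpace X] [ChartedSpace ℂ X] [IsManifold 𝓘(ℂ, ℂ) ω X]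

namespace HitchinBase

variable {a : HitchinBase X}

/-! #### The involution `σ` and its quotient -/

theorem sigmaRel_iff {z z' : a.S6} : a.sigmaRel z z' ↔ ∃ (x : X) (t₁ t₂ t₃ t₄ : K x),
    a.Fib x t₁ t₂ t₃ t₄ ∧ z.1 = sym ⟨x, (t₁, t₂)⟩ ∧ z'.1 = sym ⟨x, (t₃, t₄)⟩ := by
  simp only [fib_iff_poly]
  rfl

theorem sigmaRel.symm {z z' : a.S6} (h : a.sigmaRel z z') : a.sigmaRel z' z := by
  rw [sigmaRel_iff] at *
  obtain ⟨x, t₁, t₂, t₃, t₄, h, h1, h2⟩ := h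
  exact ⟨x, t₃, t₄, t₁, t₂, h.swapPairs, h2, h1⟩

theorem Fib.sigmaRel (hS : a.IsSmooth) (hR : a.HasGenericRamification) {x : X}
    {t₁ t₂ t₃ t₄ : K x} (h : a.Fib x t₁ t₂ t₃ t₄) :
    a.sigmaRel (a.q.toFun (h.pt hS hR)) (a.q.toFun (h.swapPairs.pt hS hR)) :=
  sigmaRel_iff.2 ⟨x, t₁, t₂, t₃, t₄, h, rfl, rfl⟩

variable (a) in
/-- The involution `σ` in local coordinates. -/
def sigmaCoord (x₀ : X) (w : ℂ × ℂ × ℂ) : ℂ × ℂ × ℂ :=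
  (w.1, -w.2.1, (a.coef x₀ w.1).1 - w.2.2 + 4 * w.2.1 ^ 2)

theorem sigmaRel.proj_eq {z z' : a.S6} (h : a.sigmaRel z z') : z'.1.1 = z.1.1 := by
  obtain ⟨x, t₁, t₂, t₃, t₄, -, h1, h2⟩ := h
  rw [h1, h2]
  rfl

/-- The coefficients of the complementary factor are polynomial in those of the given one and in
`a₂`. Uniqueness of σ and its holomorphy both come from this formula. -/
theorem sigmaRel.coord {z z' : a.S6} (h : a.sigmaRel z z') {x₀ : X}
    (hx : z.1.1 ∈ (chartAt ℂ x₀).source) :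
    coordKK2 x₀ z'.1 = a.sigmaCoord x₀ (coordKK2 x₀ z.1) := by
  rw [sigmaRel_iff] at h
  obtain ⟨x, t₁, t₂, t₃, t₄, h, h1, h2⟩ := h
  rw [h1] at hx
  have f := h x₀ hx
  rw [h1, h2, coordKK2_sym, coordKK2_sym]
  refine Prod.ext rfl (Prod.ext ?_ ?_)
  · change (Kcoord x₀ t₃ + Kcoord x₀ t₄) / 2 = -((Kcoord x₀ t₁ + Kcoord x₀ t₂) / 2)
    linear_combination (1 / 2) * f.s₁
  · change Kcoord x₀ t₃ * Kcoord x₀ t₄ = (a.coef x₀ (zc x₀ x)).1 - Kcoord x₀ t₁ * Kcoord x₀ t₂ +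
      4 * ((Kcoord x₀ t₁ + Kcoord x₀ t₂) / 2) ^ 2
    rw [f.s₂]
    linear_combination (-Kcoord x₀ t₁ - Kcoord x₀ t₂) * f.s₁

theorem sigmaRel.unique {z z' z'' : a.S6} (h : a.sigmaRel z z') (h' : a.sigmaRel z z'') :
    z' = z'' := by
  have hx := mem_chart_source ℂ z.1.1
  apply Subtype.ext
  rw [← embKK2_coordKK2 (x₀ := z.1.1) (p := z'.1) (by rw [h.proj_eq]; exact hx),
    ← embKK2_coordKK2 (x₀ := z.1.1) (p := z''.1) (by rw [h'.proj_eq]; exact hx), h.coord hx,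
    h'.coord hx]

theorem exists_sigmaRel (hS : a.IsSmooth) (hR : a.HasGenericRamification) (z : a.S6) :
    ∃ z', a.sigmaRel z z' := by
  obtain ⟨y, rfl⟩ := q_surjective z
  obtain ⟨t₃, t₄, h⟩ := exists_fib y
  exact ⟨_, h.sigmaRel hS hR⟩

/-- At a fixed point the pairs `{t₁, t₂}` and `{t₃, t₄}` would agree, which is two coincidences in
one fibre. -/
theorem sigmaRel.ne (hR : a.HasGenericRamification) {z z' : a.S6} (h : a.sigmaRel z z') :
    z ≠ z' := by
  rintro rfl
  rw [sigmaRel_iff] at h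
  obtain ⟨x, t₁, t₂, t₃, t₄, h, h1, h2⟩ := h
  have hx := mem_chart_source ℂ x
  have f := h.isFib
  have hc := coordKK2_sym x ⟨x, (t₁, t₂)⟩
  rw [← h1, h2, coordKK2_sym] at hc
  have hs : (Kcoord x t₃ + Kcoord x t₄) / 2 = (Kcoord x t₁ + Kcoord x t₂) / 2 :=
    congrArg (fun w => w.2.1) hc
  have hp : Kcoord x t₃ * Kcoord x t₄ = Kcoord x t₁ * Kcoord x t₂ := congrArg (fun w => w.2.2) hc
  have h0 : (Kcoord x t₁ - Kcoord x t₃) * (Kcoord x t₁ - Kcoord x t₄) = 0 := by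
    linear_combination hp - 2 * Kcoord x t₁ * hs
  rcases mul_eq_zero.1 h0 with h0 | h0
  · refine (h.swap₂₃.of_eq hR (K_ext hx (sub_eq_zero.1 h0))).2.2 (K_ext hx ?_)
    change Kcoord x t₂ = Kcoord x t₄
    linear_combination -2 * hs - h0
  · refine (h.swap₃₄.swap₂₃.of_eq hR (K_ext hx (sub_eq_zero.1 h0))).2.2 (K_ext hx ?_)
    change Kcoord x t₂ = Kcoord x t₃
    linear_combination -2 * hs - h0

/-- The relation is symmetric and single-valued, so the equivalence it generates adds only the
diagonal. -/
theorem quotσ_eq_iff {z z' : a.S6} : a.quotσ z = a.quotσ z' ↔ z = z' ∨ a.sigmaRel z z' := by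
  constructor
  · intro h
    have h' := Quot.eqvGen_exact h
    clear h
    induction h' with
    | rel x y h => exact Or.inr h
    | refl x => exact Or.inl rfl
    | symm x y _ ih =>
      rcases ih with rfl | h
      · exact Or.inl rfl
      · exact Or.inr h.symm
    | trans x y z _ _ ih1 ih2 =>
      rcases ih1 with rfl | h1
      · exact ih2
      · rcases ih2 with rfl | h2
        · exact Or.inr h1
        · exact Or.inl (h1.symm.unique h2)
  · rintro (rfl | h)
    · rfl
    · exact Quot.sound h

/-- The involution `σ`. -/
def σEquiv (hS : a.IsSmooth) (hR : a.HasGenericRamification) : a.S6 ≃ a.S6 where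
  toFun z := (exists_sigmaRel hS hR z).choose
  invFun z := (exists_sigmaRel hS hR z).choose
  left_inv z := (exists_sigmaRel hS hR _).choose_spec.unique
    (exists_sigmaRel hS hR z).choose_spec.symm
  right_inv z := (exists_sigmaRel hS hR _).choose_spec.unique
    (exists_sigmaRel hS hR z).choose_spec.symm

theorem sigmaRel_σEquiv (hS : a.IsSmooth) (hR : a.HasGenericRamification) (z : a.S6) :
    a.sigmaRel z (σEquiv hS hR z) := (exists_sigmaRel hS hR z).choose_spec

theorem sigmaRel_iff_eq (hS : a.IsSmooth) (hR : a.HasGenericRamification) {z z' : a.S6} :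
    a.sigmaRel z z' ↔ z' = σEquiv hS hR z := by
  constructor
  · intro h
    exact h.unique (sigmaRel_σEquiv hS hR z)
  · rintro rfl
    exact sigmaRel_σEquiv hS hR z

theorem isBihol_σ (hS : a.IsSmooth) (hR : a.HasGenericRamification) : IsBihol (σEquiv hS hR) := by
  have hA : ∀ p : TotKK2 X, ContMDiffAt IKK2 IKK2 ω
      (fun m => embKK2 p.1 (a.sigmaCoord p.1 (coordKK2 p.1 m))) p := by
    intro p
    have hp := mem_chart_source ℂ p.1
    refine ContMDiffAt.comp (g := embKK2 p.1) p (contMDiffAt_embKK2 (zc_mem hp)) ?_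
    refine ContMDiffAt.comp (g := a.sigmaCoord p.1) p ?_ (contMDiffAt_coordKK2 hp)
    refine contMDiffAt_iff_contDiffAt.2 (AnalyticAt.contDiffAt ?_)
    have h1 : AnalyticAt ℂ (fun z => (a.coef p.1 z).1) (zc p.1 p.1) :=
      AnalyticAt.fun_comp (g := Prod.fst) analyticAt_fst (a.analyticAt_coef (zc_mem hp))
    have h2 : AnalyticAt ℂ (fun w : ℂ × ℂ × ℂ => (a.coef p.1 w.1).1) (coordKK2 p.1 p) :=
      AnalyticAt.fun_comp (g := fun z => (a.coef p.1 z).1) (f := fun w : ℂ × ℂ × ℂ => w.1) h1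
        analyticAt_fst
    exact analyticAt_fst.prod ((analyticAt_snd_fst _).neg.prod
      ((h2.sub (analyticAt_snd_snd _)).add (analyticAt_const.mul ((analyticAt_snd_fst _).pow 2))))
  have hE : ∀ z : a.S6, ∀ᶠ z' : a.S6 in 𝓝 z, (σEquiv hS hR z').1 =
      embKK2 z.1.1 (a.sigmaCoord z.1.1 (coordKK2 z.1.1 z'.1)) := by
    intro z
    filter_upwards [continuous_subtype_val.continuousAt.eventually
      (eventually_mem_source (E := (K : X → Type) ×ᵇ (K2 : X → Type))
        (mem_chart_source ℂ z.1.1))] with z' hz'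
    have h := sigmaRel_σEquiv hS hR z'
    rw [← h.coord hz', embKK2_coordKK2]
    rw [h.proj_eq]
    exact hz'
  have hc : Continuous (σEquiv hS hR) := continuous_iff_continuousAt.2 fun y =>
    continuousAt_induced (I₁ := IKK2) (I₂ := IKK2) (j₁ := Subtype.val) (j₂ := Subtype.val)
      continuous_subtype_val .subtypeVal (hA y.1) (hE y)
  have hh : ∀ (y : a.S6) (f : a.S6 → ℂ), IsHolAt f (σEquiv hS hR y) →
      IsHolAt (fun y => f (σEquiv hS hR y)) y :=
    fun y f hf => isHolAt_comp_induced (I₁ := IKK2) (I₂ := IKK2) (j₁ := Subtype.val)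
      (j₂ := Subtype.val) continuous_subtype_val .subtypeVal (hA y.1) (hE y) hf
  exact ⟨hc, hc, hh, hh⟩

theorem quotσ_σEquiv (hS : a.IsSmooth) (hR : a.HasGenericRamification) (z : a.S6) :
    a.quotσ (σEquiv hS hR z) = a.quotσ z := (Quot.sound (sigmaRel_σEquiv hS hR z)).symm

theorem isOpenMap_quotσ (hS : a.IsSmooth) (hR : a.HasGenericRamification) :
    IsOpenMap a.quotσ := by
  intro U hU
  change IsOpen (a.quotσ ⁻¹' (a.quotσ '' U))
  have : a.quotσ ⁻¹' (a.quotσ '' U) = U ∪ σEquiv hS hR ⁻¹' U := by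
    ext z
    constructor
    · rintro ⟨z', hz', h⟩
      rcases quotσ_eq_iff.1 h with rfl | h
      · exact Or.inl hz'
      · right
        rw [mem_preimage, ← (sigmaRel_iff_eq hS hR).1 h.symm]
        exact hz'
    · rintro (h | h)
      · exact ⟨z, h, rfl⟩
      · exact ⟨_, h, quotσ_σEquiv hS hR z⟩
  rw [this]
  exact hU.union (hU.preimage (isBihol_σ hS hR).cont)

/-- A pullback from the quotient is σ-invariant, so if it is holomorphic on `U` it is so on the
whole preimage of the open set `quotσ '' U`. -/
theorem isHolAt_quotσ_iff (hS : a.IsSmooth) (hR : a.HasGenericRamification) {f : a.S6modσ → ℂ}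
    {z : a.S6} : IsHolAt f (a.quotσ z) ↔ IsHolAt (fun z => f (a.quotσ z)) z := by
  constructor
  · rintro ⟨V, hz, hV⟩
    exact ⟨Opens.comap ⟨a.quotσ, continuous_quot_mk⟩ V, hz, hV⟩
  · intro h
    obtain ⟨U, hU, hzU⟩ : ∃ U : Opens a.S6, z ∈ U ∧ ∀ z' ∈ U, IsHolAt (fun z => f (a.quotσ z)) z' := by
      obtain ⟨U, hU, hUo, hz⟩ := eventually_nhds_iff.1 h.eventually
      exact ⟨⟨U, hUo⟩, hz, hU⟩
    refine ⟨⟨_, isOpenMap_quotσ hS hR _ U.2⟩, ⟨z, hU, rfl⟩, ?_⟩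
    refine (restrict_mem_O_iff (f := fun z => f (a.quotσ z))
      (U := Opens.comap ⟨a.quotσ, continuous_quot_mk⟩ ⟨_, isOpenMap_quotσ hS hR _ U.2⟩)).2 ?_
    rintro z' ⟨z'', hz'', h⟩
    rcases quotσ_eq_iff.1 h with rfl | h
    · exact hzU _ hz''
    · rw [sigmaRel_iff_eq hS hR] at h
      have h1 := (isBihol_σ hS hR).hol z' (fun z => f (a.quotσ z))
        (by rw [← (sigmaRel_iff_eq hS hR).1 ((sigmaRel_iff_eq hS hR).2 h).symm]; exact hzU _ hz'')
      simpa only [quotσ_σEquiv] using h1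

/-- As `z` is not fixed, the coordinates of `z` and `σ z` in the same chart have disjoint
neighbourhoods. -/
theorem eventually_not_sigmaRel (hS : a.IsSmooth) (hR : a.HasGenericRamification) (z : a.S6) :
    ∃ U ∈ 𝓝 z, ∀ z' ∈ U, ∀ z'' ∈ U, ¬a.sigmaRel z' z'' := by
  have hx := mem_chart_source ℂ z.1.1
  have hσ := sigmaRel_σEquiv hS hR z
  have hx' : (σEquiv hS hR z).1.1 ∈ (chartAt ℂ z.1.1).source := by rw [hσ.proj_eq]; exact hx
  have hne : coordKK2 z.1.1 z.1 ≠ coordKK2 z.1.1 (σEquiv hS hR z).1 := by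
    intro h
    refine hσ.ne hR (Subtype.ext ?_)
    rw [← embKK2_coordKK2 hx, h, embKK2_coordKK2 hx']
  obtain ⟨V, V', hV, hV', hz, hz', hd⟩ := t2_separation hne
  have c1 : ContinuousAt (fun z' : a.S6 => coordKK2 z.1.1 z'.1) z :=
    (contMDiffAt_coordKK2 hx).continuousAt.comp continuous_subtype_val.continuousAt
  have c2 : ContinuousAt (fun z' : a.S6 => coordKK2 z.1.1 (σEquiv hS hR z').1) z :=
    ContinuousAt.comp (g := fun z' : a.S6 => coordKK2 z.1.1 z'.1)
      ((contMDiffAt_coordKK2 hx').continuousAt.comp continuous_subtype_val.continuousAt)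
      (isBihol_σ hS hR).cont.continuousAt
  refine ⟨_, (c1.eventually (hV.mem_nhds hz)).and (c2.eventually (hV'.mem_nhds hz')), ?_⟩
  rintro z' ⟨-, h1⟩ z'' ⟨h2, -⟩ h
  rw [sigmaRel_iff_eq hS hR] at h
  subst h
  exact disjoint_left.1 hd h2 h1

/-- The quotient map is open and, σ being free, locally injective; parameters upstairs are therefore
parameters downstairs. -/
theorem isParam_quotσ (hS : a.IsSmooth) (hR : a.HasGenericRamification) {γ : ℂ → a.S6} {s₀ : ℂ}
    (h : IsParam γ s₀) : IsParam (fun s => a.quotσ (γ s)) s₀ := by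
  have hmap : map a.quotσ (𝓝 (γ s₀)) = 𝓝 (a.quotσ (γ s₀)) :=
    (isOpenMap_quotσ hS hR).map_nhds_eq (continuous_quot_mk.continuousAt)
  obtain ⟨U, hU, hUσ⟩ := eventually_not_sigmaRel hS hR (γ s₀)
  have hinj : InjOn a.quotσ U := by
    intro z hz z' hz' h
    rcases quotσ_eq_iff.1 h with h | h
    · exact h
    · exact absurd h (hUσ z hz z' hz')
  have : Nonempty a.S6 := ⟨γ s₀⟩
  refine h.transport a.quotσ (Function.invFunOn a.quotσ U) hmap ?_ fun f =>
    isHolAt_quotσ_iff hS hR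
  filter_upwards [hU] with z hz
  exact hinj.leftInvOn_invFunOn hz

theorem quotσ_surjective (w : a.S6modσ) : ∃ z, a.quotσ z = w := Quot.exists_rep w

/-- The projection of `Ŝ₆ / σ` to the base curve. -/
def baseσ : a.S6modσ → X := Quot.lift base₆ fun _ _ h => (sigmaRel.proj_eq h).symm

theorem hasRamification_baseσ (hS : a.IsSmooth) (hR : a.HasGenericRamification) {z : a.S6} {e : ℕ}
    (h : HasRamification base₆ z e) : HasRamification baseσ (a.quotσ z) e := by
  obtain ⟨γ, γ', k, s₀, rfl, hγ, hγ', hk, ha, he⟩ := h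
  exact ⟨_, γ', k, s₀, rfl, isParam_quotσ hS hR hγ, hγ', hk, ha, he⟩

/-! #### Partitions of the fibres into pairs -/

/-- The partition `{t₁, t₂}, {t₃, t₄}` of a fibre. -/
def Fib.part (hS : a.IsSmooth) (hR : a.HasGenericRamification) {x : X}
    {t₁ t₂ t₃ t₄ : K x} (h : a.Fib x t₁ t₂ t₃ t₄) : a.S6modσ := a.quotσ (a.q.toFun (h.pt hS hR))

variable {x : X} {t₁ t₂ t₃ t₄ : K x}

theorem Fib.part_swap₁₂ (hS : a.IsSmooth) (hR : a.HasGenericRamification)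
    (h : a.Fib x t₁ t₂ t₃ t₄) : h.swap₁₂.part hS hR = h.part hS hR :=
  congrArg a.quotσ (a.q_τ (h.pt hS hR))

theorem Fib.part_swapPairs (hS : a.IsSmooth) (hR : a.HasGenericRamification)
    (h : a.Fib x t₁ t₂ t₃ t₄) : h.swapPairs.part hS hR = h.part hS hR :=
  (Quot.sound (h.sigmaRel hS hR)).symm

/-- The point `pt` depends only on the first two roots; the others enter only through a proof. -/
theorem Fib.part_congr (hS : a.IsSmooth) (hR : a.HasGenericRamification) {t₃' t₄' : K x}
    (h : a.Fib x t₁ t₂ t₃ t₄) (h' : a.Fib x t₁ t₂ t₃' t₄') : h.part hS hR = h'.part hS hR := rfl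

/-- The sum of the three partitions of a fibre. -/
def Fib.parts (hS : a.IsSmooth) (hR : a.HasGenericRamification)
    (h : a.Fib x t₁ t₂ t₃ t₄) : a.S6modσ →₀ ℤ :=
  Finsupp.single (h.part hS hR) 1 + Finsupp.single (h.swap₂₃.part hS hR) 1 +
    Finsupp.single (h.swap₃₄.swap₂₃.part hS hR) 1

theorem Fib.parts_swap₁₂ (hS : a.IsSmooth) (hR : a.HasGenericRamification)
    (h : a.Fib x t₁ t₂ t₃ t₄) : h.swap₁₂.parts hS hR = h.parts hS hR := by
  unfold Fib.parts
  have e1 : h.swap₁₂.swap₂₃.part hS hR = h.swap₃₄.swap₂₃.part hS hR :=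
    (Fib.part_swapPairs hS hR h.swap₁₂.swap₂₃).symm
  have e2 : h.swap₁₂.swap₃₄.swap₂₃.part hS hR = h.swap₂₃.part hS hR :=
    (Fib.part_swapPairs hS hR h.swap₁₂.swap₃₄.swap₂₃).symm
  rw [e1, e2, Fib.part_swap₁₂ hS hR h]
  abel

theorem Fib.parts_swap₂₃ (hS : a.IsSmooth) (hR : a.HasGenericRamification)
    (h : a.Fib x t₁ t₂ t₃ t₄) : h.swap₂₃.parts hS hR = h.parts hS hR := by
  unfold Fib.parts
  rw [Fib.part_congr hS hR h.swap₂₃.swap₂₃ h,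
    Fib.part_congr hS hR h.swap₂₃.swap₃₄.swap₂₃ h.swap₃₄.swap₂₃]
  abel

theorem Fib.parts_swap₃₄ (hS : a.IsSmooth) (hR : a.HasGenericRamification)
    (h : a.Fib x t₁ t₂ t₃ t₄) : h.swap₃₄.parts hS hR = h.parts hS hR := by
  unfold Fib.parts
  rw [Fib.part_congr hS hR h.swap₃₄ h,
    Fib.part_congr hS hR h.swap₃₄.swap₃₄.swap₂₃ h.swap₂₃]
  abel

theorem Fib.parts_eq_of_left (hS : a.IsSmooth) (hR : a.HasGenericRamification) {s₂ s₃ s₄ : K x}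
    (h : a.Fib x t₁ t₂ t₃ t₄) (h' : a.Fib x t₁ s₂ s₃ s₄) : h'.parts hS hR = h.parts hS hR := by
  have key : ∀ {u v w : K x} (k : a.Fib x t₁ u v w), s₂ = u → h'.parts hS hR = k.parts hS hR := by
    rintro u v w k rfl
    rcases k.det h' with ⟨rfl, rfl⟩ | ⟨rfl, rfl⟩
    · rfl
    · exact (Fib.parts_swap₃₄ hS hR _).symm
  rcases h.mem_of_fib h' with e | e | e
  · exact key h e
  · exact (key h.swap₂₃ e).trans (Fib.parts_swap₂₃ hS hR _)
  · exact (key h.swap₃₄.swap₂₃ e).trans ((Fib.parts_swap₂₃ hS hR _).trans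
      (Fib.parts_swap₃₄ hS hR _))

/-- The sum of the partitions does not depend on the order of the fibre. -/
theorem Fib.parts_eq (hS : a.IsSmooth) (hR : a.HasGenericRamification) {s₁ s₂ s₃ s₄ : K x}
    (h : a.Fib x t₁ t₂ t₃ t₄) (h' : a.Fib x s₁ s₂ s₃ s₄) : h'.parts hS hR = h.parts hS hR := by
  have key : ∀ {t u v w : K x} (k : a.Fib x t u v w), s₁ = t → h'.parts hS hR = k.parts hS hR := by
    rintro t u v w k rfl
    exact k.parts_eq_of_left hS hR h'
  rcases (h.isRoot_iff s₁).1 ((h'.isRoot_iff s₁).2 (Or.inl rfl)) with e | e | e | e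
  · exact key h e
  · exact (key h.swap₁₂ e).trans (Fib.parts_swap₁₂ hS hR _)
  · exact (key h.swap₂₃.swap₁₂ e).trans ((Fib.parts_swap₁₂ hS hR _).trans
      (Fib.parts_swap₂₃ hS hR _))
  · exact (key h.swap₃₄.swap₂₃.swap₁₂ e).trans ((Fib.parts_swap₁₂ hS hR _).trans
      ((Fib.parts_swap₂₃ hS hR _).trans (Fib.parts_swap₃₄ hS hR _)))

/-- Exchanging `t₂` and `t₃` leaves the partition unchanged only if the exchanged roots, or
equivalently for partitions `t₁` and `t₄`, coincide. -/
theorem Fib.part_swap₂₃_eq_iff (hS : a.IsSmooth) (hR : a.HasGenericRamification)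
    (h : a.Fib x t₁ t₂ t₃ t₄) :
    h.swap₂₃.part hS hR = h.part hS hR ↔ t₂ = t₃ ∨ t₁ = t₄ := by
  have hpt : ∀ {t u v w t' u' v' w' : K x} (k : a.Fib x t u v w) (k' : a.Fib x t' u' v' w'),
      a.q.toFun (k.pt hS hR) = a.q.toFun (k'.pt hS hR) ↔ t = t' ∧ u = u' ∨ t = u' ∧ u = t' := by
    intro t u v w t' u' v' w' k k'
    have e : ∀ y y' : K x × K x, ((⟨x, y⟩ : TotKK X) = ⟨x, y'⟩) ↔ y = y' := fun y y' =>
      ⟨fun h => eq_of_heq (TotalSpace.mk.inj h).2, fun h => by rw [h]⟩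
    rw [q_eq_iff, Subtype.ext_iff, Subtype.ext_iff]
    change (⟨x, (t, u)⟩ : TotKK X) = ⟨x, (t', u')⟩ ∨ (⟨x, (t, u)⟩ : TotKK X) = ⟨x, (u', t')⟩ ↔ _
    rw [e, e, Prod.mk.injEq, Prod.mk.injEq]
  unfold Fib.part
  rw [quotσ_eq_iff, sigmaRel_iff_eq hS hR, ← (sigmaRel_iff_eq hS hR).1 (h.swap₂₃.sigmaRel hS hR),
    hpt, hpt]
  constructor
  · rintro ((⟨-, e⟩ | ⟨e, e'⟩) | (⟨e, e'⟩ | ⟨e, -⟩))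
    · exact Or.inl e.symm
    · exact Or.inl (e'.trans e).symm
    · exact Or.inr (e.trans e')
    · exact Or.inr e
  · rintro (rfl | rfl) <;> simp

variable (a) in
/-- The sum of the three partitions of the fibre over a point of the base. -/
def baseParts (hS : a.IsSmooth) (hR : a.HasGenericRamification) : (X →₀ ℤ) →+ (a.S6modσ →₀ ℤ) :=
  Finsupp.liftAddHom fun x => zmultiplesHom _
    ((a.exists_fib_of_base x).choose_spec.choose_spec.choose_spec.choose_spec.parts hS hR)

theorem baseParts_single (hS : a.IsSmooth) (hR : a.HasGenericRamification)
    (h : a.Fib x t₁ t₂ t₃ t₄) (n : ℤ) :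
    a.baseParts hS hR (Finsupp.single x n) = n • h.parts hS hR := by
  rw [baseParts, Finsupp.liftAddHom_apply_single, zmultiplesHom_apply, Fib.parts_eq hS hR h]

/-- The pairs containing `t₁` represent the three partitions of its fibre, and `Fib.parts_eq` makes
their sum independent of the chosen root. So only the image of `D` in the base matters. -/
theorem normDiv_corr (hS : a.IsSmooth) (hR : a.HasGenericRamification) (D : a.S →₀ ℤ) :
    normDiv a.quotσ (a.corr D) = a.baseParts hS hR (normDiv a.proj D) := by
  have : (normDiv a.quotσ).comp a.corr = (a.baseParts hS hR).comp (normDiv a.proj) := by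
    refine Finsupp.addHom_ext' fun p => AddMonoidHom.ext_int ?_
    obtain ⟨⟨x, t₁⟩, hp⟩ := p
    obtain ⟨t₂, t₃, t₄, h⟩ := exists_fib_of_isRoot hp
    change normDiv a.quotσ (a.corr (Finsupp.single _ 1)) =
      a.baseParts hS hR (Finsupp.mapDomain a.proj (Finsupp.single _ 1))
    rw [corr_single hS hR h hp, map_add, map_add, Finsupp.mapDomain_single]
    refine Eq.trans ?_ (baseParts_single hS hR h 1).symm
    simp only [normDiv, Finsupp.mapDomain.addMonoidHom_apply, Finsupp.mapDomain_single, one_smul]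
    rfl
  exact DFunLike.congr_fun this D

/-- This says that `baseParts` is the pullback along `baseσ`. A partition is repeated in `parts`
exactly when a root of one of its pairs equals a root of the other, which is also when `baseσ` has
index two. -/
theorem baseParts_apply (hS : a.IsSmooth) (hR : a.HasGenericRamification) (D : X →₀ ℤ)
    (w : a.S6modσ) : ∃ e : ℕ, HasRamification baseσ w e ∧
      a.baseParts hS hR D w = e * D (baseσ w) := by
  classical
  obtain ⟨z, rfl⟩ := quotσ_surjective w
  obtain ⟨y, rfl⟩ := q_surjective z
  obtain ⟨t₃, t₄, h⟩ := exists_fib y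
  refine ⟨_, hasRamification_baseσ hS hR (hasRamification hS hR y h).2.2, ?_⟩
  induction D using Finsupp.induction_linear with
  | zero => simp
  | add f g hf hg => rw [map_add, Finsupp.add_apply, hf, hg, Finsupp.add_apply, mul_add]
  | single x n =>
    obtain ⟨s₁, s₂, s₃, s₄, k⟩ := a.exists_fib_of_base x
    rw [baseParts_single hS hR k]
    by_cases hx : x = y.1.1
    · subst hx
      have e0 : (a.quotσ (a.q.toFun y)) = h.part hS hR := rfl
      have e1 : baseσ (h.part hS hR) = y.1.1 := rfl
      have h3 := h.swap₃₄.part_swap₂₃_eq_iff hS hR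
      rw [Fib.part_congr hS hR h.swap₃₄ h] at h3
      rw [e0, e1, Fib.parts_eq hS hR h k, Finsupp.single_eq_same, Finsupp.smul_apply, Fib.parts,
        Finsupp.add_apply, Finsupp.add_apply, Finsupp.single_eq_same, Finsupp.single_apply,
        Finsupp.single_apply, smul_eq_mul, mul_comm]
      simp only [h3, h.part_swap₂₃_eq_iff hS hR]
      congr 1
      -- If roots of different pairs coincide, exactly one of the other two partitions equals the
      -- given one, a second coincidence being excluded.
      by_cases h₁₃ : y.1.2.1 = t₃
      · have n := h.swap₂₃.of_eq hR h₁₃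
        rw [if_pos (Or.inl h₁₃), if_pos (Or.inr h₁₃), if_neg]
        · norm_num
        · rintro (e | e)
          · exact n.1 (h₁₃.trans e.symm)
          · exact n.2.1 e
      by_cases h₂₄ : y.1.2.2 = t₄
      · have n := h.swap₁₂.swap₃₄.swap₂₃.of_eq hR h₂₄
        rw [if_pos (Or.inl h₂₄), if_pos (Or.inr (Or.inr (Or.inr h₂₄))), if_neg]
        · norm_num
        · rintro (e | e)
          · exact n.2.1 e
          · exact n.1 (h₂₄.trans e.symm)
      rw [if_neg (c := y.1.2.2 = t₄ ∨ y.1.2.1 = t₃) (by tauto), add_zero]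
      by_cases h₁₄ : y.1.2.2 = t₃ ∨ y.1.2.1 = t₄
      · rw [if_pos h₁₄, if_pos (by tauto)]
        norm_num
      · rw [if_neg h₁₄, if_neg (by tauto)]
        norm_num
    · have e : ∀ {u v w t : K x} (h : a.Fib x u v w t), h.part hS hR ≠ a.quotσ (a.q.toFun y) :=
        fun h h' => hx (congrArg baseσ h')
      have e1 : baseσ (a.quotσ (a.q.toFun y)) = y.1.1 := rfl
      rw [e1, Finsupp.single_eq_of_ne (Ne.symm hx)]
      simp only [Fib.parts, Finsupp.smul_apply, Finsupp.add_apply]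
      rw [Finsupp.single_eq_of_ne (e _).symm, Finsupp.single_eq_of_ne (e _).symm,
        Finsupp.single_eq_of_ne (e _).symm]
      simp

/-- The divisor is that of the function pulled back along `baseσ`. -/
theorem baseParts_principal (hS : a.IsSmooth) (hR : a.HasGenericRamification) {D : X →₀ ℤ}
    (hD : D ∈ principalDiv X) : a.baseParts hS hR D ∈ principalDiv a.S6modσ := by
  have : principalDiv X ≤ (principalDiv a.S6modσ).comap (a.baseParts hS hR) := by
    refine (AddSubgroup.closure_le _).2 ?_
    rintro D ⟨f, hf⟩
    refine AddSubgroup.subset_closure ⟨fun w => f (baseσ w), fun w => ?_⟩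
    obtain ⟨e, he, h⟩ := baseParts_apply hS hR D w
    rw [h]
    exact he.hasOrder_comp (hf _)
  exact this hD

theorem corrClass_mem_Prym (hS : a.IsSmooth) (hR : a.HasGenericRamification) {c : Pic a.S}
    (hc : c ∈ Prym a.proj) : corrClass hS hR c ∈ Prym a.quotσ := by
  obtain ⟨D, ⟨hD, hN⟩, rfl⟩ := hc
  refine ⟨a.corr D, ⟨?_, ?_⟩, rfl⟩
  · have hD' : degDiv a.S D = 0 := hD
    change degDiv a.S6 _ = 0
    rw [degDiv_corr hS hR, hD', mul_zero]
  · change normDiv a.quotσ (a.corr D) ∈ principalDiv a.S6modσ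
    rw [normDiv_corr hS hR]
    exact baseParts_principal hS hR hN

end HitchinBase

end Curves

/-! ### Pole bounds and punctured neighbourhoods under a ramified map. -/

section Ramification

variable {Y : Type u} [TopologicalSpace Y] [HolSpace Y] {Z : Type v} [TopologicalSpace Z]
  [HolSpace Z] {φ : Y → Z} {p : Y} {e : ℕ}

theorem HasRamification.hasPoleLE_comp (hφ : HasRamification φ p e) {f : Z → ℂ} {n : ℤ}
    (hf : HasPoleLE f (φ p) n) : HasPoleLE (fun y => f (φ y)) p (e * n) := by
  obtain ⟨k, g, hk, hg, hfg⟩ := hf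
  exact ⟨_, _, hφ.hasOrder_comp hk, hφ.isHolAt_comp hg, hφ.tendsto_punctured.eventually hfg⟩

/-- A power of a uniformizer downstairs clears the pole upstairs, and the resulting holomorphic
function descends. -/
theorem HasRamification.hasPoleLE_of_comp (hφ : HasRamification φ p e) (hY : IsCurve Y)
    (hZ : IsCurve Z) {f : Z → ℂ} {n : ℤ} (hf : HasPoleLE (fun y => f (φ y)) p (e * n)) :
    HasPoleLE f (φ p) n := by
  obtain ⟨t, ht⟩ := hZ.exists_isUniformizer (φ p)
  have ho := (ht.hasOrder hZ).zpow hZ n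
  rw [one_mul] at ho
  obtain ⟨g, hg, hfg⟩ := hf.exists_of_hasOrder hY (hφ.hasOrder_comp ho)
  obtain ⟨V, hV, -, hGV, -⟩ := hφ.exists_descend (G := fun z => f z * t z ^ n) hg hfg
  exact ⟨_, V, ho, hV, hGV⟩

/-- In the parameters this is the open mapping theorem; a finite order excludes the constant case.
-/
theorem HasRamification.nhds_le (hφ : HasRamification φ p e) :
    𝓝 (φ p) ≤ map φ (𝓝 p) := by
  obtain ⟨γ, γ', h, s₀, rfl, hγ, hγ', hh, ha, ho⟩ := hφ
  rw [hh.self_of_nhds, ← hγ.map_nhds, ← hγ'.map_nhds, map_map]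
  have h1 : map (φ ∘ γ) (𝓝 s₀) = map γ' (map h (𝓝 s₀)) := by
    rw [map_map]
    exact map_congr hh
  rw [h1]
  refine map_mono ?_
  rcases ha.eventually_constant_or_nhds_le_map_nhds with hc | hc
  · exfalso
    have h2 := ho.eventually_ne
    obtain ⟨s, hs, hs'⟩ := (h2.and (hc.filter_mono nhdsWithin_le_nhds)).exists
    exact hs (sub_eq_zero.2 hs')
  · exact hc

theorem HasRamification.punctured_le (hφ : HasRamification φ p e) {P : Z → Prop}
    (h : ∀ᶠ y in 𝓝[≠] p, P (φ y)) : ∀ᶠ z in 𝓝[≠] (φ p), P z := by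
  rw [eventually_nhdsWithin_iff] at *
  refine hφ.nhds_le (U := {z | z ∈ ({φ p}ᶜ : Set Z) → P z}) (mem_map.2 ?_)
  filter_upwards [h] with y hy hne
  exact hy fun h' => hne (by rw [mem_singleton_iff] at *; rw [h'])

/-- The quotient of a holomorphic function that vanishes at `p` by a function of order one. -/
theorem exists_eq_mul_of_hasOrder_one (hY : IsCurve Y) {f g : Y → ℂ} (hf : HasOrder f p 1)
    (hg : IsHolAt g p) (h0 : g p = 0) :
    ∃ k : Y → ℂ, IsHolAt k p ∧ ∀ᶠ y in 𝓝[≠] p, g y = f y * k y := by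
  obtain ⟨t, k, ht, hk, hk0, hfk⟩ := hf
  obtain ⟨l, hl, hgl⟩ := ht.2.2.2 g hg h0
  refine ⟨fun y => (k y)⁻¹ * l y, (hk.inv hY hk0).mul hl, ?_⟩
  filter_upwards [hfk, hgl.filter_mono nhdsWithin_le_nhds,
    ((hk.continuousAt hY).eventually_ne hk0).filter_mono nhdsWithin_le_nhds] with y h1 h2 h3
  rw [h1, h2, zpow_one]
  field_simp

end Ramification

/-! ### Meromorphic sections of a line bundle and its exterior square. -/

section LineBundles

variable {Y : Type u} [TopologicalSpace Y] [HolSpace Y] (L : LineBundle.{u, v} Y)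

section Change

variable {L} {e e' : Trivialization ℂ (π ℂ L.E)} [MemTrivializationAtlas e]
  [MemTrivializationAtlas e']

theorem LineBundle.linearMapAt_symm {y : Y} (hy : y ∈ e.baseSet) (c : ℂ) :
    e.linearMapAt ℂ y (e.symmₗ ℂ y c) = c := e.linearMapAt_symmₗ hy c

theorem LineBundle.symm_linearMapAt {y : Y} (hy : y ∈ e.baseSet) (v : L.E y) :
    e.symmₗ ℂ y (e.linearMapAt ℂ y v) = v := e.symmₗ_linearMapAt hy v

theorem LineBundle.linearMapAt_change {y : Y} (hy : y ∈ e.baseSet) (hy' : y ∈ e'.baseSet)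
    (v : L.E y) : e'.linearMapAt ℂ y v = e.coordChangeL ℂ e' y 1 * e.linearMapAt ℂ y v := by
  have h1 : e.coordChangeL ℂ e' y (e.linearMapAt ℂ y v) = e'.linearMapAt ℂ y v := by
    rw [Trivialization.coordChangeL_apply e e' ⟨hy, hy'⟩, ← e.symmₗ_apply (R := ℂ) hy,
      symm_linearMapAt hy,
      Trivialization.linearMapAt_apply, if_pos hy']
  rw [← h1]
  have h2 := (e.coordChangeL ℂ e' y).map_smul (e.linearMapAt ℂ y v) 1
  rw [smul_eq_mul, mul_one, smul_eq_mul] at h2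
  rw [h2, mul_comm]

end Change

/-- The local generator of the sheaf of sections given by a trivialization. -/
theorem LineBundle.symm_one_mem (e : Trivialization ℂ (π ℂ L.E)) [MemTrivializationAtlas e]
    (V : Opens Y) (hV : ∀ y ∈ V, y ∈ e.baseSet) : (fun y : V => e.symmₗ ℂ y 1) ∈ L.sheaf.sec V := by
  intro p e' _ hp
  have h := L.hol e e' p ⟨hV p p.2, hp⟩
  refine (holNear_iff (f := fun y => e'.linearMapAt ℂ y (e.symmₗ ℂ y 1))).2 (h.congr ?_)
  filter_upwards [e'.open_baseSet.mem_nhds hp, V.isOpen.mem_nhds p.2] with y hy hyV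
  rw [linearMapAt_change (hV y hyV) hy, linearMapAt_symm (hV y hyV), mul_one]

theorem LineBundle.linearMapAt_mem (e : Trivialization ℂ (π ℂ L.E)) [MemTrivializationAtlas e]
    {V : Opens Y} (hV : ∀ y ∈ V, y ∈ e.baseSet) (s : L.sheaf.sec V) :
    (fun y : V => e.linearMapAt ℂ y (s.1 y)) ∈ HolSpace.O V :=
  mem_O_iff.2 fun p => s.2 p e (hV p p.2)

/-- The values of a section of a line bundle. -/
def secVal {L : LineBundle.{u, v} Y} {V : Opens Y} (s : L.sheaf.sec V) (y : V) : L.E y := s.1 y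

/-- The values of a section of `O(D)`. -/
def divVal {D : Y →₀ ℤ} {V : Opens Y} (s : (sheafOfDiv D).sec V) (y : V) : ℂ := s.1 y

/-- A section of an invertible sheaf isomorphic to `O(D)` that corresponds to the function `1`. -/
theorem LineBundle.exists_meromorphic_section [T1Space Y] (hY : IsCurve Y) {D : Y →₀ ℤ}
    (h : L.sheaf.toOMod.IsIso (sheafOfDiv D).toOMod) :
    ∃ ψ : (y : Y) → L.E y, ∀ (p : Y) (e : Trivialization ℂ (π ℂ L.E)) [MemTrivializationAtlas e],
      p ∈ e.baseSet → HasOrder (fun y => e.linearMapAt ℂ y (ψ y)) p (D p) := by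
  classical
  obtain ⟨Θ, hΘ⟩ := h
  -- By linearity over holomorphic functions, `Θ` of any section is its coordinate times `Θ` of the
  -- local generator.
  have hmul : ∀ (e : Trivialization ℂ (π ℂ L.E)) [MemTrivializationAtlas e] {V : Opens Y}
      (hV : ∀ y ∈ V, y ∈ e.baseSet) (s : L.sheaf.sec V) (y : V),
      divVal (Θ V s) y = e.linearMapAt ℂ y (secVal s y) *
        divVal (Θ V ⟨_, L.symm_one_mem e V hV⟩) y := by
    intro e _ V hV s y
    set σ : L.sheaf.toOMod.sec V := ⟨_, L.symm_one_mem e V hV⟩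
    set s' : L.sheaf.toOMod.sec V := s
    set c : HolSpace.O V := ⟨_, L.linearMapAt_mem e hV s⟩
    have h1 : s' = c • σ := by
      apply Subtype.ext
      funext y
      change s.1 y = e.linearMapAt ℂ y (s.1 y) • e.symmₗ ℂ y.1 (1 : ℂ)
      have := (e.symmₗ ℂ y.1).map_smul (e.linearMapAt ℂ y (s.1 y)) 1
      rw [smul_eq_mul, mul_one] at this
      exact (symm_linearMapAt (hV y y.2) (s.1 y)).symm.trans this
    have h2 := (Θ V).map_smul c σ
    have h3 := (congrArg (Θ V) h1).trans h2
    exact congrFun (congrArg Subtype.val h3) y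
  set U₀ : Opens Y := ⟨(D.support : Set Y)ᶜ, D.support.finite_toSet.isClosed.isOpen_compl⟩ with hU₀
  have hU₀D : ∀ {y : Y}, y ∈ U₀ ↔ D y = 0 := by
    intro y
    change ¬ (y ∈ (D.support : Set Y)) ↔ _
    simp
  have hone : (fun _ : U₀ => (1 : ℂ)) ∈ (sheafOfDiv D).sec U₀ :=
    ⟨fun p _ => holNear_iff.2 (isHolAt_const 1 p.1), fun p hp => absurd (hU₀D.1 p.2) hp⟩
  set s : L.sheaf.sec U₀ := (Θ U₀).symm ⟨_, hone⟩ with hs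
  refine ⟨fun y => if hy : y ∈ U₀ then secVal s ⟨y, hy⟩ else 0, fun p e _ hp => ?_⟩
  obtain ⟨t, ht⟩ := hY.exists_isUniformizer p
  have hto : HasOrder (fun y => t y ^ D p) p (D p) := by
    simpa using (ht.hasOrder hY).zpow hY (D p)
  have htne := (ht.hasOrder hY).eventually_ne hY
  -- This is the local generator of `O(D)` at `p`.
  set k : Y → ℂ := fun y => t y ^ (-D p) with hk
  have hkp : HasPoleLE k p (D p) := by
    refine ⟨_, fun _ => 1, hto, isHolAt_const 1 p, ?_⟩
    filter_upwards [htne] with y hy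
    rw [hk]
    simp only
    rw [← zpow_add₀ hy, neg_add_cancel, zpow_zero]
  obtain ⟨V, hpV, hVe, hVD⟩ : ∃ V : Opens Y, p ∈ V ∧ (∀ y ∈ V, y ∈ e.baseSet) ∧
      ∀ y ∈ V, y ≠ p → D y = 0 ∧ IsHolAt k y := by
    have h1 : ∀ᶠ y in 𝓝 p, y ∈ e.baseSet ∧ (y ≠ p → D y = 0 ∧ IsHolAt k y) := by
      have h2 := (eventually_apply_eq_zero D p).and (hkp.eventually_isHolAt hY)
      rw [eventually_nhdsWithin_iff] at h2
      filter_upwards [e.open_baseSet.mem_nhds hp, h2] with y h3 h4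
      exact ⟨h3, h4⟩
    obtain ⟨V, hV, hVo, hpV⟩ := eventually_nhds_iff.1 h1
    exact ⟨⟨V, hVo⟩, hpV, fun y hy => (hV y hy).1, fun y hy => (hV y hy).2⟩
  have hk' := normalize_mem hY (D := D) (U := V) (f := k) fun y hy => by
    by_cases h : y = p
    · rw [h]
      exact hkp
    · obtain ⟨h1, h2⟩ := hVD y hy h
      rw [h1, hasPoleLE_zero_iff hY]
      exact ⟨k, h2, Eventually.of_forall fun _ => rfl⟩
  set g := Θ V ⟨_, L.symm_one_mem e V hVe⟩ with hg
  set m : L.sheaf.sec V := (Θ V).symm ⟨_, hk'⟩ with hm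
  have hgp : HasPoleLE (extendZero (divVal g)) p (D p) := hasPoleLE_of_mem_sheafOfDiv hY g.2 hpV
  obtain ⟨G, hG, hgG⟩ := hgp.exists_of_hasOrder hY hto
  have hV𝓝 : ∀ᶠ y in 𝓝[≠] p, y ∈ V := (V.isOpen.mem_nhds hpV |> mem_nhdsWithin_of_mem_nhds)
  set b : Y → ℂ := extendZero fun y : V => e.linearMapAt ℂ y (secVal m y) with hb
  have hbh : IsHolAt b p := holNear_iff_extendZero.1 (m.2 ⟨p, hpV⟩ e hp)
  have hbg : ∀ y ∈ V, normalize D k y = b y * extendZero (divVal g) y := by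
    intro y hy
    have h1 := hmul e hVe m ⟨y, hy⟩
    rw [hb, extendZero_of_mem _ hy, extendZero_of_mem _ hy, ← h1, hm]
    exact (congrFun (congrArg Subtype.val ((Θ V).apply_symm_apply ⟨_, hk'⟩)) ⟨y, hy⟩).symm
  -- Surjectivity of `Θ`: the generator `k` is the image of `m`, so `b g = k` off `p` and `b G = 1`.
  -- Hence the image `g` of the trivializing section has order exactly `-D p`.
  have hG0 : G p ≠ 0 := by
    have h1 : ∀ᶠ y in 𝓝[≠] p, b y * G y = 1 := by
      filter_upwards [hV𝓝, hgG, normalize_eventually_eq hY (D := D) hkp, htne] with y h1 h2 h3 h4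
      rw [← h2, ← mul_assoc, ← hbg y h1, h3, hk]
      simp only
      rw [← zpow_add₀ h4, neg_add_cancel, zpow_zero]
    have h2 := eq_of_punctured hY ((hbh.continuousAt hY).mul (hG.continuousAt hY))
      continuousAt_const h1
    intro h0
    simp [h0] at h2
  refine ⟨t, fun y => (G y)⁻¹, ht, hG.inv hY hG0, inv_ne_zero hG0, ?_⟩
  have hle : V ⊓ U₀ ≤ U₀ := inf_le_right
  have hle' : V ⊓ U₀ ≤ V := inf_le_left
  filter_upwards [hV𝓝, eventually_apply_eq_zero D p, hgG, htne] with y hyV hyD h3 h4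
  have hyU : y ∈ U₀ := hU₀D.2 hyD
  have hyW : y ∈ V ⊓ U₀ := ⟨hyV, hyU⟩
  rw [dif_pos hyU]
  -- The coordinate of `s` times `g` equals 1, so that coordinate is `t ^ D p / G`, of order `D p`.
  have h1 := hmul e (V := V ⊓ U₀) (fun y hy => hVe y hy.1) (L.sheaf.toOMod.res hle s) ⟨y, hyW⟩
  have h5 : divVal (Θ (V ⊓ U₀) (L.sheaf.toOMod.res hle s)) ⟨y, hyW⟩ = 1 := by
    have h6 := hΘ U₀ (V ⊓ U₀) hle s
    have h7 : divVal (Θ (V ⊓ U₀) (L.sheaf.toOMod.res hle s)) ⟨y, hyW⟩ = divVal (Θ U₀ s) ⟨y, hyU⟩ :=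
      congrFun (congrArg Subtype.val h6) ⟨y, hyW⟩
    rw [h7, hs]
    exact congrFun (congrArg Subtype.val ((Θ U₀).apply_symm_apply ⟨_, hone⟩)) ⟨y, hyU⟩
  have h8 : divVal (Θ (V ⊓ U₀) ⟨_, L.symm_one_mem e (V ⊓ U₀) fun y hy => hVe y hy.1⟩) ⟨y, hyW⟩ =
      extendZero (divVal g) y := by
    have h6 := hΘ V (V ⊓ U₀) hle' ⟨_, L.symm_one_mem e V hVe⟩
    rw [extendZero_of_mem _ hyV]
    exact congrFun (congrArg Subtype.val h6) ⟨y, hyW⟩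
  rw [h5, h8] at h1
  change 1 = e.linearMapAt ℂ y (secVal s ⟨y, hyU⟩) * _ at h1
  have h9 : extendZero (divVal g) y ≠ 0 := right_ne_zero_of_mul (h1 ▸ one_ne_zero)
  rw [← h3, mul_inv, mul_comm _ (t y ^ D p)⁻¹, ← mul_assoc,
    mul_inv_cancel₀ (zpow_ne_zero _ h4), one_mul]
  exact eq_inv_of_mul_eq_one_left h1.symm

/-! #### The exterior product of a line bundle with itself -/

section Box

variable {L} {T : Type w} (p₁ p₂ : T → Y)

/-- The coordinate of a vector of `p₁^* L ⊗ p₂^* L` in the trivialization induced by two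
trivializations of `L`. -/
def boxCoord (e₁ e₂ : Trivialization ℂ (π ℂ L.E)) [MemTrivializationAtlas e₁]
    [MemTrivializationAtlas e₂] (y : T) : L.E (p₁ y) ⊗[ℂ] L.E (p₂ y) →ₗ[ℂ] ℂ :=
  LinearMap.mul' ℂ ℂ ∘ₗ TensorProduct.map (e₁.linearMapAt ℂ (p₁ y)) (e₂.linearMapAt ℂ (p₂ y))

variable {p₁ p₂} {e₁ e₂ e₁' e₂' : Trivialization ℂ (π ℂ L.E)} [MemTrivializationAtlas e₁]
  [MemTrivializationAtlas e₂] [MemTrivializationAtlas e₁'] [MemTrivializationAtlas e₂']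

theorem boxCoord_tmul (y : T) (v : L.E (p₁ y)) (w : L.E (p₂ y)) : boxCoord p₁ p₂ e₁ e₂ y (v ⊗ₜ w) =
    e₁.linearMapAt ℂ (p₁ y) v * e₂.linearMapAt ℂ (p₂ y) w := rfl

/-- The tensor product of two lines is a line, so a single coordinate decides all equalities between
its vectors. -/
theorem eq_boxCoord_smul {y : T} (h₁ : p₁ y ∈ e₁.baseSet) (h₂ : p₂ y ∈ e₂.baseSet)
    (v : L.E (p₁ y) ⊗[ℂ] L.E (p₂ y)) :
    v = boxCoord p₁ p₂ e₁ e₂ y v • (e₁.symmₗ ℂ (p₁ y) 1 ⊗ₜ e₂.symmₗ ℂ (p₂ y) 1) := by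
  induction v with
  | zero => rw [map_zero, zero_smul]
  | add v w hv hw => rw [map_add, add_smul, ← hv, ← hw]
  | tmul v w =>
    have k : ∀ (e : Trivialization ℂ (π ℂ L.E)) [MemTrivializationAtlas e] {p : Y}
        (_ : p ∈ e.baseSet) (v : L.E p), v = e.linearMapAt ℂ p v • e.symmₗ ℂ p (1 : ℂ) := by
      intro e _ p hp v
      have := (e.symmₗ ℂ p).map_smul (e.linearMapAt ℂ p v) 1
      rw [smul_eq_mul, mul_one] at this
      exact (LineBundle.symm_linearMapAt hp v).symm.trans this
    rw [boxCoord_tmul, mul_smul, ← TensorProduct.tmul_smul, ← k e₂ h₂, TensorProduct.smul_tmul', ← k e₁ h₁]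

theorem boxCoord_injective {y : T} (h₁ : p₁ y ∈ e₁.baseSet) (h₂ : p₂ y ∈ e₂.baseSet) :
    Function.Injective (boxCoord p₁ p₂ e₁ e₂ y) := by
  intro v w h
  rw [eq_boxCoord_smul h₁ h₂ v, h, ← eq_boxCoord_smul h₁ h₂ w]

theorem exists_boxCoord_eq {y : T} (h₁ : p₁ y ∈ e₁.baseSet) (h₂ : p₂ y ∈ e₂.baseSet) (c : ℂ) :
    ∃ v, boxCoord p₁ p₂ e₁ e₂ y v = c := by
  refine ⟨c • (e₁.symmₗ ℂ (p₁ y) 1 ⊗ₜ e₂.symmₗ ℂ (p₂ y) 1), ?_⟩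
  rw [map_smul, boxCoord_tmul, LineBundle.linearMapAt_symm h₁, LineBundle.linearMapAt_symm h₂]
  simp

theorem boxCoord_change {y : T} (h₁ : p₁ y ∈ e₁.baseSet) (h₂ : p₂ y ∈ e₂.baseSet)
    (h₁' : p₁ y ∈ e₁'.baseSet) (h₂' : p₂ y ∈ e₂'.baseSet) (v : L.E (p₁ y) ⊗[ℂ] L.E (p₂ y)) :
    boxCoord p₁ p₂ e₁' e₂' y v = (e₁.coordChangeL ℂ e₁' (p₁ y) 1 *
      e₂.coordChangeL ℂ e₂' (p₂ y) 1) * boxCoord p₁ p₂ e₁ e₂ y v := by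
  induction v with
  | zero => simp
  | add v w hv hw => rw [map_add, map_add, hv, hw, mul_add]
  | tmul v w =>
    rw [boxCoord_tmul, boxCoord_tmul, LineBundle.linearMapAt_change h₁ h₁',
      LineBundle.linearMapAt_change h₂ h₂']
    ring

end Box

end LineBundles

/-! ### Sections of T and of L₋. -/

section Curves

variable {X : Type u} [TopologicalSpace X] [ChartedSpace ℂ X] [IsManifold 𝓘(ℂ, ℂ) ω X]

namespace HitchinBase

variable {a : HitchinBase X} {L : LineBundle.{u, v} a.S} {W : Opens a.S6}

/-! #### Sections of `T` -/

/-- The values of an anti-invariant function. -/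
def tVal (δ : a.sheafT.sec W) : a.SS0 → ℂ :=
  extendZero (U := Opens.comap ⟨a.q.toFun, a.q.cont⟩ W) δ.1.1

theorem tVal_of_mem (δ : a.sheafT.sec W) {y : a.SS0} (hy : a.q.toFun y ∈ W) :
    tVal δ y = δ.1.1 ⟨y, hy⟩ :=
  extendZero_of_mem (U := Opens.comap ⟨a.q.toFun, a.q.cont⟩ W) δ.1.1 hy

theorem tVal_add (δ δ' : a.sheafT.sec W) (y : a.SS0) : tVal (δ + δ') y = tVal δ y + tVal δ' y := by
  by_cases hy : a.q.toFun y ∈ W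
  · rw [tVal_of_mem _ hy, tVal_of_mem _ hy, tVal_of_mem _ hy]
    rfl
  · have h : ∀ δ : a.sheafT.sec W, tVal δ y = 0 := fun δ => dif_neg hy
    rw [h, h, h, add_zero]

theorem tVal_smul (f : HolSpace.O W) (δ : a.sheafT.sec W) {y : a.SS0} (hy : a.q.toFun y ∈ W) :
    tVal (f • δ) y = f.1 ⟨_, hy⟩ * tVal δ y := by
  rw [tVal_of_mem _ hy, tVal_of_mem _ hy]
  rfl

theorem tVal_res {V : Opens a.S6} (h : V ≤ W) (δ : a.sheafT.sec W) {y : a.SS0}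
    (hy : a.q.toFun y ∈ V) : tVal (a.sheafT.res h δ) y = tVal δ y := by
  rw [tVal_of_mem _ hy, tVal_of_mem _ (h hy)]
  rfl

theorem isHolAt_tVal (δ : a.sheafT.sec W) {y : a.SS0} (hy : a.q.toFun y ∈ W) :
    IsHolAt (tVal δ) y :=
  holNear_iff_extendZero.1 (holNear_of_mem δ.1.2 (⟨y, hy⟩ : Opens.comap ⟨a.q.toFun, a.q.cont⟩ W))

theorem tVal_τ (δ : a.sheafT.sec W) {y : a.SS0} (hy : a.q.toFun y ∈ W) :
    tVal δ (a.τ y) = -tVal δ y := by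
  rw [tVal_of_mem _ hy, tVal_of_mem _ (by rwa [a.q_τ])]
  exact δ.2 y hy

theorem sheafT_ext {δ δ' : a.sheafT.sec W} (h : ∀ y, a.q.toFun y ∈ W → tVal δ y = tVal δ' y) :
    δ = δ' := by
  apply Subtype.ext
  apply Subtype.ext
  funext y
  have := h y y.2
  rwa [tVal_of_mem _ y.2, tVal_of_mem _ y.2] at this

theorem exists_sheafT (g : a.SS0 → ℂ) (hg : ∀ y, a.q.toFun y ∈ W → IsHolAt g y)
    (hτ : ∀ y, a.q.toFun y ∈ W → g (a.τ y) = -g y) :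
    ∃ δ : a.sheafT.sec W, ∀ y, a.q.toFun y ∈ W → tVal δ y = g y := by
  have h : (fun y : (Opens.comap ⟨a.q.toFun, a.q.cont⟩ W : Opens a.SS0) => g y) ∈
      HolSpace.O (Opens.comap ⟨a.q.toFun, a.q.cont⟩ W) := restrict_mem_O_iff.2 hg
  exact ⟨⟨⟨_, h⟩, hτ⟩, fun y hy => tVal_of_mem _ hy⟩

/-! #### Sections of `L₋` -/

open Classical in
/-- The values of a section of `L₋`. -/
def lVal (s : (a.LMinus L).sec W) (y : a.SS0) : L.E (a.p₁ y) ⊗[ℂ] L.E (a.p₂ y) :=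
  if hy : a.q.toFun y ∈ W then s.1.1 ⟨y, hy⟩ else 0

theorem lVal_of_mem (s : (a.LMinus L).sec W) {y : a.SS0} (hy : a.q.toFun y ∈ W) :
    lVal s y = s.1.1 ⟨y, hy⟩ := dif_pos hy

theorem lVal_add (s s' : (a.LMinus L).sec W) (y : a.SS0) :
    lVal (s + s') y = lVal s y + lVal s' y := by
  by_cases hy : a.q.toFun y ∈ W
  · rw [lVal_of_mem _ hy, lVal_of_mem _ hy, lVal_of_mem _ hy]
    rfl
  · have h : ∀ s : (a.LMinus L).sec W, lVal s y = 0 := fun δ => dif_neg hy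
    rw [h, h, h, add_zero]

theorem lVal_smul (f : HolSpace.O W) (s : (a.LMinus L).sec W) {y : a.SS0} (hy : a.q.toFun y ∈ W) :
    lVal (f • s) y = f.1 ⟨_, hy⟩ • lVal s y := by
  rw [lVal_of_mem _ hy, lVal_of_mem _ hy]
  rfl

theorem lVal_res {V : Opens a.S6} (h : V ≤ W) (s : (a.LMinus L).sec W) {y : a.SS0}
    (hy : a.q.toFun y ∈ V) : lVal ((a.LMinus L).res h s) y = lVal s y := by
  rw [lVal_of_mem _ hy, lVal_of_mem _ (h hy)]
  rfl

theorem isHolAt_lVal (s : (a.LMinus L).sec W) {y : a.SS0} (hy : a.q.toFun y ∈ W)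
    {e₁ e₂ : Trivialization ℂ (π ℂ L.E)} [MemTrivializationAtlas e₁] [MemTrivializationAtlas e₂]
    (h₁ : a.p₁ y ∈ e₁.baseSet) (h₂ : a.p₂ y ∈ e₂.baseSet) :
    IsHolAt (fun y => boxCoord a.p₁ a.p₂ e₁ e₂ y (lVal s y)) y := by
  have h := s.1.2 ⟨y, hy⟩ e₁ e₂ h₁ h₂
  refine (holNear_iff (U := Opens.comap ⟨a.q.toFun, a.q.cont⟩ W) (p := ⟨y, hy⟩)).1 ?_
  convert h using 2 with y'
  rw [lVal_of_mem _ y'.2]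
  rfl

theorem lVal_τ (s : (a.LMinus L).sec W) {y : a.SS0} (hy : a.q.toFun y ∈ W) :
    TensorProduct.comm ℂ (L.E (a.p₂ y)) (L.E (a.p₁ y)) (lVal s (a.τ y)) = -lVal s y := by
  rw [lVal_of_mem _ hy, lVal_of_mem _ (by rwa [a.q_τ])]
  exact s.2 y hy

theorem LMinus_ext {s s' : (a.LMinus L).sec W}
    (h : ∀ y, a.q.toFun y ∈ W → lVal s y = lVal s' y) : s = s' := by
  apply Subtype.ext
  apply Subtype.ext
  funext y
  have := h y y.2
  rwa [lVal_of_mem _ y.2, lVal_of_mem _ y.2] at this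

theorem exists_LMinus (g : (y : a.SS0) → L.E (a.p₁ y) ⊗[ℂ] L.E (a.p₂ y))
    (hg : ∀ y, a.q.toFun y ∈ W → ∀ (e₁ e₂ : Trivialization ℂ (π ℂ L.E)) [MemTrivializationAtlas e₁]
      [MemTrivializationAtlas e₂], a.p₁ y ∈ e₁.baseSet → a.p₂ y ∈ e₂.baseSet →
      IsHolAt (fun y => boxCoord a.p₁ a.p₂ e₁ e₂ y (g y)) y)
    (hτ : ∀ y, a.q.toFun y ∈ W →
      TensorProduct.comm ℂ (L.E (a.p₂ y)) (L.E (a.p₁ y)) (g (a.τ y)) = -g y) :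
    ∃ s : (a.LMinus L).sec W, ∀ y, a.q.toFun y ∈ W → lVal s y = g y := by
  have h : (fun y : (Opens.comap ⟨a.q.toFun, a.q.cont⟩ W : Opens a.SS0) => g y) ∈
      (L.box a.p₁ a.p₂).sec (Opens.comap ⟨a.q.toFun, a.q.cont⟩ W) := by
    intro p e₁ e₂ _ _ h₁ h₂
    exact (holNear_iff (f := fun y => boxCoord a.p₁ a.p₂ e₁ e₂ y (g y))).2 (hg p p.2 e₁ e₂ h₁ h₂)
  exact ⟨⟨⟨_, h⟩, hτ⟩, fun y hy => lVal_of_mem _ hy⟩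

theorem eventually_mem_baseSet (hS : a.IsSmooth) (hR : a.HasGenericRamification) {y : a.SS0}
    {e₁ e₂ : Trivialization ℂ (π ℂ L.E)} (h₁ : a.p₁ y ∈ e₁.baseSet) (h₂ : a.p₂ y ∈ e₂.baseSet) :
    ∀ᶠ y' in 𝓝 y, a.p₁ y' ∈ e₁.baseSet ∧ a.p₂ y' ∈ e₂.baseSet :=
  ((hasRamification_p₁ hS hR y).continuousAt.eventually_mem (e₁.open_baseSet.mem_nhds h₁)).and
    ((hasRamification_p₂ hS hR y).continuousAt.eventually_mem (e₂.open_baseSet.mem_nhds h₂))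

theorem boxCoord_comm {e₁ e₂ : Trivialization ℂ (π ℂ L.E)} [MemTrivializationAtlas e₁]
    [MemTrivializationAtlas e₂] (y : a.SS0)
    (v : L.E (a.p₁ (a.τ y)) ⊗[ℂ] L.E (a.p₂ (a.τ y))) : boxCoord a.p₁ a.p₂ e₁ e₂ y
      (TensorProduct.comm ℂ (L.E (a.p₂ y)) (L.E (a.p₁ y)) v) =
      boxCoord a.p₁ a.p₂ e₂ e₁ (a.τ y) v := by
  induction v with
  | zero =>
    exact ((congrArg _ (map_zero (TensorProduct.comm ℂ (L.E (a.p₂ y)) (L.E (a.p₁ y))))).trans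
      (map_zero _)).trans (map_zero _).symm
  | add v w hv hw =>
    rw [map_add, ← hv, ← hw]
    exact (congrArg _ (map_add (TensorProduct.comm ℂ (L.E (a.p₂ y)) (L.E (a.p₁ y))) v w)).trans
      (map_add _ _ _)
  | tmul v w => exact mul_comm _ _

/-- Sections of `L₋` are determined by their germs away from isolated points. -/
theorem LMinus_ext_punctured (hS : a.IsSmooth) (hR : a.HasGenericRamification)
    {s s' : (a.LMinus L).sec W}
    (h : ∀ y, a.q.toFun y ∈ W → ∀ᶠ y' in 𝓝[≠] y, lVal s y' = lVal s' y') : s = s' := by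
  refine LMinus_ext fun y hy => ?_
  have hY := isCurve_SS0 hS hR
  have h₁ := FiberBundle.mem_baseSet_trivializationAt ℂ L.E (a.p₁ y)
  have h₂ := FiberBundle.mem_baseSet_trivializationAt ℂ L.E (a.p₂ y)
  refine boxCoord_injective h₁ h₂ (eq_of_punctured hY ((isHolAt_lVal s hy h₁ h₂).continuousAt hY)
    ((isHolAt_lVal s' hy h₁ h₂).continuousAt hY) ?_)
  filter_upwards [h y hy] with y' hy'
  rw [hy']

/-- The meromorphic section of `p₁^* L ⊗ p₂^* L` given by a meromorphic section of `L`. -/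
def boxSection (ψ : (p : a.S) → L.E p) (y : a.SS0) : L.E (a.p₁ y) ⊗[ℂ] L.E (a.p₂ y) :=
  ψ (a.p₁ y) ⊗ₜ ψ (a.p₂ y)

variable (L) in
/-- The section `ψ` of `L` is meromorphic with divisor `D`. -/
def HasDivisor (ψ : (p : a.S) → L.E p) (D : a.S →₀ ℤ) : Prop :=
  ∀ (p : a.S) (e : Trivialization ℂ (π ℂ L.E)) [MemTrivializationAtlas e],
    p ∈ e.baseSet → HasOrder (fun y => e.linearMapAt ℂ y (ψ y)) p (D p)

theorem boxSection_τ (ψ : (p : a.S) → L.E p) (y : a.SS0) :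
    TensorProduct.comm ℂ (L.E (a.p₂ y)) (L.E (a.p₁ y)) (boxSection ψ (a.τ y)) = boxSection ψ y := rfl

theorem HasDivisor.hasOrder (hS : a.IsSmooth) (hR : a.HasGenericRamification)
    {ψ : (p : a.S) → L.E p} {D : a.S →₀ ℤ} (hψ : HasDivisor L ψ D) {y : a.SS0}
    {e₁ e₂ : Trivialization ℂ (π ℂ L.E)} [MemTrivializationAtlas e₁] [MemTrivializationAtlas e₂]
    (h₁ : a.p₁ y ∈ e₁.baseSet) (h₂ : a.p₂ y ∈ e₂.baseSet) :
    HasOrder (fun y => boxCoord a.p₁ a.p₂ e₁ e₂ y (boxSection ψ y)) y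
      (ramIdx a.p₁ y * D (a.p₁ y) + ramIdx a.p₁ (a.τ y) * D (a.p₂ y)) :=
  ((hasRamification_p₁ hS hR y).hasOrder_comp (hψ _ e₁ h₁)).mul (isCurve_SS0 hS hR)
    ((hasRamification_p₂ hS hR y).hasOrder_comp (hψ _ e₂ h₂))

/-- The section of `L₋` given by a function with poles bounded by `corr D` and a section of `T`. -/
theorem HasDivisor.exists_section (hS : a.IsSmooth) (hR : a.HasGenericRamification)
    {ψ : (p : a.S) → L.E p} {D : a.S →₀ ℤ} (hψ : HasDivisor L ψ D) {f : a.S6 → ℂ}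
    (hf : ∀ z ∈ W, HasPoleLE f z (a.corr D z)) (δ : a.sheafT.sec W) :
    ∃ s : (a.LMinus L).sec W, ∀ y₀, a.q.toFun y₀ ∈ W → ∀ᶠ y in 𝓝[≠] y₀,
      lVal s y = (f (a.q.toFun y) * tVal δ y) • boxSection ψ y := by
  have hY := isCurve_SS0 hS hR
  -- The poles of `f ∘ q` are bounded by `q^*(corr D)`, which is the divisor of `ψ ⊗ ψ`; they cancel
  -- in every trivialization.
  have hA : ∀ y, a.q.toFun y ∈ W → ∀ (e₁ e₂ : Trivialization ℂ (π ℂ L.E)) [MemTrivializationAtlas e₁]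
      [MemTrivializationAtlas e₂], a.p₁ y ∈ e₁.baseSet → a.p₂ y ∈ e₂.baseSet →
      ∃ g : a.SS0 → ℂ, IsHolAt g y ∧ ∀ᶠ y' in 𝓝[≠] y, boxCoord a.p₁ a.p₂ e₁ e₂ y'
        ((f (a.q.toFun y') * tVal δ y') • boxSection ψ y') = g y' := by
    intro y hy e₁ e₂ _ _ h₁ h₂
    obtain ⟨e, he, hD⟩ := exists_hasRamification_q hS hR D y
    have h3 := he.hasPoleLE_comp (hf _ hy)
    rw [hD] at h3
    obtain ⟨g, hg, hfg⟩ := h3.exists_of_hasOrder hY (hψ.hasOrder hS hR h₁ h₂)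
    refine ⟨_, (isHolAt_tVal δ hy).mul hg, ?_⟩
    filter_upwards [hfg] with y' hy'
    rw [map_smul, smul_eq_mul, ← hy']
    ring
  -- The product has a limit in the fibre at each point; changing trivializations multiplies by
  -- continuous functions, so the limit is the same vector in all of them.
  have hB : ∀ y, ∃ v : L.E (a.p₁ y) ⊗[ℂ] L.E (a.p₂ y), a.q.toFun y ∈ W →
      ∀ (e₁ e₂ : Trivialization ℂ (π ℂ L.E)) [MemTrivializationAtlas e₁]
      [MemTrivializationAtlas e₂], a.p₁ y ∈ e₁.baseSet → a.p₂ y ∈ e₂.baseSet →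
      Tendsto (fun y' => boxCoord a.p₁ a.p₂ e₁ e₂ y'
        ((f (a.q.toFun y') * tVal δ y') • boxSection ψ y')) (𝓝[≠] y)
        (𝓝 (boxCoord a.p₁ a.p₂ e₁ e₂ y v)) := by
    intro y
    by_cases hy : a.q.toFun y ∈ W
    swap
    · exact ⟨0, fun h => absurd h hy⟩
    have h₁ := FiberBundle.mem_baseSet_trivializationAt ℂ L.E (a.p₁ y)
    have h₂ := FiberBundle.mem_baseSet_trivializationAt ℂ L.E (a.p₂ y)
    set e₁ := trivializationAt ℂ L.E (a.p₁ y)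
    set e₂ := trivializationAt ℂ L.E (a.p₂ y)
    obtain ⟨g, hg, hfg⟩ := hA y hy e₁ e₂ h₁ h₂
    obtain ⟨v, hv⟩ := exists_boxCoord_eq (p₁ := a.p₁) (p₂ := a.p₂) h₁ h₂ (g y)
    refine ⟨v, fun _ e₁' e₂' _ _ h₁' h₂' => ?_⟩
    have hc : IsHolAt (fun y' => e₁.coordChangeL ℂ e₁' (a.p₁ y') 1 *
        e₂.coordChangeL ℂ e₂' (a.p₂ y') 1) y :=
      ((hasRamification_p₁ hS hR y).isHolAt_comp (L.hol e₁ e₁' _ ⟨h₁, h₁'⟩)).mul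
        ((hasRamification_p₂ hS hR y).isHolAt_comp (L.hol e₂ e₂' _ ⟨h₂, h₂'⟩))
    rw [boxCoord_change h₁ h₂ h₁' h₂' v, hv]
    refine Tendsto.congr' ?_
      (((hc.mul hg).continuousAt hY).tendsto.mono_left nhdsWithin_le_nhds)
    filter_upwards [hfg, (eventually_mem_baseSet hS hR h₁ h₂).filter_mono nhdsWithin_le_nhds,
      (eventually_mem_baseSet hS hR h₁' h₂').filter_mono nhdsWithin_le_nhds] with y' h1 h2 h3
    rw [boxCoord_change h2.1 h2.2 h3.1 h3.2, h1]
  choose g hg using hB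
  -- The section of limits is holomorphic and agrees with the product off isolated points.
  have hC : ∀ y, a.q.toFun y ∈ W → ∀ (e₁ e₂ : Trivialization ℂ (π ℂ L.E)) [MemTrivializationAtlas e₁]
      [MemTrivializationAtlas e₂], a.p₁ y ∈ e₁.baseSet → a.p₂ y ∈ e₂.baseSet →
      IsHolAt (fun y => boxCoord a.p₁ a.p₂ e₁ e₂ y (g y)) y ∧
      ∀ᶠ y' in 𝓝[≠] y, g y' = (f (a.q.toFun y') * tVal δ y') • boxSection ψ y' := by
    intro y hy e₁ e₂ _ _ h₁ h₂
    obtain ⟨k, hk, hfk⟩ := hA y hy e₁ e₂ h₁ h₂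
    have hb := eventually_mem_baseSet hS hR h₁ h₂
    have hW : ∀ᶠ y' in 𝓝 y, a.q.toFun y' ∈ W := a.q.cont.continuousAt.eventually_mem
      (W.isOpen.mem_nhds hy)
    have h1 : ∀ᶠ y' in 𝓝[≠] y, boxCoord a.p₁ a.p₂ e₁ e₂ y' (g y') = k y' := by
      filter_upwards [eventually_eventually_punctured hfk, hk.eventually.filter_mono nhdsWithin_le_nhds,
        hb.filter_mono nhdsWithin_le_nhds, hW.filter_mono nhdsWithin_le_nhds] with y' r1 r2 r3 r4
      have := hY.neBot y'
      refine tendsto_nhds_unique (hg y' r4 e₁ e₂ r3.1 r3.2) (Tendsto.congr' ?_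
        ((r2.continuousAt hY).tendsto.mono_left nhdsWithin_le_nhds))
      filter_upwards [r1.filter_mono nhdsWithin_le_nhds] with y'' h
      exact h.symm
    have h2 : boxCoord a.p₁ a.p₂ e₁ e₂ y (g y) = k y := by
      have := hY.neBot y
      refine tendsto_nhds_unique (hg y hy e₁ e₂ h₁ h₂) (Tendsto.congr' ?_
        ((hk.continuousAt hY).tendsto.mono_left nhdsWithin_le_nhds))
      filter_upwards [hfk] with y'' h
      exact h.symm
    refine ⟨hk.congr ?_, ?_⟩
    · rw [eventually_nhdsWithin_iff] at h1
      filter_upwards [h1] with y' hy'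
      by_cases h : y' = y
      · rw [h, h2]
      · exact hy' h
    · filter_upwards [h1, hfk, hb.filter_mono nhdsWithin_le_nhds] with y' r1 r2 r3
      exact boxCoord_injective r3.1 r3.2 (r1.trans r2.symm)
  obtain ⟨s, hs⟩ := exists_LMinus (W := W) g (fun y hy e₁ e₂ _ _ h₁ h₂ => (hC y hy e₁ e₂ h₁ h₂).1) (by
    intro y hy
    have h₁ := FiberBundle.mem_baseSet_trivializationAt ℂ L.E (a.p₁ y)
    have h₂ := FiberBundle.mem_baseSet_trivializationAt ℂ L.E (a.p₂ y)
    set e₁ := trivializationAt ℂ L.E (a.p₁ y)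
    set e₂ := trivializationAt ℂ L.E (a.p₂ y)
    -- Anti-invariance passes to the limit: `f ∘ q` and `ψ ⊗ ψ` are invariant under τ and `δ`
    -- changes sign.
    refine boxCoord_injective h₁ h₂ ?_
    rw [boxCoord_comm, map_neg]
    have := hY.neBot y
    have hτ : Tendsto a.τ (𝓝[≠] y) (𝓝[≠] (a.τ y)) :=
      tendsto_nhdsWithin_iff.2 ⟨(isBihol_τ (a := a)).cont.continuousAt.tendsto.mono_left
        nhdsWithin_le_nhds, by
          filter_upwards [self_mem_nhdsWithin] with y' hy' h
          exact hy' (a.τEquiv.injective h)⟩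
    refine tendsto_nhds_unique ((hg (a.τ y) (by rwa [a.q_τ]) e₂ e₁ h₂ h₁).comp hτ) ?_
    refine Tendsto.congr' ?_ (hg y hy e₁ e₂ h₁ h₂).neg
    have hW : ∀ᶠ y' in 𝓝 y, a.q.toFun y' ∈ W := a.q.cont.continuousAt.eventually_mem
      (W.isOpen.mem_nhds hy)
    filter_upwards [hW.filter_mono nhdsWithin_le_nhds] with y' hy'
    rw [Function.comp_apply, a.q_τ, tVal_τ δ hy', map_smul, map_smul, ← boxCoord_comm, boxSection_τ]
    simp)
  refine ⟨s, fun y hy => ?_⟩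
  have h₁ := FiberBundle.mem_baseSet_trivializationAt ℂ L.E (a.p₁ y)
  have h₂ := FiberBundle.mem_baseSet_trivializationAt ℂ L.E (a.p₂ y)
  have hW : ∀ᶠ y' in 𝓝 y, a.q.toFun y' ∈ W := a.q.cont.continuousAt.eventually_mem
    (W.isOpen.mem_nhds hy)
  filter_upwards [(hC y hy _ _ h₁ h₂).2, hW.filter_mono nhdsWithin_le_nhds] with y' h1 h2
  rw [hs y' h2, h1]

end HitchinBase

end Curves

/-! ### The local generator of T, and the meromorphic function representing a homomorphism. -/

section Curves

variable {X : Type u} [TopologicalSpace X] [ChartedSpace ℂ X] [IsManifold 𝓘(ℂ, ℂ) ω X]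

namespace HitchinBase

variable {a : HitchinBase X} {L : LineBundle.{u, v} a.S} {U W : Opens a.S6} {x₀ : X}

/-! #### The local generator of `T` -/

variable (a x₀) in
/-- The part of `Ŝ₆` over the domain of a chart. -/
def chartOpen : Opens a.S6 :=
  ⟨{z | z.1.1 ∈ (chartAt ℂ x₀).source}, (chartAt ℂ x₀).open_source.preimage
    ((FiberBundle.continuous_proj ((ℂ →L[ℂ] ℂ) × (ℂ →L[ℂ] ℂ →L[ℂ] ℂ))
      ((K : X → Type) ×ᵇ (K2 : X → Type))).comp continuous_subtype_val)⟩

theorem mem_chartOpen_self (z : a.S6) : z ∈ a.chartOpen z.1.1 := mem_chart_source ℂ z.1.1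

theorem isHolAt_delta {y : a.SS0} (hy : y.1.1 ∈ (chartAt ℂ x₀).source) :
    IsHolAt (a.delta x₀) y := by
  refine (isHolAt_induced_iff continuous_subtype_val).2
    ⟨fun m => (coordKK x₀ m).2.1 - (coordKK x₀ m).2.2, ?_, Eventually.of_forall fun _ => rfl⟩
  have h1 : ContDiff ℂ ω (fun w : ℂ × ℂ × ℂ => w.2.1 - w.2.2) := by fun_prop
  exact h1.contMDiff.contMDiffAt.comp y.1 (contMDiffAt_coordKK hy)

theorem delta_τ (y : a.SS0) : a.delta x₀ (a.τ y) = -a.delta x₀ y := (neg_sub _ _).symm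

theorem delta_eq_zero_iff {y : a.SS0} (hy : y.1.1 ∈ (chartAt ℂ x₀).source) :
    a.delta x₀ y = 0 ↔ y = a.τ y := by
  rw [eq_τ_iff]
  exact sub_eq_zero.trans ⟨fun h => K_ext hy h, fun h => by rw [h]⟩

theorem hasOrder_delta (hS : a.IsSmooth) (hR : a.HasGenericRamification) {y : a.SS0}
    (hy : y.1.1 ∈ (chartAt ℂ x₀).source) (h : y = a.τ y) : HasOrder (a.delta x₀) y 1 := by
  obtain ⟨t₃, t₄, hf⟩ := exists_fib y
  exact (ramification_double hS hR y hy (hf x₀ hy) (by rw [eq_τ_iff.1 h])).2.2.2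

theorem eventually_delta_ne (hS : a.IsSmooth) (hR : a.HasGenericRamification) {y : a.SS0}
    (hy : y.1.1 ∈ (chartAt ℂ x₀).source) : ∀ᶠ y' in 𝓝[≠] y, a.delta x₀ y' ≠ 0 := by
  have hY := isCurve_SS0 hS hR
  by_cases h : y = a.τ y
  · exact (hasOrder_delta hS hR hy h).eventually_ne hY
  · exact (HasOrder.of_isHolAt hY (isHolAt_delta hy)
      (fun h0 => h ((delta_eq_zero_iff hy).1 h0))).eventually_ne hY

/-- The function `delta` vanishes only at fixed points of τ, and there to first order; elsewhere it
is a unit. -/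
theorem exists_eq_delta_mul (hS : a.IsSmooth) (hR : a.HasGenericRamification) {y : a.SS0}
    (hy : y.1.1 ∈ (chartAt ℂ x₀).source) {g : a.SS0 → ℂ} (hg : IsHolAt g y)
    (h0 : y = a.τ y → g y = 0) :
    ∃ k : a.SS0 → ℂ, IsHolAt k y ∧ ∀ᶠ y' in 𝓝[≠] y, g y' = a.delta x₀ y' * k y' := by
  have hY := isCurve_SS0 hS hR
  by_cases h : y = a.τ y
  · exact exists_eq_mul_of_hasOrder_one hY (hasOrder_delta hS hR hy h) hg (h0 h)
  · have hd := isHolAt_delta (x₀ := x₀) hy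
    have hne : a.delta x₀ y ≠ 0 := fun h0 => h ((delta_eq_zero_iff hy).1 h0)
    refine ⟨fun y' => (a.delta x₀ y')⁻¹ * g y', (hd.inv hY hne).mul hg, ?_⟩
    filter_upwards [eventually_delta_ne hS hR hy] with y' h'
    rw [mul_inv_cancel_left₀ h']

theorem exists_generator (hW : W ≤ a.chartOpen x₀) :
    ∃ δ : a.sheafT.sec W, ∀ y, a.q.toFun y ∈ W → tVal δ y = a.delta x₀ y :=
  exists_sheafT _ (fun _ hy => isHolAt_delta (hW hy)) fun y _ => delta_τ y

/-- Anti-invariance makes a section of `T` vanish at the fixed points of τ, so its quotient by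
`delta` is holomorphic. The quotient is invariant and descends along `q`. -/
theorem exists_eq_smul_generator (hS : a.IsSmooth) (hR : a.HasGenericRamification)
    (hW : W ≤ a.chartOpen x₀) {δ₀ : a.sheafT.sec W}
    (h₀ : ∀ y, a.q.toFun y ∈ W → tVal δ₀ y = a.delta x₀ y) (δ : a.sheafT.sec W) :
    ∃ f : HolSpace.O W, δ = f • δ₀ := by
  have hY := isCurve_SS0 hS hR
  have hZ := isCurve_S6 hS hR
  choose r hr using q_surjective (a := a)
  set G : a.S6 → ℂ := fun z => tVal δ (r z) / a.delta x₀ (r z) with hG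
  have hGq : ∀ y, a.q.toFun y ∈ W → G (a.q.toFun y) = tVal δ y / a.delta x₀ y := by
    intro y hy
    rcases q_eq_iff.1 (hr (a.q.toFun y)) with h | h
    · rw [hG]
      simp only
      rw [h]
    · rw [hG]
      simp only
      rw [h, tVal_τ δ hy, delta_τ, neg_div_neg_eq]
  have hk : ∀ y, a.q.toFun y ∈ W → HasPoleLE G (a.q.toFun y) 0 := by
    intro y hy
    obtain ⟨k, hk, hgk⟩ := exists_eq_delta_mul hS hR (hW hy) (isHolAt_tVal δ hy) (fun h => by
      have h1 := tVal_τ δ hy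
      rw [← h] at h1
      exact self_eq_neg.1 h1)
    refine (hasRamification_q hS hR y).hasPoleLE_of_comp hY hZ ?_
    rw [mul_zero, hasPoleLE_zero_iff hY]
    refine ⟨k, hk, ?_⟩
    filter_upwards [hgk, eventually_delta_ne hS hR (hW hy),
      (a.q.cont.continuousAt.eventually_mem (W.isOpen.mem_nhds hy)).filter_mono nhdsWithin_le_nhds]
      with y' h1 h2 h3
    rw [hGq y' h3, h1, mul_div_cancel_left₀ _ h2]
  have hN := normalize_mem hZ (D := 0) (U := W) (f := G) (by
    intro z hz
    obtain ⟨y, rfl⟩ := q_surjective z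
    exact hk y hz)
  have hO : (fun z : W => normalize 0 G z.1) ∈ HolSpace.O W := mem_O_iff.2 fun p => hN.1 p rfl
  refine ⟨⟨_, hO⟩, sheafT_ext fun y hy => ?_⟩
  rw [tVal_smul _ _ hy, h₀ y hy]
  have hn : IsHolAt (normalize 0 G) (a.q.toFun y) := restrict_mem_O_iff.1 hO _ hy
  refine eq_of_punctured hY ((isHolAt_tVal δ hy).continuousAt hY)
    (g := fun y => normalize 0 G (a.q.toFun y) * a.delta x₀ y)
    ((((hasRamification_q hS hR y).isHolAt_comp hn).mul (isHolAt_delta (hW hy))).continuousAt hY) ?_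
  filter_upwards [(hasRamification_q hS hR y).tendsto_punctured.eventually
      (normalize_eventually_eq hZ (D := 0) (hk y hy)), eventually_delta_ne hS hR (hW hy),
      (a.q.cont.continuousAt.eventually_mem (W.isOpen.mem_nhds hy)).filter_mono nhdsWithin_le_nhds]
      with y' h1 h2 h3
  rw [h1, hGq y' h3, div_mul_cancel₀ _ h2]

/-! #### The function that represents a section of `I₃(L)` -/

/-- The homomorphism `φ` from `T` to `L₋` is the multiplication with `r ψ ⊗ ψ`. -/
def Represents (ψ : (p : a.S) → L.E p) (φ : (a.I3 L).sec U) (r : a.S6 → ℂ) : Prop :=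
  ∀ (W : Opens a.S6) (hW : W ≤ U) (δ : a.sheafT.sec W) (y₀ : a.SS0), a.q.toFun y₀ ∈ W →
    ∀ᶠ y in 𝓝[≠] y₀, lVal (φ.1 ⟨W, hW⟩ δ) y = (r (a.q.toFun y) * tVal δ y) • boxSection ψ y

section Representation

variable {ψ : (p : a.S) → L.E p} {φ φ' : (a.I3 L).sec U} {r r' : a.S6 → ℂ} {D : a.S →₀ ℤ}

theorem eventually_mem_q {y : a.SS0} (hy : a.q.toFun y ∈ W) :
    ∀ᶠ y' in 𝓝[≠] y, a.q.toFun y' ∈ W :=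
  (a.q.cont.continuousAt.eventually_mem (W.isOpen.mem_nhds hy)).filter_mono nhdsWithin_le_nhds

theorem Represents.congr (hS : a.IsSmooth) (hR : a.HasGenericRamification)
    (h : Represents ψ φ r) (hr : ∀ z ∈ U, ∀ᶠ z' in 𝓝[≠] z, r' z' = r z') : Represents ψ φ r' := by
  intro W hW δ y hy
  filter_upwards [h W hW δ y hy,
    (hasRamification_q hS hR y).tendsto_punctured.eventually (hr _ (hW hy))] with y' h1 h2
  rw [h1, h2]

theorem Represents.add (h : Represents ψ φ r) (h' : Represents ψ φ' r') :
    Represents ψ (φ + φ') fun z => r z + r' z := by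
  intro W hW δ y hy
  filter_upwards [h W hW δ y hy, h' W hW δ y hy] with y' h1 h2
  refine (lVal_add (φ.1 ⟨W, hW⟩ δ) (φ'.1 ⟨W, hW⟩ δ) y').trans ?_
  rw [h1, h2, ← add_smul, add_mul]

theorem Represents.smul (h : Represents ψ φ r) (f : HolSpace.O U) :
    Represents ψ (f • φ) fun z => extendZero f.1 z * r z := by
  intro W hW δ y hy
  filter_upwards [h W hW δ y hy, eventually_mem_q hy] with y' h1 h2
  refine (lVal_smul (resHom hW f) (φ.1 ⟨W, hW⟩ δ) h2).trans ?_
  rw [h1, smul_smul, extendZero_of_mem _ (hW h2), mul_assoc]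
  rfl

theorem Represents.res (h : Represents ψ φ r) (hW : W ≤ U) :
    Represents ψ ((a.I3 L).res hW φ) r :=
  fun V hV δ y hy => h V (hV.trans hW) δ y hy

theorem Represents.eq (hS : a.IsSmooth) (hR : a.HasGenericRamification)
    (h : Represents ψ φ r) (h' : Represents ψ φ' r) : φ = φ' := by
  apply Subtype.ext
  funext W
  refine LinearMap.ext fun δ => LMinus_ext_punctured hS hR fun y hy => ?_
  filter_upwards [h W.1 W.2 δ y hy, h' W.1 W.2 δ y hy] with y' h1 h2
  exact h1.trans h2.symm

theorem HasDivisor.eventually_ne (hS : a.IsSmooth) (hR : a.HasGenericRamification)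
    (hψ : HasDivisor L ψ D) (y : a.SS0) : ∀ᶠ y' in 𝓝[≠] y, boxSection ψ y' ≠ 0 := by
  have h₁ := FiberBundle.mem_baseSet_trivializationAt ℂ L.E (a.p₁ y)
  have h₂ := FiberBundle.mem_baseSet_trivializationAt ℂ L.E (a.p₂ y)
  filter_upwards [(hψ.hasOrder hS hR h₁ h₂).eventually_ne (isCurve_SS0 hS hR)] with y' h h0
  rw [h0, map_zero] at h
  exact h rfl

/-- Evaluating on the local generator leaves the factor `delta` times `ψ ⊗ ψ`, which is nonzero off
isolated points and can be cancelled. -/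
theorem Represents.eventually_eq (hS : a.IsSmooth) (hR : a.HasGenericRamification)
    (hψ : HasDivisor L ψ D) (h : Represents ψ φ r) (h' : Represents ψ φ r') :
    ∀ z ∈ U, ∀ᶠ z' in 𝓝[≠] z, r z' = r' z' := by
  intro z hz
  obtain ⟨y, rfl⟩ := q_surjective z
  obtain ⟨δ, hδ⟩ := exists_generator (a := a) (x₀ := y.1.1) (W := U ⊓ a.chartOpen y.1.1) inf_le_right
  have hy : a.q.toFun y ∈ U ⊓ a.chartOpen y.1.1 := ⟨hz, mem_chartOpen_self (a.q.toFun y)⟩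
  refine (hasRamification_q hS hR y).punctured_le ?_
  filter_upwards [h _ inf_le_left δ y hy, h' _ inf_le_left δ y hy, hψ.eventually_ne hS hR y,
    eventually_delta_ne hS hR hy.2, eventually_mem_q hy] with y' h1 h2 h3 h4 h5
  have h6 := smul_left_injective ℂ h3 (h1.symm.trans h2)
  rw [hδ y' h5] at h6
  exact mul_right_cancel₀ h4 h6

/-- Linearity and compatibility with restriction may be checked off isolated points, where the
sections are given by the formula. -/
theorem exists_represents (hS : a.IsSmooth) (hR : a.HasGenericRamification)
    (hψ : HasDivisor L ψ D) {f : a.S6 → ℂ} (hf : ∀ z ∈ U, HasPoleLE f z (a.corr D z)) :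
    ∃ φ : (a.I3 L).sec U, Represents ψ φ f := by
  have h (W : {W : Opens a.S6 // W ≤ U}) (δ : a.sheafT.sec W.1) :=
    hψ.exists_section hS hR (W := W.1) (fun z hz => hf z (W.2 hz)) δ
  choose s hs using h
  refine ⟨⟨fun W => ⟨⟨s W, fun δ δ' => ?_⟩, fun c δ => ?_⟩, fun W W' hWW δ => ?_⟩,
    fun W hW δ y hy => hs ⟨W, hW⟩ δ y hy⟩
  · refine LMinus_ext_punctured hS hR fun y hy => ?_
    filter_upwards [hs W δ y hy, hs W δ' y hy, hs W (δ + δ') y hy] with y' h1 h2 h3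
    refine h3.trans (Eq.trans ?_ (lVal_add (s W δ) (s W δ') y').symm)
    rw [h1, h2, tVal_add δ δ', mul_add, add_smul]
  · refine LMinus_ext_punctured hS hR fun y hy => ?_
    filter_upwards [hs W δ y hy, hs W (c • δ) y hy, eventually_mem_q hy] with y' h1 h2 h3
    refine h2.trans (Eq.trans ?_ (lVal_smul c (s W δ) h3).symm)
    rw [h1, tVal_smul c δ h3, smul_smul, mul_left_comm]
  · refine LMinus_ext_punctured hS hR fun y hy => ?_
    filter_upwards [hs W δ y (hWW hy), hs W' (a.sheafT.res hWW δ) y hy, eventually_mem_q hy]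
      with y' h1 h2 h3
    refine h2.trans (Eq.trans ?_ (lVal_res hWW (s W δ) h3).symm)
    rw [h1, tVal_res hWW δ h3]

end Representation

end HitchinBase

end Curves

theorem normalize_congr {Y : Type u} [TopologicalSpace Y] {D : Y →₀ ℤ} {f g : Y → ℂ} {p : Y}
    (h : ∀ᶠ y in 𝓝[≠] p, f y = g y) : normalize D f p = normalize D g p := by
  rw [normalize, normalize, limUnder, limUnder, map_congr h]

section Curves

variable {X : Type u} [TopologicalSpace X] [ChartedSpace ℂ X] [IsManifold 𝓘(ℂ, ℂ) ω X]

namespace HitchinBase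

variable {a : HitchinBase X} {L : LineBundle.{u, v} a.S} {U W : Opens a.S6} {x₀ : X}
  {ψ : (p : a.S) → L.E p} {φ φ' : (a.I3 L).sec U} {D : a.S →₀ ℤ}

theorem exists_eq_smul {y : a.SS0} (v : L.E (a.p₁ y) ⊗[ℂ] L.E (a.p₂ y))
    {w : L.E (a.p₁ y) ⊗[ℂ] L.E (a.p₂ y)} (hw : w ≠ 0) : ∃ c : ℂ, v = c • w := by
  have h₁ := FiberBundle.mem_baseSet_trivializationAt ℂ L.E (a.p₁ y)
  have h₂ := FiberBundle.mem_baseSet_trivializationAt ℂ L.E (a.p₂ y)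
  have hi := boxCoord_injective h₁ h₂
  set κ := boxCoord a.p₁ a.p₂ (trivializationAt ℂ L.E (a.p₁ y)) (trivializationAt ℂ L.E (a.p₂ y)) y
  have h0 : κ w ≠ 0 := fun h => hw (hi (h.trans (map_zero κ).symm))
  refine ⟨κ v / κ w, hi ?_⟩
  rw [map_smul, smul_eq_mul, div_mul_cancel₀ _ h0]

/-- With one trivialization on both factors the interchange acts trivially on the fibre over a fixed
point, so anti-invariance makes the value its own negative. -/
theorem lVal_eq_zero (s : (a.LMinus L).sec W) {y : a.SS0} (hy : a.q.toFun y ∈ W) (h : y = a.τ y) :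
    lVal s y = 0 := by
  have h₁ := FiberBundle.mem_baseSet_trivializationAt ℂ L.E (a.p₁ y)
  have h₂ : a.p₂ y ∈ (trivializationAt ℂ L.E (a.p₁ y)).baseSet :=
    (congrArg (fun y' => a.p₁ y' ∈ (trivializationAt ℂ L.E (a.p₁ y)).baseSet) h).mp h₁
  set e := trivializationAt ℂ L.E (a.p₁ y)
  refine boxCoord_injective h₁ h₂ ?_
  have h1 := boxCoord_comm (e₁ := e) (e₂ := e) y (lVal s (a.τ y))
  rw [lVal_τ s hy, map_neg] at h1
  have h2 := congrArg (fun y' => boxCoord a.p₁ a.p₂ e e y' (lVal s y')) h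
  rw [map_zero]
  exact self_eq_neg.1 (h2.trans h1.symm)

/-- Both sides change sign under τ, so the coefficient `c` depends only on the image in `Ŝ₆`. -/
theorem lVal_eq_smul_of_q_eq (s : (a.LMinus L).sec W) {y y' : a.SS0} (hy : a.q.toFun y ∈ W) {c : ℂ}
    (h : lVal s y = (c * a.delta x₀ y) • boxSection ψ y) (hq : a.q.toFun y' = a.q.toFun y) :
    lVal s y' = (c * a.delta x₀ y') • boxSection ψ y' := by
  rcases q_eq_iff.1 hq with rfl | rfl
  · exact h
  · apply (TensorProduct.comm ℂ (L.E (a.p₂ y)) (L.E (a.p₁ y))).injective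
    refine (lVal_τ s hy).trans (Eq.trans ?_ (map_smul _ _ _).symm)
    rw [h, boxSection_τ, delta_τ, mul_neg, neg_smul]

/-- A homomorphism from `T` is determined by its value at the local generator. -/
theorem represents_of_generator (hS : a.IsSmooth) (hR : a.HasGenericRamification)
    (hU : U ≤ a.chartOpen x₀) {δ₀ : a.sheafT.sec U}
    (h₀ : ∀ y, a.q.toFun y ∈ U → tVal δ₀ y = a.delta x₀ y) {r : a.S6 → ℂ}
    (h : ∀ y, a.q.toFun y ∈ U → ∀ᶠ y' in 𝓝[≠] y, lVal (φ.1 ⟨U, le_rfl⟩ δ₀) y' =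
      (r (a.q.toFun y') * a.delta x₀ y') • boxSection ψ y') : Represents ψ φ r := by
  intro W hW δ y hy
  obtain ⟨δ₁, h₁⟩ := exists_generator (hW.trans hU)
  have e₁ : a.sheafT.res hW δ₀ = δ₁ := sheafT_ext fun y hy => by
    rw [tVal_res hW δ₀ hy, h₀ y (hW hy), h₁ y hy]
  have e₂ : φ.1 ⟨W, hW⟩ δ₁ = (a.LMinus L).res hW (φ.1 ⟨U, le_rfl⟩ δ₀) :=
    (congrArg (φ.1 ⟨W, hW⟩) e₁.symm).trans (φ.2 ⟨U, le_rfl⟩ ⟨W, hW⟩ hW δ₀)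
  obtain ⟨f, hf⟩ := exists_eq_smul_generator hS hR (hW.trans hU) h₁ δ
  have e₃ : φ.1 ⟨W, hW⟩ δ = f • φ.1 ⟨W, hW⟩ δ₁ :=
    (congrArg (φ.1 ⟨W, hW⟩) hf).trans ((φ.1 ⟨W, hW⟩).map_smul f δ₁)
  filter_upwards [h y (hW hy), eventually_mem_q hy] with y' h3 h4
  have h5 := lVal_smul f (φ.1 ⟨W, hW⟩ δ₁) h4
  have h6 := tVal_smul f δ₁ h4
  have h7 := lVal_res hW (φ.1 ⟨U, le_rfl⟩ δ₀) h4
  rw [e₃, h5, e₂, h7, h3, hf, h6, h₁ y' h4, smul_smul, mul_left_comm]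

/-- Over the domain of a chart, sections of `I₃(L)` are given by meromorphic functions. -/
theorem HasDivisor.exists_of_le_chartOpen (hS : a.IsSmooth) (hR : a.HasGenericRamification)
    (hψ : HasDivisor L ψ D) (hU : U ≤ a.chartOpen x₀) (φ : (a.I3 L).sec U) :
    ∃ r : a.S6 → ℂ, (∀ z ∈ U, HasPoleLE r z (a.corr D z)) ∧ Represents ψ φ r := by
  classical
  have hY := isCurve_SS0 hS hR
  have hZ := isCurve_S6 hS hR
  obtain ⟨δ₀, h₀⟩ := exists_generator hU
  set s := φ.1 ⟨U, le_rfl⟩ δ₀ with hs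
  -- The coefficient is chosen on `Ŝ₆` itself, so that it is valid for both points above `z`.
  set Q : a.S6 → ℂ → Prop := fun z c => ∀ y, a.q.toFun y = z →
    lVal s y = (c * a.delta x₀ y) • boxSection ψ y with hQ
  set r : a.S6 → ℂ := fun z => if h : ∃ c, Q z c then h.choose else 0 with hr
  have key : ∀ y, a.q.toFun y ∈ U → ∀ᶠ y' in 𝓝[≠] y,
      lVal s y' = (r (a.q.toFun y') * a.delta x₀ y') • boxSection ψ y' := by
    intro y hy
    filter_upwards [hψ.eventually_ne hS hR y, eventually_delta_ne hS hR (hU hy), eventually_mem_q hy]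
      with y' h1 h2 h3
    have hc : ∃ c, Q (a.q.toFun y') c := by
      obtain ⟨c, hc⟩ := exists_eq_smul (lVal s y') h1
      exact ⟨c / a.delta x₀ y', fun y'' hq =>
        lVal_eq_smul_of_q_eq s h3 (by rw [div_mul_cancel₀ _ h2, hc]) hq⟩
    have h4 : r (a.q.toFun y') = hc.choose := dif_pos hc
    rw [h4]
    exact hc.choose_spec y' rfl
  refine ⟨r, fun z hz => ?_, fun W hW δ y hy => ?_⟩
  · obtain ⟨y, rfl⟩ := q_surjective z
    have h₁ := FiberBundle.mem_baseSet_trivializationAt ℂ L.E (a.p₁ y)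
    have h₂ := FiberBundle.mem_baseSet_trivializationAt ℂ L.E (a.p₂ y)
    obtain ⟨e, he, hD⟩ := exists_hasRamification_q hS hR D y
    -- The value of the generator vanishes at fixed points of τ and is divisible by `delta`. The
    -- holomorphic quotient is `r ∘ q` times the coordinate of `ψ ⊗ ψ`, which is the required pole
    -- bound upstairs.
    obtain ⟨k, hk, hgk⟩ := exists_eq_delta_mul hS hR (hU hz) (isHolAt_lVal s hz h₁ h₂) (fun h => by
      rw [lVal_eq_zero s hz h, map_zero])
    refine he.hasPoleLE_of_comp hY hZ ?_
    rw [hD]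
    refine ⟨_, k, hψ.hasOrder hS hR h₁ h₂, hk, ?_⟩
    filter_upwards [hgk, key y hz, eventually_delta_ne hS hR (hU hz)] with y' h1 h2 h3
    rw [h2, map_smul, smul_eq_mul, mul_comm (r _), mul_assoc] at h1
    exact mul_left_cancel₀ h3 h1
  · exact represents_of_generator hS hR hU h₀ key W hW δ y hy

/-- The representing functions over different charts agree off isolated points by uniqueness, so
they glue. -/
theorem HasDivisor.exists_representing (hS : a.IsSmooth) (hR : a.HasGenericRamification)
    (hψ : HasDivisor L ψ D) (φ : (a.I3 L).sec U) :
    ∃ r : a.S6 → ℂ, (∀ z ∈ U, HasPoleLE r z (a.corr D z)) ∧ Represents ψ φ r := by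
  have hZ := isCurve_S6 hS hR
  have hloc (x : X) := hψ.exists_of_le_chartOpen hS hR (x₀ := x) (U := U ⊓ a.chartOpen x)
    inf_le_right ((a.I3 L).res inf_le_left φ)
  choose ρ hp hρ using hloc
  -- At each point the function of the chart at its base point is used. The normalized value depends
  -- only on the punctured germ, so it does not depend on that chart.
  set r : a.S6 → ℂ := fun z => normalize (a.corr D) (ρ z.1.1) z with hr
  have hcong : ∀ z ∈ U, ∀ x, z ∈ a.chartOpen x → ∀ᶠ z' in 𝓝[≠] z, r z' = ρ x z' := by
    intro z hz x hx
    filter_upwards [normalize_eventually_eq hZ (D := a.corr D) (hp x z ⟨hz, hx⟩),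
      ((U ⊓ a.chartOpen x).isOpen.mem_nhds ⟨hz, hx⟩ |> mem_nhdsWithin_of_mem_nhds)] with z' h1 h2
    rw [← h1]
    have hV : z' ∈ (U ⊓ a.chartOpen x) ⊓ (U ⊓ a.chartOpen z'.1.1) :=
      ⟨h2, h2.1, mem_chartOpen_self z'⟩
    exact normalize_congr (Represents.eventually_eq hS hR hψ
      (Represents.res (hρ z'.1.1) inf_le_right) (Represents.res (hρ x) inf_le_left) z' hV)
  refine ⟨r, fun z hz => (hp z.1.1 z ⟨hz, mem_chartOpen_self z⟩).congr
    (hcong z hz _ (mem_chartOpen_self z)), fun W hW δ y hy => ?_⟩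
  have hx := mem_chartOpen_self (a.q.toFun y)
  set x := (a.q.toFun y).1.1
  have hWx : W ⊓ a.chartOpen x ≤ U ⊓ a.chartOpen x := inf_le_inf_right _ hW
  have hWW : W ⊓ a.chartOpen x ≤ W := inf_le_left
  have hyx : a.q.toFun y ∈ W ⊓ a.chartOpen x := ⟨hy, hx⟩
  filter_upwards [hρ x _ hWx (a.sheafT.res hWW δ) y hyx, eventually_mem_q hyx,
    (hasRamification_q hS hR y).tendsto_punctured.eventually (hcong _ (hW hy) x hx)] with y' h1 h2 h3
  have h4 : φ.1 ⟨W ⊓ a.chartOpen x, hWW.trans hW⟩ (a.sheafT.res hWW δ) =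
      (a.LMinus L).res hWW (φ.1 ⟨W, hW⟩ δ) := φ.2 ⟨W, hW⟩ ⟨_, hWW.trans hW⟩ hWW δ
  rw [h3, ← tVal_res hWW δ h2, ← lVal_res hWW (φ.1 ⟨W, hW⟩ δ) h2, ← h4]
  exact h1

/-! #### The isomorphism between `I₃(L)` and `O(corr D)` -/

/-- The values of a section of `O(D)`, extended by zero. -/
def divFun {Y : Type u} [TopologicalSpace Y] [HolSpace Y] {D : Y →₀ ℤ} {V : Opens Y}
    (f : (sheafOfDiv D).toOMod.sec V) : Y → ℂ := extendZero (divVal f)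

section DivFun

variable {Y : Type u} [TopologicalSpace Y] [HolSpace Y] {D : Y →₀ ℤ} {V V' : Opens Y}

theorem divFun_of_mem (f : (sheafOfDiv D).toOMod.sec V) {y : Y} (hy : y ∈ V) :
    divFun f y = divVal f ⟨y, hy⟩ := extendZero_of_mem _ hy

theorem divFun_add (f g : (sheafOfDiv D).toOMod.sec V) {y : Y} (hy : y ∈ V) :
    divFun (f + g) y = divFun f y + divFun g y := by
  rw [divFun_of_mem _ hy, divFun_of_mem _ hy, divFun_of_mem _ hy]
  rfl

theorem divFun_smul (c : HolSpace.O V) (f : (sheafOfDiv D).toOMod.sec V) {y : Y} (hy : y ∈ V) :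
    divFun (c • f) y = extendZero c.1 y * divFun f y := by
  rw [divFun_of_mem _ hy, divFun_of_mem _ hy, extendZero_of_mem _ hy]
  rfl

theorem divFun_res (h : V' ≤ V) (f : (sheafOfDiv D).toOMod.sec V) {y : Y} (hy : y ∈ V') :
    divFun ((sheafOfDiv D).toOMod.res h f) y = divFun f y := by
  rw [divFun_of_mem _ hy, divFun_of_mem _ (h hy)]
  rfl

theorem hasPoleLE_divFun (hY : IsCurve Y) (f : (sheafOfDiv D).toOMod.sec V) {y : Y} (hy : y ∈ V) :
    HasPoleLE (divFun f) y (D y) := hasPoleLE_of_mem_sheafOfDiv hY f.2 hy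

theorem divFun_ext (hY : IsCurve Y) {f g : (sheafOfDiv D).toOMod.sec V}
    (h : ∀ p ∈ V, ∀ᶠ y in 𝓝[≠] p, divFun f y = divFun g y) : f = g :=
  Subtype.ext (sheafOfDiv_ext hY f.2 g.2 h)

theorem exists_divFun [T1Space Y] (hY : IsCurve Y) {r : Y → ℂ} (hr : ∀ y ∈ V, HasPoleLE r y (D y)) :
    ∃ f : (sheafOfDiv D).toOMod.sec V, ∀ p ∈ V, ∀ᶠ y in 𝓝[≠] p, divFun f y = r y := by
  refine ⟨⟨_, normalize_mem hY hr⟩, fun p hp => ?_⟩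
  filter_upwards [normalize_eventually_eq hY (D := D) (hr p hp),
    mem_nhdsWithin_of_mem_nhds (V.isOpen.mem_nhds hp)] with y h1 h2
  exact (divFun_of_mem _ h2).trans h1

end DivFun

/-- Normalization selects one section of `O(corr D)` among the functions representing `φ`. The
equivalence is the form in which uniqueness yields linearity and compatibility with restriction. -/
theorem HasDivisor.exists_divFun_representing (hS : a.IsSmooth) (hR : a.HasGenericRamification)
    (hψ : HasDivisor L ψ D) (φ : (a.I3 L).sec U) :
    ∃ f : (sheafOfDiv (a.corr D)).toOMod.sec U,
      ∀ g : (sheafOfDiv (a.corr D)).toOMod.sec U, g = f ↔ Represents ψ φ (divFun g) := by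
  have hZ := isCurve_S6 hS hR
  obtain ⟨r, hp, hr⟩ := hψ.exists_representing hS hR φ
  obtain ⟨f, hf⟩ := exists_divFun hZ hp
  have h1 : Represents ψ φ (divFun f) := hr.congr hS hR hf
  refine ⟨f, fun g => ⟨?_, fun h => divFun_ext hZ (h.eventually_eq hS hR hψ h1)⟩⟩
  rintro rfl
  exact h1

/-- Sending `φ` to its representing section is injective since that section determines `φ`, and
surjective since every section of `O(corr D)` defines a homomorphism. -/
theorem HasDivisor.I3_isIso (hS : a.IsSmooth) (hR : a.HasGenericRamification)
    (hψ : HasDivisor L ψ D) : (a.I3 L).IsIso (sheafOfDiv (a.corr D)).toOMod := by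
  have hZ := isCurve_S6 hS hR
  have h (U : Opens a.S6) (φ : (a.I3 L).sec U) := hψ.exists_divFun_representing hS hR φ
  choose F hF using h
  have hrep : ∀ U φ, Represents ψ φ (divFun (F U φ)) := fun U φ => (hF U φ _).1 rfl
  have hU : ∀ (U : Opens a.S6) {z : a.S6}, z ∈ U → ∀ᶠ z' in 𝓝[≠] z, z' ∈ U := fun U z hz =>
    mem_nhdsWithin_of_mem_nhds (U.isOpen.mem_nhds hz)
  have hadd : ∀ U φ φ', F U (φ + φ') = F U φ + F U φ' := fun U φ φ' =>
    ((hF U _ _).2 (((hrep U φ).add (hrep U φ')).congr hS hR fun z hz =>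
      (hU U hz).mono fun z' hz' => divFun_add (F U φ) (F U φ') hz')).symm
  have hsmul : ∀ U (f : HolSpace.O U) φ, F U (f • φ) = f • F U φ := fun U f φ =>
    ((hF U _ _).2 (((hrep U φ).smul f).congr hS hR fun z hz =>
      (hU U hz).mono fun z' hz' => divFun_smul f (F U φ) hz')).symm
  have hinj : ∀ U, Function.Injective (F U) := fun U φ φ' hφ => by
    have h1 := hrep U φ
    rw [hφ] at h1
    exact Represents.eq hS hR h1 (hrep U φ')
  have hsurj : ∀ U, Function.Surjective (F U) := fun U f => by
    obtain ⟨φ, hφ⟩ := exists_represents hS hR hψ fun z hz => hasPoleLE_divFun hZ f hz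
    exact ⟨φ, ((hF U φ f).2 hφ).symm⟩
  exact ⟨fun U => LinearEquiv.ofBijective ⟨⟨F U, hadd U⟩, hsmul U⟩ ⟨hinj U, hsurj U⟩,
    fun U V hV φ => ((hF V _ _).2 (((hrep U φ).res hV).congr hS hR fun z hz =>
      (hU V hz).mono fun z' hz' => divFun_res hV (F U φ) hz')).symm⟩

theorem I3_hasClass (hS : a.IsSmooth) (hR : a.HasGenericRamification) (L : LineBundle.{u, v} a.S)
    {c : Pic a.S} (hL : L.sheaf.toOMod.HasClass c) : (a.I3 L).HasClass (corrClass hS hR c) := by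
  obtain ⟨D, rfl, hD⟩ := hL
  obtain ⟨ψ, hψ⟩ := L.exists_meromorphic_section (isCurve_S hS hR) hD
  exact ⟨a.corr D, rfl, HasDivisor.I3_isIso hS hR hψ⟩

end HitchinBase

end Curves

end Trigonal

end

/-! ### The three assertions for the map induced by the correspondence. -/

theorem mainTheorem5 {X : Type u} [TopologicalSpace X] [T2Space X] [CompactSpace X]
    [ConnectedSpace X] [ChartedSpace ℂ X] [IsManifold 𝓘(ℂ, ℂ) ω X]
    (a : Trigonal.HitchinBase X) (hS : a.IsSmooth) (hR : a.HasGenericRamification) :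
    ∃ C : Trigonal.Jac a.S →+ Trigonal.Jac a.S6,
      (∀ (D : a.S →₀ ℤ) (c : Trigonal.Jac a.S), Trigonal.degDiv a.S D = 0 → c.1 = Trigonal.divClass D →
        (C c).1 = Trigonal.divClass (a.corr D)) ∧
      (∀ c : Trigonal.Jac a.S, c.1 ∈ Trigonal.Prym a.proj → (C c).1 ∈ Trigonal.Prym a.quotσ) ∧
      (∀ (L : Trigonal.LineBundle.{u, v} a.S) (c : Trigonal.Jac a.S), L.sheaf.toOMod.HasClass c.1 →
        (a.I3 L).HasClass (C c).1) :=
  ⟨Trigonal.HitchinBase.corrJac hS hR,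
    fun D _ _ hD => (congrArg (Trigonal.HitchinBase.corrClass hS hR) hD).trans
      (Trigonal.HitchinBase.corrClass_divClass hS hR D),
    fun _ hc => Trigonal.HitchinBase.corrClass_mem_Prym hS hR hc,
    fun L _ hL => Trigonal.HitchinBase.I3_hasClass hS hR L hL⟩
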